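/- **Theorem (Conservation laws).** Write $\widehat f(\mathbf p)=\frac1{2\pi}\int_{\mathbb R^2}e^{-i\mathbf p\cdot\mathbf x}f(\mathbf x)\,d\mathbf x$, $p=|\mathbf p|$, let $\gamma$ be the Euler constant, $U_0(t)=e^{it\Delta}$ the free propagator on $L^2(\mathbb R^2)$, $U_0(t;r)=\frac{1}{2it}e^{-r^2/(4it)}$, and $$\mathcal I(t)=\int_0^\infty \frac{t^{\tau-1}}{\Gamma(\tau)}\,d\tau\qquad(t>0).$$ Fix $\mathbf y\in\mathbb R^2$, $\beta_0\in\mathbb R$ and $\sigma\ge\frac12$. For $\lambda>0$ let $K_0(\sqrt\lambda\,|\cdot|)$ be the inverse Fourier transform of $(p^2+\lambda)^{-1}$ (the Macdonald function). Let $\mathscr D$ be the set of all $\psi\in L^2(\mathbb R^2)$ of the form $$\psi=\phi_\lambda+\tfrac1{2\pi}\,q\,K_0(\sqrt\lambda\,|\cdot-\mathbf y|),\qquad q\in\mathbb C,\quad \phi_\lambda\in H^1(\mathbb R^2),\quad (1+p^\varepsilon)\,\widehat{\phi_\lambda}\in L^1(\mathbb R^2)\ \text{for some }\varepsilon>0$$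 (a set that does not depend on $\lambda>0$). Let $\psi_0\in\mathscr D$, $T>0$, and let $q\in C([0,T];\mathbb C)$ be a solution, for $0<t\le T$, of the charge equation $$q(t)+4\pi\beta_0\int_0^t\mathcal I(t-\tau)|q(\tau)|^{2\sigma}q(\tau)\,d\tau-2\left(\log2-\gamma+\tfrac{i\pi}4\right)\int_0^t\mathcal I(t-\tau)q(\tau)\,d\tau=4\pi\int_0^t\mathcal I(t-\tau)\,(U_0(\tau)\psi_0)(\mathbf y)\,d\tau ,$$ where $(U_0(\tau)\psi_0)(\mathbf y)=\lim_{R\to\infty}\frac1{2\pi}\int_{p<R}e^{i\mathbf p\cdot\mathbf y}e^{-ip^2\tau}\widehat{\psi_0}(\mathbf p)\,d\mathbf p$. Then, for every $t\in[0,T]$, there is exactly one $\psi_t\in L^2(\mathbb R^2)$ such that $$\psi_t(\mathbf x)=(U_0(t)\psi_0)(\mathbf x)+\frac i{2\pi}\int_0^tU_0(t-\tau;|\mathbf x-\mathbf y|)\,q(\tau)\,d\tau$$ in the sense of tempered distributions in $\mathbf x$; it equals $\psi_0$ for $t=0$. The function $\phi_{1,t}:=\psi_t-\frac1{2\pi}q(t)K_0(|\cdot-\mathbf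 y|)$ belongs to $H^1(\mathbb R^2)$ for every $t\in[0,T]$, and the mass $M(t)=\|\psi_t\|_2$ and the energy $$E(t)=\|\phi_{1,t}\|_{H^1(\mathbb R^2)}^2+\left(\frac{\beta_0}{\sigma+1}|q(t)|^{2\sigma}+\frac{\gamma-\log2}{2\pi}\right)|q(t)|^2,\qquad \|\phi\|_{H^1}^2=\|\phi\|_2^2+\|\nabla\phi\|_2^2,$$ are conserved: $M(t)=M(0)$ and $E(t)=E(0)$ for every $t\in[0,T]$. -/

import Mathlib

noncomputable section

open MeasureTheory Filter Topology Complex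
open scoped FourierTransform SchwartzMap RealInnerProductSpace

namespace PointNLS

/-- The Euclidean plane `ℝ²`. -/
abbrev Plane : Type := EuclideanSpace ℝ (Fin 2)

/-- The Hilbert space `L²(ℝ²)`. Its Fourier transform `𝓕` is Mathlib's, with kernel
`exp (-2πi ⟪x, ξ⟫)`; the momentum variable of the physics convention is `p = 2πξ`, so that the
symbol of `-Δ` is `(2π‖ξ‖)²`. -/
abbrev L2Plane : Type := Lp (α := Plane) ℂ 2

/-- `H¹(ℝ²)`, as a condition on `L²` functions. -/
def MemH1 (φ : L2Plane) : Prop :=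
  TemperedDistribution.MemSobolev 1 2 (φ : 𝓢'(Plane, ℂ))

/-- `‖φ‖²_{H¹} = ‖φ‖²_{L²} + ‖∇φ‖²_{L²} = ∫ (1 + p²) |φ̂|²`, for `φ ∈ H¹(ℝ²)`. -/
def h1NormSq (φ : L2Plane) : ℝ :=
  ∫ ξ : Plane, (1 + (2 * Real.pi * ‖ξ‖) ^ 2) * ‖(𝓕 φ : L2Plane) ξ‖ ^ 2

/-! ### The free propagator -/

/-- The symbol `exp (-i t p²)` of `exp (i t Δ)`. -/
def freeSymbol (t : ℝ) (ξ : Plane) : ℂ :=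
  exp (-I * ((t * (2 * Real.pi * ‖ξ‖) ^ 2 : ℝ) : ℂ))

theorem norm_freeSymbol (t : ℝ) (ξ : Plane) : ‖freeSymbol t ξ‖ = 1 := by
  rw [freeSymbol, neg_mul, ← mul_neg, ← ofReal_neg, mul_comm, norm_exp_ofReal_mul_I]

theorem continuous_freeSymbol (t : ℝ) : Continuous (freeSymbol t) := by
  unfold freeSymbol
  fun_prop

theorem memLp_freeSymbol_mul (t : ℝ) (f : L2Plane) :
    MemLp (fun ξ => freeSymbol t ξ * f ξ) 2 (volume : Measure Plane) := by
  refine (Lp.memLp f).of_le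
    ((continuous_freeSymbol t).aestronglyMeasurable.mul (Lp.aestronglyMeasurable f)) ?_
  filter_upwards with ξ
  rw [norm_mul, norm_freeSymbol, one_mul]

/-- The free propagator `U₀(t) = exp (i t Δ)` on `L²(ℝ²)`. -/
def freeEvolution (t : ℝ) (ψ : L2Plane) : L2Plane :=
  𝓕⁻ ((memLp_freeSymbol_mul t (𝓕 ψ)).toLp (fun ξ => freeSymbol t ξ * (𝓕 ψ : L2Plane) ξ))

/-- The kernel `U₀(t; r) = exp (-r² / (4 i t)) / (2 i t)` of the free propagator, normalised by
`(U₀(t) ψ)(x) = (2π)⁻¹ ∫ U₀(t; ‖x - x'‖) ψ(x') dx'`. -/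
def freeKernel (t r : ℝ) : ℂ :=
  exp (-((r : ℂ) ^ 2) / (4 * I * t)) / (2 * I * t)

/-- The value at the point `x` of `f ∈ L²(ℝ²)`, given by the improper Fourier inversion integral
`lim_{R → ∞} ∫_{‖ξ‖ < R} exp (2πi ⟪ξ, x⟫) f̂(ξ) dξ`. It is used for `f = U₀(τ) ψ₀` with `τ > 0`,
at the point `x = y`, where the limit exists for all initial data considered below and is the value
of the continuous representative, though `f̂` need not be integrable. -/
def pointValue (f : L2Plane) (x : Plane) : ℂ :=
  limUnder atTop fun R : ℝ =>
    ∫ ξ in Metric.ball (0 : Plane) R, exp (2 * Real.pi * ⟪ξ, x⟫ * I) * (𝓕 f : L2Plane) ξ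

/-! ### The singular profile and the form domain -/

/-- `exp (-i ⟪p, y⟫) / (p² + lam)`, times the factor `2π` between `𝓕` and the unitary Fourier
transform `(2π)⁻¹ ∫ exp (-i ⟪p, x⟫) f(x) dx`. -/
def macdonaldFourier (lam : ℝ) (y ξ : Plane) : ℂ :=
  2 * Real.pi * exp (-(2 * Real.pi * ⟪ξ, y⟫ * I)) /
    (((2 * Real.pi * ‖ξ‖) ^ 2 + lam : ℝ) : ℂ)

theorem memLp_macdonaldFourier {lam : ℝ} (hlam : 0 < lam) (y : Plane) :
    MemLp (macdonaldFourier lam y) 2 (volume : Measure Plane) := by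
  have hden : ∀ ξ : Plane, 0 < (2 * Real.pi * ‖ξ‖) ^ 2 + lam := fun ξ => by positivity
  have hcont : Continuous (macdonaldFourier lam y) := by
    unfold macdonaldFourier
    refine Continuous.div (by fun_prop) (by fun_prop) fun ξ => ?_
    exact_mod_cast (hden ξ).ne'
  have hc : 0 < min 1 lam := lt_min one_pos hlam
  have hbound : ∀ ξ : Plane,
      ‖macdonaldFourier lam y ξ‖ ≤ ‖2 * Real.pi / min 1 lam * (1 + ‖ξ‖ ^ 2)⁻¹‖ := by
    intro ξ
    have h1 : ‖exp (-(2 * Real.pi * ⟪ξ, y⟫ * I))‖ = 1 := by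
      have := norm_exp_ofReal_mul_I (-(2 * Real.pi * ⟪ξ, y⟫))
      rw [← this]
      push_cast
      ring_nf
    have h2 : min 1 lam * (1 + ‖ξ‖ ^ 2) ≤ (2 * Real.pi * ‖ξ‖) ^ 2 + lam := by
      have hp : (1 : ℝ) ≤ (2 * Real.pi) ^ 2 := by nlinarith [Real.pi_gt_three]
      have e1 : min 1 lam * ‖ξ‖ ^ 2 ≤ (2 * Real.pi) ^ 2 * ‖ξ‖ ^ 2 :=
        mul_le_mul_of_nonneg_right ((min_le_left _ _).trans hp) (by positivity)
      have e2 : min 1 lam ≤ lam := min_le_right _ _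
      rw [mul_pow]
      linarith
    rw [macdonaldFourier, norm_div, norm_mul, h1, mul_one, norm_real,
      Real.norm_of_nonneg (hden ξ).le, Real.norm_of_nonneg (by positivity)]
    have h3 : ‖(2 * Real.pi : ℂ)‖ = 2 * Real.pi := by
      rw [norm_mul, norm_real, Real.norm_of_nonneg Real.pi_pos.le]
      norm_num
    rw [h3, ← div_eq_mul_inv, div_div]
    exact div_le_div_of_nonneg_left (by positivity) (by positivity) h2
  refine MemLp.of_le (g := fun ξ : Plane => 2 * Real.pi / min 1 lam * (1 + ‖ξ‖ ^ 2)⁻¹) ?_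
    hcont.aestronglyMeasurable (Eventually.of_forall hbound)
  refine MemLp.const_mul ?_ _
  have hc2 : Continuous fun ξ : Plane => (1 + ‖ξ‖ ^ 2)⁻¹ :=
    Continuous.inv₀ (by fun_prop) fun ξ => by positivity
  rw [memLp_two_iff_integrable_sq hc2.aestronglyMeasurable]
  have hint := integrable_rpow_neg_one_add_norm_sq (E := Plane) (μ := volume) (r := 4)
    (by rw [finrank_euclideanSpace_fin]; norm_num)
  refine hint.congr (Eventually.of_forall fun ξ => ?_)
  have h4 : (-4 / 2 : ℝ) = -(2 : ℕ) := by norm_num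
  simp only [h4, Real.rpow_neg (show (0 : ℝ) ≤ 1 + ‖ξ‖ ^ 2 by positivity), Real.rpow_natCast,
    inv_pow]

/-- The `L²` function `x ↦ K₀(√lam ‖x - y‖)`, where `K₀(√lam ‖·‖)` (the Macdonald function) is the
inverse (unitary) Fourier transform of `(p² + lam)⁻¹`. -/
def macdonald (lam : ℝ) (hlam : 0 < lam) (y : Plane) : L2Plane :=
  𝓕⁻ ((memLp_macdonaldFourier hlam y).toLp (macdonaldFourier lam y))

/-- `φ_lam = ψ - (2π)⁻¹ q K₀(√lam ‖· - y‖)`. -/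
def regularPart (lam : ℝ) (hlam : 0 < lam) (y : Plane) (ψ : L2Plane) (q : ℂ) : L2Plane :=
  ψ - (q / (2 * Real.pi)) • macdonald lam hlam y

/-- `ψ` belongs to the form domain with charge `q`: the regular part of `ψ` relative to `q` is in
`H¹(ℝ²)`. -/
def HasCharge (lam : ℝ) (hlam : 0 < lam) (y : Plane) (ψ : L2Plane) (q : ℂ) : Prop :=
  MemH1 (regularPart lam hlam y ψ q)

/-- The set `𝒟` of initial data: `ψ = φ_lam + (2π)⁻¹ q K₀(√lam ‖· - y‖)` with `q ∈ ℂ`,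
`φ_lam ∈ H¹(ℝ²)` and `(1 + p^ε) φ̂_lam ∈ L¹(ℝ²)` for some `ε > 0`. -/
def initialData (lam : ℝ) (hlam : 0 < lam) (y : Plane) : Set L2Plane :=
  {ψ | ∃ q : ℂ, HasCharge lam hlam y ψ q ∧ ∃ ε : ℝ, 0 < ε ∧
    Integrable (fun ξ : Plane =>
      (((1 + (2 * Real.pi * ‖ξ‖) ^ ε : ℝ) : ℂ)) *
        (𝓕 (regularPart lam hlam y ψ q) : L2Plane) ξ)}

/-! ### The charge equation and the ansatz -/

/-- The Volterra function of order `-1`. -/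
def volterraKernel (t : ℝ) : ℝ :=
  ∫ τ in Set.Ioi (0 : ℝ), t ^ (τ - 1) / Real.Gamma τ

/-- `q` is a continuous solution on `[0, T]` of the charge equation. The equation is imposed for
`t > 0` (its right-hand side is discontinuous at `t = 0`, where the integral is void); the initial
value `q 0` is then fixed by the continuity of `q`. -/
def SolvesChargeEq (β₀ σ : ℝ) (y : Plane) (ψ₀ : L2Plane) (T : ℝ) (q : ℝ → ℂ) : Prop :=
  ContinuousOn q (Set.Icc 0 T) ∧
  ∀ t ∈ Set.Ioc 0 T,
    q t + 4 * Real.pi * β₀ *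
        (∫ τ in (0 : ℝ)..t, volterraKernel (t - τ) * ((‖q τ‖ ^ (2 * σ) : ℝ) : ℂ) * q τ)
      - 2 * (Real.log 2 - Real.eulerMascheroniConstant + I * Real.pi / 4) *
        (∫ τ in (0 : ℝ)..t, volterraKernel (t - τ) * q τ)
      = 4 * Real.pi *
        ∫ τ in (0 : ℝ)..t, volterraKernel (t - τ) * pointValue (freeEvolution τ ψ₀) y

/-- `ψ ∈ L²(ℝ²)` is the wave function at time `t`
`ψ(x) = (U₀(t) ψ₀)(x) + (i / 2π) ∫₀ᵗ U₀(t - τ; ‖x - y‖) q(τ) dτ`.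
The time integral does not converge absolutely at fixed `x`; the identity is meant in the sense of
(tempered) distributions in `x`. -/
def IsAnsatz (y : Plane) (ψ₀ : L2Plane) (q : ℝ → ℂ) (t : ℝ) (ψ : L2Plane) : Prop :=
  ∀ χ : 𝓢(Plane, ℂ),
    ∫ x : Plane, χ x * ψ x =
      (∫ x : Plane, χ x * freeEvolution t ψ₀ x) +
      (I / (2 * Real.pi)) *
        ∫ τ in (0 : ℝ)..t, (∫ x : Plane, χ x * freeKernel (t - τ) ‖x - y‖) * q τ

/-- The energy of a state `ψ` with charge `q`, through the decomposition with `lam = 1`. -/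
def energy (β₀ σ : ℝ) (y : Plane) (ψ : L2Plane) (q : ℂ) : ℝ :=
  h1NormSq (regularPart 1 one_pos y ψ q) +
    (β₀ / (σ + 1) * ‖q‖ ^ (2 * σ) +
      (Real.eulerMascheroniConstant - Real.log 2) / (2 * Real.pi)) * ‖q‖ ^ 2

end PointNLS

end

noncomputable section

open MeasureTheory Filter Topology Complex
open scoped FourierTransform SchwartzMap RealInnerProductSpace

namespace PointNLS

/-! ### The Volterra kernel -/

/-! Translate `y` to the origin, pass to the Fourier side and put k = p². The ansatz then says that
every mode is `wave`, the solution of ∂ₜw = -ikw + iq(t), and functions of k are integrated over the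
plane against dk/(4π) on (0, ∞). Formally the mass changes at the rate 2⟨iq, ∫w⟩. The energy density
(1 + k)|w - q/(k+1)|² equals |w|² + (k|w|² - 2⟨q, w⟩) + |q|²/(k+1), and the bracket changes at the
rate -2⟨q', w⟩. Both laws thus hinge on the trace ∫w at the origin, which diverges logarithmically.

The charge equation says that the renormalised trace is a force: with the cut-off e^{-εk}, the
quantity 4π∫e^{-εk}w + q log ε tends, after integration in time, to `chargeForce` of q
(`IsChargeSolution.tendsto_renormalizedTrace`). This rests on two facts. Sonine's relation
(`integral_volterraKernel_sub_mul_log`) says that the convolution of the Volterra kernel with -γ -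
log is 1, so the kernel can be inverted. And the profile 1/(k+1), freely evolved and evaluated at
the origin, is up to 1/(4π) the function e^z E₁(z) at z = it, whose logarithmic singularity is
isolated by `scaledExpIntegral_add_log`. The force is a real multiple of q, so ⟨iq, force⟩ = 0 and
the mass is conserved; twice the force is the gradient of `chargePotential`, whose change
compensates that of the H¹ norm.

The difficulty is that q is only continuous and that the regular part at later times is not known
beforehand to have finite energy. What the equation gives is q = q₀ + (Volterra kernel) * b with b
bounded. Hence q has the modulus of continuity `volterraPrimitive`, of size 1/log(1/h), and an L²
Gronwall inequality (`exists_volterra_stability`) improves this in the mean to ∫|q(t+h) - q(t)|² dt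
= o(h) (`IsChargeSolution.tendsto_increment`).

The balance laws are therefore proved for averages over [t, t+h], which are C¹ in time and have
finite energy for every continuous q (`integral_norm_sq_averagedWave_sub`,
`integral_averagedEnergyDensity_sub`); then h → 0. The o(h) bound turns the power of the force into
the difference of the potentials. At the initial time the averaged energy converges because its
error, of order (modulus)² log(1/h), vanishes (`tendsto_integral_averagedEnergyDensity_zero`). At
the final time Fatou's lemma yields finite energy, after which conjugation and time reversal reduce
the limit to the one at the initial time (`energy_conservation`, `mass_conservation`). -/

theorem continuous_inv_Gamma : Continuous fun τ : ℝ => (Real.Gamma τ)⁻¹ := by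
  have h : Continuous fun z : ℂ => (Complex.Gamma z)⁻¹ :=
    Complex.differentiable_one_div_Gamma.continuous
  have h2 := Complex.continuous_re.comp (h.comp Complex.continuous_ofReal)
  refine h2.congr fun τ => ?_
  simp only [Function.comp, Complex.Gamma_ofReal]
  rw [← Complex.ofReal_inv, Complex.ofReal_re]

/-- Keep only the part x > R of Euler's integral, where x^τ ≥ R^τ. The free parameter `R` is what
makes the bound useful. -/
theorem rpow_mul_exp_neg_le_Gamma {R τ : ℝ} (hR : 0 < R) (hτ : 0 ≤ τ) :
    R ^ τ * Real.exp (-R) ≤ Real.Gamma (τ + 1) := by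
  have hint := Real.GammaIntegral_convergent (s := τ + 1) (by linarith)
  rw [Real.Gamma_eq_integral (by linarith)]
  calc R ^ τ * Real.exp (-R) = ∫ x in Set.Ioi R, R ^ τ * Real.exp (-x) := by
        rw [integral_const_mul, integral_exp_neg_Ioi]
    _ ≤ ∫ x in Set.Ioi R, Real.exp (-x) * x ^ (τ + 1 - 1) := by
        refine setIntegral_mono_on ?_ (hint.mono_set (Set.Ioi_subset_Ioi hR.le)) measurableSet_Ioi ?_
        · exact (integrableOn_exp_neg_Ioi R).const_mul _
        · intro x hx
          rw [mul_comm, add_sub_cancel_right]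
          gcongr
          exact (Set.mem_Ioi.1 hx).le
    _ ≤ _ := by
        refine setIntegral_mono_set hint ?_ (Set.Ioi_subset_Ioi hR.le).eventuallyLE
        filter_upwards [ae_restrict_mem measurableSet_Ioi] with x hx
        have : (0 : ℝ) < x := hx
        positivity

/-- The choice R = e·t gives the decay e^{-τ} at large orders, hence integrability in τ; the choice
R = 1 gives the logarithmic smallness in `volterraPrimitive_le`. -/
theorem rpow_div_Gamma_le {R t τ : ℝ} (hR : 0 < R) (ht : 0 ≤ t) (hτ : 0 ≤ τ) :
    t ^ τ / Real.Gamma (τ + 1) ≤ Real.exp R * (t / R) ^ τ := by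
  have h := rpow_mul_exp_neg_le_Gamma hR hτ
  have h0 : 0 < R ^ τ * Real.exp (-R) := by positivity
  calc t ^ τ / Real.Gamma (τ + 1) ≤ t ^ τ / (R ^ τ * Real.exp (-R)) := by gcongr
    _ = _ := by
      rw [Real.div_rpow ht hR.le, Real.exp_neg]
      field_simp

theorem rpow_div_Gamma_le_exp {t τ : ℝ} (ht : 0 < t) (hτ : 0 ≤ τ) :
    t ^ τ / Real.Gamma (τ + 1) ≤ Real.exp (Real.exp 1 * t) * Real.exp (-τ) := by
  have h := rpow_div_Gamma_le (R := Real.exp 1 * t) (by positivity) ht.le hτ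
  have e : t / (Real.exp 1 * t) = Real.exp (-1) := by
    rw [Real.exp_neg]; field_simp
  rw [e, ← Real.exp_mul] at h
  simpa using h

theorem rpow_sub_one_div_Gamma {t τ : ℝ} (ht : 0 < t) (hτ : 0 < τ) :
    t ^ (τ - 1) / Real.Gamma τ = τ / t * (t ^ τ / Real.Gamma (τ + 1)) := by
  rw [Real.Gamma_add_one hτ.ne', Real.rpow_sub_one ht.ne']
  have := (Real.Gamma_pos_of_pos hτ).ne'
  field_simp

theorem rpow_sub_one_div_Gamma_nonneg {t τ : ℝ} (ht : 0 ≤ t) (hτ : 0 < τ) :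
    0 ≤ t ^ (τ - 1) / Real.Gamma τ :=
  div_nonneg (Real.rpow_nonneg ht _) (Real.Gamma_pos_of_pos hτ).le

theorem integrableOn_volterra {t : ℝ} (ht : 0 < t) :
    IntegrableOn (fun τ => t ^ (τ - 1) / Real.Gamma τ) (Set.Ioi 0) := by
  -- The majorant is a multiple of τ e^{-τ}, written as the integrand of Γ(2).
  have hg : IntegrableOn (fun τ : ℝ => (Real.exp (Real.exp 1 * t) / t) * (Real.exp (-τ) * τ ^ ((2 : ℝ) - 1)))
      (Set.Ioi 0) := (Real.GammaIntegral_convergent (s := 2) (by norm_num)).const_mul _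
  refine Integrable.mono' hg ?_ ?_
  · have : Continuous fun τ : ℝ => t ^ (τ - 1) * (Real.Gamma τ)⁻¹ := by
      refine Continuous.mul ?_ continuous_inv_Gamma
      exact Continuous.rpow continuous_const (by fun_prop) fun _ => Or.inl ht.ne'
    exact this.aestronglyMeasurable
  · filter_upwards [ae_restrict_mem measurableSet_Ioi] with τ hτ
    have hτ : 0 < τ := hτ
    rw [Real.norm_of_nonneg (rpow_sub_one_div_Gamma_nonneg ht.le hτ), rpow_sub_one_div_Gamma ht hτ]
    have h1 : (2 : ℝ) - 1 = 1 := by norm_num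
    rw [h1, Real.rpow_one]
    calc τ / t * (t ^ τ / Real.Gamma (τ + 1))
        ≤ τ / t * (Real.exp (Real.exp 1 * t) * Real.exp (-τ)) := by
          gcongr; exact rpow_div_Gamma_le_exp ht hτ.le
      _ = _ := by ring

theorem integrableOn_rpow_div_Gamma {t : ℝ} (ht : 0 < t) :
    IntegrableOn (fun τ => t ^ τ / Real.Gamma (τ + 1)) (Set.Ioi 0) := by
  refine Integrable.mono' ((integrableOn_exp_neg_Ioi 0).const_mul (Real.exp (Real.exp 1 * t))) ?_ ?_
  · have : Continuous fun τ : ℝ => t ^ τ * (Real.Gamma (τ + 1))⁻¹ := by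
      refine Continuous.mul ?_ (continuous_inv_Gamma.comp (by fun_prop : Continuous fun τ : ℝ => τ + 1))
      exact Continuous.rpow continuous_const (by fun_prop) fun _ => Or.inl ht.ne'
    exact this.aestronglyMeasurable
  · filter_upwards [ae_restrict_mem measurableSet_Ioi] with τ hτ
    have hτ : 0 < τ := hτ
    rw [Real.norm_of_nonneg (div_nonneg (by positivity) (Real.Gamma_pos_of_pos (by linarith)).le)]
    exact rpow_div_Gamma_le_exp ht hτ.le

theorem volterraKernel_nonneg {t : ℝ} (ht : 0 ≤ t) : 0 ≤ volterraKernel t :=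
  setIntegral_nonneg measurableSet_Ioi fun _ hτ => rpow_sub_one_div_Gamma_nonneg ht hτ

/-- The Volterra function of order `0`, the primitive of `volterraKernel`. -/
def volterraPrimitive (t : ℝ) : ℝ :=
  ∫ τ in Set.Ioi (0 : ℝ), t ^ τ / Real.Gamma (τ + 1)

theorem volterraPrimitive_nonneg {t : ℝ} (ht : 0 ≤ t) : 0 ≤ volterraPrimitive t :=
  setIntegral_nonneg measurableSet_Ioi fun τ hτ => div_nonneg (Real.rpow_nonneg ht _)
    (Real.Gamma_pos_of_pos (by linarith [Set.mem_Ioi.1 hτ])).le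

theorem measurable_volterra_integrand :
    Measurable fun p : ℝ × ℝ => p.2 ^ (p.1 - 1) / Real.Gamma p.1 := by
  simp only [div_eq_mul_inv]
  exact (measurable_snd.pow (measurable_fst.sub_const 1)).mul
    (continuous_inv_Gamma.measurable.comp measurable_fst)

theorem measurable_volterraKernel : Measurable volterraKernel := by
  have h : StronglyMeasurable fun p : ℝ × ℝ => p.1 ^ (p.2 - 1) / Real.Gamma p.2 :=
    (measurable_volterra_integrand.comp measurable_swap).stronglyMeasurable
  exact (h.integral_prod_right (ν := volume.restrict (Set.Ioi 0))).measurable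

theorem ofReal_volterraKernel {t : ℝ} (ht : 0 < t) :
    ENNReal.ofReal (volterraKernel t) =
      ∫⁻ τ in Set.Ioi (0 : ℝ), ENNReal.ofReal (t ^ (τ - 1) / Real.Gamma τ) := by
  rw [volterraKernel, ofReal_integral_eq_lintegral_ofReal (integrableOn_volterra ht)]
  filter_upwards [ae_restrict_mem measurableSet_Ioi] with τ hτ
  exact rpow_sub_one_div_Gamma_nonneg ht.le hτ

/-- Euler's beta integral: the Riemann–Liouville kernels form a convolution semigroup. The form with
`ENNReal` values lets Tonelli's theorem be applied afterwards without integrability conditions. -/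
theorem lintegral_beta {τ w t : ℝ} (hτ : 0 < τ) (hw : -1 < w) (ht : 0 < t) :
    ∫⁻ s in Set.Ioo 0 t, ENNReal.ofReal ((t - s) ^ (τ - 1) / Real.Gamma τ) *
        ENNReal.ofReal (s ^ w / Real.Gamma (w + 1)) =
      ENNReal.ofReal (t ^ (τ + w) / Real.Gamma (τ + w + 1)) := by
  have hw1 : 0 < w + 1 := by linarith
  have hG1 := Real.Gamma_pos_of_pos hτ
  have hG2 := Real.Gamma_pos_of_pos hw1
  have hG3 := Real.Gamma_pos_of_pos (show 0 < τ + w + 1 by linarith)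
  have key : ∀ s ∈ Set.Ioo 0 t, ((s : ℂ) ^ (((w + 1 : ℝ) : ℂ) - 1) * ((t : ℂ) - s) ^ ((τ : ℂ) - 1)) =
      ((s ^ w * (t - s) ^ (τ - 1) : ℝ) : ℂ) := by
    intro s hs
    rw [Complex.ofReal_mul, Complex.ofReal_cpow hs.1.le, Complex.ofReal_cpow (by linarith [hs.2])]
    push_cast
    ring_nf
  have hI : IntervalIntegrable (fun s : ℝ => ((s : ℂ) ^ (((w + 1 : ℝ) : ℂ) - 1) *
      ((t : ℂ) - s) ^ ((τ : ℂ) - 1))) volume 0 t := by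
    have hb := Complex.betaIntegral_convergent (u := ((w + 1 : ℝ) : ℂ)) (v := (τ : ℂ))
      (by simpa using hw1) (by simpa using hτ)
    -- The substitution s = t·u carries the convergence from [0, 1] to [0, t].
    have h2 := (hb.comp_mul_left (c := t⁻¹)).const_mul ((t : ℂ) ^ (((w + 1 : ℝ) : ℂ) - 1 + ((τ : ℂ) - 1)))
    simp only [zero_div, one_div, inv_inv] at h2
    rw [intervalIntegrable_iff_integrableOn_Ioo_of_le ht.le] at h2 ⊢
    refine h2.congr_fun (fun s hs => ?_) measurableSet_Ioo
    have ht' : (t : ℂ) ≠ 0 := Complex.ofReal_ne_zero.2 ht.ne'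
    have hs' : (0:ℝ) ≤ s / t := div_nonneg hs.1.le ht.le
    have e1 : (s : ℂ) = (t : ℂ) * ((t⁻¹ * s : ℝ) : ℂ) := by
      push_cast; field_simp
    have e2 : ((t : ℂ) - s) = (t : ℂ) * ((1 - t⁻¹ * s : ℝ) : ℂ) := by
      push_cast; field_simp
    have h3 : (0:ℝ) ≤ 1 - t⁻¹ * s := by
      rw [inv_mul_eq_div, sub_nonneg]; exact (div_le_one ht).2 hs.2.le
    conv_rhs => rw [e2, e1, Complex.mul_cpow_ofReal_nonneg ht.le (by rw [inv_mul_eq_div]; exact hs'),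
      Complex.mul_cpow_ofReal_nonneg ht.le h3]
    simp only []
    rw [Complex.cpow_add _ _ ht']
    push_cast
    ring
  have hR : IntegrableOn (fun s : ℝ => s ^ w * (t - s) ^ (τ - 1)) (Set.Ioo 0 t) := by
    rw [intervalIntegrable_iff_integrableOn_Ioo_of_le ht.le] at hI
    have := (hI.congr_fun key measurableSet_Ioo).re
    simpa [IntegrableOn] using this
  have hval : ∫ s in Set.Ioo 0 t, s ^ w * (t - s) ^ (τ - 1) =
      t ^ (τ + w) * (Real.Gamma τ * Real.Gamma (w + 1) / Real.Gamma (τ + w + 1)) := by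
    have h1 := Complex.betaIntegral_scaled ((w + 1 : ℝ) : ℂ) (τ : ℂ) ht
    have h2 := Complex.Gamma_mul_Gamma_eq_betaIntegral (s := ((w + 1 : ℝ) : ℂ)) (t := (τ : ℂ))
      (by simpa using hw1) (by simpa using hτ)
    rw [intervalIntegral.integral_of_le ht.le, integral_Ioc_eq_integral_Ioo,
      setIntegral_congr_fun measurableSet_Ioo key, integral_complex_ofReal] at h1
    rw [← Complex.ofReal_add, Complex.Gamma_ofReal, Complex.Gamma_ofReal, Complex.Gamma_ofReal] at h2
    have e : w + 1 + τ = τ + w + 1 := by ring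
    have e3 : ((w + 1 : ℝ) : ℂ) + τ - 1 = ((τ + w : ℝ) : ℂ) := by push_cast; ring
    rw [e] at h2
    rw [e3, ← Complex.ofReal_cpow ht.le] at h1
    have h4 : Complex.betaIntegral ((w + 1 : ℝ) : ℂ) (τ : ℂ) =
        ((Real.Gamma τ * Real.Gamma (w + 1) / Real.Gamma (τ + w + 1) : ℝ) : ℂ) := by
      rw [Complex.ofReal_div, eq_div_iff (Complex.ofReal_ne_zero.2 hG3.ne'), mul_comm, ← h2]
      push_cast; ring
    rw [h4] at h1
    exact_mod_cast h1
  have h5 : ∀ s ∈ Set.Ioo 0 t, ENNReal.ofReal ((t - s) ^ (τ - 1) / Real.Gamma τ) *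
        ENNReal.ofReal (s ^ w / Real.Gamma (w + 1)) =
      ENNReal.ofReal ((Real.Gamma τ * Real.Gamma (w + 1))⁻¹ * (s ^ w * (t - s) ^ (τ - 1))) := by
    intro s hs
    rw [← ENNReal.ofReal_mul (rpow_sub_one_div_Gamma_nonneg (by linarith [hs.2]) hτ)]
    congr 1
    field_simp
  rw [setLIntegral_congr_fun measurableSet_Ioo h5, ← ofReal_integral_eq_lintegral_ofReal
    (hR.const_mul _), integral_const_mul, hval]
  · congr 1
    field_simp
  · filter_upwards [ae_restrict_mem measurableSet_Ioo] with s hs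
    have h1 : 0 ≤ t - s := by linarith [hs.2]
    have h2 : 0 ≤ s := hs.1.le
    have := Real.rpow_nonneg h1 (τ - 1)
    have := Real.rpow_nonneg h2 w
    simp only [Pi.zero_apply]
    positivity

/-- The Volterra kernel is the superposition over all orders τ > 0 of Riemann–Liouville kernels, so
Tonelli reduces the convolution to the semigroup law at each order. -/
theorem lintegral_volterraKernel_mul_rpow {w t : ℝ} (hw : -1 < w) (ht : 0 < t) :
    ∫⁻ s in Set.Ioo 0 t, ENNReal.ofReal (volterraKernel (t - s)) *
        ENNReal.ofReal (s ^ w / Real.Gamma (w + 1)) =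
      ∫⁻ τ in Set.Ioi (0 : ℝ), ENNReal.ofReal (t ^ (τ + w) / Real.Gamma (τ + w + 1)) := by
  have hmeas : Measurable fun p : ℝ × ℝ => ENNReal.ofReal ((t - p.1) ^ (p.2 - 1) / Real.Gamma p.2) *
      ENNReal.ofReal (p.1 ^ w / Real.Gamma (w + 1)) := by
    refine Measurable.mul ?_
      ((measurable_fst.pow_const w).div_const _).ennreal_ofReal
    exact (measurable_volterra_integrand.comp
      (measurable_snd.prodMk (measurable_const.sub measurable_fst))).ennreal_ofReal
  have h1 : ∀ s ∈ Set.Ioo 0 t, ENNReal.ofReal (volterraKernel (t - s)) *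
        ENNReal.ofReal (s ^ w / Real.Gamma (w + 1)) =
      ∫⁻ τ in Set.Ioi (0 : ℝ), ENNReal.ofReal ((t - s) ^ (τ - 1) / Real.Gamma τ) *
        ENNReal.ofReal (s ^ w / Real.Gamma (w + 1)) := by
    intro s hs
    rw [ofReal_volterraKernel (by linarith [hs.2] : 0 < t - s), lintegral_mul_const]
    exact (measurable_volterra_integrand.comp
      (measurable_id.prodMk measurable_const)).ennreal_ofReal
  rw [setLIntegral_congr_fun measurableSet_Ioo h1, lintegral_lintegral_swap hmeas.aemeasurable]
  exact setLIntegral_congr_fun measurableSet_Ioi fun τ hτ => lintegral_beta hτ hw ht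

theorem lintegral_volterraKernel_mul_rpow_lt_top {w t : ℝ} (hw : -1 < w) (ht : 0 < t) :
    ∫⁻ s in Set.Ioo 0 t, ENNReal.ofReal (volterraKernel (t - s)) *
        ENNReal.ofReal (s ^ w / Real.Gamma (w + 1)) < ⊤ := by
  rw [lintegral_volterraKernel_mul_rpow hw ht]
  have hi : IntegrableOn (fun τ => t ^ (τ + w) / Real.Gamma (τ + w + 1)) (Set.Ioi 0) := by
    have h := (integrableOn_volterra ht).mono_set (Set.Ioi_subset_Ioi (by linarith : 0 ≤ w + 1))
    have h2 := ((measurePreserving_add_right volume (w + 1)).integrableOn_comp_preimage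
      (measurableEmbedding_addRight (w + 1))).2 h
    rw [Set.preimage_add_const_Ioi, sub_self] at h2
    refine h2.congr_fun (fun τ _ => ?_) measurableSet_Ioi
    simp only [Function.comp]
    congr 2 <;> ring
  exact hi.lintegral_lt_top

/-- Negative exponents w > -1 are included so that a logarithm can be dominated by the powers ±1/2.
-/
theorem integrableOn_volterraKernel_sub_mul_rpow {w t : ℝ} (hw : -1 < w) (ht : 0 < t) :
    IntegrableOn (fun s => volterraKernel (t - s) * (s ^ w / Real.Gamma (w + 1))) (Set.Ioo 0 t) := by
  have hG := Real.Gamma_pos_of_pos (show 0 < w + 1 by linarith)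
  have hm : Measurable fun s : ℝ => volterraKernel (t - s) * (s ^ w / Real.Gamma (w + 1)) :=
    (measurable_volterraKernel.comp (measurable_const.sub measurable_id)).mul
      ((measurable_id.pow_const w).div_const _)
  refine ⟨hm.aestronglyMeasurable, ?_⟩
  rw [hasFiniteIntegral_iff_norm]
  refine lt_of_le_of_lt (le_of_eq ?_) (lintegral_volterraKernel_mul_rpow_lt_top hw ht)
  refine setLIntegral_congr_fun measurableSet_Ioo fun s hs => ?_
  have h1 := volterraKernel_nonneg (show 0 ≤ t - s by linarith [hs.2])
  have h2 := Real.rpow_nonneg hs.1.le w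
  rw [Real.norm_of_nonneg (by positivity), ENNReal.ofReal_mul h1]

/-- Convolving with a power of order w only moves the lower limit in the integral over orders.
Differentiating this in w at 0 is the source of Sonine's relation. -/
theorem setIntegral_volterraKernel_sub_mul_rpow {w t : ℝ} (hw : 0 ≤ w) (ht : 0 < t) :
    ∫ s in Set.Ioo 0 t, volterraKernel (t - s) * (s ^ w / Real.Gamma (w + 1)) =
      ∫ τ in Set.Ioi w, t ^ τ / Real.Gamma (τ + 1) := by
  have hG := Real.Gamma_pos_of_pos (show 0 < w + 1 by linarith)
  have e : ∫ τ in Set.Ioi w, t ^ τ / Real.Gamma (τ + 1) =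
      ∫ τ in Set.Ioi (0 : ℝ), t ^ (τ + w) / Real.Gamma (τ + w + 1) := by
    have := (measurePreserving_add_right volume w).setIntegral_preimage_emb
      (measurableEmbedding_addRight w) (fun τ => t ^ τ / Real.Gamma (τ + 1)) (Set.Ioi w)
    rw [Set.preimage_add_const_Ioi, sub_self] at this
    exact this.symm
  rw [e, integral_eq_lintegral_of_nonneg_ae, integral_eq_lintegral_of_nonneg_ae]
  · congr 1
    rw [← lintegral_volterraKernel_mul_rpow (by linarith) ht]
    refine setLIntegral_congr_fun measurableSet_Ioo fun s hs => ?_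
    exact ENNReal.ofReal_mul (volterraKernel_nonneg (by linarith [hs.2]))
  · filter_upwards [ae_restrict_mem measurableSet_Ioi] with τ hτ
    exact div_nonneg (Real.rpow_nonneg ht.le _)
      (Real.Gamma_pos_of_pos (by linarith [Set.mem_Ioi.1 hτ])).le
  · refine Continuous.aestronglyMeasurable ?_
    simp only [div_eq_mul_inv]
    exact (Continuous.rpow continuous_const (by fun_prop) fun _ => Or.inl ht.ne').mul
      (continuous_inv_Gamma.comp (by fun_prop : Continuous fun τ : ℝ => τ + w + 1))
  · filter_upwards [ae_restrict_mem measurableSet_Ioo] with s hs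
    have h1 := volterraKernel_nonneg (show 0 ≤ t - s by linarith [hs.2])
    have h2 := Real.rpow_nonneg hs.1.le w
    simp only [Pi.zero_apply]
    positivity
  · exact (integrableOn_volterraKernel_sub_mul_rpow (by linarith) ht).1

theorem intervalIntegrable_volterraKernel (t : ℝ) (ht : 0 ≤ t) :
    IntervalIntegrable volterraKernel volume 0 t := by
  rcases ht.eq_or_lt with rfl | ht
  · exact IntervalIntegrable.refl
  have h := integrableOn_volterraKernel_sub_mul_rpow (w := 0) (by norm_num) ht
  simp only [Real.rpow_zero, zero_add, Real.Gamma_one, div_one, mul_one] at h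
  rw [← intervalIntegrable_iff_integrableOn_Ioo_of_le ht.le] at h
  simpa using (h.comp_sub_left t).symm

theorem integral_volterraKernel {t : ℝ} (ht : 0 < t) :
    ∫ s in (0 : ℝ)..t, volterraKernel s = volterraPrimitive t := by
  have h := setIntegral_volterraKernel_sub_mul_rpow (w := 0) le_rfl ht
  simp only [Real.rpow_zero, zero_add, Real.Gamma_one, div_one, mul_one] at h
  rw [← integral_Ioc_eq_integral_Ioo, ← intervalIntegral.integral_of_le ht.le,
    intervalIntegral.integral_comp_sub_left (fun s => volterraKernel s)] at h
  simpa [volterraPrimitive] using h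

/-- The integrand is at most e·h^τ, whose integral over τ > 0 is e/(-log h). This decay is slow, but
exactly enough to beat the logarithmic divergence of the energy. -/
theorem volterraPrimitive_le {h : ℝ} (h0 : 0 < h) (h1 : h < 1) :
    volterraPrimitive h ≤ Real.exp 1 / -Real.log h := by
  have hl : 0 < -Real.log h := by linarith [Real.log_neg h0 h1]
  have hi := integral_exp_mul_Ioi (a := Real.log h) (by linarith) 0
  have hii := integrableOn_exp_mul_Ioi (a := Real.log h) (by linarith) 0
  calc volterraPrimitive h ≤ ∫ τ in Set.Ioi (0 : ℝ), Real.exp 1 * Real.exp (Real.log h * τ) := by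
        refine setIntegral_mono_on (integrableOn_rpow_div_Gamma h0) (hii.const_mul _)
          measurableSet_Ioi fun τ hτ => ?_
        have := rpow_div_Gamma_le one_pos h0.le (le_of_lt (Set.mem_Ioi.1 hτ))
        rw [div_one] at this
        rwa [← Real.rpow_def_of_pos h0]
    _ = _ := by
        rw [integral_const_mul, hi]
        simp [div_eq_mul_inv]

end PointNLS

/-! ### Sonine's relation and the variation of the Volterra kernel -/

namespace PointNLS

theorem abs_log_le {s : ℝ} (hs : 0 < s) :
    |Real.log s| ≤ 2 * s ^ (1 / 2 : ℝ) + 2 * s ^ (-(1 / 2) : ℝ) := by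
  have h1 := Real.log_le_rpow_div hs.le (ε := 1 / 2) (by norm_num)
  have h2 := Real.log_le_rpow_div (inv_pos.2 hs).le (ε := 1 / 2) (by norm_num)
  rw [Real.log_inv, Real.inv_rpow hs.le, ← Real.rpow_neg hs.le] at h2
  have p1 := Real.rpow_nonneg hs.le (1 / 2 : ℝ)
  have p2 := Real.rpow_nonneg hs.le (-(1 / 2) : ℝ)
  rw [abs_le]
  constructor <;> linarith

theorem integrableOn_volterraKernel_sub_mul_log {t : ℝ} (ht : 0 < t) :
    IntegrableOn (fun s => volterraKernel (t - s) * |Real.log s|) (Set.Ioo 0 t) := by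
  have h1 := integrableOn_volterraKernel_sub_mul_rpow (w := 1 / 2) (by norm_num) ht
  have h2 := integrableOn_volterraKernel_sub_mul_rpow (w := -(1 / 2)) (by norm_num) ht
  have h3 := (h1.const_mul (2 * Real.Gamma (1 / 2 + 1))).add
    (h2.const_mul (2 * Real.Gamma (-(1 / 2) + 1)))
  have g1 := Real.Gamma_pos_of_pos (show (0 : ℝ) < 1 / 2 + 1 by norm_num)
  have g2 := Real.Gamma_pos_of_pos (show (0 : ℝ) < -(1 / 2) + 1 by norm_num)
  refine Integrable.mono' h3 ?_ ?_
  · exact ((measurable_volterraKernel.comp (measurable_const.sub measurable_id)).mul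
      (Real.measurable_log.norm)).aestronglyMeasurable
  · filter_upwards [ae_restrict_mem measurableSet_Ioo] with s hs
    have hk := volterraKernel_nonneg (show 0 ≤ t - s by linarith [hs.2])
    rw [Real.norm_of_nonneg (by positivity)]
    have := mul_le_mul_of_nonneg_left (abs_log_le hs.1) hk
    refine this.trans (le_of_eq ?_)
    simp only [Pi.add_apply]
    field_simp

theorem integrableOn_volterraKernel_sub {t : ℝ} (ht : 0 < t) :
    IntegrableOn (fun s => volterraKernel (t - s)) (Set.Ioo 0 t) := by
  simpa using integrableOn_volterraKernel_sub_mul_rpow (w := 0) (by norm_num) ht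

/-- From e^x ≥ 1 + x, applied to the exponent w, or for s ≥ 1 to the exponent -w followed by
multiplication by s^w ≤ s. It bounds the difference quotients (1 - s^w)/w uniformly in w. -/
theorem abs_one_sub_rpow_le {s w : ℝ} (hs : 0 < s) (hw : 0 < w) (hw1 : w ≤ 1) :
    |1 - s ^ w| ≤ w * |Real.log s| * (1 + s) := by
  have h1 : w * Real.log s + 1 ≤ s ^ w := by
    rw [Real.rpow_def_of_pos hs, mul_comm (Real.log s)]; exact Real.add_one_le_exp _
  rcases le_total s 1 with h | h
  · have hl := Real.log_nonpos hs.le h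
    have h2 := Real.rpow_le_one hs.le h hw.le
    rw [abs_of_nonneg (by linarith), abs_of_nonpos hl]
    nlinarith [mul_nonneg (mul_nonneg hw.le (neg_nonneg.2 hl)) hs.le]
  · have hl := Real.log_nonneg h
    have h2 := Real.one_le_rpow h hw.le
    rw [abs_of_nonpos (by linarith), abs_of_nonneg hl]
    have h3 : -(w * Real.log s) + 1 ≤ s ^ (-w) := by
      rw [Real.rpow_def_of_pos hs]; convert Real.add_one_le_exp (Real.log s * -w) using 2; ring
    have h4 : s ^ w * s ^ (-w) = 1 := by rw [← Real.rpow_add hs]; simp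
    have h5 : s ^ w ≤ s := by simpa using Real.rpow_le_rpow_of_exponent_le h hw1
    have h6 := mul_le_mul_of_nonneg_left h3 (by linarith : 0 ≤ s ^ w)
    rw [h4] at h6
    nlinarith [mul_nonneg hw.le hl, mul_le_mul_of_nonneg_right h5 (mul_nonneg hw.le hl)]

theorem hasDerivAt_rpow_div_Gamma {s : ℝ} (hs : 0 < s) :
    HasDerivAt (fun w : ℝ => s ^ w / Real.Gamma (w + 1))
      (Real.log s + Real.eulerMascheroniConstant) 0 := by
  have h1 := (Real.hasStrictDerivAt_const_rpow hs 0).hasDerivAt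
  have h2 : HasDerivAt (fun w : ℝ => Real.Gamma (w + 1)) (-Real.eulerMascheroniConstant) 0 := by
    have := Real.hasDerivAt_Gamma_one
    exact HasDerivAt.comp_add_const 0 1 (by simpa using this)
  have h3 := h1.div h2 (by simp)
  convert! h3 using 1
  simp

/-- Sonine's relation between the Volterra kernel and the logarithm. -/
theorem integral_volterraKernel_sub_mul_log {t : ℝ} (ht : 0 < t) :
    ∫ s in Set.Ioo 0 t, volterraKernel (t - s) * (-Real.eulerMascheroniConstant - Real.log s) = 1 := by
  set γ := Real.eulerMascheroniConstant
  -- Subtracting the exponent w from the exponent 0 leaves the integral over the orders in (0, w].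
  -- Divided by w, this mean tends to 1, the value of t^τ/Γ(τ+1) at τ = 0, while the quotient under
  -- the convolution tends to -γ - log s, because the derivative of s^w/Γ(w+1) at w = 0 is log s +
  -- γ.
  have hval : ∀ w : ℝ, 0 < w → ∫ s in Set.Ioo 0 t, volterraKernel (t - s) *
      ((1 - s ^ w / Real.Gamma (w + 1)) / w) =
        w⁻¹ • ∫ τ in (0 : ℝ)..w, t ^ τ / Real.Gamma (τ + 1) := by
    intro w hw
    have h0 := setIntegral_volterraKernel_sub_mul_rpow (w := 0) le_rfl ht
    have h1 := setIntegral_volterraKernel_sub_mul_rpow hw.le ht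
    have i0 := integrableOn_volterraKernel_sub_mul_rpow (w := 0) (by norm_num) ht
    have i1 := integrableOn_volterraKernel_sub_mul_rpow (w := w) (by linarith) ht
    have e : ∀ s : ℝ, volterraKernel (t - s) * ((1 - s ^ w / Real.Gamma (w + 1)) / w) =
        w⁻¹ * (volterraKernel (t - s) * (s ^ (0 : ℝ) / Real.Gamma (0 + 1)) -
          volterraKernel (t - s) * (s ^ w / Real.Gamma (w + 1))) := by
      intro s
      simp only [Real.rpow_zero, zero_add, Real.Gamma_one]
      ring
    simp_rw [e]
    rw [integral_const_mul, integral_sub i0 i1, h0, h1, smul_eq_mul,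
      intervalIntegral.integral_Ioi_sub_Ioi (integrableOn_rpow_div_Gamma ht) hw.le]
  have hlim : Tendsto (fun w : ℝ => w⁻¹ • ∫ τ in (0 : ℝ)..w, t ^ τ / Real.Gamma (τ + 1))
      (𝓝[>] 0) (𝓝 1) := by
    have hc : Continuous fun τ : ℝ => t ^ τ / Real.Gamma (τ + 1) := by
      simp only [div_eq_mul_inv]
      exact (Continuous.rpow continuous_const (by fun_prop) fun _ => Or.inl ht.ne').mul
        (continuous_inv_Gamma.comp (by fun_prop : Continuous fun τ : ℝ => τ + 1))
    have hd := hc.integral_hasStrictDerivAt 0 0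
    have := hd.hasDerivAt.tendsto_slope_zero_right
    simpa using this
  have hpt : ∀ s ∈ Set.Ioo 0 t, Tendsto (fun w : ℝ => volterraKernel (t - s) *
      ((1 - s ^ w / Real.Gamma (w + 1)) / w)) (𝓝[>] 0)
      (𝓝 (volterraKernel (t - s) * (-γ - Real.log s))) := by
    intro s hs
    refine Tendsto.const_mul _ ?_
    have := (hasDerivAt_rpow_div_Gamma hs.1).tendsto_slope_zero_right.neg
    have e : -(Real.log s + γ) = -γ - Real.log s := by ring
    rw [e] at this
    refine this.congr fun w => ?_
    simp [div_eq_mul_inv]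
    ring
  have hg0 : Tendsto (fun w : ℝ => (Real.Gamma (w + 1))⁻¹) (𝓝[>] 0) (𝓝 1) := by
    have := (continuous_inv_Gamma.comp (by fun_prop : Continuous fun τ : ℝ => τ + 1)).tendsto 0
    simp only [Function.comp, zero_add, Real.Gamma_one, inv_one] at this
    exact this.mono_left nhdsWithin_le_nhds
  have hg1 : Tendsto (fun w : ℝ => (1 - (Real.Gamma (w + 1))⁻¹) / w) (𝓝[>] 0) (𝓝 (-γ)) := by
    have := (hasDerivAt_rpow_div_Gamma one_pos).tendsto_slope_zero_right.neg
    simp only [Real.log_one, zero_add] at this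
    refine this.congr fun w => ?_
    simp [div_eq_mul_inv]
    ring
  have hb0 : ∀ᶠ w in 𝓝[>] (0 : ℝ), |(Real.Gamma (w + 1))⁻¹| ≤ 2 := by
    filter_upwards [hg0.abs.eventually_lt_const (by norm_num : |(1 : ℝ)| < 2)] with w hw using hw.le
  have hb1 : ∀ᶠ w in 𝓝[>] (0 : ℝ), |(1 - (Real.Gamma (w + 1))⁻¹) / w| ≤ |γ| + 1 := by
    filter_upwards [hg1.abs.eventually_lt_const (by rw [abs_neg]; linarith : |-γ| < |γ| + 1)]
      with w hw using hw.le
  have hdom : Tendsto (fun w : ℝ => ∫ s in Set.Ioo 0 t, volterraKernel (t - s) *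
      ((1 - s ^ w / Real.Gamma (w + 1)) / w)) (𝓝[>] 0)
      (𝓝 (∫ s in Set.Ioo 0 t, volterraKernel (t - s) * (-γ - Real.log s))) := by
    refine tendsto_integral_filter_of_dominated_convergence
      (fun s => 2 * (1 + t) * (volterraKernel (t - s) * |Real.log s|) +
        (|γ| + 1) * volterraKernel (t - s)) ?_ ?_ ?_ ?_
    · refine Eventually.of_forall fun w => Measurable.aestronglyMeasurable ?_
      exact (measurable_volterraKernel.comp (measurable_const.sub measurable_id)).mul
        ((measurable_const.sub ((measurable_id.pow_const w).div_const _)).div_const _)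
    · filter_upwards [hb0, hb1, Ioc_mem_nhdsGT (zero_lt_one' ℝ)] with w h0 h1 hw
      filter_upwards [ae_restrict_mem measurableSet_Ioo] with s hs
      have hk := volterraKernel_nonneg (show 0 ≤ t - s by linarith [hs.2])
      rw [norm_mul, Real.norm_of_nonneg hk]
      -- This splitting confines the dependence on s to (1 - s^w)/w; the remaining factors converge
      -- as w → 0 and so are bounded near 0.
      have e : (1 - s ^ w / Real.Gamma (w + 1)) / w =
          ((1 - s ^ w) / w) * (Real.Gamma (w + 1))⁻¹ + (1 - (Real.Gamma (w + 1))⁻¹) / w := by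
        ring
      have h2 : |(1 - s ^ w) / w| ≤ |Real.log s| * (1 + t) := by
        rw [abs_div, abs_of_pos hw.1, div_le_iff₀ hw.1]
        refine (abs_one_sub_rpow_le hs.1 hw.1 hw.2).trans ?_
        have : w * |Real.log s| * (1 + s) ≤ w * |Real.log s| * (1 + t) := by
          have := hw.1.le
          gcongr
          exact hs.2.le
        linarith
      have h3 : ‖(1 - s ^ w / Real.Gamma (w + 1)) / w‖ ≤ |Real.log s| * (1 + t) * 2 + (|γ| + 1) := by
        rw [e, Real.norm_eq_abs]
        refine (abs_add_le _ _).trans ?_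
        rw [abs_mul]
        gcongr
      calc _ ≤ volterraKernel (t - s) * (|Real.log s| * (1 + t) * 2 + (|γ| + 1)) := by gcongr
        _ = _ := by ring
    · exact ((integrableOn_volterraKernel_sub_mul_log ht).const_mul _).add
        ((integrableOn_volterraKernel_sub ht).const_mul _)
    · filter_upwards [ae_restrict_mem measurableSet_Ioo] with s hs using hpt s hs
  refine tendsto_nhds_unique hdom (hlim.congr' ?_)
  filter_upwards [self_mem_nhdsWithin] with w hw using (hval w hw).symm

theorem volterraPrimitive_zero : volterraPrimitive 0 = 0 := by
  rw [volterraPrimitive]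
  refine setIntegral_eq_zero_of_forall_eq_zero fun τ hτ => ?_
  rw [Real.zero_rpow (ne_of_gt hτ), zero_div]

theorem integral_volterraKernel' {t : ℝ} (ht : 0 ≤ t) :
    ∫ s in (0 : ℝ)..t, volterraKernel s = volterraPrimitive t := by
  rcases ht.eq_or_lt with rfl | ht
  · simp [volterraPrimitive_zero]
  · exact integral_volterraKernel ht

theorem volterraPrimitive_mono {s t : ℝ} (hs : 0 ≤ s) (hst : s ≤ t) :
    volterraPrimitive s ≤ volterraPrimitive t := by
  rw [← integral_volterraKernel' hs, ← integral_volterraKernel' (hs.trans hst)]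
  refine intervalIntegral.integral_mono_interval le_rfl hs hst ?_
    (intervalIntegrable_volterraKernel t (hs.trans hst))
  filter_upwards [ae_restrict_mem measurableSet_Ioc] with x hx using volterraKernel_nonneg hx.1.le

theorem continuousOn_volterraPrimitive (T : ℝ) : ContinuousOn volterraPrimitive (Set.Icc 0 T) := by
  rcases lt_or_ge T 0 with h | h
  · simp [Set.Icc_eq_empty (not_le.2 h)]
  have := intervalIntegral.continuousOn_primitive_interval
    ((intervalIntegrable_iff' ).1 (intervalIntegrable_volterraKernel T h))
  rw [Set.uIcc_of_le h] at this
  refine this.congr fun t ht => ?_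
  exact (integral_volterraKernel' ht.1).symm

/-- Orders at most 1 contribute nonpositive powers, hence a decreasing function; orders above 1,
shifted by one, give the increasing function `volterraPrimitive`. This monotone splitting controls
the variation. -/
theorem volterraKernel_eq_add {s : ℝ} (hs : 0 < s) :
    volterraKernel s = (∫ τ in Set.Ioc (0 : ℝ) 1, s ^ (τ - 1) / Real.Gamma τ) +
      volterraPrimitive s := by
  have hi := integrableOn_volterra hs
  rw [volterraKernel, ← Set.Ioc_union_Ioi_eq_Ioi zero_le_one,
    setIntegral_union (Set.Ioc_disjoint_Ioi le_rfl) measurableSet_Ioi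
      (hi.mono_set Set.Ioc_subset_Ioi_self) (hi.mono_set (Set.Ioi_subset_Ioi zero_le_one))]
  congr 1
  have := (measurePreserving_add_right volume (1 : ℝ)).setIntegral_preimage_emb
      (measurableEmbedding_addRight 1) (fun τ => s ^ (τ - 1) / Real.Gamma τ) (Set.Ioi 1)
  rw [Set.preimage_add_const_Ioi, sub_self] at this
  rw [← this, volterraPrimitive]
  simp

/-- For a decreasing plus an increasing function ν, the absolute increment is at most minus the
increment of the sum plus twice the increment of ν. Both terms telescope upon integration, and the
first leaves at most ν(h). -/
theorem integral_abs_volterraKernel_sub_le {t h : ℝ} (ht : 0 ≤ t) (hh : 0 < h) :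
    IntervalIntegrable (fun s => volterraKernel (s + h)) volume 0 t ∧
    ∫ s in (0 : ℝ)..t, |volterraKernel (s + h) - volterraKernel s| ≤
      volterraPrimitive h + 2 * (h * volterraPrimitive (t + h)) := by
  set K : ℝ → ℝ := fun s => ∫ τ in Set.Ioc (0 : ℝ) 1, s ^ (τ - 1) / Real.Gamma τ with hK
  have hI : ∀ T : ℝ, 0 ≤ T → IntervalIntegrable volterraKernel volume 0 T :=
    intervalIntegrable_volterraKernel
  have hI1 : IntervalIntegrable volterraKernel volume h (t + h) :=
    (hI h hh.le).symm.trans (hI (t + h) (by linarith))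
  have hIs : IntervalIntegrable (fun s => volterraKernel (s + h)) volume 0 t := by
    have := hI1.comp_add_right h
    simpa using this
  refine ⟨hIs, ?_⟩
  have hν : ∀ T : ℝ, 0 ≤ T → IntervalIntegrable volterraPrimitive volume 0 T := fun T hT =>
    (by simpa [Set.uIcc_of_le hT] using continuousOn_volterraPrimitive T :
      ContinuousOn volterraPrimitive (Set.uIcc 0 T)).intervalIntegrable
  have hν1 : IntervalIntegrable volterraPrimitive volume h (t + h) :=
    (hν h hh.le).symm.trans (hν (t + h) (by linarith))
  have hνs : IntervalIntegrable (fun s => volterraPrimitive (s + h)) volume 0 t := by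
    have := hν1.comp_add_right h
    simpa using this
  have hanti : ∀ s : ℝ, 0 < s → K (s + h) ≤ K s := by
    intro s hs
    refine setIntegral_mono_on
      ((integrableOn_volterra (by linarith)).mono_set Set.Ioc_subset_Ioi_self)
      ((integrableOn_volterra hs).mono_set Set.Ioc_subset_Ioi_self) measurableSet_Ioc
      fun τ hτ => ?_
    have := Real.Gamma_pos_of_pos hτ.1
    gcongr ?_ / _
    exact Real.rpow_le_rpow_of_nonpos hs (by linarith) (by linarith [hτ.2])
  have hbd : ∀ s : ℝ, 0 < s → |volterraKernel (s + h) - volterraKernel s| ≤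
      (volterraKernel s - volterraKernel (s + h)) +
        2 * (volterraPrimitive (s + h) - volterraPrimitive s) := by
    intro s hs
    have h1 := volterraKernel_eq_add hs
    have h2 := volterraKernel_eq_add (show 0 < s + h by linarith)
    have h3 := hanti s hs
    have h4 := volterraPrimitive_mono hs.le (show s ≤ s + h by linarith)
    simp only [hK] at h3
    rw [abs_le]
    constructor <;> linarith
  have hint : IntervalIntegrable (fun s => (volterraKernel s - volterraKernel (s + h)) +
        2 * (volterraPrimitive (s + h) - volterraPrimitive s)) volume 0 t :=
    ((hI t ht).sub hIs).add ((hνs.sub (hν t ht)).const_mul 2)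
  have hle : ∫ s in (0 : ℝ)..t, |volterraKernel (s + h) - volterraKernel s| ≤
      ∫ s in (0 : ℝ)..t, ((volterraKernel s - volterraKernel (s + h)) +
        2 * (volterraPrimitive (s + h) - volterraPrimitive s)) := by
    rw [intervalIntegral.integral_of_le ht, intervalIntegral.integral_of_le ht]
    refine setIntegral_mono_on ?_ hint.1 measurableSet_Ioc fun s hs => hbd s hs.1
    exact (hIs.sub (hI t ht)).abs.1
  refine hle.trans ?_
  rw [intervalIntegral.integral_add ((hI t ht).sub hIs) ((hνs.sub (hν t ht)).const_mul 2),
    intervalIntegral.integral_sub (hI t ht) hIs, intervalIntegral.integral_const_mul,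
    intervalIntegral.integral_sub hνs (hν t ht),
    intervalIntegral.integral_comp_add_right (fun s => volterraKernel s),
    intervalIntegral.integral_comp_add_right (fun s => volterraPrimitive s), zero_add]
  have e1 := intervalIntegral.integral_interval_sub_left (hI (t + h) (by linarith)) (hI h hh.le)
  have e2 := intervalIntegral.integral_interval_sub_left (hν (t + h) (by linarith)) (hν h hh.le)
  have e3 := intervalIntegral.integral_interval_sub_left (hν (t + h) (by linarith)) (hν t ht)
  rw [integral_volterraKernel' (by linarith), integral_volterraKernel' hh.le] at e1
  rw [← e1, ← e2, integral_volterraKernel' ht]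
  have hpr : ∫ s in t..(t + h), volterraPrimitive s ≤ h * volterraPrimitive (t + h) := by
    have h1 : IntervalIntegrable volterraPrimitive volume t (t + h) :=
      (hν t ht).symm.trans (hν (t + h) (by linarith))
    have := intervalIntegral.integral_mono_on (by linarith) h1
      (intervalIntegrable_const (c := volterraPrimitive (t + h)))
      (fun s hs => volterraPrimitive_mono (ht.trans hs.1) hs.2)
    simpa using this
  have hp0 : 0 ≤ ∫ s in (0 : ℝ)..h, volterraPrimitive s :=
    intervalIntegral.integral_nonneg hh.le fun s hs => volterraPrimitive_nonneg hs.1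
  have hmono := volterraPrimitive_mono ht (show t ≤ t + h by linarith)
  linarith

end PointNLS

namespace PointNLS

/-! ### The scaled exponential integral -/

/-- The scaled exponential integral `exp z * E₁ z`, for `0 ≤ re z` and `z ≠ 0`. -/
def scaledExpIntegral (z : ℂ) : ℂ :=
  ∫ u in Set.Ioi (0 : ℝ), (Real.exp (-u) : ℂ) / (u + z)

theorem le_norm_add {u : ℝ} {z : ℂ} (hz : 0 ≤ z.re) (_ : 0 ≤ u) : u ≤ ‖(u : ℂ) + z‖ := by
  have := Complex.re_le_norm ((u : ℂ) + z)
  simp at this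
  linarith

theorem norm_le_norm_add {u : ℝ} {z : ℂ} (hz : 0 ≤ z.re) (hu : 0 ≤ u) : ‖z‖ ≤ ‖(u : ℂ) + z‖ := by
  rw [Complex.norm_def, Complex.norm_def]
  apply Real.sqrt_le_sqrt
  rw [Complex.normSq_apply, Complex.normSq_apply]
  simp
  nlinarith

/-- Geometric interpolation between u ≤ |u + z| and |z| ≤ |u + z|. The exponent 1/2 serves
integrability, 0 the limit onto the imaginary axis, and 3/4 the increments of the logarithm. -/
theorem rpow_mul_rpow_le_norm_add {u : ℝ} {z : ℂ} (hz : 0 ≤ z.re) (hu : 0 < u) {a : ℝ}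
    (ha : 0 ≤ a) (ha1 : a ≤ 1) : u ^ a * ‖z‖ ^ (1 - a) ≤ ‖(u : ℂ) + z‖ := by
  have h : 0 < ‖(u : ℂ) + z‖ := hu.trans_le (le_norm_add hz hu.le)
  calc u ^ a * ‖z‖ ^ (1 - a) ≤ ‖(u : ℂ) + z‖ ^ a * ‖(u : ℂ) + z‖ ^ (1 - a) := by
        have := le_norm_add hz hu.le
        have := sub_nonneg.2 ha1
        gcongr
        · exact norm_le_norm_add hz hu.le
    _ = _ := by rw [← Real.rpow_add h]; simp

theorem add_ne_zero_of_re_nonneg {u : ℝ} {z : ℂ} (hz : 0 ≤ z.re) (hz0 : z ≠ 0) (hu : 0 ≤ u) :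
    (u : ℂ) + z ≠ 0 := by
  have h := norm_le_norm_add hz hu
  rw [← norm_pos_iff] at hz0 ⊢
  linarith

theorem add_mem_slitPlane {u : ℝ} {z : ℂ} (hz : 0 ≤ z.re) (hz0 : z ≠ 0) (hu : 0 ≤ u) :
    (u : ℂ) + z ∈ slitPlane := by
  have h := add_ne_zero_of_re_nonneg hz hz0 hu
  rw [mem_slitPlane_iff]
  by_contra hcon
  push Not at hcon
  simp only [add_re, ofReal_re, add_im, ofReal_im, zero_add] at hcon
  apply h
  apply Complex.ext <;> simp
  · linarith
  · exact hcon.2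

theorem integrableOn_exp_neg_mul_rpow {a : ℝ} (ha : -1 < a) :
    IntegrableOn (fun u : ℝ => Real.exp (-u) * u ^ a) (Set.Ioi 0) := by
  simpa using Real.GammaIntegral_convergent (s := a + 1) (by linarith)

theorem norm_exp_div_le {u : ℝ} {z : ℂ} (hz : 0 ≤ z.re) (hz0 : z ≠ 0) (hu : 0 < u) {a : ℝ}
    (ha : 0 ≤ a) (ha1 : a ≤ 1) :
    ‖(Real.exp (-u) : ℂ) / (u + z)‖ ≤ Real.exp (-u) * u ^ (-a) * ‖z‖ ^ (a - 1) := by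
  have hzn := norm_pos_iff.2 hz0
  rw [norm_div, norm_real, Real.norm_of_nonneg (Real.exp_pos _).le]
  have h := rpow_mul_rpow_le_norm_add hz hu ha ha1
  have h2 : 0 < u ^ a * ‖z‖ ^ (1 - a) := by positivity
  calc Real.exp (-u) / ‖(u : ℂ) + z‖ ≤ Real.exp (-u) / (u ^ a * ‖z‖ ^ (1 - a)) := by gcongr
    _ = _ := by
      rw [Real.rpow_neg hu.le, show a - 1 = -(1 - a) by ring, Real.rpow_neg hzn.le]
      field_simp

theorem measurable_scaledExpIntegral_integrand :
    Measurable fun p : ℂ × ℝ => (Real.exp (-p.2) : ℂ) / (p.2 + p.1) := by fun_prop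

theorem measurable_scaledExpIntegral : Measurable scaledExpIntegral :=
  (measurable_scaledExpIntegral_integrand.stronglyMeasurable.integral_prod_right
    (ν := volume.restrict (Set.Ioi 0))).measurable

theorem integrableOn_scaledExpIntegral {z : ℂ} (hz : 0 ≤ z.re) (hz0 : z ≠ 0) :
    IntegrableOn (fun u : ℝ => (Real.exp (-u) : ℂ) / (u + z)) (Set.Ioi 0) := by
  have hi := (integrableOn_exp_neg_mul_rpow (a := -(1 / 2)) (by norm_num)).mul_const
    (‖z‖ ^ ((1 / 2 : ℝ) - 1))
  refine Integrable.mono' hi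
    (measurable_scaledExpIntegral_integrand.comp (measurable_const.prodMk measurable_id)
      ).aestronglyMeasurable ?_
  filter_upwards [ae_restrict_mem measurableSet_Ioi] with u hu
  exact norm_exp_div_le hz hz0 hu (by norm_num) (by norm_num)

/-- Cruder than the true logarithmic singularity at 0, but the power -1/2 is integrable along the
imaginary axis, which suffices for dominated convergence. -/
theorem norm_scaledExpIntegral_le {z : ℂ} (hz : 0 ≤ z.re) (hz0 : z ≠ 0) :
    ‖scaledExpIntegral z‖ ≤ Real.Gamma (1 / 2) * ‖z‖ ^ (-(1 / 2) : ℝ) := by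
  have hi := (integrableOn_exp_neg_mul_rpow (a := -(1 / 2)) (by norm_num)).mul_const
    (‖z‖ ^ ((1 / 2 : ℝ) - 1))
  have h := norm_integral_le_of_norm_le hi (f := fun u : ℝ => (Real.exp (-u) : ℂ) / (u + z)) (by
    filter_upwards [ae_restrict_mem measurableSet_Ioi] with u hu
    exact norm_exp_div_le hz hz0 hu (by norm_num) (by norm_num))
  refine h.trans (le_of_eq ?_)
  rw [integral_mul_const, Real.Gamma_eq_integral (by norm_num)]
  norm_num

/-- `exp z * E₁ z` is the Laplace transform of `(k + 1)⁻¹`. -/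
theorem integral_exp_neg_mul_div_add_one {z : ℂ} (hz : 0 < z.re) :
    IntegrableOn (fun k : ℝ => Complex.exp (-z * k) / (k + 1)) (Set.Ioi 0) ∧
    ∫ k in Set.Ioi (0 : ℝ), Complex.exp (-z * k) / (k + 1) = scaledExpIntegral z := by
  have hne : (-z).re < 0 := by simpa using hz
  have hexp := integrableOn_exp_mul_complex_Ioi hne 0
  -- Writing 1/(k+1) as ∫₀^∞ e^{-u(k+1)} du, the identity becomes an exchange of the two
  -- integrations.
  have hint : Integrable (fun p : ℝ × ℝ => Complex.exp (-z * p.1) * (Real.exp (-p.2 * (p.1 + 1)) : ℂ))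
      ((volume.restrict (Set.Ioi 0)).prod (volume.restrict (Set.Ioi 0))) := by
    have h1 : Integrable (fun p : ℝ × ℝ => ‖Complex.exp (-z * p.1)‖ * Real.exp (-p.2))
      ((volume.restrict (Set.Ioi 0)).prod (volume.restrict (Set.Ioi 0))) :=
      hexp.norm.mul_prod (integrableOn_exp_neg_Ioi 0)
    refine h1.mono' (by fun_prop) ?_
    rw [Measure.prod_restrict]
    filter_upwards [ae_restrict_mem (measurableSet_Ioi.prod measurableSet_Ioi)] with p hp
    have hp1 : 0 < p.1 := hp.1
    have hp2 : 0 < p.2 := hp.2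
    rw [norm_mul, norm_real, Real.norm_of_nonneg (Real.exp_pos _).le]
    gcongr
    nlinarith
  have inner : ∀ k ∈ Set.Ioi (0 : ℝ), ∫ u in Set.Ioi (0 : ℝ),
      Complex.exp (-z * k) * (Real.exp (-u * (k + 1)) : ℂ) = Complex.exp (-z * k) / (k + 1) := by
    intro k hk
    have hk : 0 < k := hk
    rw [integral_const_mul]
    have h1 := integral_exp_mul_complex_Ioi (a := -((k : ℂ) + 1)) (by simp; linarith) 0
    have h2 : ∀ u : ℝ, (Real.exp (-u * (k + 1)) : ℂ) = Complex.exp (-((k : ℂ) + 1) * u) := by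
      intro u; push_cast; ring_nf
    simp_rw [h2]
    rw [h1]
    rw [ofReal_zero, mul_zero, Complex.exp_zero, neg_div_neg_eq, mul_one_div]
  have inner2 : ∀ u ∈ Set.Ioi (0 : ℝ), ∫ k in Set.Ioi (0 : ℝ),
      Complex.exp (-z * k) * (Real.exp (-u * (k + 1)) : ℂ) = (Real.exp (-u) : ℂ) / (u + z) := by
    intro u hu
    have hu : 0 < u := hu
    have h1 := integral_exp_mul_complex_Ioi (a := -((u : ℂ) + z)) (by simp; linarith) 0
    have h2 : ∀ k : ℝ, Complex.exp (-z * k) * (Real.exp (-u * (k + 1)) : ℂ) =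
        (Real.exp (-u) : ℂ) * Complex.exp (-((u : ℂ) + z) * k) := by
      intro k
      push_cast
      rw [← Complex.exp_add, ← Complex.exp_add]; ring_nf
    simp_rw [h2]
    rw [integral_const_mul, h1, ofReal_zero, mul_zero, Complex.exp_zero, neg_div_neg_eq, mul_one_div]
  constructor
  · refine (hint.integral_prod_left).congr ?_
    filter_upwards [ae_restrict_mem measurableSet_Ioi] with k hk using inner k hk
  · rw [scaledExpIntegral, ← setIntegral_congr_fun measurableSet_Ioi inner,
      ← setIntegral_congr_fun measurableSet_Ioi inner2]
    exact integral_integral_swap hint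

/-- On the imaginary axis the Laplace integral of 1/(k+1) converges only conditionally. Truncation
at Λ legitimises the exchange of integrals and leaves an explicit error e^{-(u+is)Λ}. -/
theorem integral_exp_neg_mul_I_div_add_one {s Λ : ℝ} (hs : 0 < s) (hΛ : 0 ≤ Λ) :
    ∫ k in (0 : ℝ)..Λ, Complex.exp (-(I * s) * k) / (k + 1) =
      ∫ u in Set.Ioi (0 : ℝ), (Real.exp (-u) : ℂ) / (u + I * s) *
        (1 - Complex.exp (-((u : ℂ) + I * s) * Λ)) := by
  have hint : Integrable (fun p : ℝ × ℝ => Complex.exp (-(I * s) * p.1) *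
      (Real.exp (-p.2 * (p.1 + 1)) : ℂ))
      ((volume.restrict (Set.Ioc 0 Λ)).prod (volume.restrict (Set.Ioi 0))) := by
    have h1 : Integrable (fun p : ℝ × ℝ => (1 : ℝ) * Real.exp (-p.2))
      ((volume.restrict (Set.Ioc 0 Λ)).prod (volume.restrict (Set.Ioi 0))) :=
      (integrable_const (1 : ℝ)).mul_prod (integrableOn_exp_neg_Ioi 0)
    refine h1.mono' (by fun_prop) ?_
    rw [Measure.prod_restrict]
    filter_upwards [ae_restrict_mem (measurableSet_Ioc.prod measurableSet_Ioi)] with p hp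
    have hp1 : 0 < p.1 := hp.1.1
    have hp2 : 0 < p.2 := hp.2
    rw [norm_mul, norm_real, Real.norm_of_nonneg (Real.exp_pos _).le, Complex.norm_exp]
    simp only [neg_mul, neg_re, mul_re, I_re, zero_mul, I_im, ofReal_im, mul_zero, sub_self,
      ofReal_re, one_mul, mul_im, zero_add, neg_zero, Real.exp_zero]
    gcongr
    nlinarith
  have inner : ∀ k ∈ Set.Ioc (0 : ℝ) Λ, ∫ u in Set.Ioi (0 : ℝ),
      Complex.exp (-(I * s) * k) * (Real.exp (-u * (k + 1)) : ℂ) =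
        Complex.exp (-(I * s) * k) / (k + 1) := by
    intro k hk
    have hk : 0 < k := hk.1
    rw [integral_const_mul]
    have h1 := integral_exp_mul_complex_Ioi (a := -((k : ℂ) + 1)) (by simp; linarith) 0
    have h2 : ∀ u : ℝ, (Real.exp (-u * (k + 1)) : ℂ) = Complex.exp (-((k : ℂ) + 1) * u) := by
      intro u; push_cast; ring_nf
    simp_rw [h2]
    rw [h1]
    rw [ofReal_zero, mul_zero, Complex.exp_zero, neg_div_neg_eq, mul_one_div]
  have inner2 : ∀ u ∈ Set.Ioi (0 : ℝ), ∫ k in Set.Ioc (0 : ℝ) Λ,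
      Complex.exp (-(I * s) * k) * (Real.exp (-u * (k + 1)) : ℂ) =
      (Real.exp (-u) : ℂ) / (u + I * s) * (1 - Complex.exp (-((u : ℂ) + I * s) * Λ)) := by
    intro u hu
    have hu : 0 < u := hu
    have hne : (u : ℂ) + I * s ≠ 0 :=
      add_ne_zero_of_re_nonneg (by simp) (by simp [hs.ne']) hu.le
    have h1 := integral_exp_mul_complex (a := 0) (b := Λ) (neg_ne_zero.2 hne)
    have h2 : ∀ k : ℝ, Complex.exp (-(I * s) * k) * (Real.exp (-u * (k + 1)) : ℂ) =
        (Real.exp (-u) : ℂ) * Complex.exp (-((u : ℂ) + I * s) * k) := by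
      intro k
      push_cast
      rw [← Complex.exp_add, ← Complex.exp_add]; ring_nf
    simp_rw [h2]
    rw [integral_const_mul, ← intervalIntegral.integral_of_le hΛ, h1, ofReal_zero, mul_zero,
      Complex.exp_zero]
    field_simp
    ring
  rw [intervalIntegral.integral_of_le hΛ, ← setIntegral_congr_fun measurableSet_Ioc inner,
      ← setIntegral_congr_fun measurableSet_Ioi inner2]
  exact integral_integral_swap hint

/-- The truncation error decays for each u > 0 and has modulus at most 1. This limit evaluates the
improper inversion integral of `pointValue` on the singular profile. -/
theorem tendsto_integral_exp_neg_mul_I_div_add_one {s : ℝ} (hs : 0 < s) :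
    Tendsto (fun Λ : ℝ => ∫ k in (0 : ℝ)..Λ, Complex.exp (-(I * s) * k) / (k + 1)) atTop
      (𝓝 (scaledExpIntegral (I * s))) := by
  have hz : 0 ≤ (I * (s : ℂ)).re := by simp
  have hz0 : I * (s : ℂ) ≠ 0 := by simp [hs.ne']
  have hb : ∀ (Λ u : ℝ), ‖Complex.exp (-((u : ℂ) + I * s) * Λ)‖ = Real.exp (-(u * Λ)) := by
    intro Λ u
    rw [Complex.norm_exp]; simp
  have h : Tendsto (fun Λ : ℝ => ∫ u in Set.Ioi (0 : ℝ), (Real.exp (-u) : ℂ) / (u + I * s) *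
        (1 - Complex.exp (-((u : ℂ) + I * s) * Λ))) atTop (𝓝 (scaledExpIntegral (I * s))) := by
    refine tendsto_integral_filter_of_dominated_convergence
      (fun u => ‖(Real.exp (-u) : ℂ) / (u + I * s)‖ * 2) ?_ ?_ ?_ ?_
    · exact Eventually.of_forall fun Λ => by fun_prop
    · filter_upwards [eventually_ge_atTop 0] with Λ hΛ
      filter_upwards [ae_restrict_mem measurableSet_Ioi] with u hu
      have hu : 0 < u := hu
      rw [norm_mul]
      gcongr
      refine (norm_sub_le _ _).trans ?_
      rw [hb, norm_one]
      have : Real.exp (-(u * Λ)) ≤ 1 := Real.exp_le_one_iff.2 (by nlinarith)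
      linarith
    · exact (integrableOn_scaledExpIntegral hz hz0).norm.mul_const 2
    · filter_upwards [ae_restrict_mem measurableSet_Ioi] with u hu
      have hu : 0 < u := hu
      have h0 : Tendsto (fun Λ : ℝ => Complex.exp (-((u : ℂ) + I * s) * Λ)) atTop (𝓝 0) := by
        rw [tendsto_zero_iff_norm_tendsto_zero]
        simp_rw [hb]
        exact Real.tendsto_exp_neg_atTop_nhds_zero.comp (tendsto_id.const_mul_atTop hu)
      simpa using (h0.const_sub 1).const_mul ((Real.exp (-u) : ℂ) / (u + I * s))
  refine h.congr' ?_
  filter_upwards [eventually_ge_atTop 0] with Λ hΛ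
  exact (integral_exp_neg_mul_I_div_add_one hs hΛ).symm

/-- Regularising with e^{-εk} gives the same boundary value as sharp truncation in k, so the trace
with cut-off may be compared with the charge equation. -/
theorem tendsto_scaledExpIntegral {s : ℝ} (hs : 0 < s) :
    Tendsto (fun ε : ℝ => scaledExpIntegral (ε + I * s)) (𝓝[>] 0)
      (𝓝 (scaledExpIntegral (I * s))) := by
  refine tendsto_integral_filter_of_dominated_convergence
      (fun u => Real.exp (-u) * u ^ (-(0 : ℝ)) * s ^ ((0 : ℝ) - 1)) ?_ ?_ ?_ ?_
  · exact Eventually.of_forall fun ε => (measurable_scaledExpIntegral_integrand.comp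
      (measurable_const.prodMk measurable_id)).aestronglyMeasurable
  · filter_upwards [self_mem_nhdsWithin] with ε hε
    have hε : 0 < ε := hε
    filter_upwards [ae_restrict_mem measurableSet_Ioi] with u hu
    have hz0 : (ε : ℂ) + I * s ≠ 0 :=
      add_ne_zero_of_re_nonneg (by simp) (by simp [hs.ne']) hε.le
    refine (norm_exp_div_le (by simpa using hε.le) hz0 hu le_rfl zero_le_one).trans ?_
    have h2 : s ≤ ‖(ε : ℂ) + I * s‖ := by
      have := norm_le_norm_add (u := ε) (z := I * s) (by simp) hε.le
      simpa [abs_of_pos hs] using this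
    have h3 : ‖(ε : ℂ) + I * s‖ ^ ((0 : ℝ) - 1) ≤ s ^ ((0 : ℝ) - 1) :=
      Real.rpow_le_rpow_of_nonpos hs h2 (by norm_num)
    have hu' : 0 < u := hu
    gcongr
  · exact (integrableOn_exp_neg_mul_rpow (a := -(0 : ℝ)) (by norm_num)).mul_const _
  · filter_upwards [ae_restrict_mem measurableSet_Ioi] with u hu
    have hu : 0 < u := hu
    refine Tendsto.div tendsto_const_nhds ?_
      (add_ne_zero_of_re_nonneg (by simp) (by simp [hs.ne']) hu.le)
    have : Tendsto (fun ε : ℝ => (u : ℂ) + ((ε : ℂ) + I * s)) (𝓝 0)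
        (𝓝 ((u : ℂ) + (((0 : ℝ) : ℂ) + I * s))) := by
      apply Continuous.tendsto; fun_prop
    simpa using this.mono_left nhdsWithin_le_nhds

end PointNLS

/-! ### The logarithmic singularity of the exponential integral -/

namespace PointNLS

/-- The term with u^{-1/2} absorbs the logarithm near u = 0 uniformly for z in the closed right
half-plane, including z → 0. -/
theorem norm_log_add_le {u : ℝ} {z : ℂ} (hz : 0 ≤ z.re) (hu : 0 < u) :
    ‖Complex.log (u + z)‖ ≤ u + ‖z‖ + 2 * u ^ (-(1 / 2) : ℝ) + Real.pi := by
  have h0 := le_norm_add hz hu.le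
  have hp : 0 < ‖(u : ℂ) + z‖ := hu.trans_le h0
  have h1 : |Real.log ‖(u : ℂ) + z‖| ≤ u + ‖z‖ + 2 * u ^ (-(1 / 2) : ℝ) := by
    have p2 := Real.rpow_nonneg hu.le (-(1 / 2) : ℝ)
    have hn := norm_nonneg z
    rw [abs_le]
    constructor
    · have h2 := Real.log_le_rpow_div (inv_pos.2 hu).le (ε := 1 / 2) (by norm_num)
      rw [Real.log_inv, Real.inv_rpow hu.le, ← Real.rpow_neg hu.le] at h2
      have h3 := Real.log_le_log hu h0
      linarith
    · have h3 := Real.log_le_sub_one_of_pos hp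
      have h4 := norm_add_le (u : ℂ) z
      rw [norm_real, Real.norm_of_nonneg hu.le] at h4
      linarith
  have h2 := Complex.norm_le_abs_re_add_abs_im (Complex.log (u + z))
  rw [Complex.log_re, Complex.log_im] at h2
  have h3 := Complex.abs_arg_le_pi (u + z)
  linarith

theorem integrableOn_exp_mul_log_bound (c : ℝ) :
    IntegrableOn (fun u : ℝ => Real.exp (-u) * (u + c + 2 * u ^ (-(1 / 2) : ℝ) + Real.pi))
      (Set.Ioi 0) := by
  have h1 := integrableOn_exp_neg_mul_rpow (a := 1) (by norm_num)
  have h2 := integrableOn_exp_neg_mul_rpow (a := -(1 / 2)) (by norm_num)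
  have h3 := (h1.add (h2.const_mul 2)).add ((integrableOn_exp_neg_Ioi 0).const_mul (c + Real.pi))
  refine h3.congr_fun (fun u hu => ?_) measurableSet_Ioi
  simp only [Pi.add_apply, Real.rpow_one]
  ring

theorem measurable_exp_mul_log (z : ℂ) :
    Measurable fun u : ℝ => (Real.exp (-u) : ℂ) * Complex.log (u + z) :=
  (by fun_prop : Measurable fun u : ℝ => (Real.exp (-u) : ℂ)).mul
    (Complex.measurable_log.comp (by fun_prop))

theorem norm_exp_mul_log_le {u : ℝ} {z : ℂ} (hz : 0 ≤ z.re) (hu : 0 < u) :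
    ‖(Real.exp (-u) : ℂ) * Complex.log (u + z)‖ ≤
      Real.exp (-u) * (u + ‖z‖ + 2 * u ^ (-(1 / 2) : ℝ) + Real.pi) := by
  rw [norm_mul, norm_real, Real.norm_of_nonneg (Real.exp_pos _).le]
  gcongr
  exact norm_log_add_le hz hu

theorem integrableOn_exp_mul_log {z : ℂ} (hz : 0 ≤ z.re) :
    IntegrableOn (fun u : ℝ => (Real.exp (-u) : ℂ) * Complex.log (u + z)) (Set.Ioi 0) := by
  refine Integrable.mono' (integrableOn_exp_mul_log_bound ‖z‖)
    (measurable_exp_mul_log z).aestronglyMeasurable ?_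
  filter_upwards [ae_restrict_mem measurableSet_Ioi] with u hu
  exact norm_exp_mul_log_le hz hu

/-- Averages of the logarithm against the exponential weight. -/
def expLogIntegral (z : ℂ) : ℂ :=
  ∫ u in Set.Ioi (0 : ℝ), (Real.exp (-u) : ℂ) * Complex.log (u + z)

/-- Integration by parts of e^{-u} log(u + z) on the half-line. The resulting average of the
logarithm stays bounded as z → 0, so this isolates the singularity of e^z E₁(z). -/
theorem scaledExpIntegral_add_log {z : ℂ} (hz : 0 ≤ z.re) (hz0 : z ≠ 0) :
    scaledExpIntegral z + Complex.log z = expLogIntegral z := by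
  have hd : ∀ u ∈ Set.Ici (0 : ℝ), HasDerivAt
      (fun u : ℝ => -((Real.exp (-u) : ℂ) * Complex.log (u + z)))
      ((Real.exp (-u) : ℂ) * Complex.log (u + z) - (Real.exp (-u) : ℂ) / (u + z)) u := by
    intro u hu
    have h1 : HasDerivAt (fun u : ℝ => (Real.exp (-u) : ℂ)) ((-Real.exp (-u) : ℝ) : ℂ) u := by
      have := (Real.hasDerivAt_exp (-u)).comp u (hasDerivAt_neg u)
      simpa using this.ofReal_comp
    have h2 : HasDerivAt (fun u : ℝ => (u : ℂ) + z) 1 u := (ofRealCLM.hasDerivAt).add_const z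
    have h3 := h2.clog_real (add_mem_slitPlane hz hz0 hu)
    have h4 := (h1.mul h3).neg
    convert! h4 using 1
    push_cast
    ring
  have hint := (integrableOn_exp_mul_log hz).sub (integrableOn_scaledExpIntegral hz hz0)
  have hlim : Tendsto (fun u : ℝ => -((Real.exp (-u) : ℂ) * Complex.log (u + z))) atTop (𝓝 0) := by
    rw [tendsto_zero_iff_norm_tendsto_zero]
    have hb : Tendsto (fun u : ℝ => Real.exp (-u) * (u + ‖z‖ + 2 + Real.pi)) atTop (𝓝 0) := by
      have h1 : Tendsto (fun u : ℝ => u ^ 1 * Real.exp (-u)) atTop (𝓝 0) :=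
        Real.tendsto_pow_mul_exp_neg_atTop_nhds_zero 1
      have h2 := Real.tendsto_exp_neg_atTop_nhds_zero.const_mul (‖z‖ + 2 + Real.pi)
      have := h1.add h2
      simp only [mul_zero, add_zero] at this
      refine this.congr fun u => ?_
      ring
    refine squeeze_zero' (Eventually.of_forall fun _ => norm_nonneg _) ?_ hb
    filter_upwards [eventually_ge_atTop 1] with u hu
    rw [norm_neg]
    refine (norm_exp_mul_log_le hz (by linarith)).trans ?_
    have : u ^ (-(1 / 2) : ℝ) ≤ 1 := Real.rpow_le_one_of_one_le_of_nonpos hu (by norm_num)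
    gcongr
    linarith
  have h := integral_Ioi_of_hasDerivAt_of_tendsto' hd hint hlim
  rw [integral_sub (integrableOn_exp_mul_log hz) (integrableOn_scaledExpIntegral hz hz0)] at h
  simp only [neg_zero, Real.exp_zero, ofReal_one, one_mul, ofReal_zero, zero_add, zero_sub,
    neg_neg] at h
  rw [expLogIntegral, scaledExpIntegral, ← h]
  ring

/-- At z = 0 the integral is Γ'(1), obtained by differentiating Euler's integral; comparison with
the known derivative -γ of Γ at 1 gives the value. -/
theorem expLogIntegral_zero : expLogIntegral 0 = -Real.eulerMascheroniConstant := by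
  have h1 := Complex.hasDerivAt_GammaIntegral (s := 1) (by simp)
  have h2 : HasDerivAt Complex.GammaIntegral (-(Real.eulerMascheroniConstant : ℂ)) 1 := by
    have h := Complex.hasDerivAt_Gamma_one
    refine h.congr_of_eventuallyEq ?_
    have : ∀ᶠ s : ℂ in 𝓝 1, 0 < s.re :=
      (isOpen_lt continuous_const Complex.continuous_re).mem_nhds (by simp)
    filter_upwards [this] with s hs using (Complex.Gamma_eq_integral hs).symm
  rw [← h1.unique h2, expLogIntegral]
  refine setIntegral_congr_fun measurableSet_Ioi fun u hu => ?_
  have hu : 0 < u := hu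
  simp only [add_zero, sub_self, Complex.cpow_zero, one_mul]
  rw [← Complex.ofReal_log hu.le, mul_comm]

/-- In the energy balance this limit cancels the divergence log ε of the singular profile and leaves
the constant -γ. -/
theorem tendsto_scaledExpIntegral_add_log :
    Tendsto (fun ε : ℝ => scaledExpIntegral ε + Real.log ε) (𝓝[>] 0)
      (𝓝 (-Real.eulerMascheroniConstant : ℂ)) := by
  have h : Tendsto (fun ε : ℝ => expLogIntegral ε) (𝓝[>] 0) (𝓝 (expLogIntegral 0)) := by
    refine tendsto_integral_filter_of_dominated_convergence
      (fun u => Real.exp (-u) * (u + 1 + 2 * u ^ (-(1 / 2) : ℝ) + Real.pi)) ?_ ?_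
      (integrableOn_exp_mul_log_bound 1) ?_
    · exact Eventually.of_forall fun ε => (measurable_exp_mul_log _).aestronglyMeasurable
    · filter_upwards [Ioc_mem_nhdsGT (zero_lt_one' ℝ)] with ε hε
      filter_upwards [ae_restrict_mem measurableSet_Ioi] with u hu
      refine (norm_exp_mul_log_le (by simpa using hε.1.le) hu).trans ?_
      have : ‖(ε : ℂ)‖ ≤ 1 := by
        rw [norm_real, Real.norm_of_nonneg hε.1.le]; exact hε.2
      gcongr
    · filter_upwards [ae_restrict_mem measurableSet_Ioi] with u hu
      have hu : 0 < u := hu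
      refine Tendsto.const_mul _ ?_
      have hc : ContinuousAt (fun ε : ℝ => Complex.log (u + ε)) 0 := by
        refine ContinuousAt.clog (by fun_prop) ?_
        simpa using hu
      have := hc.tendsto.mono_left (nhdsWithin_le_nhds (s := Set.Ioi 0))
      simpa using this
  rw [expLogIntegral_zero] at h
  refine h.congr' ?_
  filter_upwards [self_mem_nhdsWithin] with ε hε
  have hε : 0 < ε := hε
  rw [← scaledExpIntegral_add_log (by simpa using hε.le) (by simpa using hε.ne'), ofReal_log hε.le]

/-- The bounded part of the boundary value `scaledExpIntegral (i t)`, once its logarithmic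
singularity is removed. -/
def expIntegralRemainder (t : ℝ) : ℂ :=
  scaledExpIntegral (I * t) + Real.log t + Real.eulerMascheroniConstant

theorem expIntegralRemainder_eq {t : ℝ} (ht : 0 < t) :
    expIntegralRemainder t =
      expLogIntegral (I * t) - I * (Real.pi / 2) + Real.eulerMascheroniConstant := by
  have hlog : Complex.log (I * t) = Real.log t + I * (Real.pi / 2) := by
    rw [mul_comm, Complex.log_ofReal_mul ht I_ne_zero, Complex.log_I]; ring
  rw [← scaledExpIntegral_add_log (by simp) (by simp [ht.ne']), hlog, expIntegralRemainder]
  ring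

theorem exists_norm_expIntegralRemainder_le (T : ℝ) :
    ∃ C, ∀ t ∈ Set.Ioc 0 T, ‖expIntegralRemainder t‖ ≤ C := by
  refine ⟨(∫ u in Set.Ioi (0 : ℝ), Real.exp (-u) * (u + T + 2 * u ^ (-(1 / 2) : ℝ) + Real.pi)) +
    ‖I * ((Real.pi : ℂ) / 2)‖ + ‖(Real.eulerMascheroniConstant : ℂ)‖, fun t ht => ?_⟩
  rw [expIntegralRemainder_eq ht.1]
  refine (norm_add_le _ _).trans (add_le_add_left ((norm_sub_le _ _).trans
    (add_le_add_left ?_ _)) _)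
  refine norm_integral_le_of_norm_le (integrableOn_exp_mul_log_bound T) ?_
  filter_upwards [ae_restrict_mem measurableSet_Ioi] with u hu
  refine (norm_exp_mul_log_le (by simp) hu).trans ?_
  have : ‖I * (t : ℂ)‖ ≤ T := by
    rw [norm_mul, norm_I, one_mul, norm_real, Real.norm_of_nonneg ht.1.le]; exact ht.2
  gcongr

/-- Mean value inequality in the imaginary direction, the derivative i/(u + is) being bounded by
interpolation. The weights 3/4 and 1/4 make the factor in u integrable against e^{-u} and the factor
in t square integrable at 0. -/
theorem norm_log_add_sub_log_le {u t h : ℝ} (hu : 0 < u) (ht : 0 < t) (hh : 0 ≤ h) :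
    ‖Complex.log (u + I * (t + h : ℝ)) - Complex.log (u + I * t)‖ ≤
      u ^ (-(3 / 4) : ℝ) * t ^ (-(1 / 4) : ℝ) * h := by
  have hd : ∀ s ∈ Set.Icc t (t + h), HasDerivWithinAt (fun s : ℝ => Complex.log (u + I * s))
      (I / (u + I * s)) (Set.Icc t (t + h)) s := by
    intro s hs
    have hs0 : 0 < s := ht.trans_le hs.1
    have h2 : HasDerivAt (fun s : ℝ => (u : ℂ) + I * s) I s := by
      have := ((ofRealCLM.hasDerivAt (x := s)).const_mul I).const_add (u : ℂ)
      simpa using this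
    exact (h2.clog_real (add_mem_slitPlane (by simp) (by simp [hs0.ne']) hu.le)).hasDerivWithinAt
  have hb : ∀ s ∈ Set.Ico t (t + h), ‖I / ((u : ℂ) + I * s)‖ ≤
      u ^ (-(3 / 4) : ℝ) * t ^ (-(1 / 4) : ℝ) := by
    intro s hs
    have hs0 : 0 < s := ht.trans_le hs.1
    have h1 := rpow_mul_rpow_le_norm_add (z := I * s) (a := 3 / 4) (by simp) hu (by norm_num)
      (by norm_num)
    have h3 : ‖I * (s : ℂ)‖ = s := by
      rw [norm_mul, norm_I, one_mul, norm_real, Real.norm_of_nonneg hs0.le]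
    rw [h3] at h1
    have h4 : t ^ (1 - 3 / 4 : ℝ) ≤ s ^ (1 - 3 / 4 : ℝ) :=
      Real.rpow_le_rpow ht.le hs.1 (by norm_num)
    have h5 : 0 < u ^ (3 / 4 : ℝ) * t ^ (1 - 3 / 4 : ℝ) := by positivity
    rw [norm_div, norm_I, one_div, Real.rpow_neg hu.le, Real.rpow_neg ht.le, ← mul_inv]
    have e : (1 - 3 / 4 : ℝ) = 1 / 4 := by norm_num
    rw [e] at h1 h4 h5
    refine inv_anti₀ h5 (le_trans ?_ h1)
    gcongr
  have := norm_image_sub_le_of_norm_deriv_le_segment' hd hb (t + h) ⟨by linarith, le_rfl⟩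
  simpa using this

theorem norm_expIntegralRemainder_sub_le {t h : ℝ} (ht : 0 < t) (hh : 0 ≤ h) :
    ‖expIntegralRemainder (t + h) - expIntegralRemainder t‖ ≤
      Real.Gamma (1 / 4) * t ^ (-(1 / 4) : ℝ) * h := by
  rw [expIntegralRemainder_eq ht, expIntegralRemainder_eq (by linarith)]
  have e : expLogIntegral (I * (t + h : ℝ)) - I * (Real.pi / 2) + Real.eulerMascheroniConstant -
      (expLogIntegral (I * t) - I * (Real.pi / 2) + Real.eulerMascheroniConstant) =
      ∫ u in Set.Ioi (0 : ℝ), ((Real.exp (-u) : ℂ) * Complex.log (u + I * (t + h : ℝ)) -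
        (Real.exp (-u) : ℂ) * Complex.log (u + I * t)) := by
    rw [integral_sub (integrableOn_exp_mul_log (by simp)) (integrableOn_exp_mul_log (by simp)),
      expLogIntegral, expLogIntegral]
    ring
  rw [e]
  have hi := (integrableOn_exp_neg_mul_rpow (a := -(3 / 4)) (by norm_num)).mul_const
    (t ^ (-(1 / 4) : ℝ) * h)
  have hb := norm_integral_le_of_norm_le hi (f := fun u : ℝ =>
    ((Real.exp (-u) : ℂ) * Complex.log (u + I * (t + h : ℝ)) -
        (Real.exp (-u) : ℂ) * Complex.log (u + I * t))) (by
    filter_upwards [ae_restrict_mem measurableSet_Ioi] with u hu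
    rw [← mul_sub, norm_mul, norm_real, Real.norm_of_nonneg (Real.exp_pos _).le]
    have := mul_le_mul_of_nonneg_left (norm_log_add_sub_log_le hu ht hh) (Real.exp_pos (-u)).le
    refine this.trans (le_of_eq ?_)
    ring)
  refine hb.trans (le_of_eq ?_)
  rw [integral_mul_const, Real.Gamma_eq_integral (by norm_num)]
  norm_num
  ring

end PointNLS

namespace PointNLS

/-! ### The kinetic energy symbol and Plancherel estimates -/

/-- The symbol `p²` of `-Δ`. -/
def kinetic (ξ : Plane) : ℝ := (2 * Real.pi * ‖ξ‖) ^ 2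

theorem kinetic_nonneg (ξ : Plane) : 0 ≤ kinetic ξ := sq_nonneg _

theorem continuous_kinetic : Continuous kinetic := by unfold kinetic; fun_prop

theorem measurable_kinetic : Measurable kinetic := continuous_kinetic.measurable

theorem kinetic_lt_iff {K : ℝ} (ξ : Plane) :
    kinetic ξ < K ↔ ξ ∈ Metric.ball (0 : Plane) (√K / (2 * Real.pi)) := by
  have hp : 0 < 2 * Real.pi := by positivity
  rw [mem_ball_zero_iff, kinetic, ← Real.lt_sqrt (by positivity), lt_div_iff₀ hp, mul_comm]

theorem volume_kinetic_lt (K : ℝ) :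
    volume (kinetic ⁻¹' Set.Iio K) = ENNReal.ofReal (K / (4 * Real.pi)) := by
  have : kinetic ⁻¹' Set.Iio K = Metric.ball (0 : Plane) (√K / (2 * Real.pi)) := by
    ext ξ; exact kinetic_lt_iff ξ
  rw [this, EuclideanSpace.volume_ball_fin_two, ← ENNReal.ofReal_pow (by positivity),
    ← ENNReal.ofReal_mul (by positivity), div_pow]
  rcases le_total 0 K with h | h
  · rw [Real.sq_sqrt h]
    congr 1
    have := Real.pi_pos.ne'
    field_simp
    norm_num
  · rw [Real.sqrt_eq_zero_of_nonpos h, ENNReal.ofReal_of_nonpos (p := K / (4 * Real.pi))]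
    · simp
    · exact div_nonpos_of_nonpos_of_nonneg h (by positivity)

/-- In the variable `p²`, Lebesgue measure on the plane is a multiple of Lebesgue measure on the
half-line. -/
theorem map_kinetic : (volume : Measure Plane).map kinetic =
    ENNReal.ofReal (1 / (4 * Real.pi)) • volume.restrict (Set.Ioi 0) := by
  -- The area of a disc is linear in its squared radius, so the region p² < K has area K/(4π) for K
  -- ≥ 0; it remains to compare the measures on half-open intervals.
  have key : ∀ ⦃a b : ℝ⦄, a < b → (volume : Measure Plane).map kinetic (Set.Ico a b) =
      ENNReal.ofReal (b / (4 * Real.pi)) - ENNReal.ofReal (a / (4 * Real.pi)) := by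
    intro a b hab
    rw [Measure.map_apply measurable_kinetic measurableSet_Ico]
    have : kinetic ⁻¹' Set.Ico a b = kinetic ⁻¹' Set.Iio b \ kinetic ⁻¹' Set.Iio a := by
      ext ξ; simp [and_comm]
    rw [this, measure_sdiff (Set.preimage_mono (Set.Iio_subset_Iio hab.le))
      (measurable_kinetic measurableSet_Iio).nullMeasurableSet, volume_kinetic_lt, volume_kinetic_lt]
    rw [volume_kinetic_lt]; exact ENNReal.ofReal_ne_top
  refine Measure.ext_of_Ico' _ _ ?_ ?_
  · intro a b hab
    rw [key hab]
    exact ne_top_of_le_ne_top ENNReal.ofReal_ne_top tsub_le_self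
  · intro a b hab
    have hp := Real.pi_pos
    rw [key hab, Measure.smul_apply, Measure.restrict_apply measurableSet_Ico, smul_eq_mul]
    rcases le_or_gt a 0 with ha | ha
    · have e : volume (Set.Ico a b ∩ Set.Ioi 0) = ENNReal.ofReal b := by
        have : Set.Ico a b ∩ Set.Ioi 0 = Set.Ioo 0 b := by
          ext x; simp only [Set.mem_inter_iff, Set.mem_Ico, Set.mem_Ioi, Set.mem_Ioo]
          constructor
          · rintro ⟨⟨_, h⟩, h'⟩; exact ⟨h', h⟩
          · rintro ⟨h, h'⟩; exact ⟨⟨ha.trans h.le, h'⟩, h⟩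
        rw [this, Real.volume_Ioo, sub_zero]
      rw [e, ENNReal.ofReal_of_nonpos (div_nonpos_of_nonpos_of_nonneg ha (by positivity)), tsub_zero,
        ← ENNReal.ofReal_mul (by positivity)]
      congr 1; ring
    · have e : Set.Ico a b ∩ Set.Ioi 0 = Set.Ico a b := by
        refine Set.inter_eq_left.2 fun x hx => ?_
        exact ha.trans_le hx.1
      rw [e, Real.volume_Ico, ← ENNReal.ofReal_mul (by positivity), ← ENNReal.ofReal_sub _
        (by positivity)]
      congr 1; ring

theorem lintegral_comp_kinetic {f : ℝ → ENNReal} (hf : Measurable f) :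
    ∫⁻ ξ : Plane, f (kinetic ξ) =
      ENNReal.ofReal (1 / (4 * Real.pi)) * ∫⁻ k in Set.Ioi (0 : ℝ), f k := by
  rw [← lintegral_map hf measurable_kinetic, map_kinetic, lintegral_smul_measure, smul_eq_mul]

theorem integral_comp_kinetic {f : ℝ → ℂ} (hf : Measurable f) :
    ∫ ξ : Plane, f (kinetic ξ) = (1 / (4 * Real.pi) : ℝ) * ∫ k in Set.Ioi (0 : ℝ), f k := by
  rw [← integral_map measurable_kinetic.aemeasurable hf.aestronglyMeasurable, map_kinetic,
    integral_smul_measure, ENNReal.toReal_ofReal (by positivity), real_smul]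

theorem integrable_comp_kinetic {f : ℝ → ℂ} (hf : Measurable f) :
    Integrable (fun ξ : Plane => f (kinetic ξ)) ↔ IntegrableOn f (Set.Ioi 0) := by
  have h := integrable_map_measure (μ := (volume : Measure Plane)) (f := kinetic) (g := f)
    hf.aestronglyMeasurable measurable_kinetic.aemeasurable
  rw [map_kinetic] at h
  refine h.symm.trans (integrable_smul_measure ?_ ENNReal.ofReal_ne_top)
  simp [Real.pi_pos]

/-- Plancherel for the pointwise Fourier integral, needed because the waves are given by integrals
and not by elements of L². -/
theorem lintegral_enorm_sq_fourier {f : ℝ → ℂ} (h1 : Integrable f) (h2 : MemLp f 2) :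
    ∫⁻ ξ, ‖𝓕 f ξ‖ₑ ^ 2 = ∫⁻ x, ‖f x‖ₑ ^ 2 := by
  set u : Lp ℂ 2 (volume : Measure ℝ) := h2.toLp f
  have hu : u =ᵐ[volume] f := h2.coeFn_toLp
  have hcont : Continuous (𝓕 f) :=
    VectorFourier.fourierIntegral_continuous Real.continuous_fourierChar
      (L := innerₗ ℝ) continuous_inner h1
  -- The L² transform and the Fourier integral agree when paired with smooth compactly supported
  -- functions, hence almost everywhere.
  have hae : (𝓕 u : Lp ℂ 2 (volume : Measure ℝ)) =ᵐ[volume] 𝓕 f := by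
    refine ae_eq_of_integral_contDiff_smul_eq
      ((Lp.memLp _).locallyIntegrable (by norm_num)) hcont.locallyIntegrable ?_
    intro g hg hc
    have hg₁ : HasCompactSupport (Complex.ofRealCLM ∘ g) := hc.comp_left rfl
    have hg₂ : ContDiff ℝ ((⊤ : ℕ∞) : WithTop ℕ∞) (Complex.ofRealCLM ∘ g) :=
      Complex.ofRealCLM.contDiff.comp hg
    set χ : 𝓢(ℝ, ℂ) := hg₁.toSchwartzMap hg₂
    have e1 : ∫ x, g x • (𝓕 u : Lp ℂ 2 (volume : Measure ℝ)) x =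
        ((𝓕 u : Lp ℂ 2 (volume : Measure ℝ)) : 𝓢'(ℝ, ℂ)) χ := by
      rw [Lp.toTemperedDistribution_apply]; rfl
    rw [e1, ← Lp.fourier_toTemperedDistribution_eq, TemperedDistribution.fourier_apply,
      Lp.toTemperedDistribution_apply]
    have e2 : ∫ x, (𝓕 χ) x • u x = ∫ x, (𝓕 χ) x • f x := by
      refine integral_congr_ae ?_
      filter_upwards [hu] with x hx
      rw [hx]
    rw [e2]
    have e3 := VectorFourier.integral_fourierIntegral_smul_eq_flip (L := innerₗ ℝ) (μ := volume)
      (ν := volume) Real.continuous_fourierChar continuous_inner χ.integrable h1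
    simpa using! e3
  have e : ∀ v : Lp ℂ 2 (volume : Measure ℝ), ∫⁻ x, ‖v x‖ₑ ^ 2 = ‖v‖ₑ ^ 2 := by
    intro v
    rw [Lp.enorm_def]
    have := eLpNorm_nnreal_pow_eq_lintegral (f := v) (μ := volume) (p := 2) (by norm_num)
    norm_num at this
    exact this.symm
  calc ∫⁻ ξ, ‖𝓕 f ξ‖ₑ ^ 2 = ∫⁻ ξ, ‖(𝓕 u : Lp ℂ 2 (volume : Measure ℝ)) ξ‖ₑ ^ 2 := by
        refine lintegral_congr_ae ?_
        filter_upwards [hae] with x hx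
        rw [hx]
    _ = ‖u‖ₑ ^ 2 := by
        rw [e, ← ofReal_norm, Lp.norm_fourier_eq, ofReal_norm]
    _ = ∫⁻ x, ‖u x‖ₑ ^ 2 := (e u).symm
    _ = _ := by
        refine lintegral_congr_ae ?_
        filter_upwards [hu] with x hx
        rw [hx]

/-- Plancherel in the angular frequency k = 2πξ; the rescaling produces the factor 2π. -/
theorem lintegral_enorm_sq_oscillatory {f : ℝ → ℂ} (h1 : Integrable f) (h2 : MemLp f 2) :
    ∫⁻ k : ℝ, ‖∫ s : ℝ, Complex.exp (-(I * k * s)) * f s‖ₑ ^ 2 =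
      ENNReal.ofReal (2 * Real.pi) * ∫⁻ x, ‖f x‖ₑ ^ 2 := by
  have hp : 0 < 2 * Real.pi := by positivity
  rw [← lintegral_enorm_sq_fourier h1 h2]
  have e : ∀ ξ : ℝ, 𝓕 f ξ = ∫ s : ℝ, Complex.exp (-(I * (ξ * (2 * Real.pi) : ℝ) * s)) * f s := by
    intro ξ
    rw [Real.fourier_eq']
    refine integral_congr_ae (Eventually.of_forall fun s => ?_)
    simp only [smul_eq_mul, RCLike.inner_apply, conj_trivial]
    congr 2
    push_cast
    ring
  simp_rw [e]
  have hcont : Continuous (𝓕 f) :=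
    VectorFourier.fourierIntegral_continuous Real.continuous_fourierChar
      (L := innerₗ ℝ) continuous_inner h1
  set G : ℝ → ENNReal := fun k => ‖∫ s : ℝ, Complex.exp (-(I * k * s)) * f s‖ₑ ^ 2 with hG
  have hGm : Measurable G := by
    have : G = fun k => ‖𝓕 f (k / (2 * Real.pi))‖ₑ ^ 2 := by
      ext k
      rw [e, div_mul_cancel₀ _ hp.ne']
    rw [this]
    exact (hcont.measurable.comp (measurable_id.div_const _)).enorm.pow_const 2
  have hmap := Real.map_volume_mul_right hp.ne'
  have h3 := lintegral_map (μ := volume) hGm (measurable_mul_const (2 * Real.pi))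
  rw [hmap, lintegral_smul_measure, smul_eq_mul, abs_of_pos (by positivity)] at h3
  change ∫⁻ k, G k = _ * ∫⁻ ξ, G (ξ * (2 * Real.pi))
  rw [← h3, ← mul_assoc, ← ENNReal.ofReal_mul hp.le, mul_inv_cancel₀ hp.ne', ENNReal.ofReal_one,
    one_mul]

/-- Plancherel's theorem in time: superpositions of free waves emitted from a point. -/
theorem lintegral_enorm_sq_oscillatory_kinetic_le {f : ℝ → ℂ} (h1 : Integrable f)
    (h2 : MemLp f 2) :
    ∫⁻ ξ : Plane, ‖∫ s : ℝ, Complex.exp (-(I * kinetic ξ * s)) * f s‖ₑ ^ 2 ≤ ∫⁻ x, ‖f x‖ₑ ^ 2 := by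
  have hp : 0 < 2 * Real.pi := by positivity
  have hm : Measurable fun k : ℝ => ‖∫ s : ℝ, Complex.exp (-(I * k * s)) * f s‖ₑ ^ 2 := by
    have : StronglyMeasurable fun k : ℝ => ∫ s : ℝ, Complex.exp (-(I * k * s)) * f s := by
      obtain ⟨g, hg, hfg⟩ := h1.1
      have : (fun k : ℝ => ∫ s : ℝ, Complex.exp (-(I * k * s)) * f s) =
          fun k : ℝ => ∫ s : ℝ, Complex.exp (-(I * k * s)) * g s := by
        ext k
        refine integral_congr_ae ?_
        filter_upwards [hfg] with s hs
        rw [hs]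
      rw [this]
      refine StronglyMeasurable.integral_prod_right' (f := fun p : ℝ × ℝ =>
        Complex.exp (-(I * p.1 * p.2)) * g p.2) ?_
      exact (by fun_prop : Continuous fun p : ℝ × ℝ =>
        Complex.exp (-(I * p.1 * p.2))).stronglyMeasurable.mul (hg.comp_measurable measurable_snd)
    exact this.measurable.enorm.pow_const 2
  rw [lintegral_comp_kinetic hm]
  -- Extending the integral from k > 0 to the whole line, Plancherel applies with total constant
  -- 2π/(4π) = 1/2 ≤ 1.
  calc _ ≤ ENNReal.ofReal (1 / (4 * Real.pi)) *
        ∫⁻ k : ℝ, ‖∫ s : ℝ, Complex.exp (-(I * k * s)) * f s‖ₑ ^ 2 := by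
        gcongr; exact Measure.restrict_le_self
    _ = ENNReal.ofReal (1 / 2) * ∫⁻ x, ‖f x‖ₑ ^ 2 := by
        rw [lintegral_enorm_sq_oscillatory h1 h2, ← mul_assoc, ← ENNReal.ofReal_mul (by positivity)]
        congr 2
        field_simp
        norm_num
    _ ≤ 1 * ∫⁻ x, ‖f x‖ₑ ^ 2 := by
        gcongr
        rw [← ENNReal.ofReal_one]
        exact ENNReal.ofReal_le_ofReal (by norm_num)
    _ = _ := one_mul _

theorem integrable_and_integral_le_of_lintegral_enorm_sq_le {α : Type*} [MeasurableSpace α]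
    {μ : Measure α} {f : α → ℂ} (hf : AEStronglyMeasurable f μ) {C : ℝ} (hC : 0 ≤ C)
    (h : ∫⁻ x, ‖f x‖ₑ ^ 2 ∂μ ≤ ENNReal.ofReal C) :
    Integrable (fun x => ‖f x‖ ^ 2) μ ∧ ∫ x, ‖f x‖ ^ 2 ∂μ ≤ C := by
  have e : ∀ x, ENNReal.ofReal (‖f x‖ ^ 2) = ‖f x‖ₑ ^ 2 := fun x => by
    rw [ENNReal.ofReal_pow (norm_nonneg _), ofReal_norm]
  have hi : Integrable (fun x => ‖f x‖ ^ 2) μ := by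
    refine ⟨(hf.norm.pow 2), ?_⟩
    rw [hasFiniteIntegral_iff_ofReal (Eventually.of_forall fun x => by positivity)]
    simp_rw [e]
    exact h.trans_lt ENNReal.ofReal_lt_top
  refine ⟨hi, ?_⟩
  rw [integral_eq_lintegral_of_nonneg_ae (Eventually.of_forall fun x => by positivity) hi.1]
  simp_rw [e]
  exact ENNReal.toReal_le_of_le_ofReal hC h

theorem ofReal_integral_norm_sq {α : Type*} [MeasurableSpace α]
    {μ : Measure α} {f : α → ℂ} (hf : Integrable (fun x => ‖f x‖ ^ 2) μ) :
    ENNReal.ofReal (∫ x, ‖f x‖ ^ 2 ∂μ) = ∫⁻ x, ‖f x‖ₑ ^ 2 ∂μ := by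
  rw [ofReal_integral_eq_lintegral_ofReal hf (Eventually.of_forall fun x => by positivity)]
  refine lintegral_congr fun x => ?_
  rw [ENNReal.ofReal_pow (norm_nonneg _), ofReal_norm]

theorem norm_exp_neg_I_mul (a s : ℝ) : ‖Complex.exp (-(I * a * s))‖ = 1 := by
  rw [Complex.norm_exp]; simp

/-- The trace at the origin of a free wave, as a function of time, is square integrable. -/
theorem integral_norm_sq_trace_le {g : Plane → ℂ} (h1 : Integrable g)
    (h2 : Integrable fun ξ => ‖g ξ‖ ^ 2) {a b : ℝ} (hab : a ≤ b) :
    ∫ t in a..b, ‖∫ ξ, Complex.exp (-(I * kinetic ξ * t)) * g ξ‖ ^ 2 ≤ ∫ ξ, ‖g ξ‖ ^ 2 := by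
  set f : ℝ → ℂ := fun t => ∫ ξ, Complex.exp (-(I * kinetic ξ * t)) * g ξ with hf
  have hfb : ∀ t, ‖f t‖ ≤ ∫ ξ, ‖g ξ‖ := fun t => by
    refine norm_integral_le_of_norm_le h1.norm (Eventually.of_forall fun ξ => ?_)
    rw [norm_mul, norm_exp_neg_I_mul, one_mul]
  have hfc : Continuous f := by
    refine continuous_of_dominated (bound := fun ξ => ‖g ξ‖) ?_ ?_ h1.norm ?_
    · intro t
      have := continuous_kinetic
      exact (by fun_prop : Continuous fun ξ : Plane =>
        Complex.exp (-(I * kinetic ξ * t))).aestronglyMeasurable.mul h1.1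
    · intro t
      refine Eventually.of_forall fun ξ => ?_
      rw [norm_mul, norm_exp_neg_I_mul, one_mul]
    · exact Eventually.of_forall fun ξ => by fun_prop
  -- Duality: with u the conjugate trace on (a, b], the integral of |u|² is the pairing of u with
  -- the trace, which by Fubini is the pairing of g with the wave w emitted by u.
  set u : ℝ → ℂ := (Set.Ioc a b).indicator fun t => (starRingEnd ℂ) (f t) with hu
  have hum : StronglyMeasurable u :=
    (Complex.continuous_conj.comp hfc).stronglyMeasurable.indicator measurableSet_Ioc
  have hu1 : Integrable u :=
    (integrable_indicator_iff measurableSet_Ioc).2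
      ((Complex.continuous_conj.comp hfc).integrableOn_Ioc)
  have hnu : ∀ t, ‖u t‖ ^ 2 = (Set.Ioc a b).indicator (fun t => ‖f t‖ ^ 2) t := by
    intro t
    by_cases ht : t ∈ Set.Ioc a b <;> simp [hu, ht]
  have hu2 : Integrable fun t => ‖u t‖ ^ 2 := by
    simp_rw [hnu]
    exact (integrable_indicator_iff measurableSet_Ioc).2 ((hfc.norm.pow 2).integrableOn_Ioc)
  have hX : ∫ t, ‖u t‖ ^ 2 = ∫ t in a..b, ‖f t‖ ^ 2 := by
    simp_rw [hnu]
    rw [integral_indicator measurableSet_Ioc, intervalIntegral.integral_of_le hab]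
  have humem : MemLp u 2 := (memLp_two_iff_integrable_sq_norm hu1.1).2 hu2
  set w : Plane → ℂ := fun ξ => ∫ s : ℝ, Complex.exp (-(I * kinetic ξ * s)) * u s with hw
  have hwm : AEStronglyMeasurable w := by
    refine StronglyMeasurable.aestronglyMeasurable ?_
    refine StronglyMeasurable.integral_prod_right' (f := fun p : Plane × ℝ =>
        Complex.exp (-(I * kinetic p.1 * p.2)) * u p.2) ?_
    have := continuous_kinetic
    exact (by fun_prop : Continuous fun p : Plane × ℝ =>
        Complex.exp (-(I * kinetic p.1 * p.2))).stronglyMeasurable.mul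
        (hum.comp_measurable measurable_snd)
  have hwb := lintegral_enorm_sq_oscillatory_kinetic_le hu1 humem
  rw [← ofReal_integral_norm_sq hu2] at hwb
  obtain ⟨hwi, hwle⟩ := integrable_and_integral_le_of_lintegral_enorm_sq_le hwm
    (integral_nonneg fun t => by positivity) hwb
  have hprod : Integrable (fun p : ℝ × Plane => u p.1 *
      (Complex.exp (-(I * kinetic p.2 * p.1)) * g p.2)) (volume.prod volume) := by
    refine (hu1.mul_prod h1).mono ?_ ?_
    · have := continuous_kinetic
      refine (hum.comp_measurable measurable_fst).aestronglyMeasurable.mul ?_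
      exact (by fun_prop : Continuous fun p : ℝ × Plane =>
        Complex.exp (-(I * kinetic p.2 * p.1))).aestronglyMeasurable.mul h1.1.comp_snd
    · refine Eventually.of_forall fun p => ?_
      rw [norm_mul, norm_mul, norm_mul, norm_exp_neg_I_mul, one_mul]
  have hdual : ((∫ t, ‖u t‖ ^ 2 : ℝ) : ℂ) = ∫ ξ, g ξ * w ξ := by
    have e1 : ((∫ t, ‖u t‖ ^ 2 : ℝ) : ℂ) = ∫ t, u t * f t := by
      rw [← integral_complex_ofReal]
      refine integral_congr_ae (Eventually.of_forall fun t => ?_)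
      by_cases ht : t ∈ Set.Ioc a b
      · simp only [hu, Set.indicator_of_mem ht, RCLike.norm_conj]
        rw [Complex.conj_mul']
        push_cast; rfl
      · simp [hu, Set.indicator_of_notMem ht]
    rw [e1]
    calc ∫ t, u t * f t = ∫ t, ∫ ξ, u t * (Complex.exp (-(I * kinetic ξ * t)) * g ξ) := by
          refine integral_congr_ae (Eventually.of_forall fun t => ?_)
          exact (integral_const_mul _ _).symm
      _ = ∫ ξ, ∫ t : ℝ, u t * (Complex.exp (-(I * kinetic ξ * t)) * g ξ) :=
          integral_integral_swap hprod
      _ = _ := by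
          refine integral_congr_ae (Eventually.of_forall fun ξ => ?_)
          simp only [hw]
          rw [← integral_const_mul]
          refine integral_congr_ae (Eventually.of_forall fun t => ?_)
          simp only []
          ring
  -- With X = ∫|u|², the pairing gives X ≤ (‖g‖² + ‖w‖²)/2, and ‖w‖² ≤ X by Plancherel in time; X is
  -- finite, so X ≤ ‖g‖².
  have hle : ∫ t, ‖u t‖ ^ 2 ≤ ∫ ξ, (‖g ξ‖ ^ 2 + ‖w ξ‖ ^ 2) / 2 := by
    have h0 : 0 ≤ ∫ t, ‖u t‖ ^ 2 := integral_nonneg fun t => by positivity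
    have : ∫ t, ‖u t‖ ^ 2 = ‖∫ ξ, g ξ * w ξ‖ := by
      rw [← hdual, norm_real, Real.norm_of_nonneg h0]
    rw [this]
    refine norm_integral_le_of_norm_le ((h2.add hwi).div_const 2) (Eventually.of_forall fun ξ => ?_)
    rw [norm_mul]
    nlinarith [sq_nonneg (‖g ξ‖ - ‖w ξ‖)]
  rw [integral_div, integral_add h2 hwi] at hle
  rw [← hX]
  linarith

/-- The wave emitted between the times `0` and `t` by a point source of strength `q`, as a
function of the kinetic energy `k`. -/
def sourceWave (q : ℝ → ℂ) (t k : ℝ) : ℂ :=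
  ∫ s in (0 : ℝ)..t, Complex.exp (-(I * k * s)) * q (t - s)

theorem continuous_sourceWave {q : ℝ → ℂ} (hq : Continuous q) :
    Continuous fun p : ℝ × ℝ => sourceWave q p.1 p.2 := by
  unfold sourceWave
  exact intervalIntegral.continuous_parametric_intervalIntegral_of_continuous (by fun_prop)
    continuous_fst

theorem norm_sourceWave_le {q : ℝ → ℂ} {t k C : ℝ} (ht : 0 ≤ t)
    (hC : ∀ s ∈ Set.Icc 0 t, ‖q s‖ ≤ C) : ‖sourceWave q t k‖ ≤ C * t := by
  have h := intervalIntegral.norm_integral_le_of_norm_le_const (a := 0) (b := t) (C := C)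
    (f := fun s : ℝ => Complex.exp (-(I * k * s)) * q (t - s)) (fun s hs => by
      rw [Set.uIoc_of_le ht] at hs
      rw [norm_mul, norm_exp_neg_I_mul, one_mul]
      exact hC _ ⟨by linarith [hs.2], by linarith [hs.1]⟩)
  rwa [sub_zero, abs_of_nonneg ht] at h

/-- Plancherel in time for the charge restricted to (0, t]: a continuous charge emits a wave in L²,
of norm tending to 0 with t. -/
theorem integral_norm_sq_sourceWave_le {q : ℝ → ℂ} (hq : Continuous q) {t : ℝ} (ht : 0 ≤ t) :
    Integrable (fun ξ : Plane => ‖sourceWave q t (kinetic ξ)‖ ^ 2) ∧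
    ∫ ξ : Plane, ‖sourceWave q t (kinetic ξ)‖ ^ 2 ≤ ∫ s in (0 : ℝ)..t, ‖q s‖ ^ 2 := by
  set u : ℝ → ℂ := (Set.Ioc 0 t).indicator fun s => q (t - s) with hu
  have hqc : Continuous fun s => q (t - s) := by fun_prop
  have hu1 : Integrable u := (integrable_indicator_iff measurableSet_Ioc).2 hqc.integrableOn_Ioc
  have hnu : ∀ s, ‖u s‖ ^ 2 = (Set.Ioc 0 t).indicator (fun s => ‖q (t - s)‖ ^ 2) s := by
    intro s
    by_cases hs : s ∈ Set.Ioc 0 t <;> simp [hu, hs]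
  have hu2 : Integrable fun t => ‖u t‖ ^ 2 := by
    simp_rw [hnu]
    exact (integrable_indicator_iff measurableSet_Ioc).2 ((hqc.norm.pow 2).integrableOn_Ioc)
  have hX : ∫ s, ‖u s‖ ^ 2 = ∫ s in (0 : ℝ)..t, ‖q s‖ ^ 2 := by
    simp_rw [hnu]
    rw [integral_indicator measurableSet_Ioc, ← intervalIntegral.integral_of_le ht,
      intervalIntegral.integral_comp_sub_left (fun s => ‖q s‖ ^ 2)]
    simp
  have humem : MemLp u 2 := (memLp_two_iff_integrable_sq_norm hu1.1).2 hu2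
  have e : ∀ k : ℝ, ∫ s : ℝ, Complex.exp (-(I * k * s)) * u s = sourceWave q t k := by
    intro k
    rw [sourceWave, intervalIntegral.integral_of_le ht, ← integral_indicator measurableSet_Ioc]
    refine integral_congr_ae (Eventually.of_forall fun s => ?_)
    by_cases hs : s ∈ Set.Ioc 0 t <;> simp [hu, hs]
  have hwb := lintegral_enorm_sq_oscillatory_kinetic_le hu1 humem
  simp_rw [e] at hwb
  rw [← ofReal_integral_norm_sq hu2, hX] at hwb
  refine integrable_and_integral_le_of_lintegral_enorm_sq_le ?_
    (intervalIntegral.integral_nonneg ht fun t _ => by positivity) hwb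
  exact ((continuous_sourceWave hq).comp
    (continuous_const.prodMk continuous_kinetic)).aestronglyMeasurable

end PointNLS

namespace PointNLS

/-! ### Stability of Volterra equations -/

/-- Cauchy–Schwarz for the measure with density `K`, by writing K = K^{1/2}·K^{1/2}. -/
theorem sq_lintegral_mul_le {α : Type*} [MeasurableSpace α] {μ : Measure α} {K f : α → ENNReal}
    (hK : AEMeasurable K μ) (hf : AEMeasurable f μ) :
    (∫⁻ x, K x * f x ∂μ) ^ 2 ≤ (∫⁻ x, K x ∂μ) * ∫⁻ x, K x * f x ^ 2 ∂μ := by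
  have h := ENNReal.lintegral_mul_le_Lp_mul_Lq μ Real.HolderConjugate.two_two
    (f := fun x => K x ^ (1 / 2 : ℝ)) (g := fun x => K x ^ (1 / 2 : ℝ) * f x)
    (hK.pow_const _) ((hK.pow_const _).mul hf)
  have e0 : ∀ x, K x ^ (1 / 2 : ℝ) * K x ^ (1 / 2 : ℝ) = K x := fun x => by
    rw [← ENNReal.rpow_add_of_nonneg _ _ (by norm_num) (by norm_num)]; norm_num
  have e1 : ∀ x, ((fun x => K x ^ (1 / 2 : ℝ)) * fun x => K x ^ (1 / 2 : ℝ) * f x) x = K x * f x :=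
    fun x => by simp only [Pi.mul_apply]; rw [← mul_assoc, e0]
  have e2 : ∀ x, (K x ^ (1 / 2 : ℝ)) ^ (2 : ℝ) = K x := fun x => by
    rw [← ENNReal.rpow_mul]; norm_num
  have e3 : ∀ x, (K x ^ (1 / 2 : ℝ) * f x) ^ (2 : ℝ) = K x * f x ^ 2 := fun x => by
    rw [ENNReal.mul_rpow_of_nonneg _ _ (by norm_num), e2]; norm_num
  simp_rw [e1, e2, e3] at h
  calc (∫⁻ x, K x * f x ∂μ) ^ 2 ≤ ((∫⁻ x, K x ∂μ) ^ (1 / 2 : ℝ) *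
        (∫⁻ x, K x * f x ^ 2 ∂μ) ^ (1 / 2 : ℝ)) ^ 2 := by gcongr
    _ = _ := by
      rw [mul_pow, ← ENNReal.rpow_natCast, ← ENNReal.rpow_natCast, ← ENNReal.rpow_mul,
        ← ENNReal.rpow_mul]
      norm_num

/-- Young's inequality for the convolution of L¹ with L². -/
theorem lintegral_sq_convolution_le {K f : ℝ → ENNReal} (hK : Measurable K) (hf : Measurable f) :
    ∫⁻ t, (∫⁻ s, K (t - s) * f s) ^ 2 ≤ (∫⁻ s, K s) ^ 2 * ∫⁻ s, f s ^ 2 := by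
  have h1 : ∀ t, (∫⁻ s, K (t - s) * f s) ^ 2 ≤ (∫⁻ s, K s) * ∫⁻ s, K (t - s) * f s ^ 2 := by
    intro t
    have := sq_lintegral_mul_le (μ := volume)
      (by fun_prop : Measurable fun s : ℝ => K (t - s)).aemeasurable hf.aemeasurable
    rwa [lintegral_sub_left_eq_self (fun s => K s)] at this
  calc ∫⁻ t, (∫⁻ s, K (t - s) * f s) ^ 2
      ≤ ∫⁻ t, (∫⁻ s, K s) * ∫⁻ s, K (t - s) * f s ^ 2 := lintegral_mono h1
    _ = (∫⁻ s, K s) * ∫⁻ t, ∫⁻ s, K (t - s) * f s ^ 2 := by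
        rw [lintegral_const_mul]
        exact Measurable.lintegral_prod_right' (f := fun p : ℝ × ℝ => K (p.1 - p.2) * f p.2 ^ 2)
          (by fun_prop)
    _ = (∫⁻ s, K s) * ∫⁻ s, ∫⁻ t, K (t - s) * f s ^ 2 := by
        rw [lintegral_lintegral_swap]
        exact (by fun_prop : Measurable fun p : ℝ × ℝ => K (p.1 - p.2) * f p.2 ^ 2).aemeasurable
    _ = (∫⁻ s, K s) * ∫⁻ s, (∫⁻ t, K t) * f s ^ 2 := by
        congr 1
        refine lintegral_congr fun s => ?_
        rw [lintegral_mul_const _ (by fun_prop), lintegral_sub_right_eq_self (fun t => K t)]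
    _ = _ := by
        rw [lintegral_const_mul _ (by fun_prop), sq, mul_assoc]

/-- An exponential weight makes the L¹ norm of the kernel as small as desired, so that the Gronwall
argument works on all of [0, T] at once. -/
theorem tendsto_lintegral_exp_mul_volterraKernel (T : ℝ) (hT : 0 ≤ T) :
    Tendsto (fun μ : ℝ => ∫⁻ s in Set.Ioc 0 T,
      ENNReal.ofReal (Real.exp (-(μ * s)) * volterraKernel s)) atTop (𝓝 0) := by
  have hi := (intervalIntegrable_volterraKernel T hT).1
  have hfin : ∫⁻ s in Set.Ioc 0 T, ENNReal.ofReal (volterraKernel s) ≠ ⊤ :=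
    hi.lintegral_lt_top.ne
  have h := tendsto_lintegral_filter_of_dominated_convergence (l := atTop)
    (F := fun μ s => ENNReal.ofReal (Real.exp (-(μ * s)) * volterraKernel s)) (f := fun _ => 0)
    (μ := volume.restrict (Set.Ioc 0 T)) (fun s => ENNReal.ofReal (volterraKernel s)) ?_ ?_ hfin ?_
  · simpa using h
  · refine Eventually.of_forall fun μ => ?_
    exact ((by fun_prop : Measurable fun s : ℝ => Real.exp (-(μ * s))).mul
      measurable_volterraKernel).ennreal_ofReal
  · filter_upwards [eventually_ge_atTop 0] with μ hμ
    filter_upwards [ae_restrict_mem measurableSet_Ioc] with s hs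
    refine ENNReal.ofReal_le_ofReal ?_
    refine mul_le_of_le_one_left (volterraKernel_nonneg hs.1.le) (Real.exp_le_one_iff.2 ?_)
    nlinarith [hs.1]
  · filter_upwards [ae_restrict_mem measurableSet_Ioc] with s hs
    have h1 : Tendsto (fun μ : ℝ => Real.exp (-(μ * s)) * volterraKernel s) atTop (𝓝 0) := by
      have := (Real.tendsto_exp_neg_atTop_nhds_zero.comp (tendsto_id.atTop_mul_const hs.1)).mul_const
        (volterraKernel s)
      simpa using this
    simpa [Function.comp_def] using (ENNReal.continuous_ofReal.tendsto 0).comp h1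

theorem two_mul_mul_le_sq_add_sq (a b : ENNReal) : 2 * a * b ≤ a ^ 2 + b ^ 2 := by
  wlog h : a ≤ b generalizing a b
  · calc 2 * a * b = 2 * b * a := by ring
      _ ≤ b ^ 2 + a ^ 2 := this b a (le_of_not_ge h)
      _ = _ := add_comm _ _
  obtain ⟨c, rfl⟩ := exists_add_of_le h
  calc 2 * a * (a + c) ≤ 2 * a * (a + c) + c ^ 2 := le_self_add
    _ = _ := by ring

theorem add_add_sq_le (a b c : ENNReal) : (a + b + c) ^ 2 ≤ 3 * (a ^ 2 + b ^ 2 + c ^ 2) := by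
  have h1 : 2 * a * b ≤ a ^ 2 + b ^ 2 := two_mul_mul_le_sq_add_sq a b
  have h2 : 2 * a * c ≤ a ^ 2 + c ^ 2 := two_mul_mul_le_sq_add_sq a c
  have h3 : 2 * b * c ≤ b ^ 2 + c ^ 2 := two_mul_mul_le_sq_add_sq b c
  calc (a + b + c) ^ 2 = a ^ 2 + b ^ 2 + c ^ 2 + (2 * a * b + 2 * a * c + 2 * b * c) := by ring
    _ ≤ a ^ 2 + b ^ 2 + c ^ 2 + ((a ^ 2 + b ^ 2) + (a ^ 2 + c ^ 2) + (b ^ 2 + c ^ 2)) := by gcongr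
    _ = _ := by ring

/-- An `L²` Gronwall inequality for the Volterra kernel. -/
theorem exists_volterra_stability (T : ℝ) (hT : 0 ≤ T) (L : NNReal) :
    ∃ C : NNReal, ∀ S ≤ T, ∀ d g ρ : ℝ → ENNReal, Measurable d → Measurable g → Measurable ρ →
      (∀ t ∈ Set.Ioo 0 S, d t ≤ (∫⁻ s in Set.Ioo 0 t,
        ENNReal.ofReal (volterraKernel (t - s)) * (g s + L * d s)) + ρ t) →
      ∫⁻ t in Set.Ioo 0 S, d t ^ 2 ≠ ⊤ →
      ∫⁻ t in Set.Ioo 0 S, d t ^ 2 ≤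
        C * ((∫⁻ t in Set.Ioo 0 S, g t ^ 2) + ∫⁻ t in Set.Ioo 0 S, ρ t ^ 2) := by
  -- The first summand ensures 3L²η ≤ 1/2, the 3 coming from the square of a sum of three terms; the
  -- second ensures η ≤ 1.
  set η : ENNReal := (6 * (L : ENNReal) ^ 2 + 6)⁻¹ with hη
  have hη0 : 0 < η := by
    rw [hη, ENNReal.inv_pos]
    exact ENNReal.add_ne_top.2 ⟨ENNReal.mul_ne_top (by norm_num) (by simp), by norm_num⟩
  have hη1 : η ≤ 1 := by
    rw [hη, ENNReal.inv_le_one]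
    calc (1 : ENNReal) ≤ 6 := by norm_num
      _ ≤ _ := le_add_self
  obtain ⟨μ, hμ0, hμ⟩ : ∃ μ : ℝ, 0 ≤ μ ∧ ∫⁻ s in Set.Ioc 0 T,
      ENNReal.ofReal (Real.exp (-(μ * s)) * volterraKernel s) ≤ η := by
    have h1 := (tendsto_lintegral_exp_mul_volterraKernel T hT).eventually_lt_const hη0
    obtain ⟨μ, h2, h3⟩ := ((eventually_ge_atTop (0 : ℝ)).and h1).exists
    exact ⟨μ, h2, h3.le⟩
  refine ⟨6 * Real.toNNReal (Real.exp (2 * μ * T)), fun S hS d g ρ hd hg hρ hle hfin => ?_⟩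
  set E : ℝ → ENNReal := fun t => ENNReal.ofReal (Real.exp (-(μ * t))) with hE
  have hEm : Measurable E := by fun_prop
  set K : ℝ → ENNReal := (Set.Ioc 0 T).indicator fun s =>
    ENNReal.ofReal (Real.exp (-(μ * s)) * volterraKernel s) with hK
  have hKm : Measurable K := by
    refine Measurable.indicator ?_ measurableSet_Ioc
    exact ((by fun_prop : Measurable fun s : ℝ => Real.exp (-(μ * s))).mul
      measurable_volterraKernel).ennreal_ofReal
  have hKη : ∫⁻ s, K s ≤ η := by rwa [hK, lintegral_indicator measurableSet_Ioc]
  set D : ℝ → ENNReal := (Set.Ioo 0 S).indicator fun s => E s * d s with hD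
  have hDm : Measurable D := (hEm.mul hd).indicator measurableSet_Ioo
  set G : ℝ → ENNReal := (Set.Ioo 0 S).indicator fun s => E s * g s with hG
  have hGm : Measurable G := (hEm.mul hg).indicator measurableSet_Ioo
  have hE1 : ∀ t, 0 < t → E t ≤ 1 := fun t ht => by
    rw [hE, ← ENNReal.ofReal_one]
    refine ENNReal.ofReal_le_ofReal (Real.exp_le_one_iff.2 ?_)
    nlinarith
  -- Since e^{-μt} = e^{-μ(t-s)} e^{-μs}, the weight passes under the convolution and replaces the
  -- kernel by its damped version.
  have hDle : ∀ t ∈ Set.Ioo 0 S, D t ≤ (∫⁻ s, K (t - s) * G s) +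
      L * (∫⁻ s, K (t - s) * D s) + ρ t := by
    intro t ht
    have hsplit : (∫⁻ s, K (t - s) * G s) + L * (∫⁻ s, K (t - s) * D s) =
        ∫⁻ s, K (t - s) * (G s + L * D s) := by
      rw [← lintegral_const_mul _ (by fun_prop), ← lintegral_add_left (by fun_prop)]
      refine lintegral_congr fun s => ?_
      ring
    rw [hsplit]
    have h1 : D t = E t * d t := Set.indicator_of_mem ht _
    rw [h1]
    calc E t * d t ≤ E t * ((∫⁻ s in Set.Ioo 0 t,
        ENNReal.ofReal (volterraKernel (t - s)) * (g s + L * d s)) + ρ t) := by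
          gcongr; exact hle t ht
      _ = (∫⁻ s in Set.Ioo 0 t, E t *
        (ENNReal.ofReal (volterraKernel (t - s)) * (g s + L * d s))) + E t * ρ t := by
          rw [mul_add, lintegral_const_mul]
          exact ((measurable_volterraKernel.comp (measurable_const.sub measurable_id)).ennreal_ofReal).mul
            (by fun_prop)
      _ ≤ _ := by
          refine add_le_add ?_ (mul_le_of_le_one_left zero_le (hE1 t ht.1))
          rw [← lintegral_indicator measurableSet_Ioo]
          refine lintegral_mono fun s => ?_
          by_cases hs : s ∈ Set.Ioo 0 t
          · rw [Set.indicator_of_mem hs]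
            have hs2 : s ∈ Set.Ioo 0 S := ⟨hs.1, hs.2.trans ht.2⟩
            have hs3 : t - s ∈ Set.Ioc 0 T := ⟨by linarith [hs.2], by linarith [hs.1, ht.2]⟩
            have e1 : K (t - s) = ENNReal.ofReal (Real.exp (-(μ * (t - s))) * volterraKernel (t - s)) :=
              Set.indicator_of_mem hs3 _
            have e2 : G s = E s * g s := Set.indicator_of_mem hs2 _
            have e3 : D s = E s * d s := Set.indicator_of_mem hs2 _
            have e4 : E t = ENNReal.ofReal (Real.exp (-(μ * (t - s)))) * E s := by
              simp only [hE]
              rw [← ENNReal.ofReal_mul (Real.exp_pos _).le, ← Real.exp_add]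
              congr 2; ring
            rw [e1, e2, e3, e4, ENNReal.ofReal_mul (Real.exp_pos _).le]
            refine le_of_eq ?_
            ring
          · rw [Set.indicator_of_notMem hs]; exact zero_le
  have hDfin : ∫⁻ t, D t ^ 2 ≠ ⊤ := by
    refine ne_top_of_le_ne_top hfin ?_
    rw [← lintegral_indicator measurableSet_Ioo]
    refine lintegral_mono fun t => ?_
    by_cases ht : t ∈ Set.Ioo 0 S
    · simp only [hD, Set.indicator_of_mem ht]
      have := hE1 t ht.1
      gcongr
      exact mul_le_of_le_one_left zero_le this
    · simp [hD, Set.indicator_of_notMem ht]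
  have hGle : ∫⁻ t, G t ^ 2 ≤ ∫⁻ t in Set.Ioo 0 S, g t ^ 2 := by
    rw [← lintegral_indicator measurableSet_Ioo]
    refine lintegral_mono fun t => ?_
    by_cases ht : t ∈ Set.Ioo 0 S
    · simp only [hG, Set.indicator_of_mem ht]
      have := hE1 t ht.1
      gcongr
      exact mul_le_of_le_one_left zero_le this
    · simp [hG, Set.indicator_of_notMem ht]
  set X := ∫⁻ t, D t ^ 2 with hX
  set A := ∫⁻ t in Set.Ioo 0 S, g t ^ 2 with hA
  set R := ∫⁻ t in Set.Ioo 0 S, ρ t ^ 2 with hR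
  have hXle : X ≤ 3 * A + 2⁻¹ * X + 3 * R := by
    have h1 : X = ∫⁻ t in Set.Ioo 0 S, D t ^ 2 := by
      rw [hX, ← lintegral_indicator measurableSet_Ioo]
      refine lintegral_congr fun t => ?_
      by_cases ht : t ∈ Set.Ioo 0 S <;> simp [hD, ht]
    have m1 : Measurable fun t => ∫⁻ s, K (t - s) * G s :=
      Measurable.lintegral_prod_right' (f := fun p : ℝ × ℝ => K (p.1 - p.2) * G p.2) (by fun_prop)
    have m2 : Measurable fun t => ∫⁻ s, K (t - s) * D s :=
      Measurable.lintegral_prod_right' (f := fun p : ℝ × ℝ => K (p.1 - p.2) * D p.2) (by fun_prop)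
    have hY1 : ∫⁻ t, (∫⁻ s, K (t - s) * G s) ^ 2 ≤ A :=
      (lintegral_sq_convolution_le hKm hGm).trans
        (mul_le_of_le_one_of_le (pow_le_one₀ zero_le (hKη.trans hη1)) hGle)
    have hY2 : ∫⁻ t, (∫⁻ s, K (t - s) * D s) ^ 2 ≤ η * X := by
      refine (lintegral_sq_convolution_le hKm hDm).trans ?_
      gcongr
      calc (∫⁻ s, K s) ^ 2 = (∫⁻ s, K s) * (∫⁻ s, K s) := sq _
        _ ≤ η * 1 := by gcongr; exact hKη.trans hη1
        _ = η := mul_one _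
    have hη3 : 3 * ((L : ENNReal) ^ 2 * η) ≤ 2⁻¹ := by
      have h6 : (6 * (L : ENNReal) ^ 2) * η ≤ 1 := by
        rw [hη, ← div_eq_mul_inv]
        refine ENNReal.div_le_of_le_mul ?_
        rw [one_mul]; exact le_self_add
      have : 3 * ((L : ENNReal) ^ 2 * η) = 2⁻¹ * ((6 * (L : ENNReal) ^ 2) * η) := by
        have : (6 : ENNReal) = 2 * 3 := by norm_num
        rw [this]
        have h2 : (2 : ENNReal)⁻¹ * 2 = 1 := ENNReal.inv_mul_cancel (by norm_num) (by norm_num)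
        calc 3 * ((L : ENNReal) ^ 2 * η) = 1 * (3 * ((L : ENNReal) ^ 2 * η)) := (one_mul _).symm
          _ = _ := by rw [← h2]; ring
      rw [this]
      exact mul_le_of_le_one_right zero_le h6
    calc X = ∫⁻ t in Set.Ioo 0 S, D t ^ 2 := h1
      _ ≤ ∫⁻ t in Set.Ioo 0 S, 3 * ((∫⁻ s, K (t - s) * G s) ^ 2 +
            (L * (∫⁻ s, K (t - s) * D s)) ^ 2 + ρ t ^ 2) := by
          refine setLIntegral_mono (by fun_prop) fun t ht => ?_
          exact (pow_le_pow_left₀ zero_le (hDle t ht) 2).trans (add_add_sq_le _ _ _)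
      _ = 3 * ((∫⁻ t in Set.Ioo 0 S, (∫⁻ s, K (t - s) * G s) ^ 2) +
            L ^ 2 * (∫⁻ t in Set.Ioo 0 S, (∫⁻ s, K (t - s) * D s) ^ 2) + R) := by
          rw [lintegral_const_mul _ (by fun_prop), lintegral_add_left (by fun_prop),
            lintegral_add_left (by fun_prop)]
          simp_rw [mul_pow]
          rw [lintegral_const_mul _ (by fun_prop)]
      _ ≤ 3 * (A + L ^ 2 * (η * X) + R) := by
          gcongr
          · exact (setLIntegral_le_lintegral _ _).trans hY1
          · exact (setLIntegral_le_lintegral _ _).trans hY2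
      _ = 3 * A + 3 * (L ^ 2 * η) * X + 3 * R := by ring
      _ ≤ _ := by gcongr
  -- Half of X is absorbed by the left-hand side, which is legitimate because X is finite.
  have hX6 : X ≤ 6 * (A + R) := by
    have hXX : 2⁻¹ * X + 2⁻¹ * X = X := by
      rw [← add_mul, ENNReal.inv_two_add_inv_two, one_mul]
    have hfinX : 2⁻¹ * X ≠ ⊤ := ENNReal.mul_ne_top (by norm_num) hDfin
    have h2 : 2⁻¹ * X ≤ 3 * (A + R) := by
      have : 2⁻¹ * X + 2⁻¹ * X ≤ 3 * (A + R) + 2⁻¹ * X := by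
        rw [hXX]
        refine hXle.trans (le_of_eq ?_)
        ring
      exact (ENNReal.add_le_add_iff_right hfinX).1 this
    calc X = 2 * (2⁻¹ * X) := by
          rw [← mul_assoc, ENNReal.mul_inv_cancel (by norm_num) (by norm_num), one_mul]
      _ ≤ 2 * (3 * (A + R)) := by gcongr
      _ = _ := by ring
  -- Removing the weight costs e^{2μT}, since t ≤ S ≤ T.
  have hback : ∫⁻ t in Set.Ioo 0 S, d t ^ 2 ≤ ENNReal.ofReal (Real.exp (2 * μ * T)) * X := by
    rw [hX, ← lintegral_const_mul _ (by fun_prop), ← lintegral_indicator measurableSet_Ioo]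
    refine lintegral_mono fun t => ?_
    by_cases ht : t ∈ Set.Ioo 0 S
    · simp only [hD, Set.indicator_of_mem ht, hE, mul_pow]
      rw [← mul_assoc, ← ENNReal.ofReal_pow (Real.exp_pos _).le, ← ENNReal.ofReal_mul (Real.exp_pos _).le]
      refine le_mul_of_one_le_left zero_le ?_
      rw [← ENNReal.ofReal_one]
      refine ENNReal.ofReal_le_ofReal ?_
      rw [← Real.exp_nat_mul, ← Real.exp_add]
      refine Real.one_le_exp ?_
      have : t ≤ T := ht.2.le.trans hS
      push_cast
      nlinarith
    · simp [Set.indicator_of_notMem ht]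
  refine hback.trans ?_
  have e : ((6 * Real.toNNReal (Real.exp (2 * μ * T)) : NNReal) : ENNReal) =
      ENNReal.ofReal (Real.exp (2 * μ * T)) * 6 := by
    rw [ENNReal.coe_mul, mul_comm]; rfl
  rw [e]
  calc _ ≤ ENNReal.ofReal (Real.exp (2 * μ * T)) * (6 * (A + R)) := by gcongr
    _ = _ := by ring

end PointNLS

/-! ### Increments of Volterra potentials -/

namespace PointNLS

theorem intervalIntegrable_volterraKernel_sub {c : ℝ} (hc : 0 ≤ c) :
    IntervalIntegrable (fun s => volterraKernel (c - s)) volume 0 c := by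
  simpa using ((intervalIntegrable_volterraKernel c hc).comp_sub_left c).symm

theorem intervalIntegrable_volterraKernel_sub_mul {b : ℝ → ℂ} {B c : ℝ} (hc : 0 ≤ c)
    (hb : Measurable b) (hB : ∀ s, ‖b s‖ ≤ B) :
    IntervalIntegrable (fun s => (volterraKernel (c - s) : ℂ) * b s) volume 0 c := by
  have h := intervalIntegrable_volterraKernel_sub hc
  rw [intervalIntegrable_iff_integrableOn_Ioc_of_le hc] at h ⊢
  exact Integrable.mul_bdd h.ofReal hb.aestronglyMeasurable (Eventually.of_forall hB)

theorem norm_integral_volterraKernel_sub_mul_le {b : ℝ → ℂ} {B a c : ℝ} (ha : 0 ≤ a) (hac : a ≤ c)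
    (hB : ∀ s, ‖b s‖ ≤ B) :
    ‖∫ s in a..c, (volterraKernel (c - s) : ℂ) * b s‖ ≤ B * volterraPrimitive (c - a) := by
  have hi : IntervalIntegrable (fun s => volterraKernel (c - s)) volume a c :=
    (intervalIntegrable_volterraKernel_sub (ha.trans hac)).mono_set (by
      rw [Set.uIcc_of_le hac, Set.uIcc_of_le (ha.trans hac)]; exact Set.Icc_subset_Icc_left ha)
  have h := intervalIntegral.norm_integral_le_of_norm_le hac
    (f := fun s => (volterraKernel (c - s) : ℂ) * b s)
    (g := fun s => volterraKernel (c - s) * B) (Eventually.of_forall fun s hs => by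
      rw [norm_mul, norm_real]
      have h0 := volterraKernel_nonneg (show 0 ≤ c - s by linarith [hs.2])
      rw [Real.norm_of_nonneg h0]
      gcongr
      exact hB s) (hi.mul_const B)
  refine h.trans (le_of_eq ?_)
  rw [intervalIntegral.integral_mul_const,
    intervalIntegral.integral_comp_sub_left (fun s => volterraKernel s), sub_self,
    integral_volterraKernel' (by linarith), mul_comm]

theorem continuousOn_volterraPrimitive_shift (h t : ℝ) (hh : 0 ≤ h) :
    ContinuousOn (fun s => volterraPrimitive (s + h)) (Set.Icc 0 t) :=
  (continuousOn_volterraPrimitive (t + h)).comp (by fun_prop)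
    fun s hs => ⟨by linarith [hs.1], by linarith [hs.2]⟩

theorem measurable_volterraPrimitive : Measurable volterraPrimitive := by
  have h : Measurable fun p : ℝ × ℝ => p.1 ^ p.2 / Real.Gamma (p.2 + 1) := by
    simp only [div_eq_mul_inv]
    exact (measurable_fst.pow measurable_snd).mul
      (continuous_inv_Gamma.measurable.comp (measurable_snd.add_const 1))
  exact (h.stronglyMeasurable.integral_prod_right' (ν := volume.restrict (Set.Ioi 0))).measurable

theorem integral_volterraPrimitive_increment_le {t h : ℝ} (ht : 0 ≤ t) (hh : 0 ≤ h) :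
    ∫ s in (0 : ℝ)..t, (volterraPrimitive (s + h) - volterraPrimitive s) ≤
      h * volterraPrimitive (t + h) := by
  have hν : ∀ T : ℝ, 0 ≤ T → IntervalIntegrable volterraPrimitive volume 0 T := fun T hT =>
    (by simpa [Set.uIcc_of_le hT] using continuousOn_volterraPrimitive T :
      ContinuousOn volterraPrimitive (Set.uIcc 0 T)).intervalIntegrable
  have hν1 : IntervalIntegrable volterraPrimitive volume h (t + h) :=
    (hν h hh).symm.trans (hν (t + h) (by linarith))
  have hνs : IntervalIntegrable (fun s => volterraPrimitive (s + h)) volume 0 t := by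
    have := hν1.comp_add_right h
    simpa using this
  rw [intervalIntegral.integral_sub hνs (hν t ht),
    intervalIntegral.integral_comp_add_right (fun s => volterraPrimitive s), zero_add]
  have e2 := intervalIntegral.integral_interval_sub_left (hν (t + h) (by linarith)) (hν h hh)
  have e3 := intervalIntegral.integral_interval_sub_left (hν (t + h) (by linarith)) (hν t ht)
  have hpr : ∫ s in t..(t + h), volterraPrimitive s ≤ h * volterraPrimitive (t + h) := by
    have h1 : IntervalIntegrable volterraPrimitive volume t (t + h) :=
      (hν t ht).symm.trans (hν (t + h) (by linarith))
    have := intervalIntegral.integral_mono_on (by linarith) h1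
      (intervalIntegrable_const (c := volterraPrimitive (t + h)))
      (fun s hs => volterraPrimitive_mono (ht.trans hs.1) hs.2)
    simpa using this
  have hp0 : 0 ≤ ∫ s in (0 : ℝ)..h, volterraPrimitive s :=
    intervalIntegral.integral_nonneg hh fun s hs => volterraPrimitive_nonneg hs.1
  linarith

/-- `q = q₀ + volterraKernel * b` on `(0, T]`, with `b` bounded by `B`. -/
structure IsVolterraPotential (q b : ℝ → ℂ) (q₀ : ℂ) (B T : ℝ) : Prop where
  meas : Measurable b
  bound : ∀ s, ‖b s‖ ≤ B
  eq : ∀ t ∈ Set.Ioc 0 T, q t = q₀ + ∫ s in (0 : ℝ)..t, (volterraKernel (t - s) : ℂ) * b s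

namespace IsVolterraPotential

variable {q b : ℝ → ℂ} {q₀ : ℂ} {B T : ℝ}

theorem bound_nonneg (H : IsVolterraPotential q b q₀ B T) : 0 ≤ B :=
  (norm_nonneg _).trans (H.bound 0)

theorem norm_sub_le (H : IsVolterraPotential q b q₀ B T) {t : ℝ} (ht : t ∈ Set.Ioc 0 T) :
    ‖q t - q₀‖ ≤ B * volterraPrimitive t := by
  rw [H.eq t ht, add_sub_cancel_left]
  simpa using norm_integral_volterraKernel_sub_mul_le le_rfl ht.1.le H.bound

/-- The representation holds only for t > 0; since its integral term is O(ν(t)) and tends to 0,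
continuity identifies the value at 0. -/
theorem initial_value (H : IsVolterraPotential q b q₀ B T) (hT : 0 < T) (hq : Continuous q) :
    q 0 = q₀ := by
  have h1 : Tendsto (fun t => q t) (𝓝[>] 0) (𝓝 (q 0)) := (hq.tendsto 0).mono_left nhdsWithin_le_nhds
  have h2 : Tendsto (fun t => B * volterraPrimitive t) (𝓝[>] 0) (𝓝 0) := by
    have hc := (continuousOn_volterraPrimitive 1) 0 ⟨le_rfl, zero_le_one⟩
    have h3 : Tendsto volterraPrimitive (𝓝[>] 0) (𝓝 0) := by
      have : 𝓝[>] (0 : ℝ) ≤ 𝓝[Set.Icc 0 1] 0 := by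
        rw [← nhdsWithin_Ioc_eq_nhdsGT (zero_lt_one' ℝ)]
        exact nhdsWithin_mono _ Set.Ioc_subset_Icc_self
      have h4 := hc.tendsto.mono_left this
      rwa [volterraPrimitive_zero] at h4
    simpa using h3.const_mul B
  have h3 : Tendsto (fun t => q t) (𝓝[>] 0) (𝓝 q₀) := by
    rw [tendsto_iff_norm_sub_tendsto_zero]
    refine squeeze_zero' (Eventually.of_forall fun _ => norm_nonneg _) ?_ h2
    filter_upwards [Ioc_mem_nhdsGT hT] with t ht using H.norm_sub_le ht
  exact tendsto_nhds_unique h1 h3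

/-- Shift the kernel and keep the density: the history over [0, t] is controlled by the L¹ variation
of the kernel, and the new piece over [t, t+h] by B·ν(h). -/
theorem norm_increment_le (H : IsVolterraPotential q b q₀ B T) {t h : ℝ} (ht : 0 < t) (hh : 0 < h)
    (hth : t + h ≤ T) :
    ‖q (t + h) - q t‖ ≤ B * (2 * volterraPrimitive h + 2 * (h * volterraPrimitive (t + h))) := by
  have hB := H.bound_nonneg
  have hi1 := intervalIntegrable_volterraKernel_sub_mul ht.le H.meas H.bound
  have hi2 := intervalIntegrable_volterraKernel_sub_mul (show 0 ≤ t + h by linarith) H.meas H.bound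
  have hi3 := hi2.mono_set (c := 0) (d := t) (by
    rw [Set.uIcc_of_le ht.le, Set.uIcc_of_le (by linarith)]
    exact Set.Icc_subset_Icc_right (by linarith))
  have hi4 := hi2.mono_set (c := t) (d := t + h) (by
    rw [Set.uIcc_of_le (by linarith), Set.uIcc_of_le (by linarith)]
    exact Set.Icc_subset_Icc_left ht.le)
  rw [H.eq t ⟨ht, by linarith⟩, H.eq (t + h) ⟨by linarith, hth⟩, add_sub_add_left_eq_sub,
    ← intervalIntegral.integral_add_adjacent_intervals hi3 hi4, add_sub_right_comm,
    ← intervalIntegral.integral_sub hi3 hi1]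
  obtain ⟨hs1, hs2⟩ := integral_abs_volterraKernel_sub_le ht.le hh
  have b2 := norm_integral_volterraKernel_sub_mul_le (B := B) (b := b) ht.le
    (show t ≤ t + h by linarith) H.bound
  rw [add_sub_cancel_left] at b2
  have hi5 : IntervalIntegrable (fun s => |volterraKernel (t - s + h) - volterraKernel (t - s)|)
      volume 0 t := by
    have := ((hs1.sub (intervalIntegrable_volterraKernel t ht.le)).abs.comp_sub_left t).symm
    simpa using this
  have b1 : ‖∫ s in (0 : ℝ)..t, ((volterraKernel (t + h - s) : ℂ) * b s -
      (volterraKernel (t - s) : ℂ) * b s)‖ ≤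
      (volterraPrimitive h + 2 * (h * volterraPrimitive (t + h))) * B := by
    have := intervalIntegral.norm_integral_le_of_norm_le ht.le
      (f := fun s => (volterraKernel (t + h - s) : ℂ) * b s - (volterraKernel (t - s) : ℂ) * b s)
      (g := fun s => |volterraKernel (t - s + h) - volterraKernel (t - s)| * B)
      (Eventually.of_forall fun s hs => by
        rw [← sub_mul, ← ofReal_sub, norm_mul, norm_real, Real.norm_eq_abs,
          show t + h - s = t - s + h by ring]
        gcongr
        exact H.bound s) (hi5.mul_const B)
    refine this.trans ?_
    rw [intervalIntegral.integral_mul_const, intervalIntegral.integral_comp_sub_left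
      (fun s => |volterraKernel (s + h) - volterraKernel s|), sub_self, sub_zero]
    gcongr
  refine (norm_add_le _ _).trans ((add_le_add b1 b2).trans (le_of_eq ?_))
  ring

/-- Shift the density and keep the kernel: the increment of the potential becomes the potential of
the increment of the density, plus the contribution of [0, h]. This is the form required by the
Gronwall inequality. -/
theorem enorm_increment_le (H : IsVolterraPotential q b q₀ B T) {t h : ℝ} (ht : 0 < t) (hh : 0 < h)
    (hth : t + h ≤ T) :
    ENNReal.ofReal ‖q (t + h) - q t‖ ≤ (∫⁻ s in Set.Ioo 0 t,
        ENNReal.ofReal (volterraKernel (t - s)) * ENNReal.ofReal ‖b (s + h) - b s‖) +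
      ENNReal.ofReal (B * (volterraPrimitive (t + h) - volterraPrimitive t)) := by
  have hB := H.bound_nonneg
  have hi1 := intervalIntegrable_volterraKernel_sub_mul ht.le H.meas H.bound
  have hi2 := intervalIntegrable_volterraKernel_sub_mul (show 0 ≤ t + h by linarith) H.meas H.bound
  have hi3 := hi2.mono_set (c := 0) (d := h) (by
    rw [Set.uIcc_of_le hh.le, Set.uIcc_of_le (by linarith)]
    exact Set.Icc_subset_Icc_right (by linarith))
  have hi4 := hi2.mono_set (c := h) (d := t + h) (by
    rw [Set.uIcc_of_le (by linarith), Set.uIcc_of_le (by linarith)]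
    exact Set.Icc_subset_Icc_left hh.le)
  have hi5 : IntervalIntegrable (fun s => (volterraKernel (t - s) : ℂ) * b (s + h)) volume 0 t :=
    intervalIntegrable_volterraKernel_sub_mul ht.le (H.meas.comp (measurable_add_const h)) (fun s => H.bound (s + h))
  have e : ∫ s in h..(t + h), (volterraKernel (t + h - s) : ℂ) * b s =
      ∫ s in (0 : ℝ)..t, (volterraKernel (t - s) : ℂ) * b (s + h) := by
    have := intervalIntegral.integral_comp_add_right (a := 0) (b := t)
      (fun s => (volterraKernel (t + h - s) : ℂ) * b s) h
    rw [zero_add] at this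
    rw [← this]
    refine intervalIntegral.integral_congr fun s _ => ?_
    congr 3
    ring
  have hq : q (t + h) - q t = (∫ s in (0 : ℝ)..t, (volterraKernel (t - s) : ℂ) * (b (s + h) - b s)) +
      ∫ s in (0 : ℝ)..h, (volterraKernel (t + h - s) : ℂ) * b s := by
    rw [H.eq t ⟨ht, by linarith⟩, H.eq (t + h) ⟨by linarith, hth⟩, add_sub_add_left_eq_sub,
      ← intervalIntegral.integral_add_adjacent_intervals hi3 hi4, e, add_sub_assoc,
      ← intervalIntegral.integral_sub hi5 hi1, add_comm]
    congr 1
    refine intervalIntegral.integral_congr fun s _ => ?_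
    ring
  have b2 : ‖∫ s in (0 : ℝ)..h, (volterraKernel (t + h - s) : ℂ) * b s‖ ≤
      B * (volterraPrimitive (t + h) - volterraPrimitive t) := by
    have hi6 : IntervalIntegrable (fun s => volterraKernel (t + h - s)) volume 0 h :=
      (intervalIntegrable_volterraKernel_sub (show 0 ≤ t + h by linarith)).mono_set (by
        rw [Set.uIcc_of_le hh.le, Set.uIcc_of_le (by linarith)]
        exact Set.Icc_subset_Icc_right (by linarith))
    have := intervalIntegral.norm_integral_le_of_norm_le hh.le
      (f := fun s => (volterraKernel (t + h - s) : ℂ) * b s)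
      (g := fun s => volterraKernel (t + h - s) * B) (Eventually.of_forall fun s hs => by
        rw [norm_mul, norm_real]
        have h0 := volterraKernel_nonneg (show 0 ≤ t + h - s by linarith [hs.2])
        rw [Real.norm_of_nonneg h0]
        gcongr
        exact H.bound s) (hi6.mul_const B)
    refine this.trans (le_of_eq ?_)
    rw [intervalIntegral.integral_mul_const,
      intervalIntegral.integral_comp_sub_left (fun s => volterraKernel s), sub_zero,
      add_sub_cancel_right]
    have e2 := intervalIntegral.integral_interval_sub_left
      (intervalIntegrable_volterraKernel (t + h) (by linarith))
      (intervalIntegrable_volterraKernel t ht.le)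
    rw [← e2, integral_volterraKernel' (by linarith), integral_volterraKernel' ht.le, mul_comm]
  rw [hq]
  refine (ENNReal.ofReal_le_ofReal (norm_add_le _ _)).trans ?_
  rw [ENNReal.ofReal_add (norm_nonneg _) (norm_nonneg _)]
  refine add_le_add ?_ (ENNReal.ofReal_le_ofReal b2)
  rw [intervalIntegral.integral_of_le ht.le, integral_Ioc_eq_integral_Ioo, ofReal_norm]
  refine (enorm_integral_le_lintegral_enorm _).trans (le_of_eq ?_)
  refine setLIntegral_congr_fun measurableSet_Ioo fun s hs => ?_
  have h0 := volterraKernel_nonneg (show 0 ≤ t - s by linarith [hs.2])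
  rw [enorm_mul, ofReal_norm, ← ofReal_norm (volterraKernel (t - s) : ℂ), norm_real,
    Real.norm_of_nonneg h0]

end IsVolterraPotential

/-- Write Δν for the increment of `volterraPrimitive`. Then ∫(Δν)² is at most (sup Δν)·∫Δν; the
supremum tends to 0 by uniform continuity and the integral is at most h·ν(T) by monotonicity. -/
theorem tendsto_lintegral_sq_volterraPrimitive_increment (B T : ℝ) (hT : 0 < T) (hB : 0 ≤ B) :
    Tendsto (fun h : ℝ => ENNReal.ofReal h⁻¹ * ∫⁻ t in Set.Ioo 0 (T - h),
      ENNReal.ofReal (B * (volterraPrimitive (t + h) - volterraPrimitive t)) ^ 2) (𝓝[>] 0)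
      (𝓝 0) := by
  have huc : UniformContinuousOn volterraPrimitive (Set.Icc 0 T) :=
    isCompact_Icc.uniformContinuousOn_of_continuous (continuousOn_volterraPrimitive T)
  have hν0 := volterraPrimitive_nonneg hT.le
  have key : ∀ η > (0 : ℝ), ∀ᶠ h in 𝓝[>] (0 : ℝ), ENNReal.ofReal h⁻¹ * ∫⁻ t in Set.Ioo 0 (T - h),
      ENNReal.ofReal (B * (volterraPrimitive (t + h) - volterraPrimitive t)) ^ 2 ≤
      ENNReal.ofReal (B ^ 2 * volterraPrimitive T * η) := by
    intro η hη
    obtain ⟨δ, hδ, hδ'⟩ := Metric.uniformContinuousOn_iff.1 huc η hη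
    filter_upwards [Ioo_mem_nhdsGT (lt_min hδ hT)] with h hh
    have hh0 := hh.1
    have hhδ : h < δ := hh.2.trans_le (min_le_left _ _)
    have hhT : h < T := hh.2.trans_le (min_le_right _ _)
    have hb : ∀ t ∈ Set.Ioo 0 (T - h),
        ENNReal.ofReal (B * (volterraPrimitive (t + h) - volterraPrimitive t)) ^ 2 ≤
        ENNReal.ofReal (B ^ 2 * η * (volterraPrimitive (t + h) - volterraPrimitive t)) := by
      intro t ht
      have h1 := volterraPrimitive_mono ht.1.le (show t ≤ t + h by linarith)
      have h2 := hδ' (t + h) ⟨by linarith [ht.1], by linarith [ht.2]⟩ t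
        ⟨ht.1.le, by linarith [ht.2]⟩ (by rw [Real.dist_eq]; simpa [abs_of_pos hh0] using hhδ)
      rw [Real.dist_eq, abs_of_nonneg (by linarith)] at h2
      rw [← ENNReal.ofReal_pow (mul_nonneg hB (by linarith))]
      refine ENNReal.ofReal_le_ofReal ?_
      rw [mul_pow, mul_assoc]
      gcongr
      rw [sq]
      gcongr
    have hint : IntegrableOn (fun t => B ^ 2 * η * (volterraPrimitive (t + h) - volterraPrimitive t))
        (Set.Ioo 0 (T - h)) := by
      refine Integrable.const_mul ?_ _
      refine (ContinuousOn.integrableOn_Icc ?_).mono_set Set.Ioo_subset_Icc_self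
      exact (continuousOn_volterraPrimitive_shift h (T - h) hh0.le).sub
        (continuousOn_volterraPrimitive (T - h))
    calc ENNReal.ofReal h⁻¹ * ∫⁻ t in Set.Ioo 0 (T - h),
        ENNReal.ofReal (B * (volterraPrimitive (t + h) - volterraPrimitive t)) ^ 2
        ≤ ENNReal.ofReal h⁻¹ * ∫⁻ t in Set.Ioo 0 (T - h),
          ENNReal.ofReal (B ^ 2 * η * (volterraPrimitive (t + h) - volterraPrimitive t)) := by
          exact mul_le_mul_right (setLIntegral_mono' measurableSet_Ioo hb) _
      _ = ENNReal.ofReal (h⁻¹ * (B ^ 2 * η *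
            ∫ t in (0 : ℝ)..(T - h), (volterraPrimitive (t + h) - volterraPrimitive t))) := by
          rw [← ofReal_integral_eq_lintegral_ofReal hint, ← ENNReal.ofReal_mul (by positivity),
            integral_const_mul, intervalIntegral.integral_of_le (by linarith),
            integral_Ioc_eq_integral_Ioo]
          filter_upwards [ae_restrict_mem measurableSet_Ioo] with t ht
          have h1 := volterraPrimitive_mono ht.1.le (show t ≤ t + h by linarith)
          have : 0 ≤ volterraPrimitive (t + h) - volterraPrimitive t := by linarith
          simp only [Pi.zero_apply]
          positivity
      _ ≤ _ := by
          refine ENNReal.ofReal_le_ofReal ?_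
          have h3 := integral_volterraPrimitive_increment_le (show 0 ≤ T - h by linarith) hh0.le
          rw [sub_add_cancel] at h3
          calc h⁻¹ * (B ^ 2 * η *
            ∫ t in (0 : ℝ)..(T - h), (volterraPrimitive (t + h) - volterraPrimitive t))
              ≤ h⁻¹ * (B ^ 2 * η * (h * volterraPrimitive T)) := by gcongr
            _ = _ := by field_simp
  rw [ENNReal.tendsto_nhds_zero]
  intro ε hε
  obtain ⟨η, hη, hηε⟩ : ∃ η > (0 : ℝ), ENNReal.ofReal (B ^ 2 * volterraPrimitive T * η) ≤ ε := by
    have ht : Tendsto (fun η : ℝ => ENNReal.ofReal (B ^ 2 * volterraPrimitive T * η)) (𝓝[>] 0)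
        (𝓝 0) := by
      have : Continuous fun η : ℝ => ENNReal.ofReal (B ^ 2 * volterraPrimitive T * η) :=
        ENNReal.continuous_ofReal.comp (by fun_prop)
      have := (this.tendsto 0).mono_left (nhdsWithin_le_nhds (s := Set.Ioi 0))
      simpa using this
    obtain ⟨η, h1, h2⟩ := ((ht.eventually_le_const hε).and self_mem_nhdsWithin).exists
    exact ⟨η, h2, h1⟩
  filter_upwards [key η hη] with h hh using hh.trans hηε

/-- Volterra potentials whose density is controlled, up to Lipschitz functions of the potential,
have increments that are `o(√h)` in quadratic mean. -/
theorem IsVolterraPotential.tendsto_increment {q b : ℝ → ℂ} {q₀ : ℂ} {B T : ℝ}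
    (H : IsVolterraPotential q b q₀ B T) (hq : Continuous q) (hT : 0 < T) (L : NNReal)
    {g : ℝ → ℝ → ENNReal} (hg : ∀ h, Measurable (g h))
    (hgb : ∀ h s, 0 < h → 0 < s → s + h ≤ T →
      ENNReal.ofReal ‖b (s + h) - b s‖ ≤ g h s + L * ENNReal.ofReal ‖q (s + h) - q s‖)
    (hg0 : Tendsto (fun h : ℝ => ENNReal.ofReal h⁻¹ * ∫⁻ s in Set.Ioo 0 (T - h), g h s ^ 2)
      (𝓝[>] 0) (𝓝 0)) :
    Tendsto (fun h : ℝ => h⁻¹ * ∫ s in (0 : ℝ)..(T - h), ‖q (s + h) - q s‖ ^ 2)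
      (𝓝[>] 0) (𝓝 0) := by
  obtain ⟨C, hC⟩ := exists_volterra_stability T hT.le L
  have hν := tendsto_lintegral_sq_volterraPrimitive_increment B T hT H.bound_nonneg
  have hlim := ENNReal.Tendsto.const_mul (a := (C : ENNReal)) (hg0.add hν) (Or.inr (by simp))
  rw [add_zero, mul_zero] at hlim
  have hlim2 := (ENNReal.tendsto_toReal ENNReal.zero_ne_top).comp hlim
  have hne := hlim.eventually_lt_const ENNReal.zero_lt_top
  rw [ENNReal.toReal_zero] at hlim2
  refine squeeze_zero' ?_ ?_ hlim2
  · filter_upwards [Ioo_mem_nhdsGT hT] with h hh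
    have := hh.1
    have : 0 ≤ ∫ s in (0 : ℝ)..(T - h), ‖q (s + h) - q s‖ ^ 2 :=
      intervalIntegral.integral_nonneg (by linarith [hh.2]) fun _ _ => by positivity
    positivity
  · filter_upwards [Ioo_mem_nhdsGT hT, hne] with h hh hfin
    have hh0 := hh.1
    have hci : Continuous fun s => ‖q (s + h) - q s‖ ^ 2 := by fun_prop
    have hii : IntegrableOn (fun s => ‖q (s + h) - q s‖ ^ 2) (Set.Ioo 0 (T - h)) :=
      hci.integrableOn_Icc.mono_set Set.Ioo_subset_Icc_self
    have e : ENNReal.ofReal (∫ s in (0 : ℝ)..(T - h), ‖q (s + h) - q s‖ ^ 2) =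
        ∫⁻ s in Set.Ioo 0 (T - h), ENNReal.ofReal ‖q (s + h) - q s‖ ^ 2 := by
      rw [intervalIntegral.integral_of_le (by linarith [hh.2]), integral_Ioc_eq_integral_Ioo,
        ofReal_integral_eq_lintegral_ofReal hii (Eventually.of_forall fun _ => by positivity)]
      refine lintegral_congr fun s => ?_
      rw [ENNReal.ofReal_pow (norm_nonneg _)]
    -- Stability on (0, T - h): the unknown is the increment of q, the source is the part of the
    -- density increment not controlled by q, and the last term is the contribution of the density
    -- on [0, h].
    have hmain := hC (T - h) (by linarith) (fun s => ENNReal.ofReal ‖q (s + h) - q s‖) (g h)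
      (fun t => ENNReal.ofReal (B * (volterraPrimitive (t + h) - volterraPrimitive t)))
      (by fun_prop) (hg h) (by
        have := measurable_volterraPrimitive
        fun_prop) (fun t ht => by
          refine (H.enorm_increment_le ht.1 hh0 (by linarith [ht.2])).trans ?_
          gcongr ?_ + _
          refine setLIntegral_mono' measurableSet_Ioo fun s hs => ?_
          gcongr
          exact hgb h s hh0 hs.1 (by linarith [hs.2, ht.2])) (by
        rw [← e]; exact ENNReal.ofReal_ne_top)
    rw [← e] at hmain
    have h2 : ENNReal.ofReal (h⁻¹ * ∫ s in (0 : ℝ)..(T - h), ‖q (s + h) - q s‖ ^ 2) ≤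
        C * (ENNReal.ofReal h⁻¹ * (∫⁻ s in Set.Ioo 0 (T - h), g h s ^ 2) +
          ENNReal.ofReal h⁻¹ * ∫⁻ t in Set.Ioo 0 (T - h),
            ENNReal.ofReal (B * (volterraPrimitive (t + h) - volterraPrimitive t)) ^ 2) := by
      rw [ENNReal.ofReal_mul (by positivity)]
      calc _ ≤ ENNReal.ofReal h⁻¹ * (C * ((∫⁻ s in Set.Ioo 0 (T - h), g h s ^ 2) +
          ∫⁻ t in Set.Ioo 0 (T - h),
            ENNReal.ofReal (B * (volterraPrimitive (t + h) - volterraPrimitive t)) ^ 2)) := by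
            gcongr
        _ = _ := by ring
    exact (ENNReal.ofReal_le_iff_le_toReal hfin.ne).1 h2

end PointNLS

/-! ### Inversion of the Volterra kernel -/

namespace PointNLS

/-- The Sonine partner of the Volterra kernel. -/
def sonineKernel (t : ℝ) : ℝ := -Real.eulerMascheroniConstant - Real.log t

theorem measurable_sonineKernel : Measurable sonineKernel := by unfold sonineKernel; fun_prop

theorem intervalIntegrable_sonineKernel (a b : ℝ) :
    IntervalIntegrable sonineKernel volume a b :=
  intervalIntegrable_const.sub intervalIntegral.intervalIntegrable_log'

/-- `volterraKernel`, cut off at negative times. -/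
def causalVolterraKernel : ℝ → ℝ := (Set.Ioi 0).indicator volterraKernel

theorem measurable_causalVolterraKernel : Measurable causalVolterraKernel :=
  measurable_volterraKernel.indicator measurableSet_Ioi

theorem causalVolterraKernel_nonneg (t : ℝ) : 0 ≤ causalVolterraKernel t :=
  Set.indicator_nonneg (fun _ hs => volterraKernel_nonneg (le_of_lt hs)) t

/-- Sonine's relation on (r, t). The causal cut-off fixes the domain of integration at (0, t), so
that Fubini takes place on a square instead of a triangle. -/
theorem setIntegral_sonineKernel_mul_causal {r t : ℝ} (hr : r ∈ Set.Ioo 0 t) :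
    ∫ s in Set.Ioo 0 t, sonineKernel (t - s) * causalVolterraKernel (s - r) = 1 := by
  have ht : 0 < t := hr.1.trans hr.2
  rw [← integral_Ioc_eq_integral_Ioo, ← intervalIntegral.integral_of_le ht.le]
  have e1 := intervalIntegral.integral_comp_sub_left (a := 0) (b := t)
    (fun u => sonineKernel u * causalVolterraKernel (t - u - r)) t
  simp only [sub_sub_cancel, sub_self, sub_zero] at e1
  rw [e1, intervalIntegral.integral_of_le ht.le, integral_Ioc_eq_integral_Ioo,
    ← integral_volterraKernel_sub_mul_log (sub_pos.2 hr.2), ← integral_indicator measurableSet_Ioo,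
    ← integral_indicator measurableSet_Ioo]
  refine integral_congr_ae (Eventually.of_forall fun u => ?_)
  by_cases hu : u ∈ Set.Ioo 0 (t - r)
  · have hu2 : u ∈ Set.Ioo 0 t := ⟨hu.1, by linarith [hu.2, hr.1]⟩
    have hu3 : t - u - r ∈ Set.Ioi (0 : ℝ) := by
      simp only [Set.mem_Ioi]; linarith [hu.2]
    simp only [Set.indicator_of_mem hu, Set.indicator_of_mem hu2, causalVolterraKernel,
      Set.indicator_of_mem hu3, sonineKernel]
    rw [mul_comm, show t - u - r = t - r - u by ring]
  · rw [Set.indicator_of_notMem hu]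
    by_cases hu2 : u ∈ Set.Ioo 0 t
    · have hu3 : t - u - r ∉ Set.Ioi (0 : ℝ) := by
        simp only [Set.mem_Ioi]; intro h; exact hu ⟨hu2.1, by linarith⟩
      simp only [Set.indicator_of_mem hu2, causalVolterraKernel, Set.indicator_of_notMem hu3,
        mul_zero]
    · rw [Set.indicator_of_notMem hu2]

theorem setIntegral_causalVolterraKernel_mul (b : ℝ → ℂ) {s t : ℝ} (hs : s ∈ Set.Ioo 0 t) :
    ∫ r in Set.Ioo 0 t, (causalVolterraKernel (s - r) : ℂ) * b r =
      ∫ r in (0 : ℝ)..s, (volterraKernel (s - r) : ℂ) * b r := by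
  rw [intervalIntegral.integral_of_le hs.1.le, integral_Ioc_eq_integral_Ioo,
    ← integral_indicator measurableSet_Ioo, ← integral_indicator measurableSet_Ioo]
  refine integral_congr_ae (Eventually.of_forall fun r => ?_)
  by_cases hr : r ∈ Set.Ioo 0 s
  · have hr2 : r ∈ Set.Ioo 0 t := ⟨hr.1, hr.2.trans hs.2⟩
    have hr3 : s - r ∈ Set.Ioi (0 : ℝ) := by simp only [Set.mem_Ioi]; linarith [hr.2]
    simp only [Set.indicator_of_mem hr, Set.indicator_of_mem hr2, causalVolterraKernel,
      Set.indicator_of_mem hr3]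
  · rw [Set.indicator_of_notMem hr]
    by_cases hr2 : r ∈ Set.Ioo 0 t
    · have hr3 : s - r ∉ Set.Ioi (0 : ℝ) := by
        simp only [Set.mem_Ioi]; intro h; exact hr ⟨hr2.1, by linarith⟩
      simp only [Set.indicator_of_mem hr2, causalVolterraKernel, Set.indicator_of_notMem hr3,
        ofReal_zero, zero_mul]
    · rw [Set.indicator_of_notMem hr2]

theorem integrableOn_causalVolterraKernel_sub (s t : ℝ) :
    IntegrableOn (fun r => causalVolterraKernel (s - r)) (Set.Ioo 0 t) := by
  have h : LocallyIntegrable causalVolterraKernel := by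
    refine locallyIntegrable_iff.2 fun K hK => ?_
    obtain ⟨M, hM⟩ := hK.isBounded.subset_closedBall 0
    have hM' : K ⊆ Set.Icc (-|M|) |M| := hM.trans (by
      rw [Real.closedBall_eq_Icc, zero_sub, zero_add]
      exact Set.Icc_subset_Icc (neg_le_neg (le_abs_self M)) (le_abs_self M))
    refine IntegrableOn.mono_set ?_ hM'
    rw [causalVolterraKernel, IntegrableOn, integrable_indicator_iff measurableSet_Ioi,
      IntegrableOn, Measure.restrict_restrict measurableSet_Ioi]
    have := (intervalIntegrable_volterraKernel |M| (abs_nonneg M)).1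
    exact this.mono_set fun x hx => ⟨hx.1, hx.2.2⟩
  have h2 : IntervalIntegrable causalVolterraKernel volume (s - 0) (s - t) :=
    intervalIntegrable_iff.2 ((h.integrableOn_isCompact isCompact_uIcc).mono_set
      Set.uIoc_subset_uIcc)
  have h3 := (h2.comp_sub_left s)
  simp only [sub_sub_cancel] at h3
  exact (intervalIntegrable_iff.1 h3).mono_set (Set.Ioo_subset_Ioc_self.trans Set.Ioc_subset_uIoc)

/-- Convolving q₀ + (Volterra kernel) * b with the Sonine partner collapses the two kernels to 1, by
associativity of convolution, that is, Fubini. -/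
theorem IsVolterraPotential.integral_sonineKernel_mul {q b : ℝ → ℂ} {q₀ : ℂ} {B T : ℝ}
    (H : IsVolterraPotential q b q₀ B T) {t : ℝ} (ht : t ∈ Set.Ioc 0 T) :
    ∫ s in (0 : ℝ)..t, (sonineKernel (t - s) : ℂ) * q s =
      q₀ * (∫ s in (0 : ℝ)..t, (sonineKernel s : ℂ)) + ∫ s in (0 : ℝ)..t, b s := by
  have ht0 := ht.1
  have hB := H.bound_nonneg
  have hJ : IntegrableOn (fun s => sonineKernel (t - s)) (Set.Ioo 0 t) := by
    have := ((intervalIntegrable_sonineKernel 0 t).comp_sub_left t).symm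
    simp only [sub_zero, sub_self] at this
    rwa [intervalIntegrable_iff_integrableOn_Ioo_of_le ht0.le] at this
  have hJm : Measurable fun s => sonineKernel (t - s) :=
    measurable_sonineKernel.comp (measurable_const.sub measurable_id)
  set F : ℝ × ℝ → ℂ := fun p =>
    (sonineKernel (t - p.1) : ℂ) * ((causalVolterraKernel (p.1 - p.2) : ℂ) * b p.2) with hF
  have hFm : Measurable F := by
    have := H.meas
    have := measurable_causalVolterraKernel
    have := measurable_sonineKernel
    fun_prop
  have hinner : ∀ s, IntegrableOn (fun r => (causalVolterraKernel (s - r) : ℂ) * b r)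
      (Set.Ioo 0 t) := fun s =>
    Integrable.mul_bdd (integrableOn_causalVolterraKernel_sub s t).ofReal
      H.meas.aestronglyMeasurable (Eventually.of_forall H.bound)
  -- The inner integral of the norm is at most B·ν(t) times the Sonine kernel, which is integrable.
  have hFint : Integrable F ((volume.restrict (Set.Ioo 0 t)).prod (volume.restrict (Set.Ioo 0 t))) := by
    rw [integrable_prod_iff hFm.aestronglyMeasurable]
    refine ⟨Eventually.of_forall fun s => (hinner s).const_mul (sonineKernel (t - s) : ℂ), ?_⟩
    refine Integrable.mono' (hJ.norm.mul_const (B * volterraPrimitive t))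
      (hFm.norm.stronglyMeasurable.integral_prod_right'.aestronglyMeasurable) ?_
    filter_upwards [ae_restrict_mem measurableSet_Ioo] with s hs
    rw [Real.norm_of_nonneg (integral_nonneg fun r => norm_nonneg _)]
    simp only [hF, norm_mul, norm_real]
    rw [integral_const_mul]
    gcongr
    calc ∫ r in Set.Ioo 0 t, ‖causalVolterraKernel (s - r)‖ * ‖b r‖
        ≤ ∫ r in Set.Ioo 0 t, causalVolterraKernel (s - r) * B := by
          refine setIntegral_mono_on ?_ ((integrableOn_causalVolterraKernel_sub s t).mul_const B)
            measurableSet_Ioo fun r _ => ?_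
          · have h := (hinner s).norm
            simp only [norm_mul, norm_real] at h
            exact h
          · rw [Real.norm_of_nonneg (causalVolterraKernel_nonneg _)]
            gcongr
            · exact causalVolterraKernel_nonneg _
            · exact H.bound r
      _ = B * volterraPrimitive s := by
          rw [integral_mul_const]
          have h1 := setIntegral_causalVolterraKernel_mul (fun _ => 1) hs
          simp only [mul_one] at h1
          rw [intervalIntegral.integral_ofReal, integral_complex_ofReal] at h1
          have h2 := ofReal_injective h1
          rw [h2, intervalIntegral.integral_comp_sub_left (fun s => volterraKernel s), sub_self,
            sub_zero, integral_volterraKernel' hs.1.le, mul_comm]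
      _ ≤ _ := by
          gcongr
          exact volterraPrimitive_mono hs.1.le hs.2.le
  have hq : ∀ s ∈ Set.Ioo 0 t, (sonineKernel (t - s) : ℂ) * q s =
      (sonineKernel (t - s) : ℂ) * q₀ + ∫ r in Set.Ioo 0 t, F (s, r) := by
    intro s hs
    rw [H.eq s ⟨hs.1, by linarith [hs.2, ht.2]⟩, mul_add]
    congr 1
    simp only [hF]
    rw [integral_const_mul, setIntegral_causalVolterraKernel_mul b hs]
  rw [intervalIntegral.integral_of_le ht0.le, integral_Ioc_eq_integral_Ioo,
    setIntegral_congr_fun measurableSet_Ioo hq,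
    integral_add (f := fun s => (sonineKernel (t - s) : ℂ) * q₀)
      (g := fun s => ∫ r in Set.Ioo 0 t, F (s, r)) (hJ.ofReal.mul_const q₀)
      hFint.integral_prod_left, integral_mul_const]
  congr 1
  · rw [mul_comm, ← integral_Ioc_eq_integral_Ioo, ← intervalIntegral.integral_of_le ht0.le,
      intervalIntegral.integral_comp_sub_left (fun s => (sonineKernel s : ℂ)), sub_self, sub_zero]
  · rw [integral_integral_swap (f := fun s r => F (s, r)) hFint,
      intervalIntegral.integral_of_le ht0.le, integral_Ioc_eq_integral_Ioo]
    refine setIntegral_congr_fun measurableSet_Ioo fun r hr => ?_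
    simp only [hF]
    have h1 := setIntegral_sonineKernel_mul_causal hr
    simp_rw [← mul_assoc]
    rw [integral_mul_const]
    have h2 : ∫ s in Set.Ioo 0 t, (sonineKernel (t - s) : ℂ) * (causalVolterraKernel (s - r) : ℂ) =
        ((∫ s in Set.Ioo 0 t, sonineKernel (t - s) * causalVolterraKernel (s - r) : ℝ) : ℂ) := by
      rw [← integral_complex_ofReal]
      push_cast
      rfl
    rw [h2, h1, ofReal_one, one_mul]

end PointNLS

/-! ### The potential of the charge and traces of free waves -/

namespace PointNLS

theorem abs_rpow_sub_rpow_le {p R a b : ℝ} (hp : 1 ≤ p) (ha : a ∈ Set.Icc 0 R)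
    (hb : b ∈ Set.Icc 0 R) : |a ^ p - b ^ p| ≤ p * R ^ (p - 1) * |a - b| := by
  refine (convex_Icc (0 : ℝ) R).norm_image_sub_le_of_norm_hasDerivWithin_le
    (f := fun x => x ^ p) (f' := fun x => p * x ^ (p - 1))
    (fun x _ => (Real.hasDerivAt_rpow_const (Or.inr hp)).hasDerivWithinAt) (fun x hx => ?_) hb ha
  have h0 := Real.rpow_nonneg hx.1 (p - 1)
  rw [Real.norm_of_nonneg (by positivity)]
  gcongr
  · exact hx.1
  · exact hx.2

/-- The derivative of the potential energy of the charge. -/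
def chargeForce (β₀ σ : ℝ) (z : ℂ) : ℂ :=
  ((Real.eulerMascheroniConstant - 2 * Real.log 2 + 4 * Real.pi * β₀ * ‖z‖ ^ (2 * σ) : ℝ) : ℂ) * z

/-- The potential energy of the charge, times `-4π`. -/
def chargePotential (β₀ σ : ℝ) (z : ℂ) : ℝ :=
  (Real.eulerMascheroniConstant - 2 * Real.log 2) * ‖z‖ ^ 2 +
    4 * Real.pi * β₀ / (σ + 1) * ‖z‖ ^ (2 * σ + 2)

theorem continuous_chargeForce {β₀ σ : ℝ} (hσ : 0 ≤ σ) : Continuous (chargeForce β₀ σ) := by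
  unfold chargeForce
  have : Continuous fun z : ℂ => ‖z‖ ^ (2 * σ) :=
    continuous_norm.rpow_const fun _ => Or.inr (by positivity)
  fun_prop

theorem continuous_chargePotential {β₀ σ : ℝ} (hσ : 0 ≤ σ) :
    Continuous (chargePotential β₀ σ) := by
  unfold chargePotential
  have : Continuous fun z : ℂ => ‖z‖ ^ (2 * σ + 2) :=
    continuous_norm.rpow_const fun _ => Or.inr (by positivity)
  fun_prop

/-- The modulus and the argument are varied separately. The exponent 2σ ≥ 1 makes r ↦ r^{2σ}
Lipschitz on bounded intervals. -/
theorem exists_lipschitz_chargeForce (β₀ : ℝ) {σ : ℝ} (hσ : 1 / 2 ≤ σ) (R : ℝ) :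
    ∃ L : NNReal, ∀ z w : ℂ, ‖z‖ ≤ R → ‖w‖ ≤ R →
      ‖chargeForce β₀ σ z - chargeForce β₀ σ w‖ ≤ L * ‖z - w‖ := by
  set c := Real.eulerMascheroniConstant - 2 * Real.log 2
  set d := 4 * Real.pi * β₀
  refine ⟨(|c| + |d| * |R| ^ (2 * σ) + |d| * (2 * σ * |R| ^ (2 * σ - 1)) * |R|).toNNReal,
    fun z w hz hw => ?_⟩
  have hz' := hz.trans (le_abs_self R)
  have hw' := hw.trans (le_abs_self R)
  rw [Real.coe_toNNReal _ (by positivity)]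
  have e : chargeForce β₀ σ z - chargeForce β₀ σ w =
      (c : ℂ) * (z - w) + (d : ℂ) * (‖z‖ ^ (2 * σ) : ℝ) * (z - w) +
        (d : ℂ) * (‖z‖ ^ (2 * σ) - ‖w‖ ^ (2 * σ) : ℝ) * w := by
    simp only [chargeForce, c, d]
    push_cast
    ring
  rw [e, add_mul, add_mul]
  refine norm_add₃_le.trans (add_le_add (add_le_add ?_ ?_) ?_)
  · rw [norm_mul, norm_real, Real.norm_eq_abs]
  · rw [norm_mul, norm_mul, norm_real, norm_real, Real.norm_eq_abs,
      Real.norm_of_nonneg (Real.rpow_nonneg (norm_nonneg z) _)]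
    gcongr
  · rw [norm_mul, norm_mul, norm_real, norm_real, Real.norm_eq_abs, Real.norm_eq_abs]
    have h1 := abs_rpow_sub_rpow_le (p := 2 * σ) (by linarith) ⟨norm_nonneg z, hz'⟩
      ⟨norm_nonneg w, hw'⟩
    calc |d| * |‖z‖ ^ (2 * σ) - ‖w‖ ^ (2 * σ)| * ‖w‖
        ≤ |d| * (2 * σ * |R| ^ (2 * σ - 1) * ‖z - w‖) * |R| := by
          gcongr
          refine h1.trans ?_
          gcongr
          exact abs_norm_sub_norm_le z w
      _ = _ := by ring

/-- Twice the force is the gradient of the potential for the real inner product on ℂ. The constant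
1/(σ+1) in the potential cancels against the exponent 2σ + 2. -/
theorem hasDerivAt_chargePotential_line (β₀ : ℝ) {σ : ℝ} (hσ : 1 / 2 ≤ σ) (a v : ℂ) (θ : ℝ) :
    HasDerivAt (fun θ : ℝ => chargePotential β₀ σ (a + θ * v))
      (2 * ⟪chargeForce β₀ σ (a + θ * v), v⟫) θ := by
  have hz : HasDerivAt (fun θ : ℝ => a + θ * v) v θ := by
    simpa using ((hasDerivAt_id θ).ofReal_comp.mul_const v).const_add a
  have h1 := hz.norm_sq
  have h2 := (hasFDerivAt_norm_rpow (a + θ * v) (p := 2 * σ + 2) (by linarith)).comp_hasDerivAt θ hz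
  have h3 := (h1.const_mul (Real.eulerMascheroniConstant - 2 * Real.log 2)).add
    (h2.const_mul (4 * Real.pi * β₀ / (σ + 1)))
  refine h3.congr_deriv ?_
  have hσ1 : σ + 1 ≠ 0 := by linarith
  simp only [chargeForce, smul_apply, innerSL_apply_apply, smul_eq_mul,
    ← real_smul (x := Real.eulerMascheroniConstant - 2 * Real.log 2 +
      4 * Real.pi * β₀ * ‖a + θ * v‖ ^ (2 * σ)), real_inner_smul_left, add_sub_cancel_right]
  field_simp

/-- Second order Taylor estimate for the potential of the charge. -/
theorem exists_chargePotential_taylor (β₀ : ℝ) {σ : ℝ} (hσ : 1 / 2 ≤ σ) (R : ℝ) :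
    ∃ C : ℝ, 0 ≤ C ∧ ∀ a b : ℂ, ‖a‖ ≤ R → ‖b‖ ≤ R →
      |chargePotential β₀ σ b - chargePotential β₀ σ a - 2 * ⟪chargeForce β₀ σ a, b - a⟫| ≤
        C * ‖b - a‖ ^ 2 := by
  obtain ⟨L, hL⟩ := exists_lipschitz_chargeForce β₀ hσ R
  refine ⟨2 * L, by positivity, fun a b ha hb => ?_⟩
  -- The mean value theorem on the segment from a to b reduces the remainder to an increment of the
  -- force, which is Lipschitz on the ball.
  obtain ⟨θ, hθ, e⟩ := exists_hasDerivAt_eq_slope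
    (fun θ : ℝ => chargePotential β₀ σ (a + θ * (b - a))) _ zero_lt_one
    (fun θ _ => (hasDerivAt_chargePotential_line β₀ hσ a (b - a) θ).continuousAt.continuousWithinAt)
    (fun θ _ => hasDerivAt_chargePotential_line β₀ hσ a (b - a) θ)
  simp only [ofReal_one, one_mul, add_sub_cancel, ofReal_zero, zero_mul, add_zero, sub_zero,
    div_one] at e
  rw [← e, ← mul_sub, ← inner_sub_left, abs_mul, abs_two]
  have hball : ‖a + θ * (b - a)‖ ≤ R := by
    have := (convex_closedBall (0 : ℂ) R).add_smul_sub_mem (mem_closedBall_zero_iff.2 ha)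
      (mem_closedBall_zero_iff.2 hb) ⟨hθ.1.le, hθ.2.le⟩
    simpa [mem_closedBall_zero_iff] using this
  have h1 := abs_real_inner_le_norm (chargeForce β₀ σ (a + θ * (b - a)) - chargeForce β₀ σ a) (b - a)
  have h2 := hL _ _ hball ha
  have h3 : ‖a + θ * (b - a) - a‖ ≤ ‖b - a‖ := by
    rw [add_sub_cancel_left, norm_mul, norm_real, Real.norm_of_nonneg hθ.1.le]
    exact mul_le_of_le_one_left (norm_nonneg _) hθ.2.le
  calc _ ≤ 2 * (L * ‖b - a‖ * ‖b - a‖) := by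
        gcongr
        refine h1.trans ?_
        gcongr
        refine h2.trans ?_
        gcongr
    _ = _ := by ring

/-- The trace at the origin of the free wave with Fourier transform `φ`. -/
def freeTrace (φ : Plane → ℂ) (t : ℝ) : ℂ := ∫ ξ, Complex.exp (-(I * kinetic ξ * t)) * φ ξ

theorem norm_freeTrace_le (φ : Plane → ℂ) (t : ℝ) : ‖freeTrace φ t‖ ≤ ∫ ξ, ‖φ ξ‖ := by
  refine (norm_integral_le_integral_norm _).trans (le_of_eq ?_)
  simp only [norm_mul, norm_exp_neg_I_mul, one_mul]

theorem continuous_oscillation :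
    Continuous fun p : Plane × ℝ => Complex.exp (-(I * kinetic p.1 * p.2)) := by
  have := continuous_kinetic
  fun_prop

theorem integrable_oscillation_mul {φ : Plane → ℂ} (h : Integrable φ) (t : ℝ) :
    Integrable fun ξ => Complex.exp (-(I * kinetic ξ * t)) * φ ξ := by
  refine h.bdd_mul (c := 1) ?_ (Eventually.of_forall fun ξ => (norm_exp_neg_I_mul _ _).le)
  exact (continuous_oscillation.comp (Continuous.prodMk_left t)).aestronglyMeasurable

theorem continuous_freeTrace {φ : Plane → ℂ} (h : Integrable φ) : Continuous (freeTrace φ) := by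
  refine continuous_of_dominated (bound := fun ξ => ‖φ ξ‖)
    (fun t => (integrable_oscillation_mul h t).aestronglyMeasurable) (fun t => ?_) h.norm ?_
  · exact Eventually.of_forall fun ξ => by rw [norm_mul, norm_exp_neg_I_mul, one_mul]
  · exact Eventually.of_forall fun ξ => by fun_prop

/-- The wave `φ` has increments of order `o(h)` in the square mean over time. -/
theorem tendsto_freeTrace_increment {φ : Plane → ℂ} (h1 : Integrable φ)
    (h2 : Integrable fun ξ => (1 + kinetic ξ) * ‖φ ξ‖ ^ 2) {T : ℝ} (hT : 0 < T) :
    Tendsto (fun h : ℝ => h⁻¹ * ∫ t in (0 : ℝ)..(T - h), ‖freeTrace φ (t + h) - freeTrace φ t‖ ^ 2)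
      (𝓝[>] 0) (𝓝 0) := by
  -- The increment over h of the trace is the trace of the wave (e^{-ikh} - 1)φ, to which the L²
  -- trace estimate applies.
  set m : ℝ → Plane → ℂ := fun h ξ => (Complex.exp (-(I * kinetic ξ * h)) - 1) * φ ξ with hm
  have hm1 : ∀ h, Integrable (m h) := fun h => by
    have := (integrable_oscillation_mul h1 h).sub h1
    refine this.congr (Eventually.of_forall fun ξ => ?_)
    simp only [hm, Pi.sub_apply]; ring
  have hb1 : ∀ h ξ, ‖m h ξ‖ ^ 2 ≤ 4 * ‖φ ξ‖ ^ 2 := fun h ξ => by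
    have : ‖Complex.exp (-(I * kinetic ξ * h)) - 1‖ ≤ 2 := by
      refine (norm_sub_le _ _).trans ?_
      rw [norm_exp_neg_I_mul, norm_one]; norm_num
    simp only [hm, norm_mul, mul_pow]
    gcongr
    nlinarith [norm_nonneg (Complex.exp (-(I * kinetic ξ * h)) - 1)]
  have hb2 : ∀ (h : ℝ) (ξ : Plane), 0 ≤ h → ‖Complex.exp (-(I * kinetic ξ * h)) - 1‖ ≤ h * kinetic ξ := fun h ξ hh => by
    have := Real.norm_exp_I_mul_ofReal_sub_one_le (x := -(kinetic ξ * h))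
    rw [Real.norm_eq_abs, abs_neg, abs_of_nonneg (mul_nonneg (kinetic_nonneg ξ) hh)] at this
    refine le_trans (le_of_eq ?_) (this.trans (le_of_eq (mul_comm _ _)))
    congr 3
    push_cast
    ring
  have hφ2 : Integrable fun ξ => ‖φ ξ‖ ^ 2 := by
    refine h2.mono' (h1.aestronglyMeasurable.norm.pow 2) (Eventually.of_forall fun ξ => ?_)
    rw [Real.norm_of_nonneg (by positivity)]
    nlinarith [kinetic_nonneg ξ, sq_nonneg ‖φ ξ‖, mul_nonneg (kinetic_nonneg ξ) (sq_nonneg ‖φ ξ‖)]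
  have hm2 : ∀ h, Integrable fun ξ => ‖m h ξ‖ ^ 2 := fun h =>
    (hφ2.const_mul 4).mono' ((hm1 h).aestronglyMeasurable.norm.pow 2)
      (Eventually.of_forall fun ξ => by
        rw [Real.norm_of_nonneg (by positivity)]; exact hb1 h ξ)
  have e : ∀ h t : ℝ, freeTrace φ (t + h) - freeTrace φ t =
      ∫ ξ, Complex.exp (-(I * kinetic ξ * t)) * m h ξ := fun h t => by
    rw [freeTrace, freeTrace, ← integral_sub (integrable_oscillation_mul h1 _)
      (integrable_oscillation_mul h1 _)]
    refine integral_congr_ae (Eventually.of_forall fun ξ => ?_)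
    have : Complex.exp (-(I * kinetic ξ * (t + h : ℝ))) =
        Complex.exp (-(I * kinetic ξ * t)) * Complex.exp (-(I * kinetic ξ * h)) := by
      rw [← Complex.exp_add]; congr 1; push_cast; ring
    simp only [hm, this]
    ring
  -- Multiplying the bounds 2 and hk for |e^{-ikh} - 1| gives h⁻¹|e^{-ikh} - 1|² ≤ 2k, dominated by
  -- the energy of φ; squaring the second bound shows that the pointwise limit is 0.
  have hlim : Tendsto (fun h : ℝ => ∫ ξ, h⁻¹ * ‖m h ξ‖ ^ 2) (𝓝[>] 0) (𝓝 (∫ _ : Plane, (0 : ℝ))) := by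
    refine tendsto_integral_filter_of_dominated_convergence
      (fun ξ => 2 * ((1 + kinetic ξ) * ‖φ ξ‖ ^ 2)) ?_ ?_ (h2.const_mul 2) ?_
    · exact Eventually.of_forall fun h => ((hm2 h).const_mul _).aestronglyMeasurable
    · filter_upwards [self_mem_nhdsWithin] with h hh
      have hh : 0 < h := hh
      refine Eventually.of_forall fun ξ => ?_
      rw [Real.norm_of_nonneg (by positivity), inv_mul_le_iff₀ hh]
      have h3 := hb2 h ξ hh.le
      have h4 : ‖Complex.exp (-(I * kinetic ξ * h)) - 1‖ ≤ 2 := by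
        refine (norm_sub_le _ _).trans ?_
        rw [norm_exp_neg_I_mul, norm_one]; norm_num
      simp only [hm, norm_mul, mul_pow]
      have h5 : ‖Complex.exp (-(I * kinetic ξ * h)) - 1‖ ^ 2 ≤ h * (2 * (1 + kinetic ξ)) := by
        have h0 := norm_nonneg (Complex.exp (-(I * kinetic ξ * h)) - 1)
        nlinarith [mul_nonneg hh.le (kinetic_nonneg ξ)]
      calc _ ≤ h * (2 * (1 + kinetic ξ)) * ‖φ ξ‖ ^ 2 := by gcongr
        _ = _ := by ring
    · refine Eventually.of_forall fun ξ => ?_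
      have h6 : Tendsto (fun h : ℝ => h * (kinetic ξ ^ 2 * ‖φ ξ‖ ^ 2)) (𝓝[>] 0) (𝓝 0) := by
        have : Continuous fun h : ℝ => h * (kinetic ξ ^ 2 * ‖φ ξ‖ ^ 2) := by fun_prop
        simpa using (this.tendsto 0).mono_left (nhdsWithin_le_nhds (s := Set.Ioi 0))
      refine squeeze_zero' ?_ ?_ h6
      · filter_upwards [self_mem_nhdsWithin] with h hh
        have hh : 0 < h := hh
        positivity
      · filter_upwards [self_mem_nhdsWithin] with h hh
        have hh : 0 < h := hh
        have h3 := hb2 h ξ hh.le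
        rw [inv_mul_le_iff₀ hh]
        simp only [hm, norm_mul, mul_pow]
        calc _ ≤ (h * kinetic ξ) ^ 2 * ‖φ ξ‖ ^ 2 := by gcongr
          _ = _ := by ring
  rw [integral_zero] at hlim
  refine squeeze_zero' ?_ ?_ hlim
  · filter_upwards [Ioo_mem_nhdsGT hT] with h hh
    have := hh.1
    have : 0 ≤ ∫ t in (0 : ℝ)..(T - h), ‖freeTrace φ (t + h) - freeTrace φ t‖ ^ 2 :=
      intervalIntegral.integral_nonneg (by linarith [hh.2]) fun _ _ => by positivity
    positivity
  · filter_upwards [Ioo_mem_nhdsGT hT] with h hh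
    have := hh.1
    rw [integral_const_mul]
    simp only [e]
    gcongr
    exact integral_norm_sq_trace_le (hm1 h) (hm2 h) (by linarith [hh.2])

end PointNLS

/-! ### Regularity of the charge -/

namespace PointNLS

theorem intervalIntegrable_volterraKernel_sub_mul_log {t : ℝ} (ht : 0 < t) :
    IntervalIntegrable (fun s => (volterraKernel (t - s) : ℂ) *
      (-Real.eulerMascheroniConstant - Real.log s : ℝ)) volume 0 t := by
  rw [intervalIntegrable_iff_integrableOn_Ioo_of_le ht.le]
  have h1 := (intervalIntegrable_iff_integrableOn_Ioo_of_le ht.le).1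
    (intervalIntegrable_volterraKernel_sub ht.le)
  have h2 := (h1.mul_const Real.eulerMascheroniConstant).norm.add
    (integrableOn_volterraKernel_sub_mul_log ht)
  have hm := measurable_volterraKernel
  refine h2.mono' (by fun_prop) ?_
  filter_upwards [ae_restrict_mem measurableSet_Ioo] with s hs
  have h0 := volterraKernel_nonneg (show 0 ≤ t - s by linarith [hs.2])
  simp only [Pi.add_apply, norm_mul, norm_real, Real.norm_eq_abs, abs_of_nonneg h0]
  rw [← mul_add]
  gcongr
  refine (abs_sub _ _).trans (le_of_eq ?_)
  rw [abs_neg]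

/-- `q` solves on `(0, T]` the charge equation with initial regular part `φ` (on the Fourier side)
and initial charge `q₀`. -/
structure IsChargeSolution (β₀ σ : ℝ) (φ : Plane → ℂ) (q₀ : ℂ) (q : ℝ → ℂ) (T : ℝ) : Prop where
  half_le : 1 / 2 ≤ σ
  pos : 0 < T
  integrable : Integrable φ
  integrable_energy : Integrable fun ξ => (1 + kinetic ξ) * ‖φ ξ‖ ^ 2
  cont : Continuous q
  eq : ∀ t ∈ Set.Ioc 0 T, q t = ∫ s in (0 : ℝ)..t, (volterraKernel (t - s) : ℂ) *
    (4 * Real.pi * freeTrace φ s + q₀ * scaledExpIntegral (I * s) - chargeForce β₀ σ (q s) +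
      (I * Real.pi / 2 - Real.eulerMascheroniConstant) * q s)

namespace IsChargeSolution

variable {β₀ σ T : ℝ} {φ : Plane → ℂ} {q₀ : ℂ} {q : ℝ → ℂ}

/-- The bounded density of the Volterra representation of the charge. -/
def density (β₀ σ : ℝ) (φ : Plane → ℂ) (q₀ : ℂ) (q : ℝ → ℂ) (T : ℝ) : ℝ → ℂ :=
  (Set.Ioc 0 T).indicator fun s =>
    4 * Real.pi * freeTrace φ s + q₀ * expIntegralRemainder s - chargeForce β₀ σ (q s) +
      (I * Real.pi / 2 - Real.eulerMascheroniConstant) * q s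

theorem measurable_expIntegralRemainder : Measurable expIntegralRemainder := by
  have := measurable_scaledExpIntegral
  unfold expIntegralRemainder
  fun_prop

theorem measurable_density (H : IsChargeSolution β₀ σ φ q₀ q T) :
    Measurable (density β₀ σ φ q₀ q T) := by
  have h1 := (continuous_freeTrace H.integrable).measurable
  have h2 := H.cont.measurable
  have h3 := (continuous_chargeForce (β₀ := β₀) (σ := σ) (by linarith [H.half_le])).measurable
  have h4 := measurable_expIntegralRemainder
  refine Measurable.indicator ?_ measurableSet_Ioc
  fun_prop

theorem exists_norm_le (H : IsChargeSolution β₀ σ φ q₀ q T) :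
    ∃ R, ∀ t ∈ Set.Icc 0 T, ‖q t‖ ≤ R :=
  isCompact_Icc.exists_bound_of_continuousOn H.cont.continuousOn

/-- The only unbounded term of the source is q₀ e^{is}E₁(is), equal to q₀(-γ - log s) plus a bounded
remainder. By Sonine's relation the singular part convolves with the Volterra kernel to the constant
q₀. -/
theorem exists_isVolterraPotential (H : IsChargeSolution β₀ σ φ q₀ q T) :
    ∃ B, IsVolterraPotential q (density β₀ σ φ q₀ q T) q₀ B T := by
  obtain ⟨C, hC⟩ := exists_norm_expIntegralRemainder_le T
  have hσ : 0 ≤ σ := by linarith [H.half_le]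
  obtain ⟨R, hR⟩ := isCompact_Icc.exists_bound_of_continuousOn (s := Set.Icc 0 T)
    (f := fun s => 4 * Real.pi * freeTrace φ s - chargeForce β₀ σ (q s) +
      (I * Real.pi / 2 - Real.eulerMascheroniConstant) * q s) (by
    have h1 := continuous_freeTrace H.integrable
    have h2 := H.cont
    have h3 := (continuous_chargeForce (β₀ := β₀) hσ).comp h2
    exact (by fun_prop : Continuous _).continuousOn)
  have hR0 : 0 ≤ R := (norm_nonneg _).trans (hR T ⟨H.pos.le, le_rfl⟩)
  have hC0 : 0 ≤ C := (norm_nonneg _).trans (hC T ⟨H.pos, le_rfl⟩)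
  have hbd : ∀ s, ‖density β₀ σ φ q₀ q T s‖ ≤ R + ‖q₀‖ * C := by
    intro s
    by_cases hs : s ∈ Set.Ioc 0 T
    · rw [density, Set.indicator_of_mem hs]
      have h1 := hR s (Set.Ioc_subset_Icc_self hs)
      have h2 := hC s hs
      calc _ = ‖(4 * Real.pi * freeTrace φ s - chargeForce β₀ σ (q s) +
              (I * Real.pi / 2 - Real.eulerMascheroniConstant) * q s) +
              q₀ * expIntegralRemainder s‖ := by congr 1; ring
        _ ≤ _ := by
          refine (norm_add_le _ _).trans (add_le_add h1 ?_)
          rw [norm_mul]; gcongr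
    · rw [density, Set.indicator_of_notMem hs, norm_zero]; positivity
  refine ⟨_, H.measurable_density, hbd, fun t ht => ?_⟩
  rw [H.eq t ht]
  have hlogm := intervalIntegrable_volterraKernel_sub_mul_log ht.1
  have hval : ∫ s in (0 : ℝ)..t, (volterraKernel (t - s) : ℂ) *
      (-Real.eulerMascheroniConstant - Real.log s : ℝ) = 1 := by
    rw [intervalIntegral.integral_of_le ht.1.le, integral_Ioc_eq_integral_Ioo]
    simp_rw [← ofReal_mul]
    rw [integral_complex_ofReal, integral_volterraKernel_sub_mul_log ht.1, ofReal_one]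
  have hdi := intervalIntegrable_volterraKernel_sub_mul ht.1.le H.measurable_density hbd
  have e : ∀ s ∈ Set.Ioc 0 t, (volterraKernel (t - s) : ℂ) *
      (4 * Real.pi * freeTrace φ s + q₀ * scaledExpIntegral (I * s) - chargeForce β₀ σ (q s) +
        (I * Real.pi / 2 - Real.eulerMascheroniConstant) * q s) =
      q₀ * ((volterraKernel (t - s) : ℂ) * (-Real.eulerMascheroniConstant - Real.log s : ℝ)) +
      (volterraKernel (t - s) : ℂ) * density β₀ σ φ q₀ q T s := by
    intro s hs
    rw [density, Set.indicator_of_mem (show s ∈ Set.Ioc 0 T from ⟨hs.1, hs.2.trans ht.2⟩),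
      expIntegralRemainder]
    push_cast
    ring
  rw [intervalIntegral.integral_congr_ae (g := fun s => q₀ * ((volterraKernel (t - s) : ℂ) *
      (-Real.eulerMascheroniConstant - Real.log s : ℝ)) +
      (volterraKernel (t - s) : ℂ) * density β₀ σ φ q₀ q T s)
      (Eventually.of_forall fun s hs => e s (by rwa [Set.uIoc_of_le ht.1.le] at hs)),
    intervalIntegral.integral_add (hlogm.const_mul q₀) hdi, intervalIntegral.integral_const_mul,
    hval, mul_one]

/-- The integrated form of the charge equation, with the kernel inverted. -/
theorem integral_sonineKernel_mul (H : IsChargeSolution β₀ σ φ q₀ q T) {t : ℝ}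
    (ht : t ∈ Set.Ioc 0 T) :
    ∫ s in (0 : ℝ)..t, (sonineKernel (t - s) : ℂ) * q s =
      ∫ s in (0 : ℝ)..t, (4 * Real.pi * freeTrace φ s + q₀ * scaledExpIntegral (I * s)
        - chargeForce β₀ σ (q s) + (I * Real.pi / 2 - Real.eulerMascheroniConstant) * q s) := by
  obtain ⟨B, hB⟩ := H.exists_isVolterraPotential
  have hi : IntervalIntegrable (density β₀ σ φ q₀ q T) volume 0 t := by
    rw [intervalIntegrable_iff_integrableOn_Ioc_of_le ht.1.le]
    exact Measure.integrableOn_of_bounded measure_Ioc_lt_top.ne hB.meas.aestronglyMeasurable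
      (Eventually.of_forall hB.bound)
  have hJ : IntervalIntegrable (fun s => (sonineKernel s : ℂ)) volume 0 t :=
    have h := intervalIntegrable_sonineKernel 0 t
    ⟨h.1.ofReal, h.2.ofReal⟩
  rw [hB.integral_sonineKernel_mul ht, ← intervalIntegral.integral_const_mul,
    ← intervalIntegral.integral_add (hJ.const_mul q₀) hi]
  refine intervalIntegral.integral_congr_ae (Eventually.of_forall fun s hs => ?_)
  rw [Set.uIoc_of_le ht.1.le] at hs
  rw [density, Set.indicator_of_mem (show s ∈ Set.Ioc 0 T from ⟨hs.1, hs.2.trans ht.2⟩),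
    expIntegralRemainder, sonineKernel]
  push_cast
  ring

theorem initial_value (H : IsChargeSolution β₀ σ φ q₀ q T) : q 0 = q₀ := by
  obtain ⟨B, hB⟩ := H.exists_isVolterraPotential
  exact hB.initial_value H.pos H.cont

/-- Three kinds of terms make up the increment of the density: the free trace, which is o(√h) in
quadratic mean since φ has finite energy; the remainder of the exponential integral, of size
h·s^{-1/4}; and terms Lipschitz in the charge, which the stability estimate absorbs. -/
theorem tendsto_increment (H : IsChargeSolution β₀ σ φ q₀ q T) :
    Tendsto (fun h : ℝ => h⁻¹ * ∫ s in (0 : ℝ)..(T - h), ‖q (s + h) - q s‖ ^ 2)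
      (𝓝[>] 0) (𝓝 0) := by
  obtain ⟨B, hB⟩ := H.exists_isVolterraPotential
  obtain ⟨R, hR⟩ := H.exists_norm_le
  obtain ⟨L, hL⟩ := exists_lipschitz_chargeForce β₀ H.half_le R
  have hft := continuous_freeTrace H.integrable
  set c := ‖I * Real.pi / 2 - Real.eulerMascheroniConstant‖
  refine hB.tendsto_increment H.cont H.pos (L + c.toNNReal)
    (g := fun h s => ENNReal.ofReal (4 * Real.pi * ‖freeTrace φ (s + h) - freeTrace φ s‖ +
      ‖q₀‖ * (Real.Gamma (1 / 4) * s ^ (-(1 / 4) : ℝ) * h))) (fun h => ?_) ?_ ?_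
  · have := hft.measurable
    fun_prop
  · intro h s hh hs hsT
    have hg := Real.Gamma_pos_of_pos (show (0 : ℝ) < 1 / 4 by norm_num)
    have hsp := Real.rpow_nonneg hs.le (-(1 / 4) : ℝ)
    rw [← ENNReal.ofReal_coe_nnreal, ← ENNReal.ofReal_mul (by positivity),
      ← ENNReal.ofReal_add (by positivity) (by positivity)]
    refine ENNReal.ofReal_le_ofReal ?_
    rw [density, Set.indicator_of_mem (show s + h ∈ Set.Ioc 0 T from ⟨by linarith, hsT⟩),
      Set.indicator_of_mem (show s ∈ Set.Ioc 0 T from ⟨hs, by linarith⟩)]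
    have h1 := norm_expIntegralRemainder_sub_le hs hh.le
    have h2 := hL (q (s + h)) (q s) (hR _ ⟨by linarith, hsT⟩) (hR _ ⟨hs.le, by linarith⟩)
    calc _ = ‖(4 * Real.pi * (freeTrace φ (s + h) - freeTrace φ s) +
              q₀ * (expIntegralRemainder (s + h) - expIntegralRemainder s)) +
              -(chargeForce β₀ σ (q (s + h)) - chargeForce β₀ σ (q s)) +
              (I * Real.pi / 2 - Real.eulerMascheroniConstant) * (q (s + h) - q s)‖ := by
            congr 1; ring
      _ ≤ (4 * Real.pi * ‖freeTrace φ (s + h) - freeTrace φ s‖ +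
            ‖q₀‖ * (Real.Gamma (1 / 4) * s ^ (-(1 / 4) : ℝ) * h)) + L * ‖q (s + h) - q s‖ +
            c * ‖q (s + h) - q s‖ := by
          refine norm_add₃_le.trans (add_le_add (add_le_add ?_ ?_) ?_)
          · refine (norm_add_le _ _).trans (add_le_add (le_of_eq ?_) ?_)
            · rw [norm_mul, norm_mul, norm_real, Real.norm_of_nonneg Real.pi_pos.le]
              norm_num
            · rw [norm_mul]; gcongr
          · rwa [norm_neg]
          · rw [norm_mul]
      _ = _ := by rw [NNReal.coe_add, Real.coe_toNNReal c (norm_nonneg _)]; ring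
  · have hG := Real.Gamma_pos_of_pos (show (0 : ℝ) < 1 / 4 by norm_num)
    set K := ‖q₀‖ * Real.Gamma (1 / 4)
    have hpow : IntervalIntegrable (fun s : ℝ => s ^ (-(1 / 2) : ℝ)) volume 0 T :=
      intervalIntegral.intervalIntegrable_rpow' (by norm_num)
    have hlim1 := (tendsto_freeTrace_increment H.integrable H.integrable_energy H.pos).const_mul
      (2 * (4 * Real.pi) ^ 2)
    have hlim2 : Tendsto (fun h : ℝ => h * (2 * K ^ 2 * ∫ s in (0 : ℝ)..T, s ^ (-(1 / 2) : ℝ)))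
        (𝓝[>] 0) (𝓝 0) := by
      have : Continuous fun h : ℝ => h * (2 * K ^ 2 * ∫ s in (0 : ℝ)..T, s ^ (-(1 / 2) : ℝ)) := by
        fun_prop
      simpa using (this.tendsto 0).mono_left (nhdsWithin_le_nhds (s := Set.Ioi 0))
    have hlim3 := ENNReal.tendsto_ofReal (hlim1.add hlim2)
    rw [mul_zero, add_zero, ENNReal.ofReal_zero] at hlim3
    refine tendsto_of_tendsto_of_tendsto_of_le_of_le' tendsto_const_nhds hlim3
      (Eventually.of_forall fun _ => zero_le) ?_
    filter_upwards [Ioo_mem_nhdsGT H.pos] with h hh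
    have hh0 := hh.1
    have hTh : 0 ≤ T - h := by linarith [hh.2]
    have hi1 : IntegrableOn (fun s => ‖freeTrace φ (s + h) - freeTrace φ s‖ ^ 2)
        (Set.Ioo 0 (T - h)) := by
      have : Continuous fun s => ‖freeTrace φ (s + h) - freeTrace φ s‖ ^ 2 := by fun_prop
      exact (this.integrableOn_Icc (a := 0) (b := T - h)).mono_set Set.Ioo_subset_Icc_self
    have hi2 : IntegrableOn (fun s : ℝ => s ^ (-(1 / 2) : ℝ)) (Set.Ioo 0 T) :=
      (intervalIntegrable_iff_integrableOn_Ioo_of_le H.pos.le).1 hpow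
    have hsub : Set.Ioo 0 (T - h) ⊆ Set.Ioo 0 T := Set.Ioo_subset_Ioo_right (by linarith)
    have hi3 : IntegrableOn (fun s => 2 * (4 * Real.pi) ^ 2 *
        ‖freeTrace φ (s + h) - freeTrace φ s‖ ^ 2 + 2 * K ^ 2 * h ^ 2 * s ^ (-(1 / 2) : ℝ))
        (Set.Ioo 0 (T - h)) := (hi1.const_mul (2 * (4 * Real.pi) ^ 2)).add
      ((hi2.mono_set hsub).const_mul (2 * K ^ 2 * h ^ 2))
    calc _ ≤ ENNReal.ofReal h⁻¹ * ∫⁻ s in Set.Ioo 0 (T - h), ENNReal.ofReal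
          (2 * (4 * Real.pi) ^ 2 * ‖freeTrace φ (s + h) - freeTrace φ s‖ ^ 2 +
            2 * K ^ 2 * h ^ 2 * s ^ (-(1 / 2) : ℝ)) := by
          refine mul_le_mul_right ?_ _
          refine setLIntegral_mono' measurableSet_Ioo fun s hs => ?_
          have hsp := Real.rpow_nonneg hs.1.le (-(1 / 4) : ℝ)
          rw [← ENNReal.ofReal_pow (by positivity)]
          refine ENNReal.ofReal_le_ofReal ?_
          -- The square of s^{-1/4} is still integrable at 0.
          have e1 : s ^ (-(1 / 2) : ℝ) = (s ^ (-(1 / 4) : ℝ)) ^ 2 := by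
            rw [← Real.rpow_natCast, ← Real.rpow_mul hs.1.le]; norm_num
          rw [e1]
          have e2 := sq_nonneg (4 * Real.pi * ‖freeTrace φ (s + h) - freeTrace φ s‖ -
            K * s ^ (-(1 / 4) : ℝ) * h)
          simp only [K] at e2 ⊢
          nlinarith [e2]
      _ = ENNReal.ofReal (h⁻¹ * ∫ s in Set.Ioo 0 (T - h),
          (2 * (4 * Real.pi) ^ 2 * ‖freeTrace φ (s + h) - freeTrace φ s‖ ^ 2 +
            2 * K ^ 2 * h ^ 2 * s ^ (-(1 / 2) : ℝ))) := by
          rw [ENNReal.ofReal_mul (by positivity), ofReal_integral_eq_lintegral_ofReal hi3]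
          filter_upwards [ae_restrict_mem measurableSet_Ioo] with s hs
          have := Real.rpow_nonneg hs.1.le (-(1 / 2) : ℝ)
          simp only [Pi.zero_apply]
          positivity
      _ ≤ _ := by
          refine ENNReal.ofReal_le_ofReal ?_
          rw [integral_add (hi1.const_mul _) ((hi2.mono_set hsub).const_mul _), integral_const_mul,
            integral_const_mul, intervalIntegral.integral_of_le hTh, integral_Ioc_eq_integral_Ioo,
            intervalIntegral.integral_of_le H.pos.le, integral_Ioc_eq_integral_Ioo]
          have h5 : ∫ s in Set.Ioo 0 (T - h), s ^ (-(1 / 2) : ℝ) ≤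
              ∫ s in Set.Ioo 0 T, s ^ (-(1 / 2) : ℝ) := by
            refine setIntegral_mono_set hi2 ?_ hsub.eventuallyLE
            filter_upwards [ae_restrict_mem measurableSet_Ioo] with s hs
            exact Real.rpow_nonneg hs.1.le _
          rw [mul_add]
          refine add_le_add (le_of_eq (by ring)) ?_
          calc _ = h * (2 * K ^ 2 * ∫ s in Set.Ioo 0 (T - h), s ^ (-(1 / 2) : ℝ)) := by
                field_simp
            _ ≤ _ := by gcongr

end IsChargeSolution

end PointNLS

/-! ### Driven modes and their balance laws -/

namespace PointNLS

/-- The Fourier component, at kinetic energy `k`, of the wave with initial value `g` driven by the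
charge `q` at the origin. -/
def wave (g : ℂ) (q : ℝ → ℂ) (t k : ℝ) : ℂ :=
  Complex.exp (-(I * k * t)) * g + I * sourceWave q t k

theorem sourceWave_eq (q : ℝ → ℂ) (t k : ℝ) :
    sourceWave q t k =
      Complex.exp (-(I * k * t)) * ∫ r in (0 : ℝ)..t, Complex.exp (I * k * r) * q r := by
  have h := intervalIntegral.integral_comp_sub_left (a := 0) (b := t)
    (fun r => Complex.exp (-(I * k * (t - r : ℝ))) * q r) t
  simp only [sub_sub_cancel, sub_self, sub_zero] at h
  rw [sourceWave, h, ← intervalIntegral.integral_const_mul]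
  refine intervalIntegral.integral_congr fun r _ => ?_
  simp only [← mul_assoc, ← Complex.exp_add]
  congr 2
  push_cast
  ring

theorem wave_eq (g : ℂ) (q : ℝ → ℂ) (t k : ℝ) :
    wave g q t k = Complex.exp (-(I * k * t)) *
      (g + I * ∫ r in (0 : ℝ)..t, Complex.exp (I * k * r) * q r) := by
  rw [wave, sourceWave_eq]; ring

theorem wave_zero (g : ℂ) (q : ℝ → ℂ) (k : ℝ) : wave g q 0 k = g := by
  simp [wave, sourceWave]

/-- Each mode is a harmonic oscillator driven by the charge. Factoring out e^{-ikt} leaves a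
primitive, so continuity of q suffices although the defining integral contains q(t - s). -/
theorem hasDerivAt_wave (g : ℂ) {q : ℝ → ℂ} (hq : Continuous q) (t k : ℝ) :
    HasDerivAt (fun t => wave g q t k) (-(I * k * wave g q t k) + I * q t) t := by
  have hc : Continuous fun r : ℝ => Complex.exp (I * k * r) * q r := by fun_prop
  have h1 : HasDerivAt (fun t : ℝ => ∫ r in (0 : ℝ)..t, Complex.exp (I * k * r) * q r)
      (Complex.exp (I * k * t) * q t) t :=
    intervalIntegral.integral_hasDerivAt_right (hc.intervalIntegrable _ _)
      hc.aestronglyMeasurable.stronglyMeasurableAtFilter hc.continuousAt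
  have h2 : HasDerivAt (fun t : ℝ => Complex.exp (-(I * k * t)))
      (Complex.exp (-(I * k * t)) * -(I * k)) t := by
    have : HasDerivAt (fun t : ℝ => -(I * k * t)) (-(I * k)) t := by
      simpa using ((hasDerivAt_id t).ofReal_comp.const_mul (I * k)).fun_neg
    exact this.cexp
  have h3 := h2.mul ((h1.const_mul I).const_add g)
  simp_rw [wave_eq]
  refine h3.congr_deriv ?_
  have e : Complex.exp (-(I * k * t)) * Complex.exp (I * k * t) = 1 := by
    rw [← Complex.exp_add]; simp
  linear_combination I * q t * e

theorem continuous_wave_left (g : ℂ) {q : ℝ → ℂ} (hq : Continuous q) (k : ℝ) :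
    Continuous fun t => wave g q t k :=
  continuous_iff_continuousAt.2 fun t => (hasDerivAt_wave g hq t k).continuousAt

/-- Time reversal. -/
theorem conj_wave_sub (g : ℂ) {q : ℝ → ℂ} (hq : Continuous q) (t s k : ℝ) :
    (starRingEnd ℂ) (wave g q (t - s) k) =
      wave ((starRingEnd ℂ) (wave g q t k)) (fun r => (starRingEnd ℂ) (q (t - r))) s k := by
  have h := intervalIntegral.integral_comp_sub_left (a := 0) (b := s)
    (fun r => Complex.exp (I * k * (t - r : ℝ)) * (starRingEnd ℂ) (q r)) t
  simp only [sub_sub_cancel, sub_zero] at h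
  have hc : Continuous fun r : ℝ => Complex.exp (I * k * r) * q r := by fun_prop
  have hadd := intervalIntegral.integral_add_adjacent_intervals (μ := volume)
    (hc.intervalIntegrable 0 (t - s)) (hc.intervalIntegrable (t - s) t)
  rw [wave_eq, wave_eq _ _ s, wave_eq _ _ t, h, ← hadd]
  have e1 : ∫ r in (t - s)..t, Complex.exp (I * k * (t - r : ℝ)) * (starRingEnd ℂ) (q r) =
      Complex.exp (I * k * t) *
        (starRingEnd ℂ) (∫ r in (t - s)..t, Complex.exp (I * k * r) * q r) := by
    rw [← intervalIntegral.intervalIntegral_conj, ← intervalIntegral.integral_const_mul]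
    refine intervalIntegral.integral_congr fun r _ => ?_
    simp only [map_mul, ← Complex.exp_conj, conj_I, conj_ofReal, ← mul_assoc, ← Complex.exp_add]
    congr 2
    push_cast
    ring
  rw [e1]
  simp only [map_mul, map_add, map_neg, ← Complex.exp_conj, conj_I, conj_ofReal]
  have e2 : Complex.exp (-(-I * k * (t - s : ℝ))) =
      Complex.exp (-(I * k * s)) * Complex.exp (I * k * t) := by
    rw [← Complex.exp_add]; congr 1; push_cast; ring
  have e3 : Complex.exp (-(-I * k * t)) = Complex.exp (I * k * t) := by
    congr 1; ring
  rw [e2, e3]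
  ring

theorem norm_wave_le (g : ℂ) {q : ℝ → ℂ} {t k C : ℝ} (ht : 0 ≤ t)
    (hC : ∀ s ∈ Set.Icc 0 t, ‖q s‖ ≤ C) : ‖wave g q t k‖ ≤ ‖g‖ + C * t := by
  refine (norm_add_le _ _).trans (add_le_add (le_of_eq ?_) ?_)
  · rw [norm_mul, norm_exp_neg_I_mul, one_mul]
  · rw [norm_mul, norm_I, one_mul]
    exact norm_sourceWave_le ht hC

theorem aestronglyMeasurable_wave {g : Plane → ℂ} (hg : AEStronglyMeasurable g) {q : ℝ → ℂ}
    (hq : Continuous q) (t : ℝ) :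
    AEStronglyMeasurable fun ξ => wave (g ξ) q t (kinetic ξ) := by
  have h1 : Continuous fun ξ => sourceWave q t (kinetic ξ) :=
    Continuous.comp (g := fun p : ℝ × ℝ => sourceWave q p.1 p.2) (f := fun ξ => (t, kinetic ξ))
      (continuous_sourceWave hq) (continuous_const.prodMk continuous_kinetic)
  have h2 : Continuous fun ξ => Complex.exp (-(I * kinetic ξ * t)) := by
    have := continuous_kinetic
    fun_prop
  exact (h2.aestronglyMeasurable.mul hg).add (h1.const_smul I).aestronglyMeasurable

theorem norm_sq_add_le (a b : ℂ) : ‖a + b‖ ^ 2 ≤ 2 * ‖a‖ ^ 2 + 2 * ‖b‖ ^ 2 := by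
  have h := norm_add_le a b
  have := norm_nonneg (a + b)
  nlinarith [sq_nonneg (‖a‖ - ‖b‖)]

theorem integrable_norm_sq_wave {g : Plane → ℂ} (hg : AEStronglyMeasurable g)
    (hg2 : Integrable fun ξ => ‖g ξ‖ ^ 2) {q : ℝ → ℂ} (hq : Continuous q) {t : ℝ} (ht : 0 ≤ t) :
    Integrable fun ξ => ‖wave (g ξ) q t (kinetic ξ)‖ ^ 2 := by
  refine ((hg2.const_mul 2).add ((integral_norm_sq_sourceWave_le hq ht).1.const_mul 2)).mono'
    ((aestronglyMeasurable_wave hg hq t).norm.pow 2) (Eventually.of_forall fun ξ => ?_)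
  rw [Real.norm_of_nonneg (by positivity)]
  refine (norm_sq_add_le _ _).trans (le_of_eq ?_)
  simp only [Pi.add_apply, norm_mul, norm_exp_neg_I_mul, norm_I, one_mul]

/-! ### Moving averages -/

/-- The average of `f` over `[t, t + h]`. -/
def movingAverage (h : ℝ) (f : ℝ → ℂ) (t : ℝ) : ℂ := (h : ℂ)⁻¹ * ∫ s in t..t + h, f s

theorem movingAverage_eq {f : ℝ → ℂ} (hf : Continuous f) (h t : ℝ) :
    movingAverage h f t = (h : ℂ)⁻¹ * ((∫ s in (0 : ℝ)..t + h, f s) - ∫ s in (0 : ℝ)..t, f s) := by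
  rw [movingAverage, intervalIntegral.integral_interval_sub_left (hf.intervalIntegrable _ _)
    (hf.intervalIntegrable _ _)]

theorem hasDerivAt_movingAverage {f : ℝ → ℂ} (hf : Continuous f) (h t : ℝ) :
    HasDerivAt (movingAverage h f) ((h : ℂ)⁻¹ * (f (t + h) - f t)) t := by
  have h1 : ∀ t : ℝ, HasDerivAt (fun t : ℝ => ∫ s in (0 : ℝ)..t, f s) (f t) t := fun t =>
    intervalIntegral.integral_hasDerivAt_right (hf.intervalIntegrable _ _)
      hf.aestronglyMeasurable.stronglyMeasurableAtFilter hf.continuousAt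
  have h2 := (h1 (t + h)).comp_add_const t h
  rw [funext (movingAverage_eq hf h)]
  exact (h2.sub (h1 t)).const_mul _

theorem continuous_movingAverage {f : ℝ → ℂ} (hf : Continuous f) (h : ℝ) :
    Continuous (movingAverage h f) :=
  continuous_iff_continuousAt.2 fun t => (hasDerivAt_movingAverage hf h t).continuousAt

theorem norm_movingAverage_le {f : ℝ → ℂ} {h t C : ℝ} (hh : 0 < h)
    (hC : ∀ s ∈ Set.Icc t (t + h), ‖f s‖ ≤ C) : ‖movingAverage h f t‖ ≤ C := by
  have h1 := intervalIntegral.norm_integral_le_of_norm_le_const (a := t) (b := t + h) (C := C)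
    (f := f) (fun s hs => by
      rw [Set.uIoc_of_le (by linarith)] at hs
      exact hC s (Set.Ioc_subset_Icc_self hs))
  rw [add_sub_cancel_left, abs_of_pos hh] at h1
  rw [movingAverage, norm_mul, norm_inv, norm_real, Real.norm_of_nonneg hh.le,
    inv_mul_le_iff₀ hh, mul_comm h]
  exact h1

theorem movingAverage_const {h : ℝ} (hh : h ≠ 0) (c : ℂ) (t : ℝ) :
    movingAverage h (fun _ => c) t = c := by
  have : (h : ℂ) ≠ 0 := ofReal_ne_zero.2 hh
  rw [movingAverage, intervalIntegral.integral_const, add_sub_cancel_left, real_smul,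
    inv_mul_cancel_left₀ this]

theorem movingAverage_sub {f g : ℝ → ℂ} (hf : Continuous f) (hg : Continuous g) (h t : ℝ) :
    movingAverage h (fun s => f s - g s) t = movingAverage h f t - movingAverage h g t := by
  simp only [movingAverage]
  rw [intervalIntegral.integral_sub (hf.intervalIntegrable _ _) (hg.intervalIntegrable _ _),
    mul_sub]

theorem movingAverage_add {f g : ℝ → ℂ} (hf : Continuous f) (hg : Continuous g) (h t : ℝ) :
    movingAverage h (fun s => f s + g s) t = movingAverage h f t + movingAverage h g t := by
  simp only [movingAverage]
  rw [intervalIntegral.integral_add (hf.intervalIntegrable _ _) (hg.intervalIntegrable _ _),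
    mul_add]

theorem movingAverage_const_mul (c : ℂ) (f : ℝ → ℂ) (h t : ℝ) :
    movingAverage h (fun s => c * f s) t = c * movingAverage h f t := by
  simp only [movingAverage, intervalIntegral.integral_const_mul]
  ring

/-- The average over `[t, t + h]` deviates from `c` no more than the function does. -/
theorem norm_movingAverage_sub_le {f : ℝ → ℂ} (hf : Continuous f) {h t C : ℝ} {c : ℂ} (hh : 0 < h)
    (hC : ∀ s ∈ Set.Icc t (t + h), ‖f s - c‖ ≤ C) : ‖movingAverage h f t - c‖ ≤ C := by
  rw [← movingAverage_const hh.ne' c t, ← movingAverage_sub hf continuous_const]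
  exact norm_movingAverage_le hh hC

/-- The equation of motion averaged over [t, t+h]. It expresses k times the averaged wave by a
difference quotient of the wave, a gain of one power of k that needs no smoothness of q. -/
theorem wave_increment (g : ℂ) {q : ℝ → ℂ} (hq : Continuous q) {h : ℝ} (t k : ℝ) :
    (h : ℂ)⁻¹ * (wave g q (t + h) k - wave g q t k) =
      -(I * k * movingAverage h (fun s => wave g q s k) t) + I * movingAverage h q t := by
  have hw := continuous_wave_left g hq k
  have hd : Continuous fun t => -(I * k * wave g q t k) + I * q t := by fun_prop
  rw [← intervalIntegral.integral_eq_sub_of_hasDerivAt (fun s _ => hasDerivAt_wave g hq s k)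
    (hd.intervalIntegrable _ _), ← movingAverage_const_mul, ← movingAverage_const_mul, ← neg_one_mul,
    ← movingAverage_const_mul, ← movingAverage_add (by fun_prop) (by fun_prop)]
  simp only [movingAverage, neg_one_mul]

theorem hasDerivAt_movingAverage_wave (g : ℂ) {q : ℝ → ℂ} (hq : Continuous q) (h t k : ℝ) :
    HasDerivAt (movingAverage h fun s => wave g q s k)
      (-(I * k * movingAverage h (fun s => wave g q s k) t) + I * movingAverage h q t) t := by
  rw [← wave_increment g hq]
  exact hasDerivAt_movingAverage (continuous_wave_left g hq k) h t

/-- The averaged density of mass changes by the power of the source. -/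
theorem norm_sq_movingAverage_wave_sub (g : ℂ) {q : ℝ → ℂ} (hq : Continuous q) (h τ k : ℝ) :
    ‖movingAverage h (fun s => wave g q s k) τ‖ ^ 2 -
      ‖movingAverage h (fun s => wave g q s k) 0‖ ^ 2 =
      ∫ t in (0 : ℝ)..τ, 2 * ⟪I * movingAverage h q t,
        movingAverage h (fun s => wave g q s k) t⟫ := by
  have c1 := continuous_movingAverage (continuous_wave_left g hq k) h
  have c2 := continuous_movingAverage hq h
  rw [intervalIntegral.integral_eq_sub_of_hasDerivAt
    (f := fun t => ‖movingAverage h (fun s => wave g q s k) t‖ ^ 2)]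
  · intro t _
    refine (hasDerivAt_movingAverage_wave g hq h t k).norm_sq.congr_deriv ?_
    simp only [Complex.inner, mul_re, mul_im, add_re, add_im, neg_re, neg_im, conj_re, conj_im,
      I_re, I_im, ofReal_re, ofReal_im]
    ring
  · exact (by fun_prop : Continuous _).intervalIntegrable _ _

/-- The averaged density of energy changes by the power of the source and by the power of the
charge. -/
theorem norm_sq_movingAverage_wave_sub_div (g : ℂ) {q : ℝ → ℂ} (hq : Continuous q) (h τ : ℝ)
    {k : ℝ} (hk : 0 ≤ k) {x p : ℝ → ℂ}
    (hx : x = movingAverage h fun s => wave g q s k) (hp : p = movingAverage h q) :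
    (1 + k) * ‖x τ - p τ / (k + 1)‖ ^ 2 - (1 + k) * ‖x 0 - p 0 / (k + 1)‖ ^ 2 =
      (‖x τ‖ ^ 2 - ‖x 0‖ ^ 2) + (k + 1)⁻¹ * (‖p τ‖ ^ 2 - ‖p 0‖ ^ 2) -
      ∫ t in (0 : ℝ)..τ, 2 * ⟪(h : ℂ)⁻¹ * (q (t + h) - q t), x t⟫ := by
  have c1 : Continuous x := hx ▸ continuous_movingAverage (continuous_wave_left g hq k) h
  -- In the derivative of k|x|² - 2⟨p, x⟩ the terms in which the oscillation meets the source
  -- cancel, and only -2⟨p', x⟩ survives.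
  have key : (k * ‖x τ‖ ^ 2 - 2 * ⟪p τ, x τ⟫) - (k * ‖x 0‖ ^ 2 - 2 * ⟪p 0, x 0⟫) =
      ∫ t in (0 : ℝ)..τ, -(2 * ⟪(h : ℂ)⁻¹ * (q (t + h) - q t), x t⟫) := by
    rw [intervalIntegral.integral_eq_sub_of_hasDerivAt
      (f := fun t => k * ‖x t‖ ^ 2 - 2 * ⟪p t, x t⟫)]
    · intro t _
      have d1 : HasDerivAt x (-(I * k * x t) + I * p t) t := by
        subst hx hp
        exact hasDerivAt_movingAverage_wave g hq h t k
      have d2 : HasDerivAt p ((h : ℂ)⁻¹ * (q (t + h) - q t)) t := by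
        subst hp
        exact hasDerivAt_movingAverage hq h t
      refine ((d1.norm_sq.const_mul k).sub ((d2.inner ℝ d1).const_mul 2)).congr_deriv ?_
      simp only [Complex.inner, mul_re, mul_im, add_re, add_im, neg_re, neg_im, conj_re, conj_im,
        I_re, I_im, ofReal_re, ofReal_im]
      ring
    · exact (by fun_prop : Continuous _).intervalIntegrable _ _
  rw [intervalIntegral.integral_neg] at key
  -- Expanding the square isolates |p|²/(k+1), the only term that is logarithmically divergent when
  -- integrated over the plane.
  have expand : ∀ x p : ℂ, (1 + k) * ‖x - p / (k + 1)‖ ^ 2 =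
      (1 + k) * ‖x‖ ^ 2 - 2 * ⟪p, x⟫ + (k + 1)⁻¹ * ‖p‖ ^ 2 := by
    intro x p
    have hk1 : k + 1 ≠ 0 := by linarith
    have e : p / ((k : ℂ) + 1) = ((k + 1)⁻¹ : ℝ) • p := by
      rw [real_smul]; push_cast; rw [div_eq_inv_mul]
    rw [e, norm_sub_sq_real, real_inner_smul_right, norm_smul, mul_pow, real_inner_comm,
      Real.norm_of_nonneg (by positivity), inv_pow]
    field_simp
    ring
  rw [expand, expand]
  linarith

/-- The averaged density of energy in terms of the wave itself. -/
theorem movingAverage_wave_sub_div (g : ℂ) {q : ℝ → ℂ} (hq : Continuous q) {h : ℝ} (t : ℝ) {k : ℝ}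
    (hk : 0 ≤ k) :
    movingAverage h (fun s => wave g q s k) t - movingAverage h q t / (k + 1) =
      (movingAverage h (fun s => wave g q s k) t +
        I * ((h : ℂ)⁻¹ * (wave g q (t + h) k - wave g q t k))) / (k + 1) := by
  have hk1 : (k : ℂ) + 1 ≠ 0 := by exact_mod_cast (by linarith : k + 1 ≠ 0)
  rw [wave_increment g hq]
  field_simp
  linear_combination (k * movingAverage h (fun s => wave g q s k) t -
    movingAverage h q t) * I_sq

end PointNLS

/-! ### Waves cut off at high momenta -/

namespace PointNLS

/-- The cut-off `exp (-ε p²)` at high momenta. -/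
def cutoff (ε : ℝ) (ξ : Plane) : ℂ := Real.exp (-(ε * kinetic ξ))

theorem continuous_cutoff (ε : ℝ) : Continuous (cutoff ε) := by
  have := continuous_kinetic
  unfold cutoff
  fun_prop

theorem norm_cutoff (ε : ℝ) (ξ : Plane) : ‖cutoff ε ξ‖ = Real.exp (-(ε * kinetic ξ)) := by
  rw [cutoff, norm_real, Real.norm_of_nonneg (Real.exp_nonneg _)]

theorem norm_cutoff_le {ε : ℝ} (hε : 0 ≤ ε) (ξ : Plane) : ‖cutoff ε ξ‖ ≤ 1 := by
  rw [norm_cutoff, Real.exp_le_one_iff, neg_nonpos]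
  exact mul_nonneg hε (kinetic_nonneg ξ)

theorem integrable_cutoff {ε : ℝ} (hε : 0 < ε) : Integrable (cutoff ε) := by
  refine (integrable_comp_kinetic (f := fun k => ((Real.exp (-(ε * k)) : ℝ) : ℂ))
    (by fun_prop)).2 ?_
  have := integrableOn_exp_mul_Ioi (a := -ε) (by linarith) 0
  simp only [neg_mul] at this
  exact this.ofReal

theorem integrable_cutoff_mul {ε : ℝ} (hε : 0 ≤ ε) {φ : Plane → ℂ} (h : Integrable φ) :
    Integrable fun ξ => cutoff ε ξ * φ ξ :=
  h.bdd_mul (c := 1) (continuous_cutoff ε).aestronglyMeasurable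
    (Eventually.of_forall (norm_cutoff_le hε))

theorem integrable_cutoff_mul_of_bounded {ε : ℝ} (hε : 0 < ε) {f : Plane → ℂ}
    (hf : AEStronglyMeasurable f) {C : ℝ} (hC : ∀ ξ, ‖f ξ‖ ≤ C) :
    Integrable fun ξ => cutoff ε ξ * f ξ :=
  (integrable_cutoff hε).mul_bdd hf (Eventually.of_forall hC)

/-- The Fourier transform of an initial datum with regular part `φ` and charge `q₀`. -/
def initialWave (φ : Plane → ℂ) (q₀ : ℂ) (ξ : Plane) : ℂ := φ ξ + q₀ / (kinetic ξ + 1)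

theorem continuous_inv_kinetic_add_one :
    Continuous fun ξ : Plane => (1 : ℂ) / (kinetic ξ + 1) := by
  have := continuous_kinetic
  refine Continuous.div (by fun_prop) (by fun_prop) fun ξ => ?_
  exact_mod_cast (by linarith [kinetic_nonneg ξ] : kinetic ξ + 1 ≠ 0)

theorem aestronglyMeasurable_initialWave {φ : Plane → ℂ} (h : AEStronglyMeasurable φ) (q₀ : ℂ) :
    AEStronglyMeasurable (initialWave φ q₀) := by
  refine h.add ?_
  have := continuous_inv_kinetic_add_one.aestronglyMeasurable (μ := volume).const_mul q₀
  simpa only [mul_one_div] using this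

theorem norm_div_kinetic_add_one_le (c : ℂ) (ξ : Plane) : ‖c / (kinetic ξ + 1)‖ ≤ ‖c‖ := by
  have h := kinetic_nonneg ξ
  have e : ‖(kinetic ξ : ℂ) + 1‖ = kinetic ξ + 1 := by
    rw [← ofReal_one, ← ofReal_add, norm_real, Real.norm_of_nonneg (by linarith)]
  rw [norm_div, e]
  exact div_le_self (norm_nonneg _) (by linarith)

theorem integrable_cutoff_mul_initialWave {ε : ℝ} (hε : 0 < ε) {φ : Plane → ℂ} (h : Integrable φ)
    (q₀ : ℂ) : Integrable fun ξ => cutoff ε ξ * initialWave φ q₀ ξ := by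
  have h1 := integrable_cutoff_mul_of_bounded hε (f := fun ξ => q₀ / (kinetic ξ + 1)) (by
    have := continuous_inv_kinetic_add_one.aestronglyMeasurable (μ := volume).const_mul q₀
    simpa only [mul_one_div] using this) (norm_div_kinetic_add_one_le q₀)
  refine ((integrable_cutoff_mul hε.le h).add h1).congr (Eventually.of_forall fun ξ => ?_)
  simp only [initialWave, Pi.add_apply]
  ring

theorem integrable_cutoff_mul_sourceWave {ε : ℝ} (hε : 0 < ε) {q : ℝ → ℂ} (hq : Continuous q)
    {s : ℝ} (hs : 0 ≤ s) : Integrable fun ξ => cutoff ε ξ * sourceWave q s (kinetic ξ) := by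
  obtain ⟨C, hC⟩ := isCompact_Icc.exists_bound_of_continuousOn (s := Set.Icc 0 s) hq.continuousOn
  refine integrable_cutoff_mul_of_bounded hε ?_ (fun ξ => norm_sourceWave_le hs hC)
  exact (Continuous.comp (g := fun p : ℝ × ℝ => sourceWave q p.1 p.2) (f := fun ξ => (s, kinetic ξ))
      (continuous_sourceWave hq) (continuous_const.prodMk continuous_kinetic)).aestronglyMeasurable

/-- With the cut-off the double integral converges absolutely, and the integration over k gives 1/(ε
+ ir). -/
theorem integral_exp_neg_mul_sourceWave {ε : ℝ} (hε : 0 < ε) {q : ℝ → ℂ} (hq : Continuous q)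
    {s : ℝ} (hs : 0 ≤ s) :
    ∫ k in Set.Ioi (0 : ℝ), ((Real.exp (-(ε * k)) : ℝ) : ℂ) * sourceWave q s k =
      ∫ r in (0 : ℝ)..s, q (s - r) / (ε + I * r) := by
  have hF : Integrable (fun p : ℝ × ℝ => ((Real.exp (-(ε * p.1)) : ℝ) : ℂ) *
      (Complex.exp (-(I * p.1 * p.2)) * q (s - p.2)))
      ((volume.restrict (Set.Ioi 0)).prod (volume.restrict (Set.Ioc 0 s))) := by
    have h1 : IntegrableOn (fun k : ℝ => Real.exp (-(ε * k))) (Set.Ioi 0) := by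
      have := integrableOn_exp_mul_Ioi (a := -ε) (by linarith) 0
      simpa only [neg_mul] using this
    have h2 : IntegrableOn (fun r => q (s - r)) (Set.Ioc 0 s) :=
      (by fun_prop : Continuous fun r => q (s - r)).integrableOn_Ioc
    refine (h1.ofReal.mul_prod h2).mono (by fun_prop) (Eventually.of_forall fun p => ?_)
    rw [norm_mul, norm_mul, norm_mul, norm_exp_neg_I_mul, one_mul]
    rfl
  have hsw := integral_integral_swap (f := fun k r : ℝ => ((Real.exp (-(ε * k)) : ℝ) : ℂ) *
      (Complex.exp (-(I * k * r)) * q (s - r))) hF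
  have e1 : ∀ k : ℝ, ((Real.exp (-(ε * k)) : ℝ) : ℂ) * sourceWave q s k =
      ∫ r in Set.Ioc 0 s, ((Real.exp (-(ε * k)) : ℝ) : ℂ) *
        (Complex.exp (-(I * k * r)) * q (s - r)) := fun k => by
    rw [sourceWave, intervalIntegral.integral_of_le hs, integral_const_mul]
  simp_rw [e1]
  rw [hsw, intervalIntegral.integral_of_le hs]
  refine setIntegral_congr_fun measurableSet_Ioc fun r _ => ?_
  have hre : (-(ε + I * r : ℂ)).re < 0 := by simpa using hε
  have h3 := integral_exp_mul_complex_Ioi hre 0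
  have e2 : ∀ k : ℝ, ((Real.exp (-(ε * k)) : ℝ) : ℂ) * (Complex.exp (-(I * k * r)) * q (s - r)) =
      Complex.exp (-(ε + I * r) * k) * q (s - r) := fun k => by
    rw [ofReal_exp, ← mul_assoc, ← Complex.exp_add]
    congr 2
    push_cast
    ring
  simp_rw [e2]
  rw [integral_mul_const, h3]
  simp only [ofReal_zero, mul_zero, Complex.exp_zero]
  rw [neg_div_neg_eq]
  ring

/-- The trace at the origin of the wave, cut off at high momenta. -/
theorem integral_cutoff_mul_wave {ε : ℝ} (hε : 0 < ε) {φ : Plane → ℂ} (h : Integrable φ) (q₀ : ℂ)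
    {q : ℝ → ℂ} (hq : Continuous q) {s : ℝ} (hs : 0 ≤ s) :
    4 * Real.pi * ∫ ξ, cutoff ε ξ * wave (initialWave φ q₀ ξ) q s (kinetic ξ) =
      4 * Real.pi * freeTrace (fun ξ => cutoff ε ξ * φ ξ) s +
      q₀ * scaledExpIntegral (ε + I * s) + ∫ r in (0 : ℝ)..s, q (s - r) * (I / (ε + I * r)) := by
  have hre : 0 < (ε + I * s : ℂ).re := by simpa using hε
  obtain ⟨hi2, he2⟩ := integral_exp_neg_mul_div_add_one hre
  have hm2 : Measurable fun k : ℝ => Complex.exp (-(ε + I * s : ℂ) * k) / (k + 1) := by fun_prop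
  have hI2 := (integrable_comp_kinetic hm2).2 hi2
  have h1 := integrable_oscillation_mul (integrable_cutoff_mul hε.le h) s
  have h3 := integrable_cutoff_mul_sourceWave hε hq hs
  have hm3 : Measurable fun k : ℝ => ((Real.exp (-(ε * k)) : ℝ) : ℂ) * sourceWave q s k := by
    have : Continuous fun k : ℝ => sourceWave q s k :=
      Continuous.comp (g := fun p : ℝ × ℝ => sourceWave q p.1 p.2) (f := fun k => (s, k))
        (continuous_sourceWave hq) (by fun_prop)
    fun_prop
  have e : ∀ ξ, cutoff ε ξ * wave (initialWave φ q₀ ξ) q s (kinetic ξ) =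
      Complex.exp (-(I * kinetic ξ * s)) * (cutoff ε ξ * φ ξ) +
      q₀ * (Complex.exp (-(ε + I * s : ℂ) * kinetic ξ) / (kinetic ξ + 1)) +
      I * (cutoff ε ξ * sourceWave q s (kinetic ξ)) := fun ξ => by
    have : Complex.exp (-(ε + I * s : ℂ) * kinetic ξ) =
        cutoff ε ξ * Complex.exp (-(I * kinetic ξ * s)) := by
      rw [cutoff, ofReal_exp, ← Complex.exp_add]
      congr 1
      push_cast
      ring
    rw [this, wave, initialWave]
    ring
  simp_rw [e]
  have hp : (4 * Real.pi : ℂ) ≠ 0 := by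
    simp [Real.pi_ne_zero]
  have e2 : ∫ ξ : Plane, Complex.exp (-(ε + I * s : ℂ) * kinetic ξ) / (kinetic ξ + 1) =
      (1 / (4 * Real.pi) : ℝ) * scaledExpIntegral (ε + I * s) := by
    rw [← he2]
    exact integral_comp_kinetic hm2
  have e3 : ∫ ξ : Plane, cutoff ε ξ * sourceWave q s (kinetic ξ) =
      (1 / (4 * Real.pi) : ℝ) * ∫ r in (0 : ℝ)..s, q (s - r) / (ε + I * r) := by
    rw [← integral_exp_neg_mul_sourceWave hε hq hs]
    exact integral_comp_kinetic hm3
  have e5 : ∫ ξ : Plane, Complex.exp (-(I * kinetic ξ * s)) * (cutoff ε ξ * φ ξ) =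
    freeTrace (fun ξ => cutoff ε ξ * φ ξ) s := rfl
  have h12 : Integrable fun ξ : Plane => Complex.exp (-(I * kinetic ξ * s)) * (cutoff ε ξ * φ ξ) +
      q₀ * (Complex.exp (-(ε + I * s : ℂ) * kinetic ξ) / (kinetic ξ + 1)) :=
    h1.add (hI2.const_mul q₀)
  rw [integral_add h12 (h3.const_mul I), integral_add h1 (hI2.const_mul q₀),
    integral_const_mul, integral_const_mul, e2, e3, e5]
  have e4 : ∫ r in (0 : ℝ)..s, q (s - r) * (I / (ε + I * r)) =
      I * ∫ r in (0 : ℝ)..s, q (s - r) / (ε + I * r) := by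
    rw [← intervalIntegral.integral_const_mul]
    refine intervalIntegral.integral_congr fun r _ => ?_
    ring
  rw [e4]
  push_cast
  field_simp

/-- Fubini on the triangle r ≤ s: integrating a convolution in time replaces its kernel by a
primitive. It is used to replace i/(ε + ir), which becomes singular as ε → 0, by a logarithm. -/
theorem intervalIntegral_convolution {f k K : ℝ → ℂ} (hf : Continuous f) (hk : Continuous k)
    (hK : ∀ u, K u = ∫ r in (0 : ℝ)..u, k r) {t : ℝ} (ht : 0 ≤ t) :
    ∫ s in (0 : ℝ)..t, ∫ r in (0 : ℝ)..s, f (s - r) * k r = ∫ r in (0 : ℝ)..t, f r * K (t - r) := by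
  set S : Set (ℝ × ℝ) := {p | p.2 ≤ p.1} with hS
  have hSm : MeasurableSet S := measurableSet_le measurable_snd measurable_fst
  set F : ℝ → ℝ → ℂ := fun s r => S.indicator (fun p => f p.2 * k (p.1 - p.2)) (s, r) with hF
  have hcont : Continuous fun p : ℝ × ℝ => f p.2 * k (p.1 - p.2) := by fun_prop
  have hFi : Integrable (Function.uncurry F)
      ((volume.restrict (Set.Ioc 0 t)).prod (volume.restrict (Set.Ioc 0 t))) := by
    have : Integrable (fun p : ℝ × ℝ => f p.2 * k (p.1 - p.2))
        ((volume.restrict (Set.Ioc 0 t)).prod (volume.restrict (Set.Ioc 0 t))) := by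
      rw [Measure.prod_restrict]
      have hc : IntegrableOn (fun p : ℝ × ℝ => f p.2 * k (p.1 - p.2))
          (Set.Icc 0 t ×ˢ Set.Icc 0 t) (volume.prod volume) :=
        hcont.continuousOn.integrableOn_compact (isCompact_Icc.prod isCompact_Icc)
      exact hc.mono_set (Set.prod_mono Set.Ioc_subset_Icc_self Set.Ioc_subset_Icc_self)
    exact this.indicator hSm
  have h1 : ∀ s ∈ Set.Ioc 0 t, ∫ r in (0 : ℝ)..s, f (s - r) * k r = ∫ r in Set.Ioc 0 t, F s r := by
    intro s hs
    have e := intervalIntegral.integral_comp_sub_left (a := 0) (b := s)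
      (fun r => f r * k (s - r)) s
    simp only [sub_sub_cancel, sub_self, sub_zero] at e
    rw [e, intervalIntegral.integral_of_le hs.1.le, ← integral_indicator measurableSet_Ioc,
      ← integral_indicator measurableSet_Ioc]
    congr 1
    ext r
    by_cases h1 : r ∈ Set.Ioc 0 s
    · rw [Set.indicator_of_mem h1, Set.indicator_of_mem (show r ∈ Set.Ioc 0 t from
        ⟨h1.1, h1.2.trans hs.2⟩)]
      simp only [hF]
      rw [Set.indicator_of_mem (show (s, r) ∈ S from h1.2)]
    · rw [Set.indicator_of_notMem h1]
      by_cases h2 : r ∈ Set.Ioc 0 t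
      · rw [Set.indicator_of_mem h2]
        simp only [hF]
        rw [Set.indicator_of_notMem (show (s, r) ∉ S from fun h => h1 ⟨h2.1, h⟩)]
      · rw [Set.indicator_of_notMem h2]
  have h2 : ∀ r ∈ Set.Ioc 0 t, ∫ s in Set.Ioc 0 t, F s r = f r * K (t - r) := by
    intro r hr
    have e := intervalIntegral.integral_comp_sub_right (a := r) (b := t) (fun s => k s) r
    simp only [sub_self] at e
    rw [hK, ← e, ← intervalIntegral.integral_const_mul, intervalIntegral.integral_of_le hr.2,
      ← integral_Icc_eq_integral_Ioc (x := r) (y := t), ← integral_indicator measurableSet_Icc,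
      ← integral_indicator measurableSet_Ioc]
    congr 1
    ext s
    by_cases h1 : s ∈ Set.Icc r t
    · rw [Set.indicator_of_mem h1, Set.indicator_of_mem (show s ∈ Set.Ioc 0 t from
        ⟨hr.1.trans_le h1.1, h1.2⟩)]
      simp only [hF]
      rw [Set.indicator_of_mem (show (s, r) ∈ S from h1.1)]
    · rw [Set.indicator_of_notMem h1]
      by_cases h2 : s ∈ Set.Ioc 0 t
      · rw [Set.indicator_of_mem h2]
        simp only [hF]
        rw [Set.indicator_of_notMem (show (s, r) ∉ S from fun h => h1 ⟨h, h2.2⟩)]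
      · rw [Set.indicator_of_notMem h2]
  rw [intervalIntegral.integral_of_le ht, setIntegral_congr_fun measurableSet_Ioc h1,
    integral_integral_swap hFi, intervalIntegral.integral_of_le ht,
    setIntegral_congr_fun measurableSet_Ioc h2]

/-- The term -log ε is precisely the divergence that `renormalizedTrace` removes. -/
theorem integral_I_div_add {ε : ℝ} (hε : 0 < ε) (u : ℝ) :
    ∫ r in (0 : ℝ)..u, I / (ε + I * r) = Complex.log (ε + I * u) - Real.log ε := by
  have hs : ∀ r : ℝ, (ε + I * r : ℂ) ∈ slitPlane := fun r => Or.inl (by simpa using hε)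
  have hd : ∀ r : ℝ, HasDerivAt (fun r : ℝ => Complex.log (ε + I * r)) (I / (ε + I * r)) r := by
    intro r
    have : HasDerivAt (fun r : ℝ => (ε + I * r : ℂ)) I r := by
      simpa using ((hasDerivAt_id r).ofReal_comp.const_mul I).const_add (ε : ℂ)
    exact this.clog_real (hs r)
  have hc : Continuous fun r : ℝ => I / (ε + I * r : ℂ) :=
    Continuous.div (by fun_prop) (by fun_prop) fun r => slitPlane_ne_zero (hs r)
  rw [intervalIntegral.integral_eq_sub_of_hasDerivAt (fun r _ => hd r) (hc.intervalIntegrable _ _),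
    ofReal_zero, mul_zero, add_zero, ofReal_log hε.le]

end PointNLS

/-! ### The charge equation as a boundary condition at the origin -/

namespace PointNLS

variable {β₀ σ T : ℝ} {φ : Plane → ℂ} {q₀ : ℂ} {q : ℝ → ℂ}

theorem aestronglyMeasurable_cutoff_mul_wave {g : Plane → ℂ} (hg : AEStronglyMeasurable g)
    (hq : Continuous q) (ε : ℝ) (μ : Measure ℝ) [SFinite μ] :
    AEStronglyMeasurable (fun p : Plane × ℝ => cutoff ε p.1 * wave (g p.1) q p.2 (kinetic p.1))
      (volume.prod μ) := by
  have hk := continuous_kinetic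
  have h1 : Continuous fun p : Plane × ℝ => sourceWave q p.2 (kinetic p.1) :=
    Continuous.comp (g := fun p : ℝ × ℝ => sourceWave q p.1 p.2)
      (f := fun p : Plane × ℝ => (p.2, kinetic p.1)) (continuous_sourceWave hq) (by fun_prop)
  have h2 : Continuous fun p : Plane × ℝ => cutoff ε p.1 := (continuous_cutoff ε).comp continuous_fst
  exact h2.aestronglyMeasurable.mul ((continuous_oscillation.aestronglyMeasurable.mul
    hg.comp_fst).add (h1.const_smul I).aestronglyMeasurable)

/-- The time integral of the trace at the origin of the wave, cut off at high momenta. -/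
def cutoffTrace (φ : Plane → ℂ) (q₀ : ℂ) (q : ℝ → ℂ) (ε t : ℝ) : ℂ :=
  ∫ ξ, cutoff ε ξ * ∫ s in (0 : ℝ)..t, wave (initialWave φ q₀ ξ) q s (kinetic ξ)

theorem integrable_cutoff_mul_wave {ε : ℝ} (hε : 0 < ε) (h : Integrable φ) (q₀ : ℂ)
    (hq : Continuous q) {t : ℝ} (ht : 0 ≤ t) :
    Integrable (fun p : Plane × ℝ => cutoff ε p.1 *
      wave (initialWave φ q₀ p.1) q p.2 (kinetic p.1))
      (volume.prod (volume.restrict (Set.Ioc 0 t))) := by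
  obtain ⟨C, hC⟩ := isCompact_Icc.exists_bound_of_continuousOn (s := Set.Icc 0 t) hq.continuousOn
  have hC0 : 0 ≤ C := (norm_nonneg _).trans (hC 0 ⟨le_rfl, ht⟩)
  have h1 : Integrable fun ξ => ‖cutoff ε ξ‖ * (‖initialWave φ q₀ ξ‖ + C * t) := by
    have := (integrable_cutoff_mul_initialWave hε h q₀).norm.add
      ((integrable_cutoff hε).norm.mul_const (C * t))
    refine this.congr (Eventually.of_forall fun ξ => ?_)
    simp only [Pi.add_apply, norm_mul]; ring
  have h2 : IntegrableOn (fun _ : ℝ => (1 : ℝ)) (Set.Ioc 0 t) :=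
    integrableOn_const measure_Ioc_lt_top.ne
  refine (h1.mul_prod h2).mono' (aestronglyMeasurable_cutoff_mul_wave
    (aestronglyMeasurable_initialWave h.aestronglyMeasurable q₀) hq ε _) ?_
  have hae : ∀ᵐ p : Plane × ℝ ∂(volume.prod (volume.restrict (Set.Ioc 0 t))), p.2 ∈ Set.Ioc 0 t :=
    Measure.quasiMeasurePreserving_snd.ae (ae_restrict_mem measurableSet_Ioc)
  filter_upwards [hae] with p hp
  rw [norm_mul, mul_one]
  gcongr
  refine (norm_wave_le _ hp.1.le fun s hs => hC s ⟨hs.1, hs.2.trans hp.2⟩).trans ?_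
  gcongr
  exact hp.2

theorem cutoffTrace_eq_integral {ε : ℝ} (hε : 0 < ε) (h : Integrable φ) (q₀ : ℂ)
    (hq : Continuous q) {t : ℝ} (ht : 0 ≤ t) :
    cutoffTrace φ q₀ q ε t =
      ∫ s in (0 : ℝ)..t, ∫ ξ, cutoff ε ξ * wave (initialWave φ q₀ ξ) q s (kinetic ξ) := by
  rw [intervalIntegral.integral_of_le ht,
    ← integral_integral_swap (f := fun ξ s => cutoff ε ξ * wave (initialWave φ q₀ ξ) q s (kinetic ξ))
      (integrable_cutoff_mul_wave hε h q₀ hq ht), cutoffTrace]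
  refine integral_congr_ae (Eventually.of_forall fun ξ => ?_)
  simp only
  rw [intervalIntegral.integral_of_le ht, integral_const_mul]

theorem intervalIntegrable_scaledExpIntegral {ε : ℝ} (hε : 0 ≤ ε) {t : ℝ} (ht : 0 ≤ t) :
    IntervalIntegrable (fun s : ℝ => scaledExpIntegral (ε + I * s)) volume 0 t := by
  rw [intervalIntegrable_iff_integrableOn_Ioc_of_le ht]
  have h := (intervalIntegrable_iff_integrableOn_Ioc_of_le ht).1
    (intervalIntegral.intervalIntegrable_rpow' (a := 0) (b := t) (r := -(1 / 2)) (by norm_num))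
  refine (h.const_mul (Real.Gamma (1 / 2))).mono'
    (measurable_scaledExpIntegral.comp (by fun_prop)).aestronglyMeasurable ?_
  filter_upwards [ae_restrict_mem measurableSet_Ioc] with s hs
  have hz : s ≤ ‖(ε + I * s : ℂ)‖ := by
    have := abs_im_le_norm (ε + I * s : ℂ)
    simp only [add_im, ofReal_im, mul_im, I_re, I_im, ofReal_re, zero_mul, one_mul, zero_add] at this
    exact (le_abs_self s).trans this
  have hs0 := hs.1
  refine (norm_scaledExpIntegral_le (by simpa using hε) ?_).trans ?_
  · rw [← norm_pos_iff]; linarith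
  · gcongr ?_ * ?_
    exact Real.rpow_le_rpow_of_nonpos hs0 hz (by norm_num)

theorem norm_scaledExpIntegral_add_le {ε s : ℝ} (hε : 0 ≤ ε) (hs : 0 < s) :
    ‖scaledExpIntegral (ε + I * s)‖ ≤ Real.Gamma (1 / 2) * s ^ (-(1 / 2) : ℝ) := by
  have hz : s ≤ ‖(ε + I * s : ℂ)‖ := by
    have := abs_im_le_norm (ε + I * s : ℂ)
    simp only [add_im, ofReal_im, mul_im, I_re, I_im, ofReal_re, zero_mul, one_mul, zero_add] at this
    exact (le_abs_self s).trans this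
  refine (norm_scaledExpIntegral_le (by simpa using hε) ?_).trans ?_
  · rw [← norm_pos_iff]; linarith
  · gcongr ?_ * ?_
    exact Real.rpow_le_rpow_of_nonpos hs hz (by norm_num)

/-- From u ≤ |ε + iu| ≤ 1 + T; the bound does not depend on ε, so an integrable logarithm dominates
the whole family. -/
theorem norm_log_add_I_mul_le {ε u T : ℝ} (hε : ε ∈ Set.Icc 0 1) (hu : u ∈ Set.Ioc 0 T) :
    ‖Complex.log (ε + I * u)‖ ≤ |Real.log u| + T + Real.pi := by
  have hz : u ≤ ‖(ε + I * u : ℂ)‖ := by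
    have := abs_im_le_norm (ε + I * u : ℂ)
    simp only [add_im, ofReal_im, mul_im, I_re, I_im, ofReal_re, zero_mul, one_mul, zero_add] at this
    exact (le_abs_self u).trans this
  have hz2 : ‖(ε + I * u : ℂ)‖ ≤ 1 + T := by
    refine (norm_add_le _ _).trans ?_
    rw [norm_mul, norm_I, one_mul, norm_real, norm_real, Real.norm_of_nonneg hε.1,
      Real.norm_of_nonneg hu.1.le]
    exact add_le_add hε.2 hu.2
  have hpos : 0 < ‖(ε + I * u : ℂ)‖ := hu.1.trans_le hz
  refine (norm_le_abs_re_add_abs_im _).trans (add_le_add ?_ ?_)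
  · rw [log_re, abs_le]
    constructor
    · have := Real.log_le_log hu.1 hz
      linarith [neg_abs_le (Real.log u), hu.1, hu.2]
    · have := Real.log_le_sub_one_of_pos hpos
      linarith [abs_nonneg (Real.log u)]
  · rw [log_im]; exact abs_arg_le_pi _

/-- The renormalised trace at the origin of the wave. -/
def renormalizedTrace (φ : Plane → ℂ) (q₀ : ℂ) (q : ℝ → ℂ) (ε t : ℝ) : ℂ :=
  4 * Real.pi * cutoffTrace φ q₀ q ε t + Real.log ε * ∫ s in (0 : ℝ)..t, q s

/-- Integration in time turns the kernel i/(ε + ir) into log(ε + iu) - log ε, and the added term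
cancels log ε. This is why the trace is integrated in time: i/(ir) is not integrable at r = 0,
whereas its primitive is. -/
theorem renormalizedTrace_eq {ε : ℝ} (hε : 0 < ε) (h : Integrable φ) (q₀ : ℂ)
    (hq : Continuous q) {t : ℝ} (ht : 0 ≤ t) :
    renormalizedTrace φ q₀ q ε t =
      (∫ s in (0 : ℝ)..t, (4 * Real.pi * freeTrace (fun ξ => cutoff ε ξ * φ ξ) s +
        q₀ * scaledExpIntegral (ε + I * s))) +
      ∫ s in (0 : ℝ)..t, q s * Complex.log (ε + I * (t - s : ℝ)) := by
  have hne : ∀ r : ℝ, (ε + I * r : ℂ) ∈ slitPlane := fun r => Or.inl (by simpa using hε)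
  have hk : Continuous fun r : ℝ => I / (ε + I * r : ℂ) :=
    Continuous.div (by fun_prop) (by fun_prop) fun r => slitPlane_ne_zero (hne r)
  have hconv := intervalIntegral_convolution hq hk
    (K := fun u => Complex.log (ε + I * u) - Real.log ε)
    (fun u => (integral_I_div_add hε u).symm) ht
  have hf := continuous_freeTrace (integrable_cutoff_mul hε.le h)
  have he := intervalIntegrable_scaledExpIntegral hε.le ht
  have hi1 : IntervalIntegrable (fun s => 4 * Real.pi * freeTrace (fun ξ => cutoff ε ξ * φ ξ) s +
      q₀ * scaledExpIntegral (ε + I * s)) volume 0 t :=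
    ((by fun_prop : Continuous fun s => 4 * Real.pi *
      freeTrace (fun ξ => cutoff ε ξ * φ ξ) s).intervalIntegrable 0 t).add (he.const_mul q₀)
  have hcs : Continuous fun s : ℝ => ∫ r in (0 : ℝ)..s, q (s - r) * (I / (ε + I * r)) :=
    intervalIntegral.continuous_parametric_intervalIntegral_of_continuous
      (f := fun s r : ℝ => q (s - r) * (I / (ε + I * r))) (by
        have := hk.comp continuous_snd (X := ℝ × ℝ)
        simp only [Function.comp_def] at this
        simp only [Function.uncurry_def]
        fun_prop) continuous_id
  have hlogc : Continuous fun s : ℝ => Complex.log (ε + I * (t - s : ℝ)) :=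
    Continuous.clog (by fun_prop) fun s => hne _
  rw [renormalizedTrace, cutoffTrace_eq_integral hε h q₀ hq ht,
    ← intervalIntegral.integral_const_mul]
  have e1 : ∫ s in (0 : ℝ)..t, 4 * Real.pi *
      ∫ ξ, cutoff ε ξ * wave (initialWave φ q₀ ξ) q s (kinetic ξ) =
      ∫ s in (0 : ℝ)..t, ((4 * Real.pi * freeTrace (fun ξ => cutoff ε ξ * φ ξ) s +
      q₀ * scaledExpIntegral (ε + I * s)) + ∫ r in (0 : ℝ)..s, q (s - r) * (I / (ε + I * r))) := by
    refine intervalIntegral.integral_congr fun s hs => ?_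
    rw [Set.uIcc_of_le ht] at hs
    exact integral_cutoff_mul_wave hε h q₀ hq hs.1
  rw [e1, intervalIntegral.integral_add hi1 (hcs.intervalIntegrable _ _), hconv, add_assoc]
  congr 1
  rw [← intervalIntegral.integral_const_mul, ← intervalIntegral.integral_add]
  · refine intervalIntegral.integral_congr fun s _ => ?_
    ring
  · exact (by fun_prop : Continuous _).intervalIntegrable _ _
  · exact (by fun_prop : Continuous _).intervalIntegrable _ _

theorem integrableOn_abs_log_sub {t : ℝ} (ht : 0 ≤ t) :
    IntegrableOn (fun s => |Real.log (t - s)|) (Set.Ioc 0 t) := by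
  have h := ((intervalIntegral.intervalIntegrable_log' (a := 0) (b := t)).comp_sub_left t).symm
  simp only [sub_zero, sub_self] at h
  exact ((intervalIntegrable_iff_integrableOn_Ioc_of_le ht).1 h).abs

/-- Uniformity in both ε and t is what allows dominated convergence in time when the cut-off is
removed in `IsChargeSolution.tendsto_power`. -/
theorem exists_norm_renormalizedTrace_le (h : Integrable φ) (q₀ : ℂ) (hq : Continuous q)
    (hT : 0 ≤ T) : ∃ C, ∀ ε ∈ Set.Ioc (0 : ℝ) 1, ∀ t ∈ Set.Icc 0 T,
      ‖renormalizedTrace φ q₀ q ε t‖ ≤ C := by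
  obtain ⟨R, hR⟩ := isCompact_Icc.exists_bound_of_continuousOn (s := Set.Icc 0 T) hq.continuousOn
  have hR0 : 0 ≤ R := (norm_nonneg _).trans (hR 0 ⟨le_rfl, hT⟩)
  set b : ℝ → ℝ := fun s => 4 * Real.pi * (∫ ξ, ‖φ ξ‖) +
    ‖q₀‖ * (Real.Gamma (1 / 2) * s ^ (-(1 / 2) : ℝ)) with hb
  set c : ℝ → ℝ := fun u => R * (|Real.log u| + T + Real.pi) with hc
  have hbi : IntervalIntegrable b volume 0 T := intervalIntegrable_const.add
    (((intervalIntegral.intervalIntegrable_rpow' (by norm_num)).const_mul _).const_mul _)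
  have hci : IntervalIntegrable c volume 0 T :=
    ((intervalIntegral.intervalIntegrable_log'.abs.add intervalIntegrable_const).add
      intervalIntegrable_const).const_mul _
  have hb0 : ∀ s ∈ Set.Ioc 0 T, 0 ≤ b s := fun s hs => by
    have := Real.rpow_nonneg hs.1.le (-(1 / 2) : ℝ)
    have := Real.Gamma_pos_of_pos (show (0 : ℝ) < 1 / 2 by norm_num)
    have : 0 ≤ ∫ ξ, ‖φ ξ‖ := integral_nonneg fun _ => norm_nonneg _
    have := Real.pi_pos
    simp only [hb]
    positivity
  have hc0 : ∀ s ∈ Set.Ioc 0 T, 0 ≤ c s := fun s hs => by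
    have := Real.pi_pos
    simp only [hc]; positivity
  refine ⟨(∫ s in (0 : ℝ)..T, b s) + ∫ s in (0 : ℝ)..T, c s, fun ε hε t ht => ?_⟩
  have hsub : Set.uIcc 0 t ⊆ Set.uIcc 0 T := by
    rw [Set.uIcc_of_le ht.1, Set.uIcc_of_le hT]; exact Set.Icc_subset_Icc_right ht.2
  have hmono : ∀ f : ℝ → ℝ, (∀ s ∈ Set.Ioc 0 T, 0 ≤ f s) → IntervalIntegrable f volume 0 T →
      ∫ s in (0 : ℝ)..t, f s ≤ ∫ s in (0 : ℝ)..T, f s := fun f hf hfi => by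
    refine intervalIntegral.integral_mono_interval le_rfl ht.1 ht.2 ?_ hfi
    filter_upwards [ae_restrict_mem measurableSet_Ioc] with s hs
    exact hf s hs
  rw [renormalizedTrace_eq hε.1 h q₀ hq ht.1]
  refine (norm_add_le _ _).trans (add_le_add ?_ ?_)
  · refine le_trans ?_ (hmono b hb0 hbi)
    refine intervalIntegral.norm_integral_le_of_norm_le ht.1 (Eventually.of_forall fun s hs => ?_)
      (hbi.mono_set hsub)
    refine (norm_add_le _ _).trans (add_le_add ?_ ?_)
    · rw [norm_mul, norm_mul, norm_real, Real.norm_of_nonneg Real.pi_pos.le]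
      norm_num
      gcongr
      refine (norm_freeTrace_le _ _).trans
        (integral_mono (integrable_cutoff_mul hε.1.le h).norm h.norm fun ξ => ?_)
      simp only [norm_mul]
      exact mul_le_of_le_one_left (norm_nonneg _) (norm_cutoff_le hε.1.le ξ)
    · rw [norm_mul]
      gcongr
      exact norm_scaledExpIntegral_add_le hε.1.le hs.1
  · refine le_trans ?_ (hmono c hc0 hci)
    have e := intervalIntegral.integral_comp_sub_left (a := 0) (b := t) c t
    rw [sub_self, sub_zero] at e
    rw [← e]
    have hci2 := ((hci.mono_set hsub).comp_sub_left t).symm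
    rw [sub_self, sub_zero] at hci2
    refine intervalIntegral.norm_integral_le_of_norm_le ht.1 ?_ hci2
    have hne : ∀ᵐ s : ℝ, s ≠ t := by simp [ae_iff, measure_singleton]
    filter_upwards [hne] with s hst hs
    rw [norm_mul]
    simp only [hc]
    gcongr
    · exact hR s ⟨hs.1.le, hs.2.trans ht.2⟩
    · exact norm_log_add_I_mul_le ⟨hε.1.le, hε.2⟩
        ⟨sub_pos.2 (lt_of_le_of_ne hs.2 hst), by linarith [hs.1, ht.2]⟩

/-- The charge equation, as a boundary condition for the wave. -/
theorem IsChargeSolution.tendsto_renormalizedTrace (H : IsChargeSolution β₀ σ φ q₀ q T) {t : ℝ}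
    (ht : t ∈ Set.Icc 0 T) :
    Tendsto (fun ε => renormalizedTrace φ q₀ q ε t) (𝓝[>] 0)
      (𝓝 (∫ s in (0 : ℝ)..t, chargeForce β₀ σ (q s))) := by
  have h := H.integrable
  have hq := H.cont
  have hf := continuous_freeTrace h
  have hev : ∀ᶠ ε : ℝ in 𝓝[>] 0, ε ∈ Set.Ioc (0 : ℝ) 1 := Ioc_mem_nhdsGT one_pos
  rcases eq_or_lt_of_le ht.1 with rfl | ht0
  · simp [renormalizedTrace, cutoffTrace]
  obtain ⟨R, hR⟩ := H.exists_norm_le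
  have hR0 : 0 ≤ R := (norm_nonneg _).trans (hR 0 ⟨le_rfl, H.pos.le⟩)
  have he := intervalIntegrable_scaledExpIntegral le_rfl ht0.le
  have hlog : IntervalIntegrable (fun s => q s * Complex.log (I * (t - s : ℝ))) volume 0 t := by
    rw [intervalIntegrable_iff_integrableOn_Ioc_of_le ht0.le]
    refine Integrable.mono' (((integrableOn_abs_log_sub ht0.le).add
      (integrableOn_const (C := T + Real.pi) measure_Ioc_lt_top.ne)).const_mul R)
      (by have := hq.measurable; fun_prop) ?_
    have hne : ∀ᵐ s : ℝ, s ≠ t := by simp [ae_iff, measure_singleton]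
    filter_upwards [ae_restrict_mem measurableSet_Ioc, ae_restrict_of_ae hne] with s hs hst
    rw [norm_mul]
    have h2 := norm_log_add_I_mul_le (ε := 0) (T := T) (u := t - s) ⟨le_rfl, zero_le_one⟩
      ⟨sub_pos.2 (lt_of_le_of_ne hs.2 hst), by linarith [hs.1, ht.2]⟩
    rw [ofReal_zero, zero_add] at h2
    simp only [Pi.add_apply]
    rw [← add_assoc]
    gcongr
    exact hR s ⟨hs.1.le, hs.2.trans ht.2⟩
  have lim1 : Tendsto (fun ε : ℝ => ∫ s in (0 : ℝ)..t,
      (4 * Real.pi * freeTrace (fun ξ => cutoff ε ξ * φ ξ) s + q₀ * scaledExpIntegral (ε + I * s)))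
      (𝓝[>] 0) (𝓝 (∫ s in (0 : ℝ)..t,
        (4 * Real.pi * freeTrace φ s + q₀ * scaledExpIntegral (I * s)))) := by
    refine intervalIntegral.tendsto_integral_filter_of_dominated_convergence
      (fun s => 4 * Real.pi * (∫ ξ, ‖φ ξ‖) + ‖q₀‖ * (Real.Gamma (1 / 2) * s ^ (-(1 / 2) : ℝ)))
      ?_ ?_ ?_ ?_
    · filter_upwards [hev] with ε hε
      have h1 := (continuous_freeTrace (integrable_cutoff_mul hε.1.le h)).measurable
      have h2 := measurable_scaledExpIntegral
      exact Measurable.aestronglyMeasurable (by fun_prop)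
    · filter_upwards [hev] with ε hε
      refine Eventually.of_forall fun s hs => ?_
      rw [Set.uIoc_of_le ht0.le] at hs
      refine (norm_add_le _ _).trans (add_le_add ?_ ?_)
      · rw [norm_mul, norm_mul, norm_real, Real.norm_of_nonneg Real.pi_pos.le]
        norm_num
        gcongr
        refine (norm_freeTrace_le _ _).trans
          (integral_mono (integrable_cutoff_mul hε.1.le h).norm h.norm fun ξ => ?_)
        simp only [norm_mul]
        exact mul_le_of_le_one_left (norm_nonneg _) (norm_cutoff_le hε.1.le ξ)
      · rw [norm_mul]
        gcongr
        exact norm_scaledExpIntegral_add_le hε.1.le hs.1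
    · exact intervalIntegrable_const.add
        (((intervalIntegral.intervalIntegrable_rpow' (by norm_num)).const_mul _).const_mul _)
    · refine Eventually.of_forall fun s hs => ?_
      rw [Set.uIoc_of_le ht0.le] at hs
      refine Tendsto.add (Tendsto.const_mul _ ?_) ((tendsto_scaledExpIntegral hs.1).const_mul _)
      refine tendsto_integral_filter_of_dominated_convergence (fun ξ => ‖φ ξ‖) ?_ ?_ h.norm ?_
      · filter_upwards [hev] with ε hε
        exact (integrable_oscillation_mul (integrable_cutoff_mul hε.1.le h) s).aestronglyMeasurable
      · filter_upwards [hev] with ε hε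
        refine Eventually.of_forall fun ξ => ?_
        rw [norm_mul, norm_exp_neg_I_mul, one_mul, norm_mul]
        exact mul_le_of_le_one_left (norm_nonneg _) (norm_cutoff_le hε.1.le ξ)
      · refine Eventually.of_forall fun ξ => ?_
        have hc : Continuous fun ε : ℝ => Complex.exp (-(I * kinetic ξ * s)) * (cutoff ε ξ * φ ξ) := by
          unfold cutoff; fun_prop
        have := (hc.tendsto 0).mono_left (nhdsWithin_le_nhds (s := Set.Ioi 0))
        simpa [cutoff] using this
  have lim2 : Tendsto (fun ε : ℝ => ∫ s in (0 : ℝ)..t, q s * Complex.log (ε + I * (t - s : ℝ)))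
      (𝓝[>] 0) (𝓝 (∫ s in (0 : ℝ)..t, q s * Complex.log (I * (t - s : ℝ)))) := by
    have hne : ∀ᵐ s : ℝ, s ≠ t := by simp [ae_iff, measure_singleton]
    refine intervalIntegral.tendsto_integral_filter_of_dominated_convergence
      (fun s => R * (|Real.log (t - s)| + (T + Real.pi))) ?_ ?_ ?_ ?_
    · have := hq.measurable
      exact Eventually.of_forall fun ε => Measurable.aestronglyMeasurable (by fun_prop)
    · filter_upwards [hev] with ε hε
      filter_upwards [hne] with s hst hs
      rw [Set.uIoc_of_le ht0.le] at hs
      rw [norm_mul, ← add_assoc]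
      gcongr
      · exact hR s ⟨hs.1.le, hs.2.trans ht.2⟩
      · exact norm_log_add_I_mul_le ⟨hε.1.le, hε.2⟩
          ⟨sub_pos.2 (lt_of_le_of_ne hs.2 hst), by linarith [hs.1, ht.2]⟩
    · rw [intervalIntegrable_iff_integrableOn_Ioc_of_le ht0.le]
      exact ((integrableOn_abs_log_sub ht0.le).add
        (integrableOn_const measure_Ioc_lt_top.ne)).const_mul R
    · filter_upwards [hne] with s hst hs
      rw [Set.uIoc_of_le ht0.le] at hs
      have hpos : 0 < t - s := sub_pos.2 (lt_of_le_of_ne hs.2 hst)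
      have hsl : ((0 : ℝ) + I * (t - s : ℝ) : ℂ) ∈ slitPlane := by
        refine Or.inr ?_
        simp only [add_im, ofReal_im, mul_im, I_re, I_im, ofReal_re]
        linarith
      have hc : ContinuousAt (fun ε : ℝ => q s * Complex.log (ε + I * (t - s : ℝ))) 0 := by
        refine continuousAt_const.mul (ContinuousAt.clog (by fun_prop) hsl)
      have := hc.tendsto.mono_left (nhdsWithin_le_nhds (s := Set.Ioi 0))
      simpa using this
  have hlim := lim1.add lim2
  -- This is the charge equation with its kernel inverted. As log(iu) = log u + iπ/2, the term (iπ/2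
  -- - γ)q combines with the Sonine kernel -γ - log u to -log(iu)·q.
  have hval : (∫ s in (0 : ℝ)..t, (4 * Real.pi * freeTrace φ s + q₀ * scaledExpIntegral (I * s))) +
      ∫ s in (0 : ℝ)..t, q s * Complex.log (I * (t - s : ℝ)) =
      ∫ s in (0 : ℝ)..t, chargeForce β₀ σ (q s) := by
    have hcf := (continuous_chargeForce (β₀ := β₀) (σ := σ) (by linarith [H.half_le])).comp hq
    have he' : IntervalIntegrable (fun s : ℝ => scaledExpIntegral (I * s)) volume 0 t := by
      simpa using he
    have hA : IntervalIntegrable (fun s => 4 * Real.pi * freeTrace φ s +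
        q₀ * scaledExpIntegral (I * s)) volume 0 t :=
      ((by fun_prop : Continuous fun s => 4 * Real.pi * freeTrace φ s).intervalIntegrable 0 t).add
        (he'.const_mul q₀)
    have hP : IntervalIntegrable (fun s => chargeForce β₀ σ (q s)) volume 0 t :=
      hcf.intervalIntegrable _ _
    have hQ : IntervalIntegrable (fun s => (I * Real.pi / 2 - Real.eulerMascheroniConstant) * q s)
      volume 0 t := (by fun_prop : Continuous fun s =>
        (I * Real.pi / 2 - Real.eulerMascheroniConstant) * q s).intervalIntegrable _ _
    have hE := H.integral_sonineKernel_mul (t := t) ⟨ht0, ht.2⟩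
    rw [intervalIntegral.integral_add (hA.sub hP) hQ, intervalIntegral.integral_sub hA hP] at hE
    have hS : ∫ s in (0 : ℝ)..t, (sonineKernel (t - s) : ℂ) * q s =
        (∫ s in (0 : ℝ)..t, (I * Real.pi / 2 - Real.eulerMascheroniConstant) * q s) -
        ∫ s in (0 : ℝ)..t, q s * Complex.log (I * (t - s : ℝ)) := by
      rw [← intervalIntegral.integral_sub hQ hlog]
      have hne : ∀ᵐ s : ℝ, s ≠ t := by simp [ae_iff, measure_singleton]
      refine intervalIntegral.integral_congr_ae ?_
      filter_upwards [hne] with s hst hs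
      rw [Set.uIoc_of_le ht0.le] at hs
      have hpos : 0 < t - s := sub_pos.2 (lt_of_le_of_ne hs.2 hst)
      rw [mul_comm I ((t - s : ℝ) : ℂ), Complex.log_ofReal_mul hpos I_ne_zero, Complex.log_I, sonineKernel]
      push_cast
      ring
    rw [hS] at hE
    linear_combination -hE
  rw [hval] at hlim
  refine hlim.congr' ?_
  filter_upwards [hev] with ε hε
  exact (renormalizedTrace_eq hε.1 h q₀ hq ht0.le).symm

end PointNLS

/-! ### Averaged waves and the renormalised power -/

namespace PointNLS

variable {β₀ σ T : ℝ} {φ : Plane → ℂ} {q₀ : ℂ} {q : ℝ → ℂ}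

theorem continuous_movingAverage_uncurry {F : ℝ → ℝ → ℂ} (hF : Continuous fun p : ℝ × ℝ => F p.1 p.2)
    (h : ℝ) : Continuous fun p : ℝ × ℝ => movingAverage h (fun s => F s p.2) p.1 := by
  have e : ∀ p : ℝ × ℝ, movingAverage h (fun s => F s p.2) p.1 =
      (h : ℂ)⁻¹ * ∫ s in (0 : ℝ)..h, F (s + p.1) p.2 := fun p => by
    have := intervalIntegral.integral_comp_add_right (a := 0) (b := h) (fun s => F s p.2) p.1
    rw [zero_add] at this
    rw [movingAverage, this, add_comm h]
  simp_rw [e]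
  have hc : Continuous fun z : (ℝ × ℝ) × ℝ => F (z.2 + z.1.1) z.1.2 :=
    Continuous.comp (g := fun p : ℝ × ℝ => F p.1 p.2)
      (f := fun z : (ℝ × ℝ) × ℝ => (z.2 + z.1.1, z.1.2)) hF (by fun_prop)
  exact continuous_const.mul (intervalIntegral.continuous_parametric_intervalIntegral_of_continuous'
    (f := fun (p : ℝ × ℝ) (s : ℝ) => F (s + p.1) p.2) hc 0 h)

/-- Separates the initial datum, known only up to null sets, from coefficients continuous in time
and momentum; joint measurability follows. -/
theorem movingAverage_wave (g : ℂ) (hq : Continuous q) (h t k : ℝ) :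
    movingAverage h (fun s => wave g q s k) t =
      movingAverage h (fun s => Complex.exp (-(I * k * s))) t * g +
        I * movingAverage h (fun s => sourceWave q s k) t := by
  have hc : Continuous fun s => sourceWave q s k :=
    Continuous.comp (g := fun p : ℝ × ℝ => sourceWave q p.1 p.2) (f := fun s => (s, k))
      (continuous_sourceWave hq) (by fun_prop)
  rw [mul_comm _ g, ← movingAverage_const_mul, ← movingAverage_const_mul,
    ← movingAverage_add (by fun_prop) (by fun_prop)]
  simp only [wave, mul_comm g]

/-- The Fourier transform of the wave, averaged over `[t, t + h]`. -/
def averagedWave (φ : Plane → ℂ) (q₀ : ℂ) (q : ℝ → ℂ) (h t : ℝ) (ξ : Plane) : ℂ :=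
  movingAverage h (fun s => wave (initialWave φ q₀ ξ) q s (kinetic ξ)) t

theorem aestronglyMeasurable_averagedWave_prod (hφ : AEStronglyMeasurable φ) (q₀ : ℂ)
    (hq : Continuous q) (h : ℝ) (μ : Measure ℝ) [SFinite μ] :
    AEStronglyMeasurable (fun p : Plane × ℝ => averagedWave φ q₀ q h p.2 p.1)
      (volume.prod μ) := by
  have hk := continuous_kinetic
  have h1 : Continuous fun p : Plane × ℝ =>
      movingAverage h (fun s => Complex.exp (-(I * kinetic p.1 * s))) p.2 :=
    Continuous.comp (g := fun p : ℝ × ℝ => movingAverage h (fun s => Complex.exp (-(I * p.2 * s))) p.1)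
      (f := fun p : Plane × ℝ => (p.2, kinetic p.1))
      (continuous_movingAverage_uncurry (F := fun s k => Complex.exp (-(I * k * s))) (by fun_prop) h)
      (by fun_prop)
  have h2 : Continuous fun p : Plane × ℝ =>
      movingAverage h (fun s => sourceWave q s (kinetic p.1)) p.2 :=
    Continuous.comp (g := fun p : ℝ × ℝ => movingAverage h (fun s => sourceWave q s p.2) p.1)
      (f := fun p : Plane × ℝ => (p.2, kinetic p.1))
      (continuous_movingAverage_uncurry (continuous_sourceWave hq) h) (by fun_prop)
  simp only [averagedWave, movingAverage_wave _ hq]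
  exact (h1.aestronglyMeasurable.mul (aestronglyMeasurable_initialWave hφ q₀).comp_fst).add
    (h2.const_smul I).aestronglyMeasurable

theorem aestronglyMeasurable_averagedWave (hφ : AEStronglyMeasurable φ) (q₀ : ℂ)
    (hq : Continuous q) (h t : ℝ) : AEStronglyMeasurable (averagedWave φ q₀ q h t) := by
  have hk := continuous_kinetic
  have h1 : Continuous fun ξ : Plane =>
      movingAverage h (fun s => Complex.exp (-(I * kinetic ξ * s))) t :=
    Continuous.comp (g := fun p : ℝ × ℝ => movingAverage h (fun s => Complex.exp (-(I * p.2 * s))) p.1)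
      (f := fun ξ : Plane => (t, kinetic ξ))
      (continuous_movingAverage_uncurry (F := fun s k => Complex.exp (-(I * k * s))) (by fun_prop) h)
      (by fun_prop)
  have h2 : Continuous fun ξ : Plane => movingAverage h (fun s => sourceWave q s (kinetic ξ)) t :=
    Continuous.comp (g := fun p : ℝ × ℝ => movingAverage h (fun s => sourceWave q s p.2) p.1)
      (f := fun ξ : Plane => (t, kinetic ξ))
      (continuous_movingAverage_uncurry (continuous_sourceWave hq) h) (by fun_prop)
  refine ((h1.aestronglyMeasurable.mul (aestronglyMeasurable_initialWave hφ q₀)).add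
    (h2.const_smul I).aestronglyMeasurable).congr (Eventually.of_forall fun ξ => ?_)
  exact (movingAverage_wave _ hq h t _).symm

theorem norm_averagedWave_le {h t C : ℝ} (hh : 0 < h) (ht : 0 ≤ t)
    (hC : ∀ s ∈ Set.Icc 0 (t + h), ‖q s‖ ≤ C) (ξ : Plane) :
    ‖averagedWave φ q₀ q h t ξ‖ ≤ ‖initialWave φ q₀ ξ‖ + C * (t + h) := by
  have hC0 : 0 ≤ C := (norm_nonneg _).trans (hC 0 ⟨le_rfl, by linarith⟩)
  refine norm_movingAverage_le hh fun s hs => ?_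
  refine (norm_wave_le _ (ht.trans hs.1) fun r hr => hC r ⟨hr.1, hr.2.trans hs.2⟩).trans ?_
  gcongr
  exact hs.2

theorem integral_cutoff_mul_averagedWave {ε : ℝ} (hε : 0 < ε) (hφ : Integrable φ) (q₀ : ℂ)
    (hq : Continuous q) (h : ℝ) {t : ℝ} (ht : 0 ≤ t) (hh : 0 ≤ h) :
    ∫ ξ, cutoff ε ξ * averagedWave φ q₀ q h t ξ =
      (h : ℂ)⁻¹ * (cutoffTrace φ q₀ q ε (t + h) - cutoffTrace φ q₀ q ε t) := by
  have hi : ∀ t : ℝ, 0 ≤ t → Integrable fun ξ => cutoff ε ξ *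
      ∫ s in (0 : ℝ)..t, wave (initialWave φ q₀ ξ) q s (kinetic ξ) := fun t ht => by
    have := (integrable_cutoff_mul_wave hε hφ q₀ hq ht).integral_prod_left
    refine this.congr (Eventually.of_forall fun ξ => ?_)
    simp only
    rw [intervalIntegral.integral_of_le ht, integral_const_mul]
  rw [cutoffTrace, cutoffTrace, ← integral_sub (hi _ (by linarith)) (hi t ht), ← integral_const_mul]
  refine integral_congr_ae (Eventually.of_forall fun ξ => ?_)
  simp only [averagedWave]
  rw [movingAverage_eq (continuous_wave_left _ hq _)]
  ring

/-- The trace of an average is a difference quotient of the time-integrated trace, so the boundary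
condition is only ever needed in integrated form. -/
theorem integral_cutoff_mul_averagedWave_eq {ε : ℝ} (hε : 0 < ε) (hφ : Integrable φ) (q₀ : ℂ)
    (hq : Continuous q) (h : ℝ) {t : ℝ} (ht : 0 ≤ t) (hh : 0 ≤ h) :
    4 * Real.pi * (∫ ξ, cutoff ε ξ * averagedWave φ q₀ q h t ξ) +
      Real.log ε * movingAverage h q t =
      (h : ℂ)⁻¹ * (renormalizedTrace φ q₀ q ε (t + h) - renormalizedTrace φ q₀ q ε t) := by
  rw [integral_cutoff_mul_averagedWave hε hφ q₀ hq h ht hh, movingAverage_eq hq, renormalizedTrace,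
    renormalizedTrace]
  ring

/-- The power delivered against a multiplier `m`, cut off at high momenta. -/
theorem integral_cutoff_power {ε : ℝ} (hε : 0 < ε) (hφ : Integrable φ) (q₀ : ℂ)
    (hq : Continuous q) {h τ : ℝ} (hh : 0 < h) (hτ : 0 ≤ τ) {m : ℝ → ℂ} (hm : Continuous m) :
    ∫ ξ, Real.exp (-(ε * kinetic ξ)) * ∫ t in (0 : ℝ)..τ, 2 * ⟪m t, averagedWave φ q₀ q h t ξ⟫ =
      ∫ t in (0 : ℝ)..τ, 2 * ⟪m t, ∫ ξ, cutoff ε ξ * averagedWave φ q₀ q h t ξ⟫ := by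
  obtain ⟨C, hC⟩ := isCompact_Icc.exists_bound_of_continuousOn (s := Set.Icc 0 (τ + h))
    hq.continuousOn
  obtain ⟨D, hD⟩ := isCompact_Icc.exists_bound_of_continuousOn (s := Set.Icc 0 τ) hm.continuousOn
  have hC0 : 0 ≤ C := (norm_nonneg _).trans (hC 0 ⟨le_rfl, by linarith⟩)
  have hD0 : 0 ≤ D := (norm_nonneg _).trans (hD 0 ⟨le_rfl, hτ⟩)
  have hmeas := aestronglyMeasurable_averagedWave_prod hφ.aestronglyMeasurable q₀ hq h
    (volume.restrict (Set.Ioc 0 τ))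
  have hbound : Integrable fun ξ => ‖cutoff ε ξ‖ * (‖initialWave φ q₀ ξ‖ + C * (τ + h)) := by
    have := (integrable_cutoff_mul_initialWave hε hφ q₀).norm.add
      ((integrable_cutoff hε).norm.mul_const (C * (τ + h)))
    refine this.congr (Eventually.of_forall fun ξ => ?_)
    simp only [Pi.add_apply, norm_mul]; ring
  have hle : ∀ t ∈ Set.Ioc 0 τ, ∀ ξ, ‖cutoff ε ξ * averagedWave φ q₀ q h t ξ‖ ≤
      ‖cutoff ε ξ‖ * (‖initialWave φ q₀ ξ‖ + C * (τ + h)) := fun t ht ξ => by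
    rw [norm_mul]
    gcongr
    refine (norm_averagedWave_le hh ht.1.le
      (fun s hs => hC s ⟨hs.1, by linarith [hs.2, ht.2]⟩) ξ).trans ?_
    gcongr
    exact ht.2
  have hFi : Integrable (fun p : Plane × ℝ => 2 * ⟪m p.2, cutoff ε p.1 * averagedWave φ q₀ q h p.2 p.1⟫)
      (volume.prod (volume.restrict (Set.Ioc 0 τ))) := by
    have h2 : IntegrableOn (fun _ : ℝ => 2 * D) (Set.Ioc 0 τ) :=
      integrableOn_const measure_Ioc_lt_top.ne
    refine (hbound.mul_prod h2).mono' (AEStronglyMeasurable.const_mul (AEStronglyMeasurable.inner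
      (hm.comp continuous_snd).aestronglyMeasurable
      (((continuous_cutoff ε).comp continuous_fst).aestronglyMeasurable.mul hmeas)) 2) ?_
    have hae : ∀ᵐ p : Plane × ℝ ∂(volume.prod (volume.restrict (Set.Ioc 0 τ))), p.2 ∈ Set.Ioc 0 τ :=
      Measure.quasiMeasurePreserving_snd.ae (ae_restrict_mem measurableSet_Ioc)
    filter_upwards [hae] with p hp
    rw [norm_mul, Real.norm_ofNat]
    calc _ ≤ 2 * (D * (‖cutoff ε p.1‖ * (‖initialWave φ q₀ p.1‖ + C * (τ + h)))) := by
          gcongr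
          refine (norm_inner_le_norm _ _).trans ?_
          gcongr
          · exact hD _ ⟨hp.1.le, hp.2⟩
          · exact hle _ hp _
      _ = _ := by ring
  have hsw := integral_integral_swap
    (f := fun ξ t => 2 * ⟪m t, cutoff ε ξ * averagedWave φ q₀ q h t ξ⟫) hFi
  rw [intervalIntegral.integral_of_le hτ]
  have e1 : ∀ ξ, Real.exp (-(ε * kinetic ξ)) *
      ∫ t in (0 : ℝ)..τ, 2 * ⟪m t, averagedWave φ q₀ q h t ξ⟫ =
      ∫ t in Set.Ioc 0 τ, 2 * ⟪m t, cutoff ε ξ * averagedWave φ q₀ q h t ξ⟫ := fun ξ => by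
    rw [intervalIntegral.integral_of_le hτ, ← integral_const_mul]
    refine integral_congr_ae (Eventually.of_forall fun t => ?_)
    simp only [cutoff, ← real_smul, real_inner_smul_right]
    ring
  simp_rw [e1]
  rw [hsw]
  refine setIntegral_congr_fun measurableSet_Ioc fun t ht => ?_
  have hi : Integrable fun ξ => cutoff ε ξ * averagedWave φ q₀ q h t ξ :=
    hbound.mono' ((continuous_cutoff ε).aestronglyMeasurable.mul
      (aestronglyMeasurable_averagedWave hφ.aestronglyMeasurable q₀ hq h t))
      (Eventually.of_forall (hle t ht))
  rw [integral_const_mul, integral_inner hi]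

theorem aestronglyMeasurable_integral_cutoff (ε : ℝ) (hφ : AEStronglyMeasurable φ) (q₀ : ℂ)
    (hq : Continuous q) (h : ℝ) (μ : Measure ℝ) [SFinite μ] :
    AEStronglyMeasurable (fun t => ∫ ξ, cutoff ε ξ * averagedWave φ q₀ q h t ξ) μ := by
  have h1 := ((continuous_cutoff ε).comp (continuous_fst (Y := ℝ))).aestronglyMeasurable
    (μ := (volume : Measure Plane).prod μ)
  exact (h1.mul (aestronglyMeasurable_averagedWave_prod hφ q₀ hq h μ)).prod_swap.integral_prod_right'

/-- The power delivered against a multiplier `m`, renormalised. -/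
theorem IsChargeSolution.tendsto_power (H : IsChargeSolution β₀ σ φ q₀ q T) {h τ : ℝ} (hh : 0 < h)
    (hτ : 0 ≤ τ) (hτT : τ + h ≤ T) {m : ℝ → ℂ} (hm : Continuous m) :
    Tendsto (fun ε : ℝ => 4 * Real.pi * (∫ ξ, Real.exp (-(ε * kinetic ξ)) *
        ∫ t in (0 : ℝ)..τ, 2 * ⟪m t, averagedWave φ q₀ q h t ξ⟫) +
      Real.log ε * ∫ t in (0 : ℝ)..τ, 2 * ⟪m t, movingAverage h q t⟫) (𝓝[>] 0)
      (𝓝 (∫ t in (0 : ℝ)..τ, 2 * ⟪m t, movingAverage h (fun s => chargeForce β₀ σ (q s)) t⟫)) := by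
  have hφ := H.integrable
  have hq := H.cont
  have hev : ∀ᶠ ε : ℝ in 𝓝[>] 0, ε ∈ Set.Ioc (0 : ℝ) 1 := Ioc_mem_nhdsGT one_pos
  have hcf : Continuous fun s => chargeForce β₀ σ (q s) :=
    (continuous_chargeForce (by linarith [H.half_le])).comp hq
  obtain ⟨C, hC⟩ := exists_norm_renormalizedTrace_le hφ q₀ hq H.pos.le
  obtain ⟨D, hD⟩ := isCompact_Icc.exists_bound_of_continuousOn (s := Set.Icc 0 τ) hm.continuousOn
  have hD0 : 0 ≤ D := (norm_nonneg _).trans (hD 0 ⟨le_rfl, hτ⟩)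
  -- `Z` is the difference quotient of the renormalised trace: bounded uniformly in ε for fixed h,
  -- and convergent to the averaged force by the boundary condition.
  set Z : ℝ → ℝ → ℂ := fun ε t => (h : ℂ)⁻¹ *
    (renormalizedTrace φ q₀ q ε (t + h) - renormalizedTrace φ q₀ q ε t) with hZ
  have hp := continuous_movingAverage hq h
  have hZe : ∀ ε ∈ Set.Ioc (0 : ℝ) 1, ∀ t ∈ Set.Ioc 0 τ,
      4 * Real.pi * (∫ ξ, cutoff ε ξ * averagedWave φ q₀ q h t ξ) +
      Real.log ε * movingAverage h q t = Z ε t := fun ε hε t ht =>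
    integral_cutoff_mul_averagedWave_eq hε.1 hφ q₀ hq h ht.1.le hh.le
  have hZm : ∀ ε ∈ Set.Ioc (0 : ℝ) 1, AEStronglyMeasurable (fun t => 2 * ⟪m t, Z ε t⟫)
      (volume.restrict (Set.Ioc 0 τ)) := fun ε hε => by
    have h1 := aestronglyMeasurable_integral_cutoff ε hφ.aestronglyMeasurable q₀ hq h
      (volume.restrict (Set.Ioc 0 τ))
    have h2 := (h1.const_mul (4 * Real.pi : ℂ)).add
      ((hp.aestronglyMeasurable (μ := volume.restrict (Set.Ioc 0 τ))).const_mul (Real.log ε : ℂ))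
    have h3 : AEStronglyMeasurable (Z ε) (volume.restrict (Set.Ioc 0 τ)) := by
      refine h2.congr ?_
      filter_upwards [ae_restrict_mem measurableSet_Ioc] with t ht
      exact hZe ε hε t ht
    exact (hm.aestronglyMeasurable.inner h3).const_mul 2
  have hZb : ∀ ε ∈ Set.Ioc (0 : ℝ) 1, ∀ t ∈ Set.Ioc 0 τ,
      ‖2 * ⟪m t, Z ε t⟫‖ ≤ 2 * (D * (h⁻¹ * (C + C))) := fun ε hε t ht => by
    rw [norm_mul, Real.norm_ofNat]
    gcongr
    refine (norm_inner_le_norm _ _).trans ?_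
    gcongr
    · exact hD t ⟨ht.1.le, ht.2⟩
    · simp only [hZ]
      rw [norm_mul, norm_inv, norm_real, Real.norm_of_nonneg hh.le]
      gcongr
      exact (norm_sub_le _ _).trans (add_le_add (hC ε hε _ ⟨by linarith [ht.1], by linarith [ht.2]⟩)
        (hC ε hε _ ⟨ht.1.le, by linarith [ht.2]⟩))
  have hZi : ∀ ε ∈ Set.Ioc (0 : ℝ) 1, IntervalIntegrable (fun t => 2 * ⟪m t, Z ε t⟫) volume 0 τ :=
      fun ε hε => by
    rw [intervalIntegrable_iff_integrableOn_Ioc_of_le hτ]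
    refine (integrableOn_const (C := 2 * (D * (h⁻¹ * (C + C)))) measure_Ioc_lt_top.ne).mono'
      (hZm ε hε) ?_
    filter_upwards [ae_restrict_mem measurableSet_Ioc] with t ht
    exact hZb ε hε t ht
  have hpi : IntervalIntegrable (fun t => 2 * ⟪m t, movingAverage h q t⟫) volume 0 τ :=
    (by fun_prop : Continuous fun t => 2 * ⟪m t, movingAverage h q t⟫).intervalIntegrable _ _
  have hlim : Tendsto (fun ε : ℝ => ∫ t in (0 : ℝ)..τ, 2 * ⟪m t, Z ε t⟫) (𝓝[>] 0)
      (𝓝 (∫ t in (0 : ℝ)..τ, 2 * ⟪m t, movingAverage h (fun s => chargeForce β₀ σ (q s)) t⟫)) := by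
    refine intervalIntegral.tendsto_integral_filter_of_dominated_convergence
      (fun _ => 2 * (D * (h⁻¹ * (C + C)))) ?_ ?_ intervalIntegrable_const ?_
    · filter_upwards [hev] with ε hε
      rw [Set.uIoc_of_le hτ]
      exact hZm ε hε
    · filter_upwards [hev] with ε hε
      refine Eventually.of_forall fun t ht => ?_
      rw [Set.uIoc_of_le hτ] at ht
      exact hZb ε hε t ht
    · refine Eventually.of_forall fun t ht => ?_
      rw [Set.uIoc_of_le hτ] at ht
      refine Tendsto.const_mul 2 (Filter.Tendsto.inner tendsto_const_nhds ?_)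
      rw [movingAverage_eq hcf]
      exact ((H.tendsto_renormalizedTrace ⟨by linarith [ht.1], by linarith [ht.2]⟩).sub
        (H.tendsto_renormalizedTrace ⟨ht.1.le, by linarith [ht.2]⟩)).const_mul _
  refine hlim.congr' ?_
  filter_upwards [hev] with ε hε
  rw [integral_cutoff_power hε.1 hφ q₀ hq hh hτ hm]
  have e : ∫ t in (0 : ℝ)..τ, 2 * ⟪m t, ∫ ξ, cutoff ε ξ * averagedWave φ q₀ q h t ξ⟫ =
      ∫ t in (0 : ℝ)..τ, (4 * Real.pi)⁻¹ * (2 * ⟪m t, Z ε t⟫ -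
        Real.log ε * (2 * ⟪m t, movingAverage h q t⟫)) := by
    refine intervalIntegral.integral_congr_ae (Eventually.of_forall fun t ht => ?_)
    rw [Set.uIoc_of_le hτ] at ht
    rw [← hZe ε hε t ht, inner_add_right]
    have e1 : (4 * Real.pi : ℂ) * (∫ ξ, cutoff ε ξ * averagedWave φ q₀ q h t ξ) =
        (4 * Real.pi : ℝ) • ∫ ξ, cutoff ε ξ * averagedWave φ q₀ q h t ξ := by
      rw [real_smul]; push_cast; rfl
    rw [e1, ← real_smul (x := Real.log ε), real_inner_smul_right, real_inner_smul_right]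
    field_simp
    ring
  rw [e, intervalIntegral.integral_const_mul (4 * Real.pi)⁻¹, intervalIntegral.integral_sub (hZi ε hε)
    (hpi.const_mul _), intervalIntegral.integral_const_mul (Real.log ε)]
  field_simp
  ring

end PointNLS

/-! ### Balance of averaged mass and energy -/

namespace PointNLS

variable {β₀ σ T : ℝ} {φ : Plane → ℂ} {q₀ : ℂ} {q : ℝ → ℂ}

/-- Jensen's inequality, as Cauchy–Schwarz on an interval of total weight 1. -/
theorem enorm_movingAverage_sq_le {f : ℝ → ℂ} (hf : Continuous f) {h : ℝ} (hh : 0 < h) (t : ℝ) :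
    ‖movingAverage h f t‖ₑ ^ 2 ≤
      ENNReal.ofReal h⁻¹ * ∫⁻ s in Set.Ioc t (t + h), ‖f s‖ₑ ^ 2 := by
  have h1 : ‖movingAverage h f t‖ₑ ≤ ∫⁻ s in Set.Ioc t (t + h), ENNReal.ofReal h⁻¹ * ‖f s‖ₑ := by
    rw [movingAverage, intervalIntegral.integral_of_le (by linarith), enorm_mul,
      lintegral_const_mul' _ _ ENNReal.ofReal_ne_top]
    refine mul_le_mul' (le_of_eq ?_) (enorm_integral_le_lintegral_enorm _)
    rw [← ofReal_norm, norm_inv, norm_real, Real.norm_of_nonneg hh.le]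
  refine (pow_le_pow_left' h1 2).trans ((sq_lintegral_mul_le aemeasurable_const
    hf.measurable.enorm.aemeasurable).trans (le_of_eq ?_))
  rw [lintegral_const, Measure.restrict_apply_univ, Real.volume_Ioc, add_sub_cancel_left,
    ← ENNReal.ofReal_mul (by positivity), inv_mul_cancel₀ hh.ne', ENNReal.ofReal_one, one_mul,
    lintegral_const_mul' _ _ ENNReal.ofReal_ne_top]

/-- Jensen in time, then Plancherel for each emitted wave at a fixed time. -/
theorem integral_norm_sq_movingAverage_sourceWave_le (hq : Continuous q) {h t : ℝ} (hh : 0 < h)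
    (ht : 0 ≤ t) :
    Integrable (fun ξ : Plane => ‖movingAverage h (fun s => sourceWave q s (kinetic ξ)) t‖ ^ 2) ∧
    ∫ ξ : Plane, ‖movingAverage h (fun s => sourceWave q s (kinetic ξ)) t‖ ^ 2 ≤
      ∫ s in (0 : ℝ)..t + h, ‖q s‖ ^ 2 := by
  have hk := continuous_kinetic
  have hc : Continuous fun p : Plane × ℝ => sourceWave q p.2 (kinetic p.1) :=
    Continuous.comp (g := fun p : ℝ × ℝ => sourceWave q p.1 p.2)
      (f := fun p : Plane × ℝ => (p.2, kinetic p.1)) (continuous_sourceWave hq) (by fun_prop)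
  have hc1 : ∀ ξ, Continuous fun s => sourceWave q s (kinetic ξ) := fun ξ =>
    Continuous.comp (g := fun p : ℝ × ℝ => sourceWave q p.1 p.2)
      (f := fun s : ℝ => (s, kinetic ξ)) (continuous_sourceWave hq) (by fun_prop)
  have hm : Continuous fun ξ : Plane => movingAverage h (fun s => sourceWave q s (kinetic ξ)) t :=
    Continuous.comp (g := fun p : ℝ × ℝ => movingAverage h (fun s => sourceWave q s p.2) p.1)
      (f := fun ξ : Plane => (t, kinetic ξ))
      (continuous_movingAverage_uncurry (continuous_sourceWave hq) h) (by fun_prop)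
  have hnn : ∀ u : ℝ, 0 ≤ u → 0 ≤ ∫ s in (0 : ℝ)..u, ‖q s‖ ^ 2 := fun u hu =>
    intervalIntegral.integral_nonneg hu fun _ _ => by positivity
  have hqi : ∀ a b : ℝ, IntervalIntegrable (fun s => ‖q s‖ ^ 2) volume a b := fun a b =>
    (by fun_prop : Continuous fun s => ‖q s‖ ^ 2).intervalIntegrable a b
  refine integrable_and_integral_le_of_lintegral_enorm_sq_le hm.aestronglyMeasurable
    (hnn _ (by linarith)) ?_
  have hmeas : Measurable fun p : Plane × ℝ => ‖sourceWave q p.2 (kinetic p.1)‖ₑ ^ 2 :=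
    hc.measurable.enorm.pow_const 2
  calc ∫⁻ ξ : Plane, ‖movingAverage h (fun s => sourceWave q s (kinetic ξ)) t‖ₑ ^ 2
      ≤ ∫⁻ ξ : Plane, ENNReal.ofReal h⁻¹ *
          ∫⁻ s in Set.Ioc t (t + h), ‖sourceWave q s (kinetic ξ)‖ₑ ^ 2 :=
        lintegral_mono fun ξ => enorm_movingAverage_sq_le (hc1 ξ) hh t
    _ = ENNReal.ofReal h⁻¹ * ∫⁻ s in Set.Ioc t (t + h), ∫⁻ ξ : Plane,
          ‖sourceWave q s (kinetic ξ)‖ₑ ^ 2 := by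
        rw [lintegral_const_mul' _ _ ENNReal.ofReal_ne_top,
          lintegral_lintegral_swap hmeas.aemeasurable]
    _ ≤ ENNReal.ofReal h⁻¹ * ∫⁻ s in Set.Ioc t (t + h),
          ENNReal.ofReal (∫ s in (0 : ℝ)..t + h, ‖q s‖ ^ 2) := by
        refine mul_le_mul_right (setLIntegral_mono' measurableSet_Ioc fun s hs => ?_) _
        have h1 := integral_norm_sq_sourceWave_le hq (ht.trans hs.1.le)
        rw [← ofReal_integral_norm_sq h1.1]
        refine ENNReal.ofReal_le_ofReal (h1.2.trans ?_)
        exact intervalIntegral.integral_mono_interval le_rfl (ht.trans hs.1.le) hs.2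
          (Eventually.of_forall fun _ => by positivity) (hqi _ _)
    _ = _ := by
        rw [lintegral_const, Measure.restrict_apply_univ, Real.volume_Ioc, add_sub_cancel_left,
          mul_comm, mul_assoc, ← ENNReal.ofReal_mul hh.le, mul_inv_cancel₀ hh.ne',
          ENNReal.ofReal_one, mul_one]

theorem norm_movingAverage_oscillation_le {h : ℝ} (hh : 0 < h) (t k : ℝ) :
    ‖movingAverage h (fun s => Complex.exp (-(I * k * s))) t‖ ≤ 1 :=
  norm_movingAverage_le hh fun _ _ => (norm_exp_neg_I_mul _ _).le

theorem norm_sq_div_kinetic_add_one (z : ℂ) (ξ : Plane) :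
    (1 + kinetic ξ) * ‖z / (kinetic ξ + 1)‖ ^ 2 = ‖z‖ ^ 2 / (kinetic ξ + 1) := by
  have h := kinetic_nonneg ξ
  have e : ‖(kinetic ξ : ℂ) + 1‖ = kinetic ξ + 1 := by
    rw [← ofReal_one, ← ofReal_add, norm_real, Real.norm_of_nonneg (by linarith)]
  rw [norm_div, e]
  field_simp
  ring

theorem integrable_norm_sq_of_energy (hφ : AEStronglyMeasurable φ)
    (h2 : Integrable fun ξ => (1 + kinetic ξ) * ‖φ ξ‖ ^ 2) : Integrable fun ξ => ‖φ ξ‖ ^ 2 := by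
  refine h2.mono' (hφ.norm.pow 2) (Eventually.of_forall fun ξ => ?_)
  rw [Real.norm_of_nonneg (by positivity)]
  nlinarith [mul_nonneg (kinetic_nonneg ξ) (sq_nonneg ‖φ ξ‖)]

/-- Up to a constant this is the squared modulus of the transform of the Macdonald function with
spectral parameter 1 centred at 0, already known to be in L². -/
theorem integrable_norm_sq_inv_kinetic (c : ℂ) :
    Integrable fun ξ : Plane => ‖c / (kinetic ξ + 1 : ℂ)‖ ^ 2 := by
  have h1 := (memLp_two_iff_integrable_sq_norm
    (memLp_macdonaldFourier one_pos 0).aestronglyMeasurable).1 (memLp_macdonaldFourier one_pos 0)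
  refine (h1.const_mul ((‖c‖ / (2 * Real.pi)) ^ 2)).congr (Eventually.of_forall fun ξ => ?_)
  have hp := Real.pi_pos
  have e : macdonaldFourier 1 0 ξ = 2 * Real.pi / (kinetic ξ + 1) := by
    simp [macdonaldFourier, kinetic]
  have e2 : ‖(2 * Real.pi : ℂ)‖ = 2 * Real.pi := by
    rw [norm_mul, norm_real, Real.norm_of_nonneg hp.le]
    norm_num
  simp only [e, norm_div, e2]
  field_simp

theorem integrable_norm_sq_initialWave (hφ : AEStronglyMeasurable φ)
    (h2 : Integrable fun ξ => ‖φ ξ‖ ^ 2) (q₀ : ℂ) :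
    Integrable fun ξ => ‖initialWave φ q₀ ξ‖ ^ 2 := by
  refine ((h2.const_mul 2).add ((integrable_norm_sq_inv_kinetic q₀).const_mul 2)).mono'
    ((aestronglyMeasurable_initialWave hφ q₀).norm.pow 2) (Eventually.of_forall fun ξ => ?_)
  rw [Real.norm_of_nonneg (by positivity)]
  exact norm_sq_add_le _ _

theorem integrable_norm_sq_averagedWave (hφ : AEStronglyMeasurable φ)
    (h2 : Integrable fun ξ => ‖φ ξ‖ ^ 2) (q₀ : ℂ) (hq : Continuous q) {h t : ℝ} (hh : 0 < h)
    (ht : 0 ≤ t) : Integrable fun ξ => ‖averagedWave φ q₀ q h t ξ‖ ^ 2 := by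
  refine (((integrable_norm_sq_initialWave hφ h2 q₀).const_mul 2).add
    ((integral_norm_sq_movingAverage_sourceWave_le hq hh ht).1.const_mul 2)).mono'
    ((aestronglyMeasurable_averagedWave hφ q₀ hq h t).norm.pow 2) (Eventually.of_forall fun ξ => ?_)
  rw [Real.norm_of_nonneg (by positivity), averagedWave, movingAverage_wave _ hq]
  refine (norm_sq_add_le _ _).trans (add_le_add ?_ (le_of_eq ?_))
  · have := norm_movingAverage_oscillation_le hh t (kinetic ξ)
    have h3 := mul_le_of_le_one_left (norm_nonneg (initialWave φ q₀ ξ)) this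
    rw [norm_mul]
    exact mul_le_mul_of_nonneg_left (pow_le_pow_left₀ (by positivity) h3 2) zero_le_two
  · rw [norm_mul, norm_I, one_mul]

/-- The density of the averaged energy. -/
def averagedEnergyDensity (φ : Plane → ℂ) (q₀ : ℂ) (q : ℝ → ℂ) (h t : ℝ) (ξ : Plane) : ℝ :=
  (1 + kinetic ξ) * ‖averagedWave φ q₀ q h t ξ - movingAverage h q t / (kinetic ξ + 1)‖ ^ 2

theorem averagedEnergyDensity_nonneg (h t : ℝ) (ξ : Plane) :
    0 ≤ averagedEnergyDensity φ q₀ q h t ξ := by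
  have := kinetic_nonneg ξ
  unfold averagedEnergyDensity
  positivity

theorem aestronglyMeasurable_averagedEnergyDensity (hφ : AEStronglyMeasurable φ) (q₀ : ℂ)
    (hq : Continuous q) (h t : ℝ) :
    AEStronglyMeasurable (averagedEnergyDensity φ q₀ q h t) := by
  have h1 := continuous_inv_kinetic_add_one.aestronglyMeasurable (μ := volume).const_mul
    (movingAverage h q t)
  simp only [mul_one_div] at h1
  have h2 := aestronglyMeasurable_averagedWave hφ q₀ hq h t
  exact (continuous_const.add continuous_kinetic).aestronglyMeasurable.mul ((h2.sub h1).norm.pow 2)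

/-- By `movingAverage_wave_sub_div` the averaged regular part is an L² function divided by k + 1,
which absorbs the weight 1 + k. So the averaged energy is finite for every h > 0 without any
smoothness of q. -/
theorem integrable_averagedEnergyDensity (hφ : AEStronglyMeasurable φ)
    (h2 : Integrable fun ξ => ‖φ ξ‖ ^ 2) (q₀ : ℂ) (hq : Continuous q) {h t : ℝ} (hh : 0 < h)
    (ht : 0 ≤ t) : Integrable (averagedEnergyDensity φ q₀ q h t) := by
  have hg := aestronglyMeasurable_initialWave hφ q₀
  have hg2 := integrable_norm_sq_initialWave hφ h2 q₀
  have i1 := integrable_norm_sq_averagedWave hφ h2 q₀ hq hh ht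
  have i2 := integrable_norm_sq_wave hg hg2 hq ht
  have i3 := integrable_norm_sq_wave hg hg2 hq (show 0 ≤ t + h by linarith)
  refine ((i1.const_mul 2).add (((i3.const_mul 2).add (i2.const_mul 2)).const_mul
    (2 * (h⁻¹) ^ 2))).mono' (aestronglyMeasurable_averagedEnergyDensity hφ q₀ hq h t)
    (Eventually.of_forall fun ξ => ?_)
  have hk := kinetic_nonneg ξ
  rw [Real.norm_of_nonneg (averagedEnergyDensity_nonneg _ _ _), averagedEnergyDensity, averagedWave,
    movingAverage_wave_sub_div _ hq t hk, norm_sq_div_kinetic_add_one]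
  refine (div_le_self (by positivity) (by linarith)).trans ?_
  refine (norm_sq_add_le _ _).trans ?_
  simp only [Pi.add_apply]
  refine add_le_add le_rfl ?_
  rw [norm_mul, norm_mul, norm_I, one_mul, norm_inv, norm_real, Real.norm_of_nonneg hh.le, mul_pow,
    ← mul_assoc]
  gcongr
  have := norm_sq_add_le (wave (initialWave φ q₀ ξ) q (t + h) (kinetic ξ))
    (-wave (initialWave φ q₀ ξ) q t (kinetic ξ))
  rwa [norm_neg, ← sub_eq_add_neg] at this

theorem tendsto_integral_exp_neg_mul {f : Plane → ℝ} (hf : Integrable f) :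
    Tendsto (fun ε : ℝ => ∫ ξ, Real.exp (-(ε * kinetic ξ)) * f ξ) (𝓝[>] 0) (𝓝 (∫ ξ, f ξ)) := by
  have hk := continuous_kinetic
  refine tendsto_integral_filter_of_dominated_convergence (fun ξ => ‖f ξ‖) ?_ ?_ hf.norm ?_
  · exact Eventually.of_forall fun ε => (by fun_prop : Continuous fun ξ =>
      Real.exp (-(ε * kinetic ξ))).aestronglyMeasurable.mul hf.aestronglyMeasurable
  · filter_upwards [self_mem_nhdsWithin] with ε hε
    refine Eventually.of_forall fun ξ => ?_
    rw [norm_mul, Real.norm_of_nonneg (Real.exp_nonneg _)]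
    refine mul_le_of_le_one_left (norm_nonneg _) ?_
    rw [Real.exp_le_one_iff, neg_nonpos]
    exact mul_nonneg (le_of_lt hε) (kinetic_nonneg ξ)
  · refine Eventually.of_forall fun ξ => ?_
    have hc : Continuous fun ε : ℝ => Real.exp (-(ε * kinetic ξ)) * f ξ := by fun_prop
    have := (hc.tendsto 0).mono_left (nhdsWithin_le_nhds (s := Set.Ioi 0))
    simpa using this

theorem integrable_exp_neg_mul {f : Plane → ℝ} (hf : Integrable f) {ε : ℝ} (hε : 0 ≤ ε) :
    Integrable fun ξ => Real.exp (-(ε * kinetic ξ)) * f ξ := by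
  have hk := continuous_kinetic
  refine hf.bdd_mul (c := 1) (by fun_prop : Continuous fun ξ =>
      Real.exp (-(ε * kinetic ξ))).aestronglyMeasurable (Eventually.of_forall fun ξ => ?_)
  rw [Real.norm_of_nonneg (Real.exp_nonneg _), Real.exp_le_one_iff, neg_nonpos]
  exact mul_nonneg hε (kinetic_nonneg ξ)

namespace IsChargeSolution

/-- Change of the averaged mass. -/
theorem integral_norm_sq_averagedWave_sub (H : IsChargeSolution β₀ σ φ q₀ q T) {h τ : ℝ}
    (hh : 0 < h) (hτ : 0 ≤ τ) (hτT : τ + h ≤ T) :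
    4 * Real.pi * ((∫ ξ, ‖averagedWave φ q₀ q h τ ξ‖ ^ 2) - ∫ ξ, ‖averagedWave φ q₀ q h 0 ξ‖ ^ 2) =
      ∫ t in (0 : ℝ)..τ, 2 * ⟪I * movingAverage h q t,
        movingAverage h (fun s => chargeForce β₀ σ (q s)) t⟫ := by
  have hq := H.cont
  have hφ := H.integrable.aestronglyMeasurable
  have h2 := integrable_norm_sq_of_energy hφ H.integrable_energy
  have hp := continuous_movingAverage hq h
  have lim1 := H.tendsto_power hh hτ hτT (m := fun t => I * movingAverage h q t) (by fun_prop)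
  have i1 := integrable_norm_sq_averagedWave hφ h2 q₀ hq hh hτ
  have i0 := integrable_norm_sq_averagedWave hφ h2 q₀ hq hh le_rfl
  have lim2 := (tendsto_integral_exp_neg_mul (i1.sub i0)).const_mul (4 * Real.pi)
  -- The coefficient of log ε is ⟨ip, p⟩ = 0, so the mass needs no renormalisation.
  have e0 : ∀ z : ℂ, ⟪I * z, z⟫ = 0 := fun z => by
    simp only [Complex.inner, mul_re, mul_im, conj_re, conj_im, I_re, I_im]; ring
  have e1 : ∀ ξ, ∫ t in (0 : ℝ)..τ, 2 * ⟪I * movingAverage h q t, averagedWave φ q₀ q h t ξ⟫ =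
      ‖averagedWave φ q₀ q h τ ξ‖ ^ 2 - ‖averagedWave φ q₀ q h 0 ξ‖ ^ 2 := fun ξ =>
    (norm_sq_movingAverage_wave_sub _ hq h τ _).symm
  simp only [e0, e1, mul_zero, intervalIntegral.integral_zero, add_zero] at lim1
  rw [← integral_sub i1 i0]
  exact tendsto_nhds_unique lim2 lim1

/-- Change of the averaged energy. -/
theorem integral_averagedEnergyDensity_sub (H : IsChargeSolution β₀ σ φ q₀ q T) {h τ : ℝ}
    (hh : 0 < h) (hτ : 0 ≤ τ) (hτT : τ + h ≤ T) :
    4 * Real.pi * ((∫ ξ, averagedEnergyDensity φ q₀ q h τ ξ) -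
        ∫ ξ, averagedEnergyDensity φ q₀ q h 0 ξ) =
      4 * Real.pi * ((∫ ξ, ‖averagedWave φ q₀ q h τ ξ‖ ^ 2) -
        ∫ ξ, ‖averagedWave φ q₀ q h 0 ξ‖ ^ 2) -
      Real.eulerMascheroniConstant * (‖movingAverage h q τ‖ ^ 2 - ‖movingAverage h q 0‖ ^ 2) -
      ∫ t in (0 : ℝ)..τ, 2 * ⟪(h : ℂ)⁻¹ * (q (t + h) - q t),
        movingAverage h (fun s => chargeForce β₀ σ (q s)) t⟫ := by
  have hq := H.cont
  have hφ := H.integrable.aestronglyMeasurable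
  have h2 := integrable_norm_sq_of_energy hφ H.integrable_energy
  have hp := continuous_movingAverage hq h
  have lim1 := H.tendsto_power hh hτ hτT (m := fun t => (h : ℂ)⁻¹ * (q (t + h) - q t)) (by fun_prop)
  have i1 := integrable_norm_sq_averagedWave hφ h2 q₀ hq hh hτ
  have i0 := integrable_norm_sq_averagedWave hφ h2 q₀ hq hh le_rfl
  have j1 := integrable_averagedEnergyDensity hφ h2 q₀ hq hh hτ
  have j0 := integrable_averagedEnergyDensity hφ h2 q₀ hq hh le_rfl
  set Δ : ℝ := ‖movingAverage h q τ‖ ^ 2 - ‖movingAverage h q 0‖ ^ 2 with hΔ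
  -- The coefficient of log ε is the increment Δ of |p|², which is also the coefficient of 1/(k+1)
  -- in the energy density.
  have hcharge : ∫ t in (0 : ℝ)..τ, 2 * ⟪(h : ℂ)⁻¹ * (q (t + h) - q t), movingAverage h q t⟫ = Δ := by
    rw [hΔ, ← intervalIntegral.integral_eq_sub_of_hasDerivAt
      (f := fun t => ‖movingAverage h q t‖ ^ 2)
      (fun t _ => (hasDerivAt_movingAverage hq h t).norm_sq)
      ((by fun_prop : Continuous fun t => 2 * ⟪movingAverage h q t, (h : ℂ)⁻¹ *
        (q (t + h) - q t)⟫).intervalIntegrable _ _)]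
    simp only [real_inner_comm]
  have hpt : ∀ ξ, ∫ t in (0 : ℝ)..τ, 2 * ⟪(h : ℂ)⁻¹ * (q (t + h) - q t), averagedWave φ q₀ q h t ξ⟫ =
      (‖averagedWave φ q₀ q h τ ξ‖ ^ 2 - ‖averagedWave φ q₀ q h 0 ξ‖ ^ 2) + (kinetic ξ + 1)⁻¹ * Δ -
      (averagedEnergyDensity φ q₀ q h τ ξ - averagedEnergyDensity φ q₀ q h 0 ξ) := fun ξ => by
    have := norm_sq_movingAverage_wave_sub_div (initialWave φ q₀ ξ) hq h τ (kinetic_nonneg ξ) rfl rfl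
    simp only [averagedEnergyDensity, averagedWave, hΔ]
    linarith
  have hexp : ∀ ε : ℝ, 0 < ε → Integrable (fun ξ => Real.exp (-(ε * kinetic ξ)) * (kinetic ξ + 1)⁻¹) ∧
      (4 * Real.pi * ∫ ξ, Real.exp (-(ε * kinetic ξ)) * (kinetic ξ + 1)⁻¹ : ℝ) =
        (scaledExpIntegral ε).re := fun ε hε => by
    obtain ⟨a1, a2⟩ := integral_exp_neg_mul_div_add_one (z := ε) (by simpa using hε)
    have hm : Measurable fun k : ℝ => Complex.exp (-(ε : ℂ) * k) / (k + 1) := by fun_prop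
    have b1 := (integrable_comp_kinetic hm).2 a1
    have b2 := integral_comp_kinetic hm
    have e : ∀ ξ, Complex.exp (-(ε : ℂ) * kinetic ξ) / (kinetic ξ + 1) =
        ((Real.exp (-(ε * kinetic ξ)) * (kinetic ξ + 1)⁻¹ : ℝ) : ℂ) := fun ξ => by
      push_cast
      rw [neg_mul, div_eq_mul_inv]
    simp only [e] at b1 b2
    refine ⟨b1.re.congr (Eventually.of_forall fun ξ => ofReal_re _), ?_⟩
    rw [integral_complex_ofReal, a2] at b2
    have b3 := congrArg re b2
    rw [ofReal_re, re_ofReal_mul] at b3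
    rw [b3]
    field_simp
  have lim2 := (tendsto_integral_exp_neg_mul (i1.sub i0)).const_mul (4 * Real.pi)
  have lim3 := (tendsto_integral_exp_neg_mul (j1.sub j0)).const_mul (4 * Real.pi)
  -- The integral of e^{-εk}/(k+1) over the plane is 1/(4π) times e^ε E₁(ε); its divergence -log ε
  -- cancels the renormalisation and leaves -γΔ.
  have lim4 : Tendsto (fun ε : ℝ => ((scaledExpIntegral ε).re + Real.log ε) * Δ) (𝓝[>] 0)
      (𝓝 (-Real.eulerMascheroniConstant * Δ)) := by
    have := (continuous_re.tendsto _).comp tendsto_scaledExpIntegral_add_log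
    have h4 := this.mul_const Δ
    simpa [Function.comp_def] using h4
  have lim5 := (lim2.add lim4).sub lim1
  rw [← integral_sub i1 i0, ← integral_sub j1 j0]
  have key := tendsto_nhds_unique lim3 (lim5.congr' ?_)
  · simp only [Pi.sub_apply] at key
    linarith
  · filter_upwards [self_mem_nhdsWithin] with ε hε
    obtain ⟨a1, a2⟩ := hexp ε hε
    have hε0 := le_of_lt (Set.mem_Ioi.1 hε)
    simp only [hpt, hcharge]
    have e : ∀ ξ, Real.exp (-(ε * kinetic ξ)) * ((‖averagedWave φ q₀ q h τ ξ‖ ^ 2 -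
        ‖averagedWave φ q₀ q h 0 ξ‖ ^ 2) + (kinetic ξ + 1)⁻¹ * Δ -
        (averagedEnergyDensity φ q₀ q h τ ξ - averagedEnergyDensity φ q₀ q h 0 ξ)) =
        Real.exp (-(ε * kinetic ξ)) * (‖averagedWave φ q₀ q h τ ξ‖ ^ 2 -
          ‖averagedWave φ q₀ q h 0 ξ‖ ^ 2) +
        (Real.exp (-(ε * kinetic ξ)) * (kinetic ξ + 1)⁻¹) * Δ -
        Real.exp (-(ε * kinetic ξ)) *
          (averagedEnergyDensity φ q₀ q h τ ξ - averagedEnergyDensity φ q₀ q h 0 ξ) := fun ξ => by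
      ring
    have k1 : Integrable fun ξ => Real.exp (-(ε * kinetic ξ)) * (‖averagedWave φ q₀ q h τ ξ‖ ^ 2 -
        ‖averagedWave φ q₀ q h 0 ξ‖ ^ 2) := integrable_exp_neg_mul (i1.sub i0) hε0
    have k2 : Integrable fun ξ => Real.exp (-(ε * kinetic ξ)) *
        (averagedEnergyDensity φ q₀ q h τ ξ - averagedEnergyDensity φ q₀ q h 0 ξ) :=
      integrable_exp_neg_mul (j1.sub j0) hε0
    have k3 := a1.mul_const Δ
    have k13 : Integrable fun ξ => Real.exp (-(ε * kinetic ξ)) * (‖averagedWave φ q₀ q h τ ξ‖ ^ 2 -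
        ‖averagedWave φ q₀ q h 0 ξ‖ ^ 2) + (Real.exp (-(ε * kinetic ξ)) * (kinetic ξ + 1)⁻¹) * Δ :=
      k1.add k3
    simp only [e, Pi.sub_apply]
    rw [integral_sub k13 k2, integral_add k1 k3, integral_mul_const, ← a2]
    ring

end IsChargeSolution

end PointNLS

/-! ### Removing the average from the power of the charge -/

namespace PointNLS

variable {β₀ σ T : ℝ} {φ : Plane → ℂ} {q₀ : ℂ} {q : ℝ → ℂ}

theorem movingAverage_comp_add (f : ℝ → ℂ) (h t : ℝ) :
    movingAverage h (fun s => f (t + s)) 0 = movingAverage h f t := by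
  have := intervalIntegral.integral_comp_add_left (a := 0) (b := h) f t
  rw [add_zero] at this
  rw [movingAverage, movingAverage, zero_add, this]

theorem tendsto_movingAverage {f : ℝ → ℂ} (hf : Continuous f) (t : ℝ) :
    Tendsto (fun h => movingAverage h f t) (𝓝[>] 0) (𝓝 (f t)) := by
  rw [Metric.tendsto_nhds]
  intro η hη
  obtain ⟨δ, hδ, hδf⟩ := Metric.continuous_iff.1 hf t (η / 2) (by positivity)
  filter_upwards [Ioo_mem_nhdsGT hδ] with h hh
  rw [dist_eq_norm]
  refine (norm_movingAverage_sub_le hf hh.1 (C := η / 2) fun s hs => ?_).trans_lt (by linarith)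
  rw [← dist_eq_norm]
  refine (hδf s ?_).le
  rw [Real.dist_eq, abs_lt]
  constructor <;> linarith [hs.1, hs.2, hh.1, hh.2]

theorem tendsto_movingAverage_sub {f : ℝ → ℂ} (hf : Continuous f) (t : ℝ) :
    Tendsto (fun h => movingAverage h f (t - h)) (𝓝[>] 0) (𝓝 (f t)) := by
  rw [Metric.tendsto_nhds]
  intro η hη
  obtain ⟨δ, hδ, hδf⟩ := Metric.continuous_iff.1 hf t (η / 2) (by positivity)
  filter_upwards [Ioo_mem_nhdsGT hδ] with h hh
  rw [dist_eq_norm]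
  refine (norm_movingAverage_sub_le hf hh.1 (C := η / 2) fun s hs => ?_).trans_lt (by linarith)
  rw [← dist_eq_norm]
  refine (hδf s ?_).le
  rw [Real.dist_eq, abs_lt]
  constructor <;> linarith [hs.1, hs.2, hh.1, hh.2]

namespace IsChargeSolution

theorem mono (H : IsChargeSolution β₀ σ φ q₀ q T) {t : ℝ} (ht : t ∈ Set.Ioc 0 T) :
    IsChargeSolution β₀ σ φ q₀ q t :=
  ⟨H.half_le, ht.1, H.integrable, H.integrable_energy, H.cont,
    fun s hs => H.eq s ⟨hs.1, hs.2.trans ht.2⟩⟩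

theorem continuous_force (H : IsChargeSolution β₀ σ φ q₀ q T) :
    Continuous fun s => chargeForce β₀ σ (q s) :=
  (continuous_chargeForce (by linarith [H.half_le])).comp H.cont

/-- As h → 0 the integrand tends to twice ⟨iq, force(q)⟩, which vanishes because the force is a real
multiple of the charge. This is where gauge invariance enters. -/
theorem tendsto_integral_inner_I_mul (H : IsChargeSolution β₀ σ φ q₀ q T) :
    Tendsto (fun h : ℝ => ∫ t in (0 : ℝ)..(T - h), 2 * ⟪I * movingAverage h q t,
      movingAverage h (fun s => chargeForce β₀ σ (q s)) t⟫) (𝓝[>] 0) (𝓝 0) := by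
  have hq := H.cont
  have hP := H.continuous_force
  obtain ⟨R, hR⟩ := isCompact_Icc.exists_bound_of_continuousOn (s := Set.Icc 0 (T + 1))
    hq.continuousOn
  obtain ⟨S, hS⟩ := isCompact_Icc.exists_bound_of_continuousOn (s := Set.Icc 0 (T + 1))
    hP.continuousOn
  have hT := H.pos
  have e0 : ∀ z : ℂ, ⟪I * z, chargeForce β₀ σ z⟫ = 0 := fun z => by
    rw [chargeForce, ← real_smul, real_inner_smul_right]
    simp only [Complex.inner, mul_re, mul_im, conj_re, conj_im, I_re, I_im]; ring
  have hlim : Tendsto (fun h : ℝ => ∫ t in (0 : ℝ)..T, ‖2 * ⟪I * movingAverage h q t,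
      movingAverage h (fun s => chargeForce β₀ σ (q s)) t⟫‖) (𝓝[>] 0)
      (𝓝 (∫ _ in (0 : ℝ)..T, (0 : ℝ))) := by
    refine intervalIntegral.tendsto_integral_filter_of_dominated_convergence
      (fun _ => 2 * (R * S)) ?_ ?_ intervalIntegrable_const ?_
    · refine Eventually.of_forall fun h => ?_
      have h1 := continuous_movingAverage hq h
      have h2 := continuous_movingAverage hP h
      exact (by fun_prop : Continuous fun t => ‖2 * ⟪I * movingAverage h q t,
        movingAverage h (fun s => chargeForce β₀ σ (q s)) t⟫‖).aestronglyMeasurable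
    · filter_upwards [Ioo_mem_nhdsGT one_pos] with h hh
      refine Eventually.of_forall fun t ht => ?_
      rw [Set.uIoc_of_le hT.le] at ht
      rw [norm_norm, norm_mul, Real.norm_ofNat]
      gcongr
      refine (norm_inner_le_norm _ _).trans ?_
      rw [norm_mul, norm_I, one_mul]
      gcongr
      · exact (norm_nonneg _).trans (hR 0 ⟨le_rfl, by linarith⟩)
      · exact norm_movingAverage_le hh.1 fun s hs =>
          hR s ⟨by linarith [ht.1, hs.1], by linarith [hs.2, ht.2, hh.2]⟩
      · exact norm_movingAverage_le hh.1 fun s hs =>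
          hS s ⟨by linarith [ht.1, hs.1], by linarith [hs.2, ht.2, hh.2]⟩
    · refine Eventually.of_forall fun t _ => ?_
      have := (((tendsto_movingAverage hq t).const_mul I).inner
        (tendsto_movingAverage hP t)).const_mul (2 : ℝ)
      rw [e0, mul_zero] at this
      simpa using this.norm
  rw [intervalIntegral.integral_zero] at hlim
  refine squeeze_zero_norm' ?_ hlim
  filter_upwards [Ioo_mem_nhdsGT hT] with h hh
  have h1 := continuous_movingAverage hq h
  have h2 := continuous_movingAverage hP h
  refine (intervalIntegral.norm_integral_le_integral_norm (by linarith [hh.2])).trans ?_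
  exact intervalIntegral.integral_mono_interval le_rfl (by linarith [hh.2]) (by linarith [hh.1])
    (Eventually.of_forall fun _ => norm_nonneg _)
    ((by fun_prop : Continuous fun t => ‖2 * ⟪I * movingAverage h q t,
        movingAverage h (fun s => chargeForce β₀ σ (q s)) t⟫‖).intervalIntegrable _ _)

/-- The averaged force differs from the force by an average of its increments over shifts s ≤ h.
These are Lipschitz in the increments of q, whose mean square is o(s). -/
theorem tendsto_force_deviation (H : IsChargeSolution β₀ σ φ q₀ q T) :
    Tendsto (fun h : ℝ => h⁻¹ * ∫ t in (0 : ℝ)..(T - h),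
      ‖movingAverage h (fun s => chargeForce β₀ σ (q s)) t - chargeForce β₀ σ (q t)‖ ^ 2)
      (𝓝[>] 0) (𝓝 0) := by
  have hq := H.cont
  have hP := H.continuous_force
  obtain ⟨R, hR⟩ := H.exists_norm_le
  obtain ⟨L, hL⟩ := exists_lipschitz_chargeForce β₀ H.half_le R
  have hb := H.tendsto_increment
  rw [Metric.tendsto_nhds]
  intro η hη
  -- Chosen so that L²δ < η, also when L = 0.
  set δ : ℝ := η / (2 * (L ^ 2 + 1)) with hδ
  have hδ0 : 0 < δ := by positivity
  have hev := (Metric.tendsto_nhds.1 hb δ hδ0)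
  rw [eventually_nhdsWithin_iff, Metric.eventually_nhds_iff] at hev
  obtain ⟨r, hr, hev⟩ := hev
  filter_upwards [Ioo_mem_nhdsGT H.pos, Ioo_mem_nhdsGT hr] with h hh hhr
  have hh0 := hh.1
  have hTh : 0 ≤ T - h := by linarith [hh.2]
  set D : ℝ → ℂ := fun t =>
    movingAverage h (fun s => chargeForce β₀ σ (q s)) t - chargeForce β₀ σ (q t) with hD
  have hDc : Continuous D := (continuous_movingAverage hP h).sub hP
  have hinc : ∀ s ∈ Set.Ioc 0 h, ∫⁻ t in Set.Ioc 0 (T - h), ‖q (t + s) - q t‖ₑ ^ 2 ≤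
      ENNReal.ofReal (δ * h) := fun s hs => by
    have hc : Continuous fun t => ‖q (t + s) - q t‖ ^ 2 := by fun_prop
    have h1 := hev (y := s) (by
      rw [Real.dist_eq, sub_zero, abs_of_pos hs.1]; linarith [hs.2, hhr.2]) hs.1
    rw [Real.dist_eq, sub_zero] at h1
    have h2 := (le_abs_self _).trans h1.le
    rw [inv_mul_le_iff₀ hs.1] at h2
    rw [← ofReal_integral_norm_sq hc.integrableOn_Ioc]
    refine ENNReal.ofReal_le_ofReal ?_
    rw [← intervalIntegral.integral_of_le hTh]
    calc _ ≤ ∫ t in (0 : ℝ)..(T - s), ‖q (t + s) - q t‖ ^ 2 :=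
          intervalIntegral.integral_mono_interval le_rfl hTh (by linarith [hs.2])
            (Eventually.of_forall fun _ => by positivity) (hc.intervalIntegrable _ _)
      _ ≤ s * δ := h2
      _ ≤ δ * h := by rw [mul_comm]; gcongr; exact hs.2
  have hkey : ∫⁻ t in Set.Ioc 0 (T - h), ‖D t‖ₑ ^ 2 ≤ ENNReal.ofReal (L ^ 2 * (δ * h)) := by
    have hm : Measurable fun p : ℝ × ℝ => ‖chargeForce β₀ σ (q (p.1 + p.2)) -
        chargeForce β₀ σ (q p.1)‖ₑ ^ 2 := by
      have hPm := hP.measurable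
      have a1 : Measurable fun p : ℝ × ℝ => chargeForce β₀ σ (q (p.1 + p.2)) :=
        hPm.comp (by fun_prop : Measurable fun p : ℝ × ℝ => p.1 + p.2)
      have a2 : Measurable fun p : ℝ × ℝ => chargeForce β₀ σ (q p.1) := hPm.comp measurable_fst
      exact (a1.sub a2).enorm.pow_const 2
    calc ∫⁻ t in Set.Ioc 0 (T - h), ‖D t‖ₑ ^ 2
        ≤ ∫⁻ t in Set.Ioc 0 (T - h), ENNReal.ofReal h⁻¹ * ∫⁻ s in Set.Ioc 0 h,
            ‖chargeForce β₀ σ (q (t + s)) - chargeForce β₀ σ (q t)‖ₑ ^ 2 := by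
          refine lintegral_mono fun t => ?_
          have hsh : Continuous fun s => chargeForce β₀ σ (q (t + s)) :=
            hP.comp (by fun_prop : Continuous fun s : ℝ => t + s)
          have hc : Continuous fun s => chargeForce β₀ σ (q (t + s)) - chargeForce β₀ σ (q t) :=
            hsh.sub continuous_const
          have e : D t = movingAverage h (fun s => chargeForce β₀ σ (q (t + s)) -
              chargeForce β₀ σ (q t)) 0 := by
            rw [movingAverage_sub hsh continuous_const, movingAverage_const hh0.ne',
              movingAverage_comp_add (fun s => chargeForce β₀ σ (q s))]
          have := enorm_movingAverage_sq_le hc hh0 0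
          rwa [zero_add, ← e] at this
      _ = ENNReal.ofReal h⁻¹ * ∫⁻ s in Set.Ioc 0 h, ∫⁻ t in Set.Ioc 0 (T - h),
            ‖chargeForce β₀ σ (q (t + s)) - chargeForce β₀ σ (q t)‖ₑ ^ 2 := by
          rw [lintegral_const_mul' _ _ ENNReal.ofReal_ne_top,
            lintegral_lintegral_swap hm.aemeasurable]
      _ ≤ ENNReal.ofReal h⁻¹ * ∫⁻ s in Set.Ioc 0 h, ENNReal.ofReal (L ^ 2 * (δ * h)) := by
          refine mul_le_mul_right (setLIntegral_mono' measurableSet_Ioc fun s hs => ?_) _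
          calc _ ≤ ∫⁻ t in Set.Ioc 0 (T - h), ENNReal.ofReal (L ^ 2) * ‖q (t + s) - q t‖ₑ ^ 2 := by
                refine setLIntegral_mono' measurableSet_Ioc fun t ht => ?_
                have := hL (q (t + s)) (q t) (hR _ ⟨by linarith [ht.1, hs.1], by
                  linarith [ht.2, hs.2]⟩) (hR _ ⟨ht.1.le, by linarith [ht.2]⟩)
                rw [← ofReal_norm, ← ofReal_norm, ← ENNReal.ofReal_pow (norm_nonneg _),
                  ← ENNReal.ofReal_pow (norm_nonneg _), ← ENNReal.ofReal_mul (by positivity),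
                  ← mul_pow]
                gcongr
            _ ≤ _ := by
                rw [lintegral_const_mul' _ _ ENNReal.ofReal_ne_top,
                  ENNReal.ofReal_mul (by positivity)]
                exact mul_le_mul_right (hinc s hs) _
      _ = _ := by
          rw [lintegral_const, Measure.restrict_apply_univ, Real.volume_Ioc, sub_zero, mul_comm,
            mul_assoc, ← ENNReal.ofReal_mul hh0.le, mul_inv_cancel₀ hh0.ne', ENNReal.ofReal_one,
            mul_one]
  have h2 := (integrable_and_integral_le_of_lintegral_enorm_sq_le
    hDc.aestronglyMeasurable (by positivity) hkey).2
  rw [Real.dist_eq, sub_zero, intervalIntegral.integral_of_le hTh]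
  have h3 : 0 ≤ ∫ t in Set.Ioc 0 (T - h), ‖D t‖ ^ 2 := integral_nonneg fun _ => by positivity
  rw [abs_of_nonneg (by positivity), inv_mul_lt_iff₀ hh0]
  refine h2.trans_lt ?_
  have h4 : (L : ℝ) ^ 2 * δ < η := by
    rw [hδ, mul_div_assoc', div_lt_iff₀ (by positivity)]
    nlinarith [sq_nonneg (L : ℝ)]
  nlinarith

/-- With d the increment of q over h, Taylor's formula gives the increment of the potential as
2⟨force, d⟩ + O(|d|²). The Taylor error and the deviation of the averaged force contribute at most
h⁻¹∫|d|² and h⁻¹∫|deviation|², up to constants, and both tend to 0. -/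
theorem tendsto_integral_inner_increment (H : IsChargeSolution β₀ σ φ q₀ q T) :
    Tendsto (fun h : ℝ => ∫ t in (0 : ℝ)..(T - h), 2 * ⟪(h : ℂ)⁻¹ * (q (t + h) - q t),
      movingAverage h (fun s => chargeForce β₀ σ (q s)) t⟫) (𝓝[>] 0)
      (𝓝 (chargePotential β₀ σ (q T) - chargePotential β₀ σ (q 0))) := by
  have hq := H.cont
  have hP := H.continuous_force
  have hV : Continuous fun s => chargePotential β₀ σ (q s) :=
    (continuous_chargePotential (by linarith [H.half_le])).comp hq
  have hVc : Continuous fun s => (chargePotential β₀ σ (q s) : ℂ) := by fun_prop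
  obtain ⟨R, hR⟩ := H.exists_norm_le
  obtain ⟨C, hC0, hC⟩ := exists_chargePotential_taylor β₀ H.half_le R
  have lim1 : Tendsto (fun h : ℝ => ∫ t in (0 : ℝ)..(T - h),
      h⁻¹ * (chargePotential β₀ σ (q (t + h)) - chargePotential β₀ σ (q t))) (𝓝[>] 0)
      (𝓝 (chargePotential β₀ σ (q T) - chargePotential β₀ σ (q 0))) := by
    -- The integral over [0, T - h] of the difference quotient telescopes to the mean of the
    -- potential over [T - h, T] minus its mean over [0, h].
    have h1 := (tendsto_movingAverage_sub hVc T).sub (tendsto_movingAverage hVc 0)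
    have h2 := (continuous_re.tendsto _).comp h1
    simp only [sub_re, ofReal_re] at h2
    refine h2.congr' ?_
    filter_upwards [self_mem_nhdsWithin] with h hh
    have e1 : ∀ a b : ℝ, ∫ s in a..b, (chargePotential β₀ σ (q s) : ℂ) =
        ((∫ s in a..b, chargePotential β₀ σ (q s) : ℝ) : ℂ) := fun a b =>
      intervalIntegral.integral_ofReal
    have hi : ∀ a b, IntervalIntegrable (fun s => chargePotential β₀ σ (q s)) volume a b :=
      fun a b => hV.intervalIntegrable a b
    have hVs : Continuous fun s => chargePotential β₀ σ (q (s + h)) :=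
      hV.comp (by fun_prop : Continuous fun s : ℝ => s + h)
    simp only [Function.comp_apply, movingAverage, e1, ← ofReal_inv, ← ofReal_mul, ← ofReal_sub,
      ofReal_re, zero_add, sub_add_cancel]
    rw [intervalIntegral.integral_const_mul, intervalIntegral.integral_sub
      (hVs.intervalIntegrable _ _) (hi _ _),
      intervalIntegral.integral_comp_add_right (fun s => chargePotential β₀ σ (q s)), zero_add,
      sub_add_cancel, ← mul_sub]
    congr 1
    have a1 := intervalIntegral.integral_add_adjacent_intervals (hi 0 h) (hi h T)
    have a2 := intervalIntegral.integral_add_adjacent_intervals (hi 0 (T - h)) (hi (T - h) T)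
    linarith
  have lim2 := (H.tendsto_increment.const_mul (C + 1)).add H.tendsto_force_deviation
  rw [mul_zero, add_zero] at lim2
  have lim3 : Tendsto (fun h : ℝ => (∫ t in (0 : ℝ)..(T - h), 2 * ⟪(h : ℂ)⁻¹ * (q (t + h) - q t),
      movingAverage h (fun s => chargeForce β₀ σ (q s)) t⟫) - ∫ t in (0 : ℝ)..(T - h),
      h⁻¹ * (chargePotential β₀ σ (q (t + h)) - chargePotential β₀ σ (q t))) (𝓝[>] 0) (𝓝 0) := by
    refine squeeze_zero_norm' ?_ lim2
    filter_upwards [Ioo_mem_nhdsGT H.pos] with h hh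
    have hh0 := hh.1
    have hTh : 0 ≤ T - h := by linarith [hh.2]
    have hav := continuous_movingAverage hP h
    have hVs : Continuous fun s => chargePotential β₀ σ (q (s + h)) :=
      hV.comp (by fun_prop : Continuous fun s : ℝ => s + h)
    have c1 : Continuous fun t => ‖q (t + h) - q t‖ ^ 2 := by fun_prop
    have c2 : Continuous fun t => ‖movingAverage h (fun s => chargeForce β₀ σ (q s)) t -
      chargeForce β₀ σ (q t)‖ ^ 2 := by fun_prop
    rw [← intervalIntegral.integral_sub
      ((by fun_prop : Continuous fun t => 2 * ⟪(h : ℂ)⁻¹ * (q (t + h) - q t),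
        movingAverage h (fun s => chargeForce β₀ σ (q s)) t⟫).intervalIntegrable _ _)
      ((by fun_prop : Continuous fun t => h⁻¹ * (chargePotential β₀ σ (q (t + h)) -
        chargePotential β₀ σ (q t))).intervalIntegrable _ _)]
    have hb : IntervalIntegrable (fun t => h⁻¹ * ((C + 1) * ‖q (t + h) - q t‖ ^ 2 +
        ‖movingAverage h (fun s => chargeForce β₀ σ (q s)) t - chargeForce β₀ σ (q t)‖ ^ 2))
        volume 0 (T - h) := by
      exact (((c1.const_smul (C + 1)).add c2).const_smul h⁻¹).intervalIntegrable _ _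
    refine (intervalIntegral.norm_integral_le_of_norm_le hTh (Eventually.of_forall fun t ht => ?_)
      hb).trans (le_of_eq ?_)
    · have h1 := hC (q t) (q (t + h)) (hR _ ⟨ht.1.le, by linarith [ht.2]⟩)
        (hR _ ⟨by linarith [ht.1], by linarith [ht.2]⟩)
      set A := movingAverage h (fun s => chargeForce β₀ σ (q s)) t
      set P := chargeForce β₀ σ (q t)
      set d := q (t + h) - q t
      have e : 2 * ⟪(h : ℂ)⁻¹ * d, A⟫ -
          h⁻¹ * (chargePotential β₀ σ (q (t + h)) - chargePotential β₀ σ (q t)) =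
          h⁻¹ * (2 * ⟪d, A - P⟫ - (chargePotential β₀ σ (q (t + h)) -
            chargePotential β₀ σ (q t) - 2 * ⟪P, d⟫)) := by
        rw [← ofReal_inv, ← real_smul, real_inner_smul_left, inner_sub_right, real_inner_comm d P]
        ring
      rw [e, norm_mul, Real.norm_of_nonneg (by positivity)]
      gcongr
      refine (norm_sub_le _ _).trans ?_
      rw [Real.norm_eq_abs, Real.norm_eq_abs, abs_mul, abs_two]
      have h2 := abs_real_inner_le_norm d (A - P)
      nlinarith [sq_nonneg (‖d‖ - ‖A - P‖)]
    · rw [intervalIntegral.integral_const_mul, intervalIntegral.integral_add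
        ((c1.intervalIntegrable _ _).const_mul (C + 1)) (c2.intervalIntegrable _ _),
        intervalIntegral.integral_const_mul]
      ring
  have := lim3.add lim1
  simpa using this

end IsChargeSolution

end PointNLS

/-! ### The limit at the initial time -/

namespace PointNLS

variable {β₀ σ T : ℝ} {φ : Plane → ℂ} {q₀ : ℂ} {q : ℝ → ℂ}

/-- Continuity of the L² norm stated for functions, from ||a|² - |b|²| ≤ (1 + 1/η)|a - b|² + η|b|².
-/
theorem tendsto_integral_norm_sq {l : Filter ℝ} {F : ℝ → Plane → ℂ} {f : Plane → ℂ}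
    (hFm : ∀ᶠ h in l, AEStronglyMeasurable (F h)) (hF : ∀ᶠ h in l, Integrable fun ξ => ‖F h ξ‖ ^ 2)
    (hfm : AEStronglyMeasurable f) (hf : Integrable fun ξ => ‖f ξ‖ ^ 2)
    (hlim : Tendsto (fun h => ∫ ξ, ‖F h ξ - f ξ‖ ^ 2) l (𝓝 0)) :
    Tendsto (fun h => ∫ ξ, ‖F h ξ‖ ^ 2) l (𝓝 (∫ ξ, ‖f ξ‖ ^ 2)) := by
  rw [Metric.tendsto_nhds]
  intro δ hδ
  set A := ∫ ξ, ‖f ξ‖ ^ 2 with hA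
  have hA0 : 0 ≤ A := integral_nonneg fun _ => by positivity
  set η : ℝ := δ / (2 * (A + 1)) with hη
  have hη0 : 0 < η := by positivity
  have h1 := hlim.const_mul (1 + η⁻¹)
  rw [mul_zero] at h1
  filter_upwards [hFm, hF, (Metric.tendsto_nhds.1 h1) (δ / 2) (by positivity)] with h hm hi hh
  have hD : Integrable fun ξ => ‖F h ξ - f ξ‖ ^ 2 := by
    refine ((hi.const_mul 2).add (hf.const_mul 2)).mono' ((hm.sub hfm).norm.pow 2)
      (Eventually.of_forall fun ξ => ?_)
    rw [Real.norm_of_nonneg (by positivity), sub_eq_add_neg]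
    simpa using norm_sq_add_le (F h ξ) (-f ξ)
  rw [Real.dist_eq, sub_zero] at hh
  rw [Real.dist_eq, hA, ← integral_sub hi hf]
  have hb : ∀ ξ, ‖‖F h ξ‖ ^ 2 - ‖f ξ‖ ^ 2‖ ≤ (1 + η⁻¹) * ‖F h ξ - f ξ‖ ^ 2 + η * ‖f ξ‖ ^ 2 := fun ξ => by
    set a := ‖F h ξ‖
    set b := ‖f ξ‖
    set d := ‖F h ξ - f ξ‖
    have hab : |a - b| ≤ d := abs_norm_sub_norm_le _ _
    have hb0 : 0 ≤ b := norm_nonneg _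
    have e : a ^ 2 - b ^ 2 = (a - b) ^ 2 + 2 * b * (a - b) := by ring
    have h2 : 2 * b * d ≤ η⁻¹ * d ^ 2 + η * b ^ 2 := by
      have : 0 ≤ η⁻¹ * (d - η * b) ^ 2 := by positivity
      have e2 : η⁻¹ * (d - η * b) ^ 2 = η⁻¹ * d ^ 2 - 2 * b * d + η * b ^ 2 := by field_simp; ring
      linarith
    rw [e, Real.norm_eq_abs]
    refine (abs_add_le _ _).trans ?_
    rw [abs_of_nonneg (sq_nonneg (a - b)), abs_mul, abs_of_nonneg (by positivity : 0 ≤ 2 * b)]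
    have h3 : (a - b) ^ 2 ≤ d ^ 2 := by rw [← sq_abs]; gcongr
    have h4 : 2 * b * |a - b| ≤ 2 * b * d := by gcongr
    linarith
  have := norm_integral_le_of_norm_le ((hD.const_mul (1 + η⁻¹)).add (hf.const_mul η))
    (Eventually.of_forall hb)
  rw [Real.norm_eq_abs, integral_add' (hD.const_mul (1 + η⁻¹)) (hf.const_mul η),
    integral_const_mul, integral_const_mul] at this
  have h5 : η * A < δ / 2 := by
    rw [hη, div_mul_eq_mul_div, div_lt_iff₀ (by positivity)]
    nlinarith
  exact this.trans_lt (by linarith [le_abs_self ((1 + η⁻¹) * ∫ ξ, ‖F h ξ - f ξ‖ ^ 2)])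

theorem tendsto_integral_oscillation_sub_one {f : Plane → ℂ} (hfm : AEStronglyMeasurable f)
    (hf : Integrable fun ξ => ‖f ξ‖ ^ 2) :
    Tendsto (fun h : ℝ => ∫ ξ, ‖(movingAverage h (fun s => Complex.exp (-(I * kinetic ξ * s))) 0 - 1) *
      f ξ‖ ^ 2) (𝓝[>] 0) (𝓝 0) := by
  have hk := continuous_kinetic
  have hcm : ∀ h, Continuous fun ξ : Plane =>
      movingAverage h (fun s => Complex.exp (-(I * kinetic ξ * s))) 0 := fun h =>
    Continuous.comp (g := fun p : ℝ × ℝ => movingAverage h (fun s => Complex.exp (-(I * p.2 * s))) p.1)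
      (f := fun ξ : Plane => (0, kinetic ξ))
      (continuous_movingAverage_uncurry (F := fun s k => Complex.exp (-(I * k * s))) (by fun_prop) h)
      (by fun_prop)
  rw [show (0 : ℝ) = ∫ _ : Plane, (0 : ℝ) by simp]
  rw [integral_zero]
  have := tendsto_integral_filter_of_dominated_convergence (μ := (volume : Measure Plane))
    (l := 𝓝[>] (0 : ℝ)) (F := fun h ξ => ‖(movingAverage h (fun s =>
      Complex.exp (-(I * kinetic ξ * s))) 0 - 1) * f ξ‖ ^ 2) (f := fun _ => (0 : ℝ))
    (fun ξ => 4 * ‖f ξ‖ ^ 2) ?_ ?_ (hf.const_mul 4) ?_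
  · simpa using this
  · exact Eventually.of_forall fun h =>
      (((hcm h).sub continuous_const).aestronglyMeasurable.mul hfm).norm.pow 2
  · filter_upwards [self_mem_nhdsWithin] with h hh
    refine Eventually.of_forall fun ξ => ?_
    rw [Real.norm_of_nonneg (by positivity), norm_mul, mul_pow]
    have h1 : ‖movingAverage h (fun s => Complex.exp (-(I * kinetic ξ * s))) 0 - 1‖ ≤ 2 := by
      refine (norm_sub_le _ _).trans ?_
      have := norm_movingAverage_oscillation_le (Set.mem_Ioi.1 hh) 0 (kinetic ξ)
      rw [norm_one]; linarith
    gcongr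
    nlinarith [norm_nonneg (movingAverage h (fun s => Complex.exp (-(I * kinetic ξ * s))) 0 - 1)]
  · refine Eventually.of_forall fun ξ => ?_
    have h1 := tendsto_movingAverage (f := fun s : ℝ => Complex.exp (-(I * kinetic ξ * s)))
      (by fun_prop) 0
    have h2 := (((h1.sub_const 1).mul_const (f ξ)).norm).pow 2
    simpa using h2

/-- Split at k = 1/h. Below, the emitted wave is at most ηh and 1/(k+1) integrates to log(1 + 1/h);
above, 1/(k+1) ≤ h and Plancherel applies. -/
theorem integral_sq_sourceWave_div_le {u : ℝ → ℂ} (hu : Continuous u) {h η : ℝ} (hh : 0 < h)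
    (hη : ∀ s ∈ Set.Icc 0 h, ‖u s‖ ≤ η) :
    Integrable (fun ξ : Plane => ‖sourceWave u h (kinetic ξ)‖ ^ 2 / (kinetic ξ + 1)) ∧
    ∫ ξ : Plane, ‖sourceWave u h (kinetic ξ)‖ ^ 2 / (kinetic ξ + 1) ≤
      h ^ 2 * (η ^ 2 * (Real.log (1 + h⁻¹) + 1)) := by
  obtain ⟨i1, i2⟩ := integral_norm_sq_sourceWave_le hu hh.le
  have hk := continuous_kinetic
  have hη0 : 0 ≤ η := (norm_nonneg _).trans (hη 0 ⟨le_rfl, hh.le⟩)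
  have hm : Measurable fun k : ℝ => (((Set.Iic h⁻¹).indicator (fun k => (k + 1)⁻¹) k : ℝ) : ℂ) :=
    measurable_ofReal.comp (Measurable.indicator (by fun_prop) measurableSet_Iic)
  have hset : Set.Iic h⁻¹ ∩ Set.Ioi 0 = Set.Ioc 0 h⁻¹ := by
    ext x; simp [and_comm]
  have hinv : IntervalIntegrable (fun k : ℝ => (k + 1)⁻¹) volume 0 h⁻¹ := by
    refine ContinuousOn.intervalIntegrable (ContinuousOn.inv₀ (by fun_prop) fun k hk => ?_)
    rw [Set.uIcc_of_le (by positivity)] at hk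
    linarith [hk.1]
  have hval : ∫ k in (0 : ℝ)..h⁻¹, (k + 1)⁻¹ = Real.log (1 + h⁻¹) := by
    rw [intervalIntegral.integral_comp_add_right (fun k : ℝ => k⁻¹), zero_add,
      integral_inv_of_pos one_pos (by positivity), div_one, add_comm]
  have hon : IntegrableOn (fun k : ℝ => (((Set.Iic h⁻¹).indicator (fun k => (k + 1)⁻¹) k : ℝ) : ℂ))
      (Set.Ioi 0) := by
    have h0 : IntegrableOn ((Set.Iic h⁻¹).indicator fun k : ℝ => (k + 1)⁻¹) (Set.Ioi 0) := by
      rw [IntegrableOn, integrable_indicator_iff measurableSet_Iic, IntegrableOn,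
        Measure.restrict_restrict measurableSet_Iic, hset]
      exact (intervalIntegrable_iff_integrableOn_Ioc_of_le (by positivity)).1 hinv
    exact Integrable.ofReal h0
  have j1 := ((integrable_comp_kinetic hm).2 hon)
  have j2 := integral_comp_kinetic hm
  have j1r : Integrable fun ξ : Plane => (Set.Iic h⁻¹).indicator (fun k => (k + 1)⁻¹) (kinetic ξ) :=
    j1.re.congr (Eventually.of_forall fun ξ => ofReal_re _)
  have j2r : ∫ ξ : Plane, (Set.Iic h⁻¹).indicator (fun k => (k + 1)⁻¹) (kinetic ξ) =
      1 / (4 * Real.pi) * Real.log (1 + h⁻¹) := by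
    rw [integral_complex_ofReal, integral_complex_ofReal, ← ofReal_mul] at j2
    rw [ofReal_injective j2, integral_indicator measurableSet_Iic,
      Measure.restrict_restrict measurableSet_Iic, hset, ← hval,
      intervalIntegral.integral_of_le (by positivity)]
  have hsc : Continuous fun ξ : Plane => sourceWave u h (kinetic ξ) :=
    Continuous.comp (g := fun p : ℝ × ℝ => sourceWave u p.1 p.2) (f := fun ξ => (h, kinetic ξ))
      (continuous_sourceWave hu) (continuous_const.prodMk continuous_kinetic)
  have hb : ∀ ξ : Plane, ‖sourceWave u h (kinetic ξ)‖ ^ 2 / (kinetic ξ + 1) ≤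
      (η * h) ^ 2 * (Set.Iic h⁻¹).indicator (fun k => (k + 1)⁻¹) (kinetic ξ) +
        h * ‖sourceWave u h (kinetic ξ)‖ ^ 2 := fun ξ => by
    have h0 := kinetic_nonneg ξ
    by_cases hx : kinetic ξ ∈ Set.Iic h⁻¹
    · rw [Set.indicator_of_mem hx, div_eq_mul_inv]
      refine le_add_of_le_of_nonneg ?_ (by positivity)
      gcongr
      exact norm_sourceWave_le hh.le hη
    · rw [Set.indicator_of_notMem hx, mul_zero, zero_add, div_eq_mul_inv, mul_comm]
      gcongr
      rw [Set.mem_Iic, not_le] at hx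
      rw [inv_le_comm₀ (by linarith) hh]
      linarith
  have hi := (j1r.const_mul ((η * h) ^ 2)).add (i1.const_mul h)
  have hint : Integrable (fun ξ : Plane => ‖sourceWave u h (kinetic ξ)‖ ^ 2 / (kinetic ξ + 1)) := by
    refine hi.mono' ?_ (Eventually.of_forall fun ξ => ?_)
    · exact (Continuous.div (by fun_prop) (by fun_prop)
        fun ξ => (by linarith [kinetic_nonneg ξ] : kinetic ξ + 1 ≠ 0)).aestronglyMeasurable
    · rw [Real.norm_of_nonneg (div_nonneg (by positivity) (by linarith [kinetic_nonneg ξ]))]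
      exact hb ξ
  refine ⟨hint, (integral_mono hint hi hb).trans ?_⟩
  rw [integral_add' (j1r.const_mul _) (i1.const_mul h), integral_const_mul, integral_const_mul, j2r]
  have hL : 0 ≤ Real.log (1 + h⁻¹) := Real.log_nonneg (by linarith [inv_pos.2 hh])
  have h3 : ∫ s in (0 : ℝ)..h, ‖u s‖ ^ 2 ≤ h * η ^ 2 := by
    have : ∫ s in (0 : ℝ)..h, ‖u s‖ ^ 2 ≤ ∫ _ in (0 : ℝ)..h, η ^ 2 := by
      refine intervalIntegral.integral_mono_on hh.le
        ((by fun_prop : Continuous fun s => ‖u s‖ ^ 2).intervalIntegrable _ _)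
        intervalIntegrable_const fun s hs => ?_
      have := hη s hs
      gcongr
    simpa using this
  have h4 : 1 / (4 * Real.pi) ≤ 1 := by
    rw [div_le_one (by positivity)]; linarith [Real.pi_gt_three]
  calc _ ≤ (η * h) ^ 2 * (1 * Real.log (1 + h⁻¹)) + h * (h * η ^ 2) := by
        gcongr
        exact i2.trans h3
    _ = _ := by ring

/-- With ℓ = -log h ≥ 1, both ν(h) and h are O(1/ℓ), while the logarithm is at most 3ℓ; the product
is O(1/ℓ). A modulus of order 1/log is thus just good enough. -/
theorem tendsto_sq_volterraPrimitive_mul_log (C : ℝ) :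
    Tendsto (fun h : ℝ => (C * (volterraPrimitive h + h)) ^ 2 * (Real.log (1 + h⁻¹) + 1)) (𝓝[>] 0)
      (𝓝 0) := by
  have hlog : Tendsto (fun h : ℝ => C ^ 2 * (Real.exp 1 + 1) ^ 2 * 3 * (-Real.log h)⁻¹) (𝓝[>] 0)
      (𝓝 0) := by
    have h1 : Tendsto (fun h : ℝ => -Real.log h) (𝓝[>] 0) atTop :=
      tendsto_neg_atBot_atTop.comp Real.tendsto_log_nhdsGT_zero
    simpa using h1.inv_tendsto_atTop.const_mul (C ^ 2 * (Real.exp 1 + 1) ^ 2 * 3)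
  refine squeeze_zero' ?_ ?_ hlog
  · filter_upwards [self_mem_nhdsWithin] with h hh
    have hh : 0 < h := hh
    have : 0 ≤ Real.log (1 + h⁻¹) := Real.log_nonneg (by linarith [inv_pos.2 hh])
    positivity
  · filter_upwards [Ioo_mem_nhdsGT (Real.exp_pos (-1))] with h hh
    have hh0 := hh.1
    have he : Real.exp (-1) < 1 := by simp
    set ℓ := -Real.log h with hℓ
    have hℓ1 : 1 ≤ ℓ := by
      have := Real.log_le_log hh0 hh.2.le
      rw [Real.log_exp] at this
      linarith
    have hℓ0 : 0 < ℓ := by linarith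
    have h1 : volterraPrimitive h ≤ Real.exp 1 / ℓ := volterraPrimitive_le hh0 (by linarith [hh.2])
    have h2 : h ≤ 1 / ℓ := by
      rw [le_div_iff₀ hℓ0]
      have h3 := Real.log_le_sub_one_of_pos (inv_pos.2 hh0)
      rw [Real.log_inv] at h3
      calc h * ℓ ≤ h * h⁻¹ := by gcongr; linarith
        _ = 1 := mul_inv_cancel₀ hh0.ne'
    have h3 : Real.log (1 + h⁻¹) + 1 ≤ 3 * ℓ := by
      have h4 : 1 ≤ h⁻¹ := (one_le_inv₀ hh0).2 (by linarith [hh.2])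
      have h5 : Real.log (1 + h⁻¹) ≤ Real.log (2 * h⁻¹) :=
        Real.log_le_log (by positivity) (by linarith)
      rw [Real.log_mul two_ne_zero (by positivity), Real.log_inv] at h5
      have := Real.log_two_lt_d9
      linarith
    have h6 := volterraPrimitive_nonneg hh0.le
    have hl0 : 0 ≤ Real.log (1 + h⁻¹) := Real.log_nonneg (by linarith [inv_pos.2 hh0])
    calc _ = C ^ 2 * (volterraPrimitive h + h) ^ 2 * (Real.log (1 + h⁻¹) + 1) := by ring
      _ ≤ C ^ 2 * (Real.exp 1 / ℓ + 1 / ℓ) ^ 2 * (3 * ℓ) := by gcongr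
      _ = _ := by field_simp

/-- Modulus of continuity of the charge at the initial time. -/
def HasVolterraModulus (q : ℝ → ℂ) (q₀ : ℂ) : Prop :=
  ∃ C δ : ℝ, 0 ≤ C ∧ 0 < δ ∧ ∀ s ∈ Set.Icc 0 δ, ‖q s - q₀‖ ≤ C * (volterraPrimitive s + s)

/-- Writing q = q₀ + (q - q₀) in the source, the constant part cancels exactly the singular part
q₀/(k+1) of the datum. What remains is the averaged regular part and two terms with a denominator k
+ 1, the last carrying only the defect q - q₀. -/
theorem averagedWave_zero_sub_div (hq : Continuous q) {h : ℝ} (hh : 0 < h) (ξ : Plane) :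
    averagedWave φ q₀ q h 0 ξ - movingAverage h q 0 / (kinetic ξ + 1) =
      movingAverage h (fun s => Complex.exp (-(I * kinetic ξ * s))) 0 * φ ξ +
      (I * movingAverage h (fun s => sourceWave q s (kinetic ξ)) 0 -
        (h : ℂ)⁻¹ * sourceWave (fun s => q s - q₀) h (kinetic ξ)) / (kinetic ξ + 1) := by
  have hk1 : (kinetic ξ : ℂ) + 1 ≠ 0 := by
    exact_mod_cast (by linarith [kinetic_nonneg ξ] : kinetic ξ + 1 ≠ 0)
  have hh' : (h : ℂ) ≠ 0 := ofReal_ne_zero.2 hh.ne'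
  set a := movingAverage h (fun s => Complex.exp (-(I * kinetic ξ * s))) 0 with ha
  have e1 : Complex.exp (-(I * kinetic ξ * h)) = 1 - I * kinetic ξ * (h * a) := by
    have h1 := wave_increment 1 (q := fun _ => 0) continuous_const (h := h) 0 (kinetic ξ)
    simp only [zero_add, wave_zero, movingAverage_const hh.ne', mul_zero, add_zero] at h1
    simp only [wave, sourceWave, mul_zero, intervalIntegral.integral_zero, add_zero, mul_one,
      ← ha] at h1
    rw [inv_mul_eq_iff_eq_mul₀ hh'] at h1
    linear_combination h1
  have e2 : sourceWave q h (kinetic ξ) = q₀ * (h * a) +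
      sourceWave (fun s => q s - q₀) h (kinetic ξ) := by
    rw [ha, movingAverage, mul_inv_cancel_left₀ hh', sourceWave, sourceWave, zero_add,
      ← intervalIntegral.integral_const_mul, ← intervalIntegral.integral_add]
    · refine intervalIntegral.integral_congr fun s _ => ?_
      ring
    · exact (by fun_prop : Continuous _).intervalIntegrable _ _
    · exact (by fun_prop : Continuous _).intervalIntegrable _ _
  rw [averagedWave, movingAverage_wave_sub_div _ hq 0 (kinetic_nonneg ξ), movingAverage_wave _ hq,
    zero_add, wave_zero, wave, e1, e2, ← ha, initialWave]
  field_simp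
  ring_nf
  simp only [I_sq]
  ring

theorem tendsto_integral_norm_sq_averagedWave_zero (hφ : AEStronglyMeasurable φ)
    (h2 : Integrable fun ξ => ‖φ ξ‖ ^ 2) (q₀ : ℂ) (hq : Continuous q) :
    Tendsto (fun h : ℝ => ∫ ξ, ‖averagedWave φ q₀ q h 0 ξ‖ ^ 2) (𝓝[>] 0)
      (𝓝 (∫ ξ, ‖initialWave φ q₀ ξ‖ ^ 2)) := by
  have hg := aestronglyMeasurable_initialWave hφ q₀
  have hg2 := integrable_norm_sq_initialWave hφ h2 q₀
  have lim1 := tendsto_integral_oscillation_sub_one hg hg2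
  have lim2 : Tendsto (fun h : ℝ => ∫ s in (0 : ℝ)..h, ‖q s‖ ^ 2) (𝓝[>] 0) (𝓝 0) := by
    have hc : Continuous fun h : ℝ => ∫ s in (0 : ℝ)..h, ‖q s‖ ^ 2 :=
      intervalIntegral.continuous_primitive
        (fun a b => (by fun_prop : Continuous fun s => ‖q s‖ ^ 2).intervalIntegrable a b) 0
    simpa using (hc.tendsto 0).mono_left (nhdsWithin_le_nhds (s := Set.Ioi 0))
  have lim3 := (lim1.const_mul 2).add (lim2.const_mul 2)
  rw [mul_zero, add_zero] at lim3
  refine tendsto_integral_norm_sq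
    (Eventually.of_forall fun h => aestronglyMeasurable_averagedWave hφ q₀ hq h 0) ?_ hg hg2
    (squeeze_zero' (Eventually.of_forall fun _ => integral_nonneg fun _ => by positivity) ?_ lim3)
  · filter_upwards [self_mem_nhdsWithin] with h hh
    exact integrable_norm_sq_averagedWave hφ h2 q₀ hq hh le_rfl
  · filter_upwards [self_mem_nhdsWithin] with h hh
    have hh : 0 < h := hh
    obtain ⟨i1, i2⟩ := integral_norm_sq_movingAverage_sourceWave_le hq hh le_rfl
    rw [zero_add] at i2
    have i3 : Integrable fun ξ => ‖(movingAverage h (fun s => Complex.exp (-(I * kinetic ξ * s))) 0 -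
        1) * initialWave φ q₀ ξ‖ ^ 2 := by
      have hcm : Continuous fun ξ : Plane =>
          movingAverage h (fun s => Complex.exp (-(I * kinetic ξ * s))) 0 :=
        Continuous.comp
          (g := fun p : ℝ × ℝ => movingAverage h (fun s => Complex.exp (-(I * p.2 * s))) p.1)
          (f := fun ξ : Plane => (0, kinetic ξ))
          (continuous_movingAverage_uncurry (F := fun s k => Complex.exp (-(I * k * s)))
            (by fun_prop) h) (continuous_const.prodMk continuous_kinetic)
      refine (hg2.const_mul 4).mono' (((hcm.sub continuous_const).aestronglyMeasurable.mul
        hg).norm.pow 2) (Eventually.of_forall fun ξ => ?_)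
      rw [Real.norm_of_nonneg (by positivity), norm_mul, mul_pow]
      have h1 : ‖movingAverage h (fun s => Complex.exp (-(I * kinetic ξ * s))) 0 - 1‖ ≤ 2 := by
        refine (norm_sub_le _ _).trans ?_
        have := norm_movingAverage_oscillation_le hh 0 (kinetic ξ)
        rw [norm_one]; linarith
      gcongr
      nlinarith [norm_nonneg (movingAverage h (fun s => Complex.exp (-(I * kinetic ξ * s))) 0 - 1)]
    calc _ ≤ ∫ ξ, (2 * ‖(movingAverage h (fun s => Complex.exp (-(I * kinetic ξ * s))) 0 -
          1) * initialWave φ q₀ ξ‖ ^ 2 +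
          2 * ‖movingAverage h (fun s => sourceWave q s (kinetic ξ)) 0‖ ^ 2) := by
          refine integral_mono_of_nonneg (Eventually.of_forall fun _ => by positivity)
            ((i3.const_mul 2).add (i1.const_mul 2)) (Eventually.of_forall fun ξ => ?_)
          have e : averagedWave φ q₀ q h 0 ξ - initialWave φ q₀ ξ =
              (movingAverage h (fun s => Complex.exp (-(I * kinetic ξ * s))) 0 - 1) *
                initialWave φ q₀ ξ + I * movingAverage h (fun s => sourceWave q s (kinetic ξ)) 0 := by
            rw [averagedWave, movingAverage_wave _ hq]; ring
          simp only [e]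
          refine (norm_sq_add_le _ _).trans (le_of_eq ?_)
          rw [norm_mul I, norm_I, one_mul]
      _ ≤ _ := by
          rw [integral_add (i3.const_mul 2) (i1.const_mul 2), integral_const_mul, integral_const_mul]
          gcongr

end PointNLS

/-! ### Energy at both ends, time reversal and the conservation laws -/

namespace PointNLS

variable {β₀ σ T : ℝ} {φ : Plane → ℂ} {q₀ : ℂ} {q : ℝ → ℂ}

theorem continuous_movingAverage_oscillation (h t : ℝ) : Continuous fun ξ : Plane =>
    movingAverage h (fun s => Complex.exp (-(I * kinetic ξ * s))) t :=
  Continuous.comp (g := fun p : ℝ × ℝ => movingAverage h (fun s => Complex.exp (-(I * p.2 * s))) p.1)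
    (f := fun ξ : Plane => (t, kinetic ξ))
    (continuous_movingAverage_uncurry (F := fun s k => Complex.exp (-(I * k * s))) (by fun_prop) h)
    (continuous_const.prodMk continuous_kinetic)

theorem norm_sq_sqrt_mul (a : ℝ) (ha : 0 ≤ a) (z : ℂ) : ‖(√a : ℂ) * z‖ ^ 2 = a * ‖z‖ ^ 2 := by
  rw [norm_mul, norm_real, Real.norm_of_nonneg (Real.sqrt_nonneg _), mul_pow, Real.sq_sqrt ha]

theorem continuous_sqrt_one_add_kinetic :
    Continuous fun ξ : Plane => (√(1 + kinetic ξ) : ℂ) := by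
  have := continuous_kinetic
  fun_prop

/-- Three errors vanish: the averaged phase on φ by dominated convergence, the averaged emitted wave
by Plancherel, and the charge defect because its squared modulus beats the logarithm. The weight is
distributed as a square root so that this becomes convergence in L². -/
theorem tendsto_integral_averagedEnergyDensity_zero (hφ : AEStronglyMeasurable φ)
    (h2 : Integrable fun ξ => (1 + kinetic ξ) * ‖φ ξ‖ ^ 2) (q₀ : ℂ) (hq : Continuous q)
    (hmod : HasVolterraModulus q q₀) :
    Tendsto (fun h : ℝ => ∫ ξ, averagedEnergyDensity φ q₀ q h 0 ξ) (𝓝[>] 0)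
      (𝓝 (∫ ξ, (1 + kinetic ξ) * ‖φ ξ‖ ^ 2)) := by
  obtain ⟨C, δ, hC, hδ, hmod⟩ := hmod
  have h2' := integrable_norm_sq_of_energy hφ h2
  have hpos : ∀ ξ : Plane, 0 ≤ 1 + kinetic ξ := fun ξ => by linarith [kinetic_nonneg ξ]
  have hsq := continuous_sqrt_one_add_kinetic
  set f : Plane → ℂ := fun ξ => (√(1 + kinetic ξ) : ℂ) * φ ξ with hf
  set F : ℝ → Plane → ℂ := fun h ξ => (√(1 + kinetic ξ) : ℂ) *
    (averagedWave φ q₀ q h 0 ξ - movingAverage h q 0 / (kinetic ξ + 1)) with hF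
  have hfm : AEStronglyMeasurable f := hsq.aestronglyMeasurable.mul hφ
  have ef : ∀ ξ, ‖f ξ‖ ^ 2 = (1 + kinetic ξ) * ‖φ ξ‖ ^ 2 := fun ξ => norm_sq_sqrt_mul _ (hpos ξ) _
  have eF : ∀ h ξ, ‖F h ξ‖ ^ 2 = averagedEnergyDensity φ q₀ q h 0 ξ := fun h ξ =>
    norm_sq_sqrt_mul _ (hpos ξ) _
  have hfi : Integrable fun ξ => ‖f ξ‖ ^ 2 := by simpa only [ef] using h2
  have hFm : ∀ h, AEStronglyMeasurable (F h) := fun h => by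
    have h1 := continuous_inv_kinetic_add_one.aestronglyMeasurable (μ := volume).const_mul
      (movingAverage h q 0)
    simp only [mul_one_div] at h1
    exact hsq.aestronglyMeasurable.mul ((aestronglyMeasurable_averagedWave hφ q₀ hq h 0).sub h1)
  have key : Tendsto (fun h => ∫ ξ, ‖F h ξ‖ ^ 2) (𝓝[>] 0) (𝓝 (∫ ξ, ‖f ξ‖ ^ 2)) := by
    have lim1 := tendsto_integral_oscillation_sub_one hfm hfi
    have lim2 : Tendsto (fun h : ℝ => ∫ s in (0 : ℝ)..h, ‖q s‖ ^ 2) (𝓝[>] 0) (𝓝 0) := by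
      have hc : Continuous fun h : ℝ => ∫ s in (0 : ℝ)..h, ‖q s‖ ^ 2 :=
        intervalIntegral.continuous_primitive
          (fun a b => (by fun_prop : Continuous fun s => ‖q s‖ ^ 2).intervalIntegrable a b) 0
      simpa using (hc.tendsto 0).mono_left (nhdsWithin_le_nhds (s := Set.Ioi 0))
    have lim3 := ((lim1.const_mul 2).add (lim2.const_mul 4)).add
      ((tendsto_sq_volterraPrimitive_mul_log C).const_mul 4)
    rw [mul_zero, mul_zero, add_zero, add_zero] at lim3
    refine tendsto_integral_norm_sq (Eventually.of_forall hFm) ?_ hfm hfi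
      (squeeze_zero' (Eventually.of_forall fun _ => integral_nonneg fun _ => by positivity) ?_ lim3)
    · filter_upwards [self_mem_nhdsWithin] with h hh
      simp only [eF]
      exact integrable_averagedEnergyDensity hφ h2' q₀ hq hh le_rfl
    · filter_upwards [Ioo_mem_nhdsGT hδ] with h hh
      have hh0 := hh.1
      obtain ⟨i1, i2⟩ := integral_norm_sq_movingAverage_sourceWave_le hq hh0 le_rfl
      rw [zero_add] at i2
      obtain ⟨j1, j2⟩ := integral_sq_sourceWave_div_le (u := fun s => q s - q₀) (by fun_prop) hh0
        (η := C * (volterraPrimitive h + h)) (fun s hs => by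
          refine (hmod s ⟨hs.1, hs.2.trans hh.2.le⟩).trans ?_
          gcongr
          · exact volterraPrimitive_mono hs.1 hs.2
          · exact hs.2)
      set a : Plane → ℂ := fun ξ => movingAverage h (fun s => Complex.exp (-(I * kinetic ξ * s))) 0
      have i3 : Integrable fun ξ => ‖(a ξ - 1) * f ξ‖ ^ 2 := by
        refine (hfi.const_mul 4).mono' ((((continuous_movingAverage_oscillation h 0).sub
          continuous_const).aestronglyMeasurable.mul hfm).norm.pow 2)
          (Eventually.of_forall fun ξ => ?_)
        rw [Real.norm_of_nonneg (by positivity), norm_mul, mul_pow]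
        have h1 : ‖a ξ - 1‖ ≤ 2 := by
          refine (norm_sub_le _ _).trans ?_
          have := norm_movingAverage_oscillation_le hh0 0 (kinetic ξ)
          rw [norm_one]; linarith
        gcongr
        nlinarith [norm_nonneg (a ξ - 1)]
      have hsum : Integrable fun ξ => 2 * ‖(a ξ - 1) * f ξ‖ ^ 2 +
          (4 * ‖movingAverage h (fun s => sourceWave q s (kinetic ξ)) 0‖ ^ 2 + 4 * (h⁻¹ ^ 2 *
          (‖sourceWave (fun s => q s - q₀) h (kinetic ξ)‖ ^ 2 / (kinetic ξ + 1)))) :=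
        (i3.const_mul 2).add ((i1.const_mul 4).add ((j1.const_mul _).const_mul 4))
      calc _ ≤ ∫ ξ, (2 * ‖(a ξ - 1) * f ξ‖ ^ 2 +
          (4 * ‖movingAverage h (fun s => sourceWave q s (kinetic ξ)) 0‖ ^ 2 + 4 * (h⁻¹ ^ 2 *
          (‖sourceWave (fun s => q s - q₀) h (kinetic ξ)‖ ^ 2 / (kinetic ξ + 1))))) := by
            refine integral_mono_of_nonneg (Eventually.of_forall fun _ => by positivity) hsum
              (Eventually.of_forall fun ξ => ?_)
            set A := movingAverage h (fun s => sourceWave q s (kinetic ξ)) 0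
            set S := sourceWave (fun s => q s - q₀) h (kinetic ξ)
            have e : F h ξ - f ξ = (a ξ - 1) * f ξ + (√(1 + kinetic ξ) : ℂ) *
                ((I * A - (h : ℂ)⁻¹ * S) / (kinetic ξ + 1)) := by
              simp only [hF, hf]
              rw [averagedWave_zero_sub_div hq hh0]
              ring
            simp only [e]
            refine (norm_sq_add_le _ _).trans (add_le_add le_rfl ?_)
            rw [norm_sq_sqrt_mul _ (hpos ξ), norm_sq_div_kinetic_add_one]
            have hk := kinetic_nonneg ξ
            have h3 := norm_sq_add_le (I * A) (-((h : ℂ)⁻¹ * S))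
            rw [norm_neg, ← sub_eq_add_neg, norm_mul I, norm_I, one_mul, norm_mul _ S, norm_inv,
              norm_real, Real.norm_of_nonneg hh0.le, mul_pow] at h3
            have hk1 : 0 < kinetic ξ + 1 := by linarith
            calc 2 * (‖I * A - (h : ℂ)⁻¹ * S‖ ^ 2 / (kinetic ξ + 1))
                ≤ 2 * ((2 * ‖A‖ ^ 2 + 2 * (h⁻¹ ^ 2 * ‖S‖ ^ 2)) / (kinetic ξ + 1)) := by gcongr
              _ = 4 * (‖A‖ ^ 2 / (kinetic ξ + 1)) +
                  4 * (h⁻¹ ^ 2 * (‖S‖ ^ 2 / (kinetic ξ + 1))) := by ring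
              _ ≤ _ := by
                gcongr
                exact div_le_self (by positivity) (by linarith)
        _ = 2 * (∫ ξ, ‖(a ξ - 1) * f ξ‖ ^ 2) +
            (4 * (∫ ξ, ‖movingAverage h (fun s => sourceWave q s (kinetic ξ)) 0‖ ^ 2) +
              4 * (h⁻¹ ^ 2 * ∫ ξ : Plane, ‖sourceWave (fun s => q s - q₀) h (kinetic ξ)‖ ^ 2 /
                (kinetic ξ + 1))) := by
            have hB : Integrable fun ξ : Plane => 4 * ‖movingAverage h
                (fun s => sourceWave q s (kinetic ξ)) 0‖ ^ 2 + 4 * (h⁻¹ ^ 2 *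
                (‖sourceWave (fun s => q s - q₀) h (kinetic ξ)‖ ^ 2 / (kinetic ξ + 1))) :=
              (i1.const_mul 4).add ((j1.const_mul _).const_mul 4)
            rw [integral_add (i3.const_mul 2) hB,
              integral_add (i1.const_mul 4) ((j1.const_mul (h⁻¹ ^ 2)).const_mul 4), integral_const_mul,
              integral_const_mul, integral_const_mul, integral_const_mul]
        _ ≤ 2 * (∫ ξ, ‖(a ξ - 1) * f ξ‖ ^ 2) + (4 * (∫ s in (0 : ℝ)..h, ‖q s‖ ^ 2) +
              4 * (h⁻¹ ^ 2 * (h ^ 2 * ((C * (volterraPrimitive h + h)) ^ 2 *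
                (Real.log (1 + h⁻¹) + 1))))) := by gcongr
        _ = _ := by
            have : h⁻¹ ^ 2 * h ^ 2 = 1 := by rw [← mul_pow, inv_mul_cancel₀ hh0.ne', one_pow]
            rw [← mul_assoc (h⁻¹ ^ 2), this]
            ring
  simpa only [eF, ef] using key

/-- The time-reversed charge. -/
def reversedCharge (q : ℝ → ℂ) (T s : ℝ) : ℂ := (starRingEnd ℂ) (q (T - s))

theorem continuous_reversedCharge (hq : Continuous q) (T : ℝ) : Continuous (reversedCharge q T) := by
  unfold reversedCharge
  exact continuous_conj.comp (hq.comp (by fun_prop))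

theorem movingAverage_conj_sub (f : ℝ → ℂ) (h T : ℝ) :
    movingAverage h (fun s => (starRingEnd ℂ) (f (T - s))) 0 =
      (starRingEnd ℂ) (movingAverage h f (T - h)) := by
  have := intervalIntegral.integral_comp_sub_left (a := 0) (b := h)
    (fun s => (starRingEnd ℂ) (f s)) T
  rw [movingAverage, movingAverage, zero_add, this, sub_add_cancel, map_mul, map_inv₀, conj_ofReal,
    ← intervalIntegral.intervalIntegral_conj, sub_zero]

/-- The Fourier transform of the regular part of the wave at time `T`. -/
def regularWave (φ : Plane → ℂ) (q₀ : ℂ) (q : ℝ → ℂ) (T : ℝ) (ξ : Plane) : ℂ :=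
  wave (initialWave φ q₀ ξ) q T (kinetic ξ) - q T / (kinetic ξ + 1)

theorem aestronglyMeasurable_regularWave (hφ : AEStronglyMeasurable φ) (q₀ : ℂ) (hq : Continuous q)
    (T : ℝ) : AEStronglyMeasurable (regularWave φ q₀ q T) := by
  have h1 := continuous_inv_kinetic_add_one.aestronglyMeasurable (μ := volume).const_mul (q T)
  simp only [mul_one_div] at h1
  exact (aestronglyMeasurable_wave (aestronglyMeasurable_initialWave hφ q₀) hq T).sub h1

/-- The conjugated state at time T is an initial datum for the reversed evolution, with charge the
conjugate of q(T) and conjugated regular part. -/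
theorem initialWave_conj_regularWave (φ : Plane → ℂ) (q₀ : ℂ) (q : ℝ → ℂ) (T : ℝ) (ξ : Plane) :
    initialWave (fun ξ => (starRingEnd ℂ) (regularWave φ q₀ q T ξ)) ((starRingEnd ℂ) (q T)) ξ =
      (starRingEnd ℂ) (wave (initialWave φ q₀ ξ) q T (kinetic ξ)) := by
  simp only [initialWave, regularWave, map_sub, map_div₀, map_add, conj_ofReal, map_one]
  ring

theorem averagedWave_reversed (hq : Continuous q) (h T : ℝ) (ξ : Plane) :
    averagedWave (fun ξ => (starRingEnd ℂ) (regularWave φ q₀ q T ξ)) ((starRingEnd ℂ) (q T))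
      (reversedCharge q T) h 0 ξ = (starRingEnd ℂ) (averagedWave φ q₀ q h (T - h) ξ) := by
  rw [averagedWave, averagedWave, ← movingAverage_conj_sub, initialWave_conj_regularWave]
  congr 1
  ext s
  rw [conj_wave_sub _ hq]
  rfl

/-- Reversal carries the average over [0, h] to the one over [T - h, T], so the limit at the final
time is an instance of the limit at the initial time. -/
theorem averagedEnergyDensity_reversed (hq : Continuous q) (h T : ℝ) (ξ : Plane) :
    averagedEnergyDensity (fun ξ => (starRingEnd ℂ) (regularWave φ q₀ q T ξ))
      ((starRingEnd ℂ) (q T)) (reversedCharge q T) h 0 ξ =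
      averagedEnergyDensity φ q₀ q h (T - h) ξ := by
  rw [averagedEnergyDensity, averagedEnergyDensity, averagedWave_reversed hq]
  have e : movingAverage h (reversedCharge q T) 0 = (starRingEnd ℂ) (movingAverage h q (T - h)) :=
    movingAverage_conj_sub q h T
  rw [e, ← norm_conj (averagedWave φ q₀ q h (T - h) ξ - movingAverage h q (T - h) / (kinetic ξ + 1))]
  simp only [map_sub, map_div₀, map_add, conj_ofReal, map_one]

namespace IsChargeSolution

theorem hasVolterraModulus (H : IsChargeSolution β₀ σ φ q₀ q T) : HasVolterraModulus q q₀ := by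
  obtain ⟨B, hB⟩ := H.exists_isVolterraPotential
  refine ⟨B, T, hB.bound_nonneg, H.pos, fun s hs => ?_⟩
  have hB0 := hB.bound_nonneg
  have h0 := volterraPrimitive_nonneg hs.1
  rcases eq_or_lt_of_le hs.1 with h | h
  · rw [← h, H.initial_value, sub_self, norm_zero]
    have := volterraPrimitive_nonneg le_rfl
    positivity
  · refine (hB.norm_sub_le ⟨h, hs.2⟩).trans ?_
    gcongr
    linarith

/-- The pointwise increment bound is applied on [T - s, T]. Restricting to s ≤ T/2 keeps the left
end positive, as that bound requires. -/
theorem hasVolterraModulus_reversed (H : IsChargeSolution β₀ σ φ q₀ q T) :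
    HasVolterraModulus (reversedCharge q T) ((starRingEnd ℂ) (q T)) := by
  obtain ⟨B, hB⟩ := H.exists_isVolterraPotential
  have hB0 := hB.bound_nonneg
  have hT := H.pos
  have hν := volterraPrimitive_nonneg hT.le
  refine ⟨B * (2 + 2 * volterraPrimitive T), T / 2, by positivity, by positivity, fun s hs => ?_⟩
  have h0 := volterraPrimitive_nonneg hs.1
  have hs0 := hs.1
  rw [reversedCharge, ← map_sub, norm_conj]
  rcases eq_or_lt_of_le hs.1 with h | h
  · rw [← h, sub_zero, sub_self, norm_zero]
    have := volterraPrimitive_nonneg le_rfl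
    positivity
  · have h1 := hB.norm_increment_le (t := T - s) (h := s) (by linarith [hs.2]) h (by linarith)
    rw [sub_add_cancel] at h1
    rw [norm_sub_rev]
    refine h1.trans ?_
    rw [mul_assoc]
    gcongr
    nlinarith [mul_nonneg h0 hν, mul_nonneg hs0 hν]

/-- Combines the averaged balance laws with the limits of their source terms. The limit is expressed
by initial data and charges only; that it is the energy at time T is still to be shown. -/
theorem tendsto_energy (H : IsChargeSolution β₀ σ φ q₀ q T) :
    Tendsto (fun h : ℝ => ∫ ξ, averagedEnergyDensity φ q₀ q h (T - h) ξ) (𝓝[>] 0)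
      (𝓝 ((∫ ξ, (1 + kinetic ξ) * ‖φ ξ‖ ^ 2) - (4 * Real.pi)⁻¹ *
        (Real.eulerMascheroniConstant * (‖q T‖ ^ 2 - ‖q 0‖ ^ 2) +
          (chargePotential β₀ σ (q T) - chargePotential β₀ σ (q 0))))) := by
  have hφ := H.integrable.aestronglyMeasurable
  have hq := H.cont
  have lim0 := tendsto_integral_averagedEnergyDensity_zero hφ H.integrable_energy q₀ hq
    H.hasVolterraModulus
  have lim1 := H.tendsto_integral_inner_I_mul
  have lim2 := H.tendsto_integral_inner_increment
  have lim3 := (((tendsto_movingAverage_sub hq T).norm.pow 2).sub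
    ((tendsto_movingAverage hq 0).norm.pow 2)).const_mul Real.eulerMascheroniConstant
  have lim4 := lim0.add (((lim1.sub lim3).sub lim2).const_mul (4 * Real.pi)⁻¹)
  rw [zero_sub, ← neg_add', mul_neg, ← sub_eq_add_neg] at lim4
  refine lim4.congr' ?_
  filter_upwards [Ioo_mem_nhdsGT H.pos] with h hh
  have e1 := H.integral_norm_sq_averagedWave_sub hh.1 (τ := T - h) (by linarith [hh.2]) (by linarith)
  have e2 := H.integral_averagedEnergyDensity_sub hh.1 (τ := T - h) (by linarith [hh.2]) (by linarith)
  rw [e1] at e2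
  have hp : (4 * Real.pi) ≠ 0 := by positivity
  rw [← e2, inv_mul_cancel_left₀ hp]
  ring

/-- Fatou's lemma along a sequence h → 0, the averaged energies being convergent. This must precede
time reversal, whose initial datum is required to have finite energy. -/
theorem integrable_regularWave (H : IsChargeSolution β₀ σ φ q₀ q T) :
    Integrable fun ξ => (1 + kinetic ξ) * ‖regularWave φ q₀ q T ξ‖ ^ 2 := by
  have hφ := H.integrable.aestronglyMeasurable
  have hq := H.cont
  have h2 := integrable_norm_sq_of_energy hφ H.integrable_energy
  obtain ⟨u, hu⟩ := exists_seq_tendsto (𝓝[>] (0 : ℝ))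
  obtain ⟨N, hN⟩ := eventually_atTop.1 (hu.eventually (Ioo_mem_nhdsGT H.pos))
  set v : ℕ → ℝ := fun n => u (n + N) with hv
  have hv1 : Tendsto v atTop (𝓝[>] 0) := hu.comp (tendsto_add_atTop_nat N)
  have hv2 : ∀ n, v n ∈ Set.Ioo 0 T := fun n => hN _ (Nat.le_add_left N n)
  have hpt : ∀ ξ, Tendsto (fun n => averagedEnergyDensity φ q₀ q (v n) (T - v n) ξ) atTop
      (𝓝 ((1 + kinetic ξ) * ‖regularWave φ q₀ q T ξ‖ ^ 2)) := fun ξ => by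
    have h1 := tendsto_movingAverage_sub (continuous_wave_left (initialWave φ q₀ ξ) hq (kinetic ξ)) T
    have h2 := (tendsto_movingAverage_sub hq T).div_const ((kinetic ξ : ℂ) + 1)
    exact ((((h1.sub h2).norm.pow 2).const_mul (1 + kinetic ξ))).comp hv1
  have hlim := H.tendsto_energy.comp hv1
  have hm := aestronglyMeasurable_regularWave hφ q₀ hq T
  have hnn : ∀ ξ, 0 ≤ (1 + kinetic ξ) * ‖regularWave φ q₀ q T ξ‖ ^ 2 := fun ξ => by
    have := kinetic_nonneg ξ
    positivity
  refine ⟨(continuous_const.add continuous_kinetic).aestronglyMeasurable.mul (hm.norm.pow 2), ?_⟩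
  rw [hasFiniteIntegral_iff_ofReal (Eventually.of_forall hnn)]
  have hmeas : ∀ n, AEMeasurable (fun ξ => ENNReal.ofReal
      (averagedEnergyDensity φ q₀ q (v n) (T - v n) ξ)) := fun n =>
    (aestronglyMeasurable_averagedEnergyDensity hφ q₀ hq _ _).aemeasurable.ennreal_ofReal
  have hfat := lintegral_liminf_le' (u := atTop) hmeas
  have e1 : ∀ ξ, liminf (fun n => ENNReal.ofReal (averagedEnergyDensity φ q₀ q (v n) (T - v n) ξ))
      atTop = ENNReal.ofReal ((1 + kinetic ξ) * ‖regularWave φ q₀ q T ξ‖ ^ 2) := fun ξ =>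
    (ENNReal.tendsto_ofReal (hpt ξ)).liminf_eq
  simp only [e1] at hfat
  refine hfat.trans_lt ?_
  have e2 : ∀ n, ∫⁻ ξ, ENNReal.ofReal (averagedEnergyDensity φ q₀ q (v n) (T - v n) ξ) =
      ENNReal.ofReal (∫ ξ, averagedEnergyDensity φ q₀ q (v n) (T - v n) ξ) := fun n =>
    (ofReal_integral_eq_lintegral_ofReal (integrable_averagedEnergyDensity hφ h2 q₀ hq (hv2 n).1
      (by linarith [(hv2 n).2])) (Eventually.of_forall fun ξ => averagedEnergyDensity_nonneg _ _ _)).symm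
  simp only [e2]
  exact (ENNReal.tendsto_ofReal hlim).liminf_eq.trans_lt ENNReal.ofReal_lt_top

/-- Conservation of the energy, on the Fourier side. -/
theorem energy_conservation (H : IsChargeSolution β₀ σ φ q₀ q T) :
    ∫ ξ, (1 + kinetic ξ) * ‖regularWave φ q₀ q T ξ‖ ^ 2 =
      (∫ ξ, (1 + kinetic ξ) * ‖φ ξ‖ ^ 2) - (4 * Real.pi)⁻¹ *
        (Real.eulerMascheroniConstant * (‖q T‖ ^ 2 - ‖q 0‖ ^ 2) +
          (chargePotential β₀ σ (q T) - chargePotential β₀ σ (q 0))) := by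
  have hφ := H.integrable.aestronglyMeasurable
  have hm := aestronglyMeasurable_regularWave hφ q₀ H.cont T
  -- Applied to the reversed evolution, this computes in a second way the limit found in
  -- `tendsto_energy`.
  have lim := tendsto_integral_averagedEnergyDensity_zero
    (φ := fun ξ => (starRingEnd ℂ) (regularWave φ q₀ q T ξ))
    (continuous_conj.comp_aestronglyMeasurable hm)
    (by simpa only [norm_conj] using H.integrable_regularWave) ((starRingEnd ℂ) (q T))
    (continuous_reversedCharge H.cont T) H.hasVolterraModulus_reversed
  simp only [averagedEnergyDensity_reversed H.cont, norm_conj] at lim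
  exact tendsto_nhds_unique lim H.tendsto_energy

/-- Conservation of mass, on the Fourier side. -/
theorem mass_conservation (H : IsChargeSolution β₀ σ φ q₀ q T) :
    ∫ ξ, ‖wave (initialWave φ q₀ ξ) q T (kinetic ξ)‖ ^ 2 = ∫ ξ, ‖initialWave φ q₀ ξ‖ ^ 2 := by
  have hφ := H.integrable.aestronglyMeasurable
  have hm := aestronglyMeasurable_regularWave hφ q₀ H.cont T
  have h2 := integrable_norm_sq_of_energy hφ H.integrable_energy
  have h3 := integrable_norm_sq_of_energy hm H.integrable_regularWave
  have lim := tendsto_integral_norm_sq_averagedWave_zero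
    (φ := fun ξ => (starRingEnd ℂ) (regularWave φ q₀ q T ξ))
    (continuous_conj.comp_aestronglyMeasurable hm)
    (by simpa only [norm_conj] using h3) ((starRingEnd ℂ) (q T))
    (continuous_reversedCharge H.cont T)
  simp only [averagedWave_reversed H.cont, initialWave_conj_regularWave, norm_conj] at lim
  have lim0 := tendsto_integral_norm_sq_averagedWave_zero hφ h2 q₀ H.cont
  have lim1 := H.tendsto_integral_inner_I_mul.const_mul (4 * Real.pi)⁻¹
  have lim2 := lim0.add lim1
  rw [mul_zero, add_zero] at lim2
  refine tendsto_nhds_unique lim (lim2.congr' ?_)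
  filter_upwards [Ioo_mem_nhdsGT H.pos] with h hh
  have e1 := H.integral_norm_sq_averagedWave_sub hh.1 (τ := T - h) (by linarith [hh.2]) (by linarith)
  have hp : (4 * Real.pi) ≠ 0 := by positivity
  rw [← e1, inv_mul_cancel_left₀ hp]
  ring

end IsChargeSolution

end PointNLS

namespace PointNLS

/-! ### Distributional identities on the Fourier side -/

theorem integral_schwartz_mul_eq (χ : 𝓢(Plane, ℂ)) (f : L2Plane) :
    ∫ x, χ x * f x = ∫ ξ, 𝓕⁻ χ ξ * (𝓕 f : L2Plane) ξ := by
  have h := congrArg (fun F : 𝓢'(Plane, ℂ) => F (𝓕⁻ χ)) (Lp.fourier_toTemperedDistribution_eq f)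
  simp only [TemperedDistribution.fourier_apply, FourierTransform.fourier_fourierInv_eq,
    Lp.toTemperedDistribution_apply, smul_eq_mul] at h
  exact h

theorem eq_of_integral_schwartz_mul_eq {f g : L2Plane}
    (h : ∀ χ : 𝓢(Plane, ℂ), ∫ x, χ x * f x = ∫ x, χ x * g x) : f = g := by
  have hinj := LinearMap.ker_eq_bot.1
    (Lp.ker_toTemperedDistributionCLM_eq_bot (E := Plane) (F := ℂ) (μ := volume) (p := 2))
  refine hinj (ContinuousLinearMap.ext fun χ => ?_)
  change Lp.toTemperedDistribution f χ = Lp.toTemperedDistribution g χ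
  simpa only [Lp.toTemperedDistribution_apply, smul_eq_mul] using h χ

/-- The phase `exp (-i ⟪p, y⟫)`. -/
def translationPhase (y ξ : Plane) : ℂ := exp (-(2 * Real.pi * ⟪ξ, y⟫ * I))

theorem continuous_translationPhase (y : Plane) : Continuous (translationPhase y) := by
  unfold translationPhase
  fun_prop

theorem translationPhase_eq (y ξ : Plane) :
    translationPhase y ξ = exp (((-(2 * Real.pi * ⟪ξ, y⟫) : ℝ) : ℂ) * I) := by
  rw [translationPhase]
  push_cast
  ring_nf

theorem norm_translationPhase (y ξ : Plane) : ‖translationPhase y ξ‖ = 1 := by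
  rw [translationPhase_eq, norm_exp_ofReal_mul_I]

/-- The Fourier transform is symmetric for the bilinear pairing, and a modulated Gaussian of complex
width transforms into a Gaussian centred at y. In dimension two the prefactor is π/b, free of square
roots. -/
theorem integral_schwartz_mul_gaussian (χ : 𝓢(Plane, ℂ)) (y : Plane) {b : ℂ} (hb : 0 < b.re) :
    ∫ x, χ x * ((Real.pi / b) * exp (-Real.pi ^ 2 * (‖x - y‖ : ℂ) ^ 2 / b)) =
      ∫ ξ, 𝓕⁻ χ ξ * (translationPhase y ξ * exp (-b * ‖ξ‖ ^ 2)) := by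
  have hi : Integrable fun v : Plane => exp (-b * ‖v‖ ^ 2 + 2 * Real.pi * I * ⟪y, v⟫) := by
    have := GaussianFourier.integrable_cexp_neg_mul_sq_norm_add hb (2 * Real.pi * I) y
    exact this
  have h1 := VectorFourier.integral_fourierIntegral_smul_eq_flip (L := innerₗ Plane)
    (μ := volume) (ν := volume) (e := Real.fourierChar) Real.continuous_fourierChar
    (by exact continuous_inner) χ.integrable hi
  have h2 : ∀ w : Plane, VectorFourier.fourierIntegral Real.fourierChar volume
      (innerₗ Plane).flip (fun v : Plane => exp (-b * ‖v‖ ^ 2 + 2 * Real.pi * I * ⟪y, v⟫)) w =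
      (Real.pi / b) * exp (-Real.pi ^ 2 * (‖w - y‖ : ℂ) ^ 2 / b) := by
    intro w
    have := fourier_gaussian_innerProductSpace' hb y w
    rw [finrank_euclideanSpace_fin, norm_sub_rev] at this
    simp only [Nat.cast_ofNat, div_self (two_ne_zero' ℂ), cpow_one] at this
    rw [← this, flip_innerₗ]
    rfl
  simp only [h2, smul_eq_mul] at h1
  rw [← h1, ← integral_neg_eq_self]
  refine integral_congr_ae (Eventually.of_forall fun ξ => ?_)
  have h3 : 𝓕⁻ χ ξ = VectorFourier.fourierIntegral Real.fourierChar volume (innerₗ Plane) χ (-ξ) := by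
    rw [SchwartzMap.fourierInv_coe, Real.fourierInv_eq_fourier_neg]
    rfl
  simp only [h3, norm_neg, inner_neg_right]
  congr 1
  rw [translationPhase, ← Complex.exp_add, real_inner_comm]
  congr 1
  push_cast
  ring

/-- The free kernel is the boundary value of Gaussians of width b = 4π²(ε + is) as ε → 0; against a
Schwartz function both sides pass to the limit by domination. -/
theorem integral_schwartz_mul_freeKernel (χ : 𝓢(Plane, ℂ)) (y : Plane) {s : ℝ} (hs : 0 < s) :
    ∫ x, χ x * freeKernel s ‖x - y‖ =
      2 * Real.pi * ∫ ξ, 𝓕⁻ χ ξ * (translationPhase y ξ * exp (-(I * kinetic ξ * s))) := by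
  have hp := Real.pi_pos
  set b : ℝ → ℂ := fun ε => 4 * Real.pi ^ 2 * (ε + I * s) with hb
  have hbre : ∀ ε, (b ε).re = 4 * Real.pi ^ 2 * ε := fun ε => by
    simp only [hb]
    norm_cast
    simp [-ofReal_pow, -ofReal_mul]
  have hbim : ∀ ε, (b ε).im = 4 * Real.pi ^ 2 * s := fun ε => by
    simp only [hb]
    norm_cast
    simp [-ofReal_pow, -ofReal_mul]
  have hb0 : ∀ ε, b ε ≠ 0 := fun ε h => by
    have := hbim ε
    rw [h, zero_im] at this
    have : 0 < 4 * Real.pi ^ 2 * s := by positivity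
    linarith
  have hbc : Continuous b := by
    simp only [hb]
    fun_prop
  have L1 : Tendsto (fun ε => ∫ x, χ x * ((Real.pi / b ε) *
      exp (-Real.pi ^ 2 * (‖x - y‖ : ℂ) ^ 2 / b ε))) (𝓝[>] 0)
      (𝓝 (∫ x, χ x * ((Real.pi / b 0) * exp (-Real.pi ^ 2 * (‖x - y‖ : ℂ) ^ 2 / b 0)))) := by
    refine tendsto_integral_filter_of_dominated_convergence
      (fun x => ‖χ x‖ * (Real.pi / (4 * Real.pi ^ 2 * s))) ?_ ?_ (χ.integrable.norm.mul_const _) ?_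
    · refine Eventually.of_forall fun ε => Continuous.aestronglyMeasurable ?_
      have := χ.continuous
      fun_prop
    · filter_upwards [self_mem_nhdsWithin] with ε hε
      refine Eventually.of_forall fun x => ?_
      -- The imaginary part alone keeps b away from 0 uniformly in ε, so the kernels stay bounded.
      have h1 : 4 * Real.pi ^ 2 * s ≤ ‖b ε‖ := by
        have := abs_im_le_norm (b ε)
        rwa [hbim, abs_of_pos (by positivity)] at this
      have h2 : ‖exp (-Real.pi ^ 2 * (‖x - y‖ : ℂ) ^ 2 / b ε)‖ ≤ 1 := by
        rw [norm_exp, Real.exp_le_one_iff]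
        have e : (-Real.pi ^ 2 * (‖x - y‖ : ℂ) ^ 2 / b ε) =
            ((-Real.pi ^ 2 * ‖x - y‖ ^ 2 : ℝ) : ℂ) * (b ε)⁻¹ := by
          push_cast
          rw [div_eq_mul_inv]
        rw [e, re_ofReal_mul, inv_re, hbre]
        have : 0 ≤ 4 * Real.pi ^ 2 * ε / normSq (b ε) :=
          div_nonneg (by have : 0 < ε := hε; positivity) (normSq_nonneg _)
        have h3 : 0 ≤ Real.pi ^ 2 * ‖x - y‖ ^ 2 := by positivity
        nlinarith [mul_nonneg h3 this]
      rw [norm_mul, norm_mul, norm_div, norm_real, Real.norm_of_nonneg hp.le]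
      gcongr
      calc _ ≤ Real.pi / ‖b ε‖ * 1 := by gcongr
        _ ≤ _ := by rw [mul_one]; gcongr
    · refine Eventually.of_forall fun x => ?_
      have hc : Continuous fun ε => χ x * ((Real.pi / b ε) *
          exp (-Real.pi ^ 2 * (‖x - y‖ : ℂ) ^ 2 / b ε)) := by
        have h1 : Continuous fun ε => (Real.pi : ℂ) / b ε := continuous_const.div hbc hb0
        have h2 : Continuous fun ε => -(Real.pi : ℂ) ^ 2 * (‖x - y‖ : ℂ) ^ 2 / b ε :=
          continuous_const.div hbc hb0
        fun_prop
      exact hc.tendsto 0 |>.mono_left nhdsWithin_le_nhds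
  have L2 : Tendsto (fun ε => ∫ ξ, 𝓕⁻ χ ξ * (translationPhase y ξ * exp (-b ε * ‖ξ‖ ^ 2))) (𝓝[>] 0)
      (𝓝 (∫ ξ, 𝓕⁻ χ ξ * (translationPhase y ξ * exp (-b 0 * ‖ξ‖ ^ 2)))) := by
    refine tendsto_integral_filter_of_dominated_convergence (fun ξ => ‖𝓕⁻ χ ξ‖) ?_ ?_
      (𝓕⁻ χ).integrable.norm ?_
    · refine Eventually.of_forall fun ε => Continuous.aestronglyMeasurable ?_
      have := (𝓕⁻ χ).continuous
      have := continuous_translationPhase y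
      fun_prop
    · filter_upwards [self_mem_nhdsWithin] with ε hε
      refine Eventually.of_forall fun ξ => ?_
      have h2 : ‖exp (-b ε * ‖ξ‖ ^ 2)‖ ≤ 1 := by
        have e : -b ε * (‖ξ‖ : ℂ) ^ 2 = ((-‖ξ‖ ^ 2 : ℝ) : ℂ) * b ε := by
          push_cast
          ring
        rw [norm_exp, Real.exp_le_one_iff, e, re_ofReal_mul, hbre]
        have : 0 < ε := hε
        have : 0 ≤ ‖ξ‖ ^ 2 * (4 * Real.pi ^ 2 * ε) := by positivity
        linarith
      rw [norm_mul, norm_mul, norm_translationPhase, one_mul]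
      exact mul_le_of_le_one_right (norm_nonneg _) h2
    · refine Eventually.of_forall fun ξ => ?_
      have hc : Continuous fun ε => 𝓕⁻ χ ξ * (translationPhase y ξ * exp (-b ε * ‖ξ‖ ^ 2)) := by
        fun_prop
      exact hc.tendsto 0 |>.mono_left nhdsWithin_le_nhds
  have key := tendsto_nhds_unique (L1.congr' (by
    filter_upwards [self_mem_nhdsWithin] with ε hε
    exact integral_schwartz_mul_gaussian χ y (by
      rw [hbre]; have : 0 < ε := hε; positivity))) L2
  have hpC : (Real.pi : ℂ) ≠ 0 := ofReal_ne_zero.2 hp.ne'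
  have hsC : (s : ℂ) ≠ 0 := ofReal_ne_zero.2 hs.ne'
  have e1 : ∀ x : Plane, χ x * freeKernel s ‖x - y‖ = 2 * Real.pi * (χ x * ((Real.pi / b 0) *
      exp (-Real.pi ^ 2 * (‖x - y‖ : ℂ) ^ 2 / b 0))) := fun x => by
    have e3 : -(Real.pi : ℂ) ^ 2 * (‖x - y‖ : ℂ) ^ 2 / b 0 = -((‖x - y‖ : ℂ) ^ 2) / (4 * I * s) := by
      simp only [hb, ofReal_zero, zero_add]
      field_simp
    rw [freeKernel, e3]
    simp only [hb, ofReal_zero, zero_add]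
    field_simp
    ring
  have e2 : ∀ ξ : Plane, exp (-(I * kinetic ξ * s)) = exp (-b 0 * ‖ξ‖ ^ 2) := fun ξ => by
    congr 1
    simp only [hb, ofReal_zero, zero_add, kinetic]
    push_cast
    ring
  simp only [e1, e2]
  rw [integral_const_mul, key]

/-! ### Sobolev regularity on the Fourier side -/

/-- The Bessel weight and its inverse are smooth multipliers of temperate growth, so the
distributional condition says that the weighted transform lies in L². The weights 1 + |ξ|² and 1 +
p² are comparable. -/
theorem memH1_iff (f : L2Plane) :
    MemH1 f ↔ Integrable fun ξ => (1 + kinetic ξ) * ‖(𝓕 f : L2Plane) ξ‖ ^ 2 := by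
  set w : Plane → ℂ := fun x => (((1 + ‖x‖ ^ 2) ^ ((1 : ℝ) / 2) : ℝ) : ℂ) with hw
  set v : Plane → ℂ := fun x => (((1 + ‖x‖ ^ 2) ^ (-(1 : ℝ) / 2) : ℝ) : ℂ) with hv
  have hwg : w.HasTemperateGrowth := by simp only [hw]; fun_prop
  have hvg : v.HasTemperateGrowth := by simp only [hv]; fun_prop
  have hvw : ∀ x, v x * w x = 1 := fun x => by
    simp only [hv, hw]
    rw [← ofReal_mul, ← Real.rpow_add (by positivity)]
    norm_num
  have hv_top : MemLp v ⊤ (volume : Measure Plane) := by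
    refine memLp_top_of_bound hvg.1.continuous.aestronglyMeasurable 1
      (Eventually.of_forall fun x => ?_)
    rw [norm_real, Real.norm_of_nonneg (by positivity)]
    exact Real.rpow_le_one_of_one_le_of_nonpos (by simp) (by norm_num)
  have hnw : ∀ x, ‖w x‖ ^ 2 = 1 + ‖x‖ ^ 2 := fun x => by
    simp only [hw]
    rw [norm_real, Real.norm_of_nonneg (by positivity), ← Real.rpow_natCast, ← Real.rpow_mul
      (by positivity)]
    norm_num
  have hfm : AEStronglyMeasurable ((𝓕 f : L2Plane) : Plane → ℂ) := Lp.aestronglyMeasurable _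
  have hwf : MemLp (fun x => w x * (𝓕 f : L2Plane) x) 2 (volume : Measure Plane) ↔
      Integrable fun ξ => (1 + kinetic ξ) * ‖(𝓕 f : L2Plane) ξ‖ ^ 2 := by
    have hm : AEStronglyMeasurable (fun x => w x * (𝓕 f : L2Plane) x) :=
      hwg.1.continuous.aestronglyMeasurable.mul hfm
    rw [memLp_two_iff_integrable_sq_norm hm]
    simp only [norm_mul, mul_pow, hnw]
    have hp := Real.pi_gt_three
    constructor <;> intro h
    · refine (h.const_mul ((2 * Real.pi) ^ 2)).mono'
        ((continuous_const.add continuous_kinetic).aestronglyMeasurable.mul (hfm.norm.pow 2))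
        (Eventually.of_forall fun ξ => ?_)
      have h0 := kinetic_nonneg ξ
      rw [Real.norm_of_nonneg (by positivity), ← mul_assoc]
      gcongr
      rw [kinetic]
      nlinarith
    · refine h.mono' ((by fun_prop : Continuous fun x : Plane => 1 + ‖x‖ ^ 2).aestronglyMeasurable.mul
        (hfm.norm.pow 2)) (Eventually.of_forall fun ξ => ?_)
      rw [Real.norm_of_nonneg (by positivity)]
      gcongr
      rw [kinetic, mul_pow]
      have : (1 : ℝ) ≤ (2 * Real.pi) ^ 2 := by nlinarith
      exact le_mul_of_one_le_left (by positivity) this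
  rw [← hwf, MemH1, TemperedDistribution.memSobolev_iff_exists_smulLeftCLM_fourier,
    Lp.fourier_toTemperedDistribution_eq]
  change (∃ f' : L2Plane, TemperedDistribution.smulLeftCLM ℂ w ((𝓕 f : L2Plane) : 𝓢'(Plane, ℂ)) =
    (f' : 𝓢'(Plane, ℂ))) ↔ _
  constructor
  · rintro ⟨f', hf'⟩
    -- The inverse weight is bounded, hence acts on L²; injectivity of L² into tempered
    -- distributions upgrades the identity to one between functions.
    have h1 : (𝓕 f : L2Plane) = (hv_top.toLp v) • f' := by
      have hinj := LinearMap.ker_eq_bot.1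
        (Lp.ker_toTemperedDistributionCLM_eq_bot (E := Plane) (F := ℂ) (μ := volume) (p := 2))
      refine hinj ?_
      change ((𝓕 f : L2Plane) : 𝓢'(Plane, ℂ)) = (((hv_top.toLp v) • f' : L2Plane) : 𝓢'(Plane, ℂ))
      rw [Lp.toTemperedDistribution_smul_eq hvg, ← hf',
        TemperedDistribution.smulLeftCLM_smulLeftCLM_apply hwg hvg]
      have : w * v = fun _ => (1 : ℂ) := funext fun x => (mul_comm _ _).trans (hvw x)
      rw [this, TemperedDistribution.smulLeftCLM_const, one_smul]
    refine (Lp.memLp f').ae_eq ?_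
    filter_upwards [Lp.coeFn_lpSMul (r := 2) (hv_top.toLp v) f', hv_top.coeFn_toLp] with x h2 h3
    rw [h1, h2, Pi.smul_apply', h3, smul_eq_mul, ← mul_assoc, mul_comm (w x), hvw, one_mul]
  · intro h
    set g : L2Plane := h.toLp _ with hg
    refine ⟨g, ?_⟩
    have h1 : (𝓕 f : L2Plane) = (hv_top.toLp v) • g := by
      refine Lp.ext ?_
      filter_upwards [Lp.coeFn_lpSMul (r := 2) (hv_top.toLp v) g, hv_top.coeFn_toLp,
        h.coeFn_toLp] with x h2 h3 h4
      rw [h2, Pi.smul_apply', h3, h4, smul_eq_mul, ← mul_assoc, hvw, one_mul]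
    rw [h1, Lp.toTemperedDistribution_smul_eq hvg,
      TemperedDistribution.smulLeftCLM_smulLeftCLM_apply hvg hwg]
    have : v * w = fun _ => (1 : ℂ) := funext hvw
    rw [this, TemperedDistribution.smulLeftCLM_const, one_smul]

end PointNLS

/-! ### States described by their Fourier amplitudes -/

namespace PointNLS

/-- The Fourier transform of `ψ`, with the point `y` translated to the origin. -/
def amplitude (y : Plane) (ψ : L2Plane) (ξ : Plane) : ℂ :=
  exp (2 * Real.pi * ⟪ξ, y⟫ * I) * (𝓕 ψ : L2Plane) ξ

theorem continuous_exp_inner (y : Plane) :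
    Continuous fun ξ : Plane => exp (2 * Real.pi * ⟪ξ, y⟫ * I) := by
  fun_prop

theorem translationPhase_mul_exp_inner (y ξ : Plane) :
    translationPhase y ξ * exp (2 * Real.pi * ⟪ξ, y⟫ * I) = 1 := by
  rw [translationPhase, ← Complex.exp_add, neg_add_cancel, Complex.exp_zero]

theorem translationPhase_mul_amplitude (y : Plane) (ψ : L2Plane) (ξ : Plane) :
    translationPhase y ξ * amplitude y ψ ξ = (𝓕 ψ : L2Plane) ξ := by
  rw [amplitude, ← mul_assoc, translationPhase_mul_exp_inner, one_mul]

theorem norm_amplitude (y : Plane) (ψ : L2Plane) (ξ : Plane) :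
    ‖amplitude y ψ ξ‖ = ‖(𝓕 ψ : L2Plane) ξ‖ := by
  rw [← translationPhase_mul_amplitude y ψ ξ, norm_mul, norm_translationPhase, one_mul]

theorem aestronglyMeasurable_amplitude (y : Plane) (ψ : L2Plane) :
    AEStronglyMeasurable (amplitude y ψ) :=
  (continuous_exp_inner y).aestronglyMeasurable.mul (Lp.aestronglyMeasurable _)

theorem memLp_amplitude (y : Plane) (ψ : L2Plane) : MemLp (amplitude y ψ) 2 volume :=
  (Lp.memLp (𝓕 ψ : L2Plane)).of_le (aestronglyMeasurable_amplitude y ψ)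
    (Eventually.of_forall fun ξ => (norm_amplitude y ψ ξ).le)

theorem integrable_norm_sq_amplitude (y : Plane) (ψ : L2Plane) :
    Integrable fun ξ => ‖amplitude y ψ ξ‖ ^ 2 :=
  (memLp_two_iff_integrable_sq_norm (aestronglyMeasurable_amplitude y ψ)).1 (memLp_amplitude y ψ)

theorem eq_of_amplitude_ae_eq {y : Plane} {ψ ψ' : L2Plane}
    (h : amplitude y ψ =ᵐ[volume] amplitude y ψ') : ψ = ψ' := by
  have : (𝓕 ψ : L2Plane) = 𝓕 ψ' := by
    refine Lp.ext ?_
    filter_upwards [h] with ξ hξ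
    rw [← translationPhase_mul_amplitude y, hξ, translationPhase_mul_amplitude]
  have h2 := congrArg (fun f : L2Plane => (𝓕⁻ f : L2Plane)) this
  simpa only [FourierTransform.fourierInv_fourier_eq] using h2

theorem exists_amplitude_ae_eq (y : Plane) {g : Plane → ℂ} (hg : MemLp g 2 volume) :
    ∃ ψ : L2Plane, amplitude y ψ =ᵐ[volume] g := by
  have h : MemLp (fun ξ => translationPhase y ξ * g ξ) 2 (volume : Measure Plane) :=
    hg.of_le ((continuous_translationPhase y).aestronglyMeasurable.mul hg.1)
      (Eventually.of_forall fun ξ => by rw [norm_mul, norm_translationPhase, one_mul])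
  refine ⟨𝓕⁻ (h.toLp _), ?_⟩
  filter_upwards [h.coeFn_toLp] with ξ hξ
  rw [amplitude, FourierTransform.fourier_fourierInv_eq, hξ, ← mul_assoc,
    mul_comm (exp _), translationPhase_mul_exp_inner, one_mul]

theorem norm_sq_eq_integral_amplitude (y : Plane) (ψ : L2Plane) :
    ‖ψ‖ ^ 2 = ∫ ξ, ‖amplitude y ψ ξ‖ ^ 2 := by
  rw [← Lp.norm_fourier_eq ψ, ← real_inner_self_eq_norm_sq]
  have h := L2.inner_def (𝕜 := ℂ) (𝓕 ψ : L2Plane) (𝓕 ψ)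
  rw [inner_self_eq_norm_sq_to_K] at h
  rw [real_inner_self_eq_norm_sq]
  have h2 : ∀ ξ : Plane, inner ℂ ((𝓕 ψ : L2Plane) ξ) ((𝓕 ψ : L2Plane) ξ) =
      ((‖amplitude y ψ ξ‖ ^ 2 : ℝ) : ℂ) := fun ξ => by
    rw [inner_self_eq_norm_sq_to_K, norm_amplitude]
    norm_cast
  simp only [h2] at h
  rw [integral_complex_ofReal] at h
  exact ofReal_injective (by simpa using h)

theorem h1NormSq_eq (y : Plane) (ψ : L2Plane) :
    h1NormSq ψ = ∫ ξ, (1 + kinetic ξ) * ‖amplitude y ψ ξ‖ ^ 2 := by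
  simp only [h1NormSq, norm_amplitude, kinetic]

theorem memH1_iff_amplitude (y : Plane) (ψ : L2Plane) :
    MemH1 ψ ↔ Integrable fun ξ => (1 + kinetic ξ) * ‖amplitude y ψ ξ‖ ^ 2 := by
  simp only [norm_amplitude, memH1_iff]

theorem amplitude_freeEvolution (y : Plane) (t : ℝ) (ψ : L2Plane) :
    amplitude y (freeEvolution t ψ) =ᵐ[volume]
      fun ξ => exp (-(I * kinetic ξ * t)) * amplitude y ψ ξ := by
  filter_upwards [(memLp_freeSymbol_mul t (𝓕 ψ)).coeFn_toLp] with ξ hξ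
  rw [amplitude, freeEvolution, FourierTransform.fourier_fourierInv_eq, hξ, amplitude]
  have : freeSymbol t ξ = exp (-(I * kinetic ξ * t)) := by
    rw [freeSymbol, kinetic]
    push_cast
    ring_nf
  rw [this]
  ring

theorem amplitude_regularPart {lam : ℝ} (hlam : 0 < lam) (y : Plane) (ψ : L2Plane) (q : ℂ) :
    amplitude y (regularPart lam hlam y ψ q) =ᵐ[volume]
      fun ξ => amplitude y ψ ξ - q / (kinetic ξ + lam) := by
  have e : (𝓕 (regularPart lam hlam y ψ q) : L2Plane) = 𝓕 ψ - (q / (2 * Real.pi)) •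
      (memLp_macdonaldFourier hlam y).toLp (macdonaldFourier lam y) := by
    rw [regularPart, sub_eq_add_neg, FourierTransform.fourier_add, ← neg_smul,
      FourierTransform.fourier_smul, macdonald, FourierTransform.fourier_fourierInv_eq, neg_smul,
      ← sub_eq_add_neg]
  filter_upwards [Lp.coeFn_sub (𝓕 ψ : L2Plane) ((q / (2 * Real.pi)) •
      (memLp_macdonaldFourier hlam y).toLp (macdonaldFourier lam y)),
    Lp.coeFn_smul (q / (2 * Real.pi : ℂ)) ((memLp_macdonaldFourier hlam y).toLp
      (macdonaldFourier lam y)), (memLp_macdonaldFourier hlam y).coeFn_toLp] with ξ h1 h2 h3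
  have hp : (Real.pi : ℂ) ≠ 0 := ofReal_ne_zero.2 Real.pi_pos.ne'
  have h4 := translationPhase_mul_exp_inner y ξ
  rw [amplitude, e, h1, Pi.sub_apply, h2, Pi.smul_apply, h3, macdonaldFourier, ← translationPhase,
    amplitude, mul_sub, smul_eq_mul]
  congr 1
  rw [← kinetic, ofReal_add]
  calc _ = (translationPhase y ξ * exp (2 * Real.pi * ⟪ξ, y⟫ * I)) * (q / (kinetic ξ + lam)) := by
        field_simp
    _ = _ := by rw [h4, one_mul]

/-! ### The ansatz on the Fourier side -/

variable {q : ℝ → ℂ}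

/-- After pairing with a Schwartz function the time integrand becomes bounded, so Fubini applies and
the source term is the emitted wave with the phase of y. -/
theorem integral_schwartz_mul_freeKernel_source (χ : 𝓢(Plane, ℂ)) (y : Plane) (hq : Continuous q)
    {t : ℝ} (ht : 0 ≤ t) :
    (I / (2 * Real.pi)) * ∫ τ in (0 : ℝ)..t, (∫ x, χ x * freeKernel (t - τ) ‖x - y‖) * q τ =
      ∫ ξ, 𝓕⁻ χ ξ * (translationPhase y ξ * (I * sourceWave q t (kinetic ξ))) := by
  have hp : (Real.pi : ℂ) ≠ 0 := ofReal_ne_zero.2 Real.pi_pos.ne'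
  have h1 := intervalIntegral.integral_comp_sub_left (a := 0) (b := t)
    (fun s => (∫ x, χ x * freeKernel s ‖x - y‖) * q (t - s)) t
  simp only [sub_sub_cancel, sub_self, sub_zero] at h1
  have h2 : ∫ s in (0 : ℝ)..t, (∫ x, χ x * freeKernel s ‖x - y‖) * q (t - s) =
      ∫ s in (0 : ℝ)..t, ∫ ξ, 2 * Real.pi * (𝓕⁻ χ ξ * (translationPhase y ξ *
        (exp (-(I * kinetic ξ * s)) * q (t - s)))) := by
    refine intervalIntegral.integral_congr_ae (Eventually.of_forall fun s hs => ?_)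
    rw [Set.uIoc_of_le ht] at hs
    rw [integral_schwartz_mul_freeKernel χ y hs.1, mul_assoc, ← integral_mul_const,
      ← integral_const_mul]
    refine integral_congr_ae (Eventually.of_forall fun ξ => ?_)
    ring
  have hint : Integrable (Function.uncurry fun (s : ℝ) (ξ : Plane) =>
      2 * Real.pi * (𝓕⁻ χ ξ * (translationPhase y ξ * (exp (-(I * kinetic ξ * s)) * q (t - s)))))
      ((volume.restrict (Set.uIoc 0 t)).prod volume) := by
    obtain ⟨C, hC⟩ := isCompact_Icc.exists_bound_of_continuousOn (s := Set.Icc 0 t) hq.continuousOn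
    have hc1 := continuous_translationPhase y
    have hc2 := continuous_kinetic
    have hc3 := (𝓕⁻ χ).continuous
    have hcont : Continuous (Function.uncurry fun (s : ℝ) (ξ : Plane) =>
        2 * Real.pi * (𝓕⁻ χ ξ * (translationPhase y ξ *
          (exp (-(I * kinetic ξ * s)) * q (t - s))))) := by
      unfold Function.uncurry
      fun_prop
    have hfin : IsFiniteMeasure (volume.restrict (Set.uIoc 0 t)) :=
      ⟨by rw [Measure.restrict_apply_univ, Set.uIoc_of_le ht]; exact measure_Ioc_lt_top⟩
    have hdom := (integrable_const (μ := volume.restrict (Set.uIoc 0 t)) (2 * Real.pi * C)).mul_prod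
      ((𝓕⁻ χ).integrable (μ := volume)).norm
    refine hdom.mono' hcont.aestronglyMeasurable ?_
    have hae : ∀ᵐ p : ℝ × Plane ∂((volume.restrict (Set.uIoc 0 t)).prod volume),
        p.1 ∈ Set.uIoc 0 t :=
      Measure.quasiMeasurePreserving_fst.ae (ae_restrict_mem measurableSet_uIoc)
    filter_upwards [hae] with p hs
    rw [Set.uIoc_of_le ht] at hs
    simp only [Function.uncurry, norm_mul, norm_translationPhase, norm_exp_neg_I_mul, one_mul,
      norm_real, Real.norm_of_nonneg Real.pi_pos.le]
    have h3 := hC (t - p.1) ⟨by linarith [hs.2], by linarith [hs.1]⟩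
    rw [norm_ofNat]
    calc _ ≤ 2 * Real.pi * (‖𝓕⁻ χ p.2‖ * C) := by gcongr
      _ = _ := by ring
  rw [h1, h2, intervalIntegral_integral_swap hint, ← integral_const_mul]
  refine integral_congr_ae (Eventually.of_forall fun ξ => ?_)
  simp only [intervalIntegral.integral_const_mul]
  rw [sourceWave]
  field_simp

theorem memLp_wave_amplitude (y : Plane) (ψ : L2Plane) (hq : Continuous q) {t : ℝ} (ht : 0 ≤ t) :
    MemLp (fun ξ => wave (amplitude y ψ ξ) q t (kinetic ξ)) 2 volume :=
  (memLp_two_iff_integrable_sq_norm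
    (aestronglyMeasurable_wave (aestronglyMeasurable_amplitude y ψ) hq t)).2
    (integrable_norm_sq_wave (aestronglyMeasurable_amplitude y ψ)
      (integrable_norm_sq_amplitude y ψ) hq ht)

theorem integrable_schwartz_mul {f : Plane → ℂ} (hf : MemLp f 2 volume) (χ : 𝓢(Plane, ℂ)) :
    Integrable fun ξ => χ ξ * f ξ :=
  MemLp.integrable_mul (p := 2) (q := 2) (χ.memLp 2 volume) hf

/-- The L² state whose amplitude is the wave satisfies the distributional identity, and an L²
function is determined by its Schwartz pairings. Existence and uniqueness come together. -/
theorem isAnsatz_iff (y : Plane) (ψ₀ Ψ : L2Plane) (hq : Continuous q) {t : ℝ} (ht : 0 ≤ t) :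
    IsAnsatz y ψ₀ q t Ψ ↔
      amplitude y Ψ =ᵐ[volume] fun ξ => wave (amplitude y ψ₀ ξ) q t (kinetic ξ) := by
  obtain ⟨Ψ₁, h₁⟩ := exists_amplitude_ae_eq y (memLp_wave_amplitude y ψ₀ hq ht)
  have key : ∀ χ : 𝓢(Plane, ℂ), (∫ x, χ x * freeEvolution t ψ₀ x) + (I / (2 * Real.pi)) *
      ∫ τ in (0 : ℝ)..t, (∫ x, χ x * freeKernel (t - τ) ‖x - y‖) * q τ = ∫ x, χ x * Ψ₁ x := by
    intro χ
    have e0 : ∀ᵐ ξ : Plane, 𝓕⁻ χ ξ * (𝓕 Ψ₁ : L2Plane) ξ - 𝓕⁻ χ ξ *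
        (𝓕 (freeEvolution t ψ₀) : L2Plane) ξ =
        𝓕⁻ χ ξ * (translationPhase y ξ * (I * sourceWave q t (kinetic ξ))) := by
      filter_upwards [h₁, amplitude_freeEvolution y t ψ₀] with ξ h2 h3
      rw [← translationPhase_mul_amplitude y Ψ₁, ← translationPhase_mul_amplitude y (freeEvolution _ _),
        h2, h3, wave]
      ring
    rw [integral_schwartz_mul_eq χ Ψ₁, integral_schwartz_mul_eq χ (freeEvolution t ψ₀),
      integral_schwartz_mul_freeKernel_source χ y hq ht, ← integral_congr_ae e0, integral_sub
        (integrable_schwartz_mul (Lp.memLp _) _) (integrable_schwartz_mul (Lp.memLp _) _)]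
    ring
  simp only [IsAnsatz, key]
  constructor
  · intro h
    rwa [eq_of_integral_schwartz_mul_eq h]
  · intro h
    rw [eq_of_amplitude_ae_eq (h.trans h₁.symm)]
    exact fun _ => rfl

end PointNLS

namespace PointNLS

/-! ### The charge equation on the Fourier side -/

variable {β₀ σ T : ℝ} {φ : Plane → ℂ} {q₀ : ℂ} {q : ℝ → ℂ}

theorem integral_ball_inv_kinetic {R t : ℝ} (hR : 0 ≤ R) :
    ∫ ξ in Metric.ball (0 : Plane) R, exp (-(I * kinetic ξ * t)) * (1 / (kinetic ξ + 1)) =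
      (1 / (4 * Real.pi) : ℝ) *
        ∫ k in (0 : ℝ)..(2 * Real.pi * R) ^ 2, exp (-(I * t) * k) / (k + 1) := by
  have hp := Real.pi_pos
  have h0 : 0 ≤ (2 * Real.pi * R) ^ 2 := by positivity
  have hball : Metric.ball (0 : Plane) R = kinetic ⁻¹' Set.Iio ((2 * Real.pi * R) ^ 2) := by
    ext ξ
    rw [Set.mem_preimage, Set.mem_Iio, kinetic_lt_iff, Real.sqrt_sq (by positivity),
      mul_div_cancel_left₀ _ (by positivity)]
  have hm : Measurable fun k : ℝ => (Set.Iio ((2 * Real.pi * R) ^ 2)).indicator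
      (fun k : ℝ => exp (-(I * t) * k) / (k + 1)) k :=
    Measurable.indicator (by fun_prop) measurableSet_Iio
  have h1 := integral_comp_kinetic hm
  rw [setIntegral_indicator measurableSet_Iio, Set.Ioi_inter_Iio,
    ← integral_Ioc_eq_integral_Ioo, ← intervalIntegral.integral_of_le h0] at h1
  rw [← h1, ← integral_indicator Metric.isOpen_ball.measurableSet, hball]
  refine integral_congr_ae (Eventually.of_forall fun ξ => ?_)
  simp only [Set.indicator, Set.mem_preimage]
  split_ifs
  · rw [mul_one_div]
    ring_nf
  · rfl

/-- The regular part contributes an absolutely convergent inversion integral. For the singular part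
the ball of radius R becomes k < (2πR)², and the conditionally convergent limit is e^{it}E₁(it) up
to the factor 1/(4π). -/
theorem pointValue_freeEvolution {y : Plane} {ψ : L2Plane} (hφ : Integrable φ)
    (h : amplitude y ψ =ᵐ[volume] initialWave φ q₀) {t : ℝ} (ht : 0 < t) :
    pointValue (freeEvolution t ψ) y =
      freeTrace φ t + q₀ * ((4 * Real.pi : ℝ) : ℂ)⁻¹ * scaledExpIntegral (I * t) := by
  refine Tendsto.limUnder_eq ?_
  have hi := integrable_oscillation_mul hφ t
  have L1 : Tendsto (fun R : ℝ => ∫ ξ in Metric.ball (0 : Plane) R,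
      exp (-(I * kinetic ξ * t)) * φ ξ) atTop (𝓝 (freeTrace φ t)) := by
    have hc : AECover (volume : Measure Plane) atTop (fun R : ℝ => Metric.ball (0 : Plane) R) :=
      aecover_ball tendsto_id
    exact hc.integral_tendsto_of_countably_generated hi
  have hsq : Tendsto (fun R : ℝ => (2 * Real.pi * R) ^ 2) atTop atTop :=
    (tendsto_pow_atTop two_ne_zero).comp (tendsto_id.const_mul_atTop (by positivity))
  have L2 := ((tendsto_integral_exp_neg_mul_I_div_add_one ht).comp hsq).const_mul
    (q₀ * ((4 * Real.pi : ℝ) : ℂ)⁻¹)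
  refine (L1.add L2).congr' ?_
  filter_upwards [eventually_ge_atTop 0] with R hR
  have e1 : q₀ * ((4 * Real.pi : ℝ) : ℂ)⁻¹ * ((fun Λ : ℝ => ∫ k in (0 : ℝ)..Λ,
      exp (-(I * t) * k) / (k + 1)) ∘ fun R : ℝ => (2 * Real.pi * R) ^ 2) R =
      ∫ ξ in Metric.ball (0 : Plane) R, q₀ * (exp (-(I * kinetic ξ * t)) * (1 / (kinetic ξ + 1))) := by
    rw [integral_const_mul, integral_ball_inv_kinetic hR, Function.comp_apply]
    push_cast
    ring
  have hi2 : IntegrableOn (fun ξ : Plane => q₀ * (exp (-(I * kinetic ξ * t)) *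
      (1 / (kinetic ξ + 1)))) (Metric.ball 0 R) := by
    have h1 := continuous_inv_kinetic_add_one
    have h2 := continuous_kinetic
    have h3 : Continuous fun ξ : Plane => q₀ * (exp (-(I * kinetic ξ * t)) *
      (1 / (kinetic ξ + 1))) := by fun_prop
    exact (h3.continuousOn.integrableOn_compact (isCompact_closedBall 0 R)).mono_set
      Metric.ball_subset_closedBall
  rw [e1, ← integral_add hi.integrableOn hi2]
  refine setIntegral_congr_ae Metric.isOpen_ball.measurableSet ?_
  filter_upwards [h, amplitude_freeEvolution y t ψ] with ξ h1 h2 _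
  rw [← amplitude, h2, h1, initialWave]
  ring

theorem intervalIntegrable_volterraKernel_sub_mul_scaledExpIntegral {t : ℝ} (ht : 0 < t) :
    IntervalIntegrable (fun s => (volterraKernel (t - s) : ℂ) * scaledExpIntegral (I * s))
      volume 0 t := by
  obtain ⟨C, hC⟩ := exists_norm_expIntegralRemainder_le t
  have hm : Measurable ((Set.Ioc 0 t).indicator expIntegralRemainder) :=
    IsChargeSolution.measurable_expIntegralRemainder.indicator measurableSet_Ioc
  have hC0 : 0 ≤ C := (norm_nonneg _).trans (hC t ⟨ht, le_rfl⟩)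
  have hb : ∀ s, ‖(Set.Ioc 0 t).indicator expIntegralRemainder s‖ ≤ C := fun s => by
    by_cases hs : s ∈ Set.Ioc 0 t
    · rw [Set.indicator_of_mem hs]
      exact hC s hs
    · rw [Set.indicator_of_notMem hs, norm_zero]
      exact hC0
  refine ((intervalIntegrable_volterraKernel_sub_mul_log ht).add
    (intervalIntegrable_volterraKernel_sub_mul ht.le hm hb)).congr fun s hs => ?_
  rw [Set.uIoc_of_le ht.le] at hs
  simp only [Set.indicator_of_mem hs, expIntegralRemainder]
  push_cast
  ring

theorem intervalIntegrable_volterraKernel_sub_mul_continuous {f : ℝ → ℂ} (hf : Continuous f)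
    {t : ℝ} (ht : 0 ≤ t) :
    IntervalIntegrable (fun s => (volterraKernel (t - s) : ℂ) * f s) volume 0 t := by
  have h := intervalIntegrable_volterraKernel_sub ht
  have h' : IntervalIntegrable (fun s => (volterraKernel (t - s) : ℂ)) volume 0 t :=
    ⟨h.1.ofReal, h.2.ofReal⟩
  exact h'.mul_continuousOn hf.continuousOn

/-- The linear coefficient is regrouped: 2(log 2 - γ + iπ/4) = (2 log 2 - γ) + (iπ/2 - γ). The first
bracket joins the nonlinearity in `chargeForce`; the second is what the inversion of the kernel
consumes. -/
theorem SolvesChargeEq.isChargeSolution {y : Plane} {ψ : L2Plane} (hσ : 1 / 2 ≤ σ) (hT : 0 < T)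
    (hφ : Integrable φ) (hφ2 : Integrable fun ξ => (1 + kinetic ξ) * ‖φ ξ‖ ^ 2)
    (h : amplitude y ψ =ᵐ[volume] initialWave φ q₀) (hq : Continuous q)
    (H : SolvesChargeEq β₀ σ y ψ T q) : IsChargeSolution β₀ σ φ q₀ q T := by
  refine ⟨hσ, hT, hφ, hφ2, hq, fun t ht => ?_⟩
  have hσ0 : 0 ≤ 2 * σ := by linarith
  have hp : (Real.pi : ℂ) ≠ 0 := ofReal_ne_zero.2 Real.pi_pos.ne'
  have h1 := H.2 t ht
  have hpow : Continuous fun s => ((‖q s‖ ^ (2 * σ) : ℝ) : ℂ) * q s :=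
    (continuous_ofReal.comp ((Real.continuous_rpow_const hσ0).comp hq.norm)).mul hq
  have i1 := intervalIntegrable_volterraKernel_sub_mul_continuous hpow ht.1.le
  have i2 := intervalIntegrable_volterraKernel_sub_mul_continuous hq ht.1.le
  have i3 := intervalIntegrable_volterraKernel_sub_mul_continuous (continuous_freeTrace hφ) ht.1.le
  have i4 := intervalIntegrable_volterraKernel_sub_mul_scaledExpIntegral ht.1
  have e1 : ∫ τ in (0 : ℝ)..t, volterraKernel (t - τ) * pointValue (freeEvolution τ ψ) y =
      (∫ τ in (0 : ℝ)..t, (volterraKernel (t - τ) : ℂ) * freeTrace φ τ) +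
      q₀ * ((4 * Real.pi : ℝ) : ℂ)⁻¹ *
        ∫ τ in (0 : ℝ)..t, (volterraKernel (t - τ) : ℂ) * scaledExpIntegral (I * τ) := by
    rw [← intervalIntegral.integral_const_mul, ← intervalIntegral.integral_add i3
      (i4.const_mul _)]
    refine intervalIntegral.integral_congr_ae (Eventually.of_forall fun s hs => ?_)
    rw [Set.uIoc_of_le ht.1.le] at hs
    rw [pointValue_freeEvolution hφ h hs.1]
    ring
  have e2 : ∫ s in (0 : ℝ)..t, (volterraKernel (t - s) : ℂ) *
      (4 * Real.pi * freeTrace φ s + q₀ * scaledExpIntegral (I * s) - chargeForce β₀ σ (q s) +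
        (I * Real.pi / 2 - Real.eulerMascheroniConstant) * q s) =
      4 * Real.pi * (∫ τ in (0 : ℝ)..t, (volterraKernel (t - τ) : ℂ) * freeTrace φ τ) +
      q₀ * (∫ τ in (0 : ℝ)..t, (volterraKernel (t - τ) : ℂ) * scaledExpIntegral (I * τ)) -
      4 * Real.pi * β₀ * (∫ τ in (0 : ℝ)..t, (volterraKernel (t - τ) : ℂ) *
        (((‖q τ‖ ^ (2 * σ) : ℝ) : ℂ) * q τ)) +
      2 * (Real.log 2 - Real.eulerMascheroniConstant + I * Real.pi / 4) *
        (∫ τ in (0 : ℝ)..t, (volterraKernel (t - τ) : ℂ) * q τ) := by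
    simp only [← intervalIntegral.integral_const_mul]
    rw [← intervalIntegral.integral_add (i3.const_mul _) (i4.const_mul _),
      ← intervalIntegral.integral_sub ((i3.const_mul _).add (i4.const_mul _)) (i1.const_mul _),
      ← intervalIntegral.integral_add (((i3.const_mul _).add (i4.const_mul _)).sub
        (i1.const_mul _)) (i2.const_mul _)]
    refine intervalIntegral.integral_congr fun s _ => ?_
    simp only [chargeForce]
    push_cast
    ring
  rw [e2]
  rw [e1] at h1
  simp only [mul_assoc (volterraKernel _ : ℂ)] at h1
  have e3 : ((4 * Real.pi : ℝ) : ℂ)⁻¹ * (4 * Real.pi) = 1 := by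
    push_cast
    field_simp
  linear_combination h1 + q₀ * (∫ τ in (0 : ℝ)..t, (volterraKernel (t - τ) : ℂ) *
    scaledExpIntegral (I * τ)) * e3

end PointNLS

namespace PointNLS

/-! ### Initial data and conservation laws -/

/-- By the resolvent identity the difference is O((k+1)⁻²). Passing from `lam` to the parameter 1
therefore keeps the regular part integrable and of finite energy, without changing the charge. -/
theorem integrable_resolvent_difference {lam : ℝ} (hlam : 0 < lam) (q₀ : ℂ) :
    let g : Plane → ℂ := fun ξ => q₀ / (kinetic ξ + lam) - q₀ / (kinetic ξ + 1)
    Integrable g ∧ Integrable fun ξ => (1 + kinetic ξ) * ‖g ξ‖ ^ 2 := by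
  intro g
  have hc := continuous_kinetic
  have hk : ∀ ξ : Plane, ∀ l : ℝ, 0 < l → (kinetic ξ : ℂ) + l ≠ 0 := fun ξ l hl => by
    rw [← ofReal_add]
    exact ofReal_ne_zero.2 (by linarith [kinetic_nonneg ξ])
  have hgc : Continuous g := by
    refine (Continuous.div (by fun_prop) (by fun_prop) fun ξ => hk ξ lam hlam).sub
      (Continuous.div (by fun_prop) (by fun_prop) fun ξ => ?_)
    simpa using hk ξ 1 one_pos
  obtain ⟨C, hC0, hC⟩ : ∃ C : ℝ, 0 ≤ C ∧ ∀ ξ, ‖g ξ‖ ≤ C * ‖(1 : ℂ) / (kinetic ξ + 1 : ℂ)‖ ^ 2 := by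
    refine ⟨‖q₀‖ * |1 - lam| * (max 1 lam⁻¹), by positivity, fun ξ => ?_⟩
    have h0 := kinetic_nonneg ξ
    have h1 : 0 < kinetic ξ + 1 := by linarith
    have h2 : 0 < kinetic ξ + lam := by linarith
    have e : g ξ = q₀ * ((1 - lam : ℝ) : ℂ) / (((kinetic ξ + lam : ℝ) : ℂ) *
        ((kinetic ξ + 1 : ℝ) : ℂ)) := by
      have a1 := hk ξ lam hlam
      have a2 := hk ξ 1 one_pos
      simp only [g]
      push_cast at a2 ⊢
      field_simp
      ring
    have h3 : kinetic ξ + 1 ≤ max 1 lam⁻¹ * (kinetic ξ + lam) := by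
      rw [mul_add]
      refine add_le_add (le_mul_of_one_le_left h0 (le_max_left _ _)) ?_
      calc 1 = lam⁻¹ * lam := (inv_mul_cancel₀ hlam.ne').symm
        _ ≤ _ := by gcongr; exact le_max_right _ _
    have h4 : ‖(1 : ℂ) / (kinetic ξ + 1 : ℂ)‖ = (kinetic ξ + 1)⁻¹ := by
      rw [one_div, norm_inv, ← ofReal_one, ← ofReal_add, norm_real, Real.norm_of_nonneg h1.le]
    rw [e, h4, norm_div, norm_mul, norm_mul, norm_real, norm_real, norm_real, Real.norm_eq_abs,
      Real.norm_of_nonneg h1.le, Real.norm_of_nonneg h2.le]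
    rw [div_le_iff₀ (by positivity)]
    calc ‖q₀‖ * |1 - lam| = ‖q₀‖ * |1 - lam| * ((kinetic ξ + 1) * (kinetic ξ + 1)⁻¹) := by
          rw [mul_inv_cancel₀ h1.ne', mul_one]
      _ ≤ ‖q₀‖ * |1 - lam| * ((max 1 lam⁻¹ * (kinetic ξ + lam)) * (kinetic ξ + 1)⁻¹) := by
          gcongr
      _ = _ := by
          field_simp
  have hi := integrable_norm_sq_inv_kinetic 1
  constructor
  · exact (hi.const_mul C).mono' hgc.aestronglyMeasurable (Eventually.of_forall hC)
  · refine (hi.const_mul (C ^ 2)).mono' (by fun_prop) (Eventually.of_forall fun ξ => ?_)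
    have h0 := kinetic_nonneg ξ
    have h1 : 0 < kinetic ξ + 1 := by linarith
    have h4 : ‖(1 : ℂ) / (kinetic ξ + 1 : ℂ)‖ = (kinetic ξ + 1)⁻¹ := by
      rw [one_div, norm_inv, ← ofReal_one, ← ofReal_add, norm_real, Real.norm_of_nonneg h1.le]
    rw [Real.norm_of_nonneg (by positivity)]
    have h5 := hC ξ
    rw [h4] at h5 ⊢
    set r := (kinetic ξ + 1)⁻¹ with hr
    have hr0 : 0 ≤ r := by positivity
    have hr1 : r ≤ 1 := inv_le_one_of_one_le₀ (by linarith)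
    have hr2 : (1 + kinetic ξ) * r = 1 := by rw [hr, add_comm, mul_inv_cancel₀ h1.ne']
    calc (1 + kinetic ξ) * ‖g ξ‖ ^ 2 ≤ (1 + kinetic ξ) * (C * r ^ 2) ^ 2 := by gcongr
      _ = C ^ 2 * r ^ 2 * (((1 + kinetic ξ) * r) * r) := by ring
      _ ≤ C ^ 2 * r ^ 2 * 1 := by rw [hr2, one_mul]; gcongr
      _ = _ := mul_one _

/-- On the Fourier side, an initial datum is the sum of a regular part, relative to the spectral
parameter `1`, and of the singular profile. -/
theorem exists_initialWave_of_mem_initialData {lam : ℝ} {hlam : 0 < lam} {y : Plane} {ψ : L2Plane}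
    (h : ψ ∈ initialData lam hlam y) :
    ∃ (q₀ : ℂ) (φ : Plane → ℂ), Integrable φ ∧
      Integrable (fun ξ => (1 + kinetic ξ) * ‖φ ξ‖ ^ 2) ∧
      amplitude y ψ =ᵐ[volume] initialWave φ q₀ := by
  obtain ⟨q₀, h1, ε, hε, h2⟩ := h
  obtain ⟨g1, g2⟩ := integrable_resolvent_difference hlam q₀
  set R := regularPart lam hlam y ψ q₀ with hR
  have hRm := aestronglyMeasurable_amplitude y R
  have h3 : Integrable (amplitude y R) := by
    refine h2.norm.mono' hRm (Eventually.of_forall fun ξ => ?_)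
    rw [norm_amplitude, norm_mul, norm_real, Real.norm_of_nonneg (by positivity)]
    exact le_mul_of_one_le_left (norm_nonneg _) (le_add_of_nonneg_right (by positivity))
  have h4 := (memH1_iff_amplitude y R).1 h1
  refine ⟨q₀, _, h3.add g1, ?_, ?_⟩
  · refine ((h4.const_mul 2).add (g2.const_mul 2)).mono' ?_ (Eventually.of_forall fun ξ => ?_)
    · exact (continuous_const.add continuous_kinetic).aestronglyMeasurable.mul
        ((h3.add g1).aestronglyMeasurable.norm.pow 2)
    · have h0 := kinetic_nonneg ξ
      rw [Real.norm_of_nonneg (by positivity)]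
      simp only [Pi.add_apply]
      calc _ ≤ (1 + kinetic ξ) * (2 * ‖amplitude y R ξ‖ ^ 2 +
            2 * ‖q₀ / (kinetic ξ + lam : ℂ) - q₀ / (kinetic ξ + 1 : ℂ)‖ ^ 2) := by
            gcongr
            exact norm_sq_add_le _ _
        _ = _ := by ring
  · filter_upwards [amplitude_regularPart hlam y ψ q₀] with ξ h5
    simp only [initialWave, Pi.add_apply]
    rw [hR, h5]
    ring

section Evolution

variable {β₀ σ T : ℝ} {φ : Plane → ℂ} {q₀ : ℂ} {q : ℝ → ℂ} {y : Plane} {ψ₀ Ψ : L2Plane}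

theorem amplitude_regularPart_ansatz (h : amplitude y ψ₀ =ᵐ[volume] initialWave φ q₀) {t : ℝ}
    (hΨ : amplitude y Ψ =ᵐ[volume] fun ξ => wave (amplitude y ψ₀ ξ) q t (kinetic ξ)) :
    amplitude y (regularPart 1 one_pos y Ψ (q t)) =ᵐ[volume] regularWave φ q₀ q t := by
  filter_upwards [h, hΨ, amplitude_regularPart one_pos y Ψ (q t)] with ξ h1 h2 h3
  rw [h3, h2, h1, regularWave, ofReal_one]

theorem conservation_laws (H : IsChargeSolution β₀ σ φ q₀ q T)
    (h : amplitude y ψ₀ =ᵐ[volume] initialWave φ q₀)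
    (hΨ : amplitude y Ψ =ᵐ[volume] fun ξ => wave (amplitude y ψ₀ ξ) q T (kinetic ξ)) :
    HasCharge 1 one_pos y Ψ (q T) ∧ ‖Ψ‖ = ‖ψ₀‖ ∧
      energy β₀ σ y Ψ (q T) = energy β₀ σ y ψ₀ (q 0) := by
  have h1 := amplitude_regularPart_ansatz h hΨ
  have h2 : amplitude y (regularPart 1 one_pos y ψ₀ (q 0)) =ᵐ[volume] φ := by
    filter_upwards [h, amplitude_regularPart one_pos y ψ₀ (q 0)] with ξ h1 h3
    rw [h3, h1, initialWave, H.initial_value, ofReal_one, add_sub_cancel_right]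
  refine ⟨?_, ?_, ?_⟩
  · refine (memH1_iff_amplitude y _).2 (H.integrable_regularWave.congr ?_)
    filter_upwards [h1] with ξ h3
    rw [h3]
  · refine (sq_eq_sq₀ (norm_nonneg _) (norm_nonneg _)).1 ?_
    rw [norm_sq_eq_integral_amplitude y, norm_sq_eq_integral_amplitude y]
    refine (integral_congr_ae ?_).trans (H.mass_conservation.trans (integral_congr_ae ?_))
    · filter_upwards [h, hΨ] with ξ h3 h4
      rw [h4, h3]
    · filter_upwards [h] with ξ h3
      rw [h3]
  · have hσ : 0 < σ + 1 := by linarith [H.half_le]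
    have e1 : h1NormSq (regularPart 1 one_pos y Ψ (q T)) =
        ∫ ξ, (1 + kinetic ξ) * ‖regularWave φ q₀ q T ξ‖ ^ 2 := by
      rw [h1NormSq_eq y]
      refine integral_congr_ae ?_
      filter_upwards [h1] with ξ h3
      rw [h3]
    have e2 : h1NormSq (regularPart 1 one_pos y ψ₀ (q 0)) = ∫ ξ, (1 + kinetic ξ) * ‖φ ξ‖ ^ 2 := by
      rw [h1NormSq_eq y]
      refine integral_congr_ae ?_
      filter_upwards [h2] with ξ h3
      rw [h3]
    have e3 : ∀ z : ℂ, ‖z‖ ^ (2 * σ + 2) = ‖z‖ ^ (2 * σ) * ‖z‖ ^ 2 := fun z => by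
      rw [Real.rpow_add_of_nonneg (norm_nonneg z) (by linarith [H.half_le]) (by norm_num),
        Real.rpow_two]
    -- The constant of the energy arises here: γ from the singular profile and γ - 2 log 2 from the
    -- force add up to 2(γ - log 2), and division by 4π gives (γ - log 2)/(2π).
    rw [energy, energy, e1, e2, H.energy_conservation, chargePotential, chargePotential, e3, e3]
    have hp := Real.pi_pos.ne'
    field_simp
    ring

theorem hasCharge_of_initialWave (H : IsChargeSolution β₀ σ φ q₀ q T)
    (h : amplitude y ψ₀ =ᵐ[volume] initialWave φ q₀) : HasCharge 1 one_pos y ψ₀ (q 0) := by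
  refine (memH1_iff_amplitude y _).2 (H.integrable_energy.congr ?_)
  filter_upwards [h, amplitude_regularPart one_pos y ψ₀ (q 0)] with ξ h1 h3
  rw [h3, h1, initialWave, H.initial_value, ofReal_one, add_sub_cancel_right]

end Evolution

theorem IsAnsatz.congr_charge {y : Plane} {ψ₀ Ψ : L2Plane} {q q' : ℝ → ℂ} {t : ℝ} (ht : 0 ≤ t)
    (h : ∀ s ∈ Set.Icc 0 t, q s = q' s) : IsAnsatz y ψ₀ q t Ψ ↔ IsAnsatz y ψ₀ q' t Ψ := by
  have e : ∀ χ : 𝓢(Plane, ℂ),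
      ∫ τ in (0 : ℝ)..t, (∫ x, χ x * freeKernel (t - τ) ‖x - y‖) * q τ =
      ∫ τ in (0 : ℝ)..t, (∫ x, χ x * freeKernel (t - τ) ‖x - y‖) * q' τ := fun χ => by
    refine intervalIntegral.integral_congr fun s hs => ?_
    rw [Set.uIcc_of_le ht] at hs
    simp only [h s hs]
  simp only [IsAnsatz, e]

theorem SolvesChargeEq.congr {β₀ σ T : ℝ} {y : Plane} {ψ₀ : L2Plane} {q q' : ℝ → ℂ}
    (H : SolvesChargeEq β₀ σ y ψ₀ T q) (h : ∀ s ∈ Set.Icc 0 T, q s = q' s) :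
    SolvesChargeEq β₀ σ y ψ₀ T q' := by
  refine ⟨H.1.congr fun s hs => (h s hs).symm, fun t ht => ?_⟩
  have hs : ∀ s ∈ Set.uIcc 0 t, q s = q' s := fun s hs => by
    rw [Set.uIcc_of_le ht.1.le] at hs
    exact h s ⟨hs.1, hs.2.trans ht.2⟩
  have e1 : ∫ τ in (0 : ℝ)..t, volterraKernel (t - τ) * ((‖q τ‖ ^ (2 * σ) : ℝ) : ℂ) * q τ =
      ∫ τ in (0 : ℝ)..t, volterraKernel (t - τ) * ((‖q' τ‖ ^ (2 * σ) : ℝ) : ℂ) * q' τ :=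
    intervalIntegral.integral_congr fun s h' => by simp only [hs s h']
  have e2 : ∫ τ in (0 : ℝ)..t, volterraKernel (t - τ) * q τ =
      ∫ τ in (0 : ℝ)..t, volterraKernel (t - τ) * q' τ :=
    intervalIntegral.integral_congr fun s h' => by simp only [hs s h']
  rw [← e1, ← e2, ← h t ⟨ht.1.le, ht.2⟩]
  exact H.2 t ht

theorem exists_evolution {β₀ σ : ℝ} (hσ : 1 / 2 ≤ σ) {y : Plane} {lam : ℝ} {hlam : 0 < lam}
    {ψ₀ : L2Plane} (hψ₀ : ψ₀ ∈ initialData lam hlam y) {T : ℝ} (hT : 0 < T) {q : ℝ → ℂ}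
    (hq : SolvesChargeEq β₀ σ y ψ₀ T q) {t : ℝ} (ht : t ∈ Set.Icc 0 T) :
    ∃ Ψ₁ : L2Plane, (∀ Ψ, IsAnsatz y ψ₀ q t Ψ ↔ Ψ = Ψ₁) ∧ (t = 0 → Ψ₁ = ψ₀) ∧
      HasCharge 1 one_pos y Ψ₁ (q t) ∧ ‖Ψ₁‖ = ‖ψ₀‖ ∧
      energy β₀ σ y Ψ₁ (q t) = energy β₀ σ y ψ₀ (q 0) := by
  obtain ⟨q₀, φ, h1, h2, h3⟩ := exists_initialWave_of_mem_initialData hψ₀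
  -- The charge is continuous on [0, T] only. It is extended by constants to the whole line, since
  -- the wave calculus assumes global continuity; neither the charge equation nor the ansatz sees
  -- the extension.
  set Q : ℝ → ℂ := Set.IccExtend hT.le ((Set.Icc 0 T).domRestrict q) with hQ
  have hQc : Continuous Q := (continuousOn_iff_continuous_domRestrict.1 hq.1).Icc_extend'
  have hqQ : ∀ s ∈ Set.Icc 0 T, q s = Q s := fun s hs => by
    rw [hQ, Set.IccExtend_of_mem _ _ hs, Set.domRestrict_apply]
  have H := (hq.congr hqQ).isChargeSolution hσ hT h1 h2 h3 hQc
  obtain ⟨Ψ₁, hΨ₁⟩ := exists_amplitude_ae_eq y (memLp_wave_amplitude y ψ₀ hQc ht.1)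
  have hzero : t = 0 → Ψ₁ = ψ₀ := fun h0 => by
    subst h0
    refine eq_of_amplitude_ae_eq (y := y) ?_
    filter_upwards [hΨ₁] with ξ h
    rw [h, wave_zero]
  refine ⟨Ψ₁, fun Ψ => ?_, hzero, ?_⟩
  · rw [IsAnsatz.congr_charge ht.1 fun s hs => hqQ s ⟨hs.1, hs.2.trans ht.2⟩,
      isAnsatz_iff y ψ₀ Ψ hQc ht.1]
    constructor
    · exact fun h => eq_of_amplitude_ae_eq (h.trans hΨ₁.symm)
    · rintro rfl
      exact hΨ₁
  · rw [hqQ t ht, hqQ 0 ⟨le_rfl, hT.le⟩]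
    -- A charge solution needs a positive horizon, so t = 0 is treated apart; for t > 0 the solution
    -- is restricted to [0, t] and t becomes the final time.
    rcases eq_or_lt_of_le ht.1 with h0 | h0
    · rw [hzero h0.symm, ← h0]
      exact ⟨hasCharge_of_initialWave H h3, rfl, rfl⟩
    · exact conservation_laws (H.mono ⟨h0, ht.2⟩) h3 hΨ₁

end PointNLS

end

theorem mainTheorem2 (β₀ σ : ℝ) (hσ : 1 / 2 ≤ σ) (y : PointNLS.Plane)
    (lam : ℝ) (hlam : 0 < lam)
    (ψ₀ : PointNLS.L2Plane) (hψ₀ : ψ₀ ∈ PointNLS.initialData lam hlam y)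
    (T : ℝ) (hT : 0 < T) (q : ℝ → ℂ) (hq : PointNLS.SolvesChargeEq β₀ σ y ψ₀ T q) :
    ∃ ψ : ℝ → PointNLS.L2Plane,
      (∀ t ∈ Set.Icc 0 T, ∀ Ψ : PointNLS.L2Plane,
        PointNLS.IsAnsatz y ψ₀ q t Ψ ↔ Ψ = ψ t) ∧
      ψ 0 = ψ₀ ∧
      ∀ t ∈ Set.Icc 0 T,
        PointNLS.HasCharge 1 one_pos y (ψ t) (q t) ∧
        ‖ψ t‖ = ‖ψ 0‖ ∧
        PointNLS.energy β₀ σ y (ψ t) (q t) = PointNLS.energy β₀ σ y (ψ 0) (q 0) := by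
  choose! ψ h1 h2 h3 h4 h5 using fun t ht =>
    PointNLS.exists_evolution (β₀ := β₀) hσ hψ₀ hT hq (t := t) ht
  have h0 : ψ 0 = ψ₀ := h2 0 ⟨le_rfl, hT.le⟩ rfl
  exact ⟨ψ, h1, h0, fun t ht => ⟨h3 t ht, by rw [h0, h4 t ht], by rw [h0, h5 t ht]⟩⟩
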